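/- **Theorem (reduced $b$-Poisson structure, local expression).** Let $(G,H)$ be a $b$-Lie group: $G$ is a finite-dimensional real Lie group and $H\subset G$ is a closed subgroup which is an embedded hypersurface (codimension one). Let $\mathfrak h$ be the Lie algebra of $H$, let $G/H$ be the space of right cosets $[g]=Hg$ (the orbits of $H$ acting on $G$ by left translations) with projection $\pi:G\to G/H$ and the quotient smooth structure. For a $b$-manifold $(M,Z)$ let ${}^bTM$ be the $b$-tangent bundle (sections: vector fields tangent to $Z$), ${}^bT^*M$ its dual, $\lambda_M$ the $b$-Liouville form on ${}^bT^*M$ and $\omega_M=-d\lambda_M$ the canonical $b$-form, with Poisson bracket $\{F,K\}=\omega_M(X_F,X_K)$, $\iota_{X_F}\omega_M=dF$. Let $h\in H$ act on ${}^bT^*G$ by the cotangent lift $\alpha\mapsto (L_{h^{-1}})^*\alpha$ of left translation. Then: 1. $G/H$ is a one-dimensional $b$-manifold with critical hypersurface the point $[e]$, and the canonical $b$-forms of ${}^bT^*G$ and of ${}^bT^*(G/H)$ are nondegenerate. 2. $({}^bT^*G)/H$ is a smooth manifold of dimension $\dim G+1$, and the canonical bracket of ${}^bT^*G$ descends to a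 Poisson bracket on it (the reduced Poisson structure). 3. This is the Poisson structure induced by minimal coupling. That is, let $\zeta_g:\mathfrak h\to{}^bT_gG$ be the infinitesimal action, $\mathcal H^\circ\subset{}^bT^*G$ the annihilator of its image, $\tau:\mathcal H^\circ\to G$ the projection, and $\bar\pi:\mathcal H^\circ\to{}^bT^*(G/H)$ the map with $(\bar\pi\alpha)(\pi_*v)=\alpha(v)$. For every principal $H$-$b$-connection $\theta\in{}^b\Omega^1(G;\mathfrak h)$ (so $\theta\circ\zeta=\mathrm{id}$ and $(L_h)^*\theta=\mathrm{Ad}_h\theta$ for $h\in H$) put $\lambda^\theta_{(\alpha,\mu)}(w,\phi)=\mu(\theta(\tau_*w))$ on $\mathcal H^\circ\times\mathfrak h^*$. Then the $b$-form $\bar\pi^*\omega_{G/H}-d\lambda^\theta$ on $\mathcal H^\circ\times\mathfrak h^*$ is nondegenerate, and under $$\psi_\theta:{}^bT^*G\to\mathcal H^\circ\times\mathfrak h^*,\qquad \alpha_g\mapsto(\alpha_g-\alpha_g\circ\zeta_g\circ\theta_g,\ \alpha_g\circ\zeta_g)$$ the bracket it induces on $\mathcal H^\circ\times_H\mathfrak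 h^*$, i.e. on $H$-invariant functions, corresponds to the bracket of (2). 4. The reduced Poisson structure is locally equivalent to $$\bigl(\mathfrak h^*\times{}^bT^*(G/H),\ \Pi^-_{\mathrm{LP}}+\Pi_{b\text{-can}}\bigr),$$ where $\Pi^-_{\mathrm{LP}}$ is the minus Lie–Poisson structure $\{f,k\}(\mu)=-\langle\mu,[df_\mu,dk_\mu]\rangle$ on $\mathfrak h^*$ (bracket of left-invariant vector fields) and $\Pi_{b\text{-can}}$ is the canonical $b$-Poisson structure on ${}^bT^*(G/H)$. Precisely: every point of $G/H$ (in particular $[e]$) has an open neighbourhood $V$ and a Poisson diffeomorphism, covering the identity of $V$, from the part of $({}^bT^*G)/H$ lying over $V$ onto $\mathfrak h^*\times{}^bT^*V$. -/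

import Mathlib

open Set Filter Topology
open scoped Manifold ContDiff

noncomputable section

namespace BLie

/-! ### Smooth structures given by their sheaves of smooth functions

A smooth structure on a space is encoded by its sheaf of smooth real-valued functions, i.e. by the
predicate "`f` is smooth on a neighbourhood of `x`".  A smooth manifold is such a space which is
Hausdorff and locally isomorphic to `ℝⁿ` (`SmoothStr.IsManifold`). -/

/-- A sheaf of (continuous) functions closed under composition with smooth functions of finitely
many real variables. `SmoothAt f x` reads: `f` is smooth on some neighbourhood of `x`. -/
structure SmoothStr (X : Type*) [TopologicalSpace X] where
  SmoothAt : (X → ℝ) → X → Prop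
  eventually : ∀ {f : X → ℝ} {x : X}, SmoothAt f x → ∀ᶠ y in 𝓝 x, SmoothAt f y
  congr : ∀ {f g : X → ℝ} {x : X}, SmoothAt f x → f =ᶠ[𝓝 x] g → SmoothAt g x
  comp : ∀ {ι : Type} [Fintype ι] {F : (ι → ℝ) → ℝ} {g : ι → X → ℝ} {x : X}, ContDiff ℝ ∞ F →
    (∀ i, SmoothAt (g i) x) → SmoothAt (fun y => F fun i => g i y) x
  continuousAt : ∀ {f : X → ℝ} {x : X}, SmoothAt f x → ContinuousAt f x

namespace SmoothStr

/-- The standard smooth structure of a normed space. -/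
def std (W : Type*) [NormedAddCommGroup W] [NormedSpace ℝ W] : SmoothStr W where
  SmoothAt f x := ∀ᶠ y in 𝓝 x, ContDiffAt ℝ ∞ f y
  eventually h := eventually_eventually_nhds.2 h
  congr h hfg := by
    filter_upwards [h, eventually_eventuallyEq_nhds.2 hfg] with y h1 h2
    exact h1.congr_of_eventuallyEq h2.symm
  comp hF hg := by
    filter_upwards [eventually_all.2 hg] with y hy
    exact hF.contDiffAt.comp y (contDiffAt_pi.2 hy)
  continuousAt h := h.self_of_nhds.continuousAt

/-- The smooth structure of a `C^∞` manifold modelled on a normed space `E`. -/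
def ofManifold (E : Type*) [NormedAddCommGroup E] [NormedSpace ℝ E]
    (M : Type*) [TopologicalSpace M] [ChartedSpace E M] : SmoothStr M where
  SmoothAt f x := ∀ᶠ y in 𝓝 x, ContMDiffAt 𝓘(ℝ, E) 𝓘(ℝ, ℝ) ∞ f y
  eventually h := eventually_eventually_nhds.2 h
  congr h hfg := by
    filter_upwards [h, eventually_eventuallyEq_nhds.2 hfg] with y h1 h2
    exact h1.congr_of_eventuallyEq h2.symm
  comp hF hg := by
    filter_upwards [eventually_all.2 hg] with y hy
    exact hF.contDiffAt.contMDiffAt.comp y (contMDiffAt_pi_space.2 hy)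
  continuousAt h := h.self_of_nhds.continuousAt

/-- The smooth structure generated by families `gen x` of functions near `x`: the smooth functions
are locally the smooth functions of finitely many generators. -/
def generated {X : Type*} [TopologicalSpace X] (gen : X → Set (X → ℝ))
    (hev : ∀ x, ∀ f ∈ gen x, ∀ᶠ y in 𝓝 x, f ∈ gen y)
    (hc : ∀ x, ∀ f ∈ gen x, ContinuousAt f x) : SmoothStr X where
  SmoothAt f x := ∃ (ι : Type) (_ : Fintype ι) (F : (ι → ℝ) → ℝ) (g : ι → X → ℝ),
    ContDiff ℝ ∞ F ∧ (∀ i, g i ∈ gen x) ∧ f =ᶠ[𝓝 x] fun y => F fun i => g i y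
  eventually := by
    rintro f x ⟨ι, _, F, g, hF, hg, h⟩
    filter_upwards [eventually_all.2 fun i => hev x _ (hg i), eventually_eventuallyEq_nhds.2 h]
      with y h1 h2
    exact ⟨ι, _, F, g, hF, h1, h2⟩
  congr := by
    rintro f f' x ⟨ι, _, F, g, hF, hg, h⟩ hff
    exact ⟨ι, _, F, g, hF, hg, hff.symm.trans h⟩
  comp := by
    intro κ _ F g x hF hg
    choose ι inst G k hG hk h using hg
    refine ⟨Σ i, ι i, inferInstance, fun z => F fun i => G i fun j => z ⟨i, j⟩,
      fun a => k a.1 a.2, ?_, fun a => hk a.1 a.2, ?_⟩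
    · refine hF.comp (contDiff_pi.2 fun i => (hG i).comp (contDiff_pi.2 fun j => ?_))
      exact contDiff_apply ℝ ℝ (⟨i, j⟩ : Σ i, ι i)
    · filter_upwards [eventually_all.2 h] with y hy
      simp only [hy]
  continuousAt := by
    rintro f x ⟨ι, _, F, g, hF, hg, h⟩
    refine ContinuousAt.congr ?_ h.symm
    exact hF.continuous.continuousAt.comp (continuousAt_pi.2 fun i => hc x _ (hg i))

variable {X Y : Type*} [TopologicalSpace X] [TopologicalSpace Y]

/-- The smooth structure of a subspace: locally, restrictions of smooth functions. -/
def sub (S : SmoothStr X) (A : Set X) : SmoothStr A :=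
  generated (fun a => {f | ∃ g, S.SmoothAt g a ∧ f = fun b : A => g b})
    (by
      rintro x _ ⟨g, hg, rfl⟩
      filter_upwards [continuousAt_subtype_val.eventually (S.eventually hg)] with y hy
      exact ⟨g, hy, rfl⟩)
    (by
      rintro x _ ⟨g, hg, rfl⟩
      exact (S.continuousAt hg).comp continuousAt_subtype_val)

/-- The product smooth structure. -/
def prod (S : SmoothStr X) (T : SmoothStr Y) : SmoothStr (X × Y) :=
  generated (fun a => {f | (∃ g, S.SmoothAt g a.1 ∧ f = fun b => g b.1) ∨
      ∃ g, T.SmoothAt g a.2 ∧ f = fun b => g b.2})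
    (by
      rintro x _ (⟨g, hg, rfl⟩ | ⟨g, hg, rfl⟩)
      · filter_upwards [continuousAt_fst.eventually (S.eventually hg)] with y hy
        exact Or.inl ⟨g, hy, rfl⟩
      · filter_upwards [continuousAt_snd.eventually (T.eventually hg)] with y hy
        exact Or.inr ⟨g, hy, rfl⟩)
    (by
      rintro x _ (⟨g, hg, rfl⟩ | ⟨g, hg, rfl⟩)
      · exact (S.continuousAt hg).comp continuousAt_fst
      · exact (T.continuousAt hg).comp continuousAt_snd)

/-- The quotient smooth structure: a function is smooth when its pullback to `X` is. -/
def quot (S : SmoothStr X) (q : X → Y) (hq : IsQuotientMap q) : SmoothStr Y where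
  SmoothAt f y := ∃ U ∈ 𝓝 y, ∀ x, q x ∈ U → S.SmoothAt (f ∘ q) x
  eventually := by
    rintro f y ⟨U, hU, h⟩
    filter_upwards [eventually_mem_nhds_iff.2 hU] with z hz
    exact ⟨U, hz, h⟩
  congr := by
    rintro f g y ⟨U, hU, h⟩ hfg
    obtain ⟨V, hV, hVo, hyV⟩ := mem_nhds_iff.1 hfg
    refine ⟨U ∩ V, inter_mem hU (hVo.mem_nhds hyV), fun x hx => S.congr (h x hx.1) ?_⟩
    filter_upwards [(hVo.preimage hq.continuous).mem_nhds hx.2] with z hz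
    exact hV hz
  comp := by
    intro ι _ F g y hF hg
    choose U hU h using hg
    exact ⟨⋂ i, U i, iInter_mem.2 hU,
      fun x hx => S.comp (g := fun i => g i ∘ q) hF fun i => h i x (mem_iInter.1 hx i)⟩
  continuousAt := by
    rintro f y ⟨U, hU, h⟩
    obtain ⟨V, hVU, hVo, hyV⟩ := mem_nhds_iff.1 hU
    refine ContinuousOn.continuousAt (s := V) ?_ (hVo.mem_nhds hyV)
    refine (continuousOn_iff'.2 fun t ht => ?_)
    refine ⟨f ⁻¹' t ∩ V, ?_, by simp [inter_assoc]⟩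
    rw [← hq.isOpen_preimage, isOpen_iff_mem_nhds]
    rintro x ⟨hx1, hx2⟩
    have := S.continuousAt (h x (hVU hx2))
    filter_upwards [this (ht.mem_nhds hx1), (hVo.preimage hq.continuous).mem_nhds hx2]
      with z h1 h2
    exact ⟨h1, h2⟩

/-- `(X, S)` is an `n`-dimensional smooth manifold. -/
def IsManifold (S : SmoothStr X) (n : ℕ) : Prop :=
  T2Space X ∧ ∀ x, ∃ e : OpenPartialHomeomorph X (EuclideanSpace ℝ (Fin n)), x ∈ e.source ∧
    ∀ y ∈ e.source, ∀ f : X → ℝ, S.SmoothAt f y ↔ (std _).SmoothAt (f ∘ e.symm) (e y)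

variable (S : SmoothStr X)

/-- The algebra of functions that are smooth near `p`. -/
def alg (p : X) : Subalgebra ℝ (X → ℝ) where
  carrier := {f | S.SmoothAt f p}
  mul_mem' {f g} hf hg := S.comp (ι := Bool) (F := fun z => z true * z false)
    (g := fun b => if b then f else g)
    ((contDiff_apply ℝ ℝ true).mul (contDiff_apply ℝ ℝ false)) (by simpa using ⟨hg, hf⟩)
  add_mem' {f g} hf hg := S.comp (ι := Bool) (F := fun z => z true + z false)
    (g := fun b => if b then f else g)
    ((contDiff_apply ℝ ℝ true).add (contDiff_apply ℝ ℝ false)) (by simpa using ⟨hg, hf⟩)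
  algebraMap_mem' c := S.comp (ι := Empty) (F := fun _ => c) (g := fun _ _ => 0)
    contDiff_const (fun i => i.elim)

end SmoothStr

/-! ### `b`-geometry -/

section BGeometry

variable {M N : Type*} [TopologicalSpace M] [TopologicalSpace N]

/-- Derivations at `p`, i.e. tangent vectors at `p`. -/
def IsDerivationAt (S : SmoothStr M) (p : M) (D : Module.Dual ℝ (S.alg p)) : Prop :=
  ∀ f g : S.alg p, D (f * g) = f.1 p * D g + g.1 p * D f

/-- `f` is a local defining function of `Z` near `p`: smooth, with zero set `Z`, and with `df_p ≠ 0`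
if `p ∈ Z`. -/
def IsDefiningAt (S : SmoothStr M) (Z : Set M) (f : M → ℝ) (p : M) : Prop :=
  ∃ hf : S.SmoothAt f p, (∀ᶠ y in 𝓝 p, y ∈ Z ↔ f y = 0) ∧
    (p ∈ Z → ∃ D, IsDerivationAt S p D ∧ D ⟨f, hf⟩ ≠ 0)

/-- `Z` is an embedded hypersurface. -/
def IsHypersurface (S : SmoothStr M) (Z : Set M) : Prop :=
  ∀ p ∈ Z, ∃ f, IsDefiningAt S Z f p

/-- The fibre at `p` of the `b`-tangent bundle of `(M, Z)`.  A `b`-tangent vector at `p` is a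
derivation of the germs at `p` of `b`-functions `c log |f| + g` (`f` a defining function of `Z`, `g`
smooth): a pair `(D, L)` of a derivation `D` of the smooth germs and numbers
`L f` (`= D (log |f|)`), which satisfy `D f = f(p) L f` and `L (u f) = L f + (D u) / u(p)`.
In an adapted chart `(f, z₂, …, zₙ)` it is given by the numbers `L f, D z₂, …, D zₙ`, its
coordinates in the frame `f ∂_f, ∂_{z₂}, …, ∂_{zₙ}`. -/
def bTangentSub (S : SmoothStr M) (Z : Set M) (p : M) :
    Submodule ℝ (Module.Dual ℝ (S.alg p) × ({f // IsDefiningAt S Z f p} → ℝ)) where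
  carrier := {v | IsDerivationAt S p v.1 ∧
    (∀ f : {f // IsDefiningAt S Z f p}, v.1 ⟨f.1, f.2.1⟩ = f.1 p * v.2 f) ∧
    ∀ (f f' : {f // IsDefiningAt S Z f p}) (u : S.alg p), u.1 p ≠ 0 →
      f'.1 =ᶠ[𝓝 p] u.1 * f.1 → v.2 f' = v.2 f + v.1 u / u.1 p}
  add_mem' := by
    rintro v w ⟨h1, h2, h3⟩ ⟨k1, k2, k3⟩
    refine ⟨fun f g => ?_, fun f => ?_, fun f f' u hu he => ?_⟩
    · simp only [Prod.fst_add, LinearMap.add_apply, h1 f g, k1 f g]; ring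
    · simp only [Prod.fst_add, Prod.snd_add, LinearMap.add_apply, Pi.add_apply, h2 f, k2 f]; ring
    · simp only [Prod.fst_add, Prod.snd_add, LinearMap.add_apply, Pi.add_apply, h3 f f' u hu he,
        k3 f f' u hu he]
      ring
  zero_mem' := ⟨fun f g => by simp, fun f => by simp, fun f f' u _ _ => by simp⟩
  smul_mem' := by
    rintro c v ⟨h1, h2, h3⟩
    refine ⟨fun f g => ?_, fun f => ?_, fun f f' u hu he => ?_⟩
    · simp only [Prod.smul_fst, LinearMap.smul_apply, h1 f g, smul_eq_mul]; ring
    · simp only [Prod.smul_fst, Prod.smul_snd, LinearMap.smul_apply, Pi.smul_apply, h2 f,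
        smul_eq_mul]; ring
    · simp only [Prod.smul_fst, Prod.smul_snd, LinearMap.smul_apply, Pi.smul_apply,
        h3 f f' u hu he, smul_eq_mul]
      ring

/-- The fibre at `p` of the `b`-tangent bundle of `(M, Z)`. -/
def bTangent (S : SmoothStr M) (Z : Set M) (p : M) : Type _ := bTangentSub S Z p

instance (S : SmoothStr M) (Z : Set M) (p : M) : AddCommGroup (bTangent S Z p) :=
  inferInstanceAs (AddCommGroup (bTangentSub S Z p))

instance (S : SmoothStr M) (Z : Set M) (p : M) : Module ℝ (bTangent S Z p) :=
  inferInstanceAs (Module ℝ (bTangentSub S Z p))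

variable {S : SmoothStr M} {Z : Set M} {T : SmoothStr N} {ZN : Set N}

open Classical in
/-- `v h`, the derivative of the function `h` (smooth near `p`) along `v`. -/
def bDeriv {p : M} (v : bTangent S Z p) (h : M → ℝ) : ℝ :=
  if hh : S.SmoothAt h p then v.1.1 ⟨h, hh⟩ else 0

open Classical in
/-- `v (log |f|)`, for a local defining function `f` of `Z` near `p`. -/
def bLogDeriv {p : M} (v : bTangent S Z p) (f : M → ℝ) : ℝ :=
  if hf : IsDefiningAt S Z f p then v.1.2 ⟨f, hf⟩ else 0

/-- `φ` is a `b`-map near `p`: it is smooth and pulls back local defining functions to local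
defining functions. -/
def IsBMapAt (S : SmoothStr M) (Z : Set M) (T : SmoothStr N) (ZN : Set N) (φ : M → N) (p : M) :
    Prop :=
  (∀ f, T.SmoothAt f (φ p) → S.SmoothAt (f ∘ φ) p) ∧
    (∀ f, IsDefiningAt T ZN f (φ p) → IsDefiningAt S Z (f ∘ φ) p) ∧ ContinuousAt φ p

open Classical in
/-- The `b`-differential `φ_* : ᵇT_p M → ᵇT_{φ p} N` of a `b`-map `φ`, `(φ_* v) h = v (h ∘ φ)`. -/
def bMap (S : SmoothStr M) (Z : Set M) (T : SmoothStr N) (ZN : Set N) (φ : M → N) (p : M) :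
    bTangent S Z p →ₗ[ℝ] bTangent T ZN (φ p) :=
  if h : IsBMapAt S Z T ZN φ p then
    { toFun := fun v => ⟨({ toFun := fun f => v.1.1 ⟨f.1 ∘ φ, h.1 f.1 f.2⟩
                            map_add' := fun f g => v.1.1.map_add
                              ⟨f.1 ∘ φ, h.1 f.1 f.2⟩ ⟨g.1 ∘ φ, h.1 g.1 g.2⟩
                            map_smul' := fun c f => v.1.1.map_smul c ⟨f.1 ∘ φ, h.1 f.1 f.2⟩ },
          fun f => v.1.2 ⟨f.1 ∘ φ, h.2.1 f.1 f.2⟩),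
          fun f g => v.2.1 ⟨f.1 ∘ φ, h.1 f.1 f.2⟩ ⟨g.1 ∘ φ, h.1 g.1 g.2⟩,
          fun f => v.2.2.1 ⟨f.1 ∘ φ, h.2.1 f.1 f.2⟩,
          fun f f' u hu he => v.2.2.2 ⟨f.1 ∘ φ, h.2.1 f.1 f.2⟩ ⟨f'.1 ∘ φ, h.2.1 f'.1 f'.2⟩
            ⟨u.1 ∘ φ, h.1 u.1 u.2⟩ hu (h.2.2.eventually he)⟩
      map_add' := fun _ _ => rfl
      map_smul' := fun _ _ => rfl }
  else 0

/-- The `b`-vector field `X` (a section of the `b`-tangent bundle) is smooth near `p`. -/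
def IsSmoothFieldAt (X : ∀ p, bTangent S Z p) (p : M) : Prop :=
  ∀ᶠ y in 𝓝 p, (∀ h, S.SmoothAt h y → S.SmoothAt (fun z => bDeriv (X z) h) y) ∧
    ∀ f, IsDefiningAt S Z f y → S.SmoothAt (fun z => bLogDeriv (X z) f) y

/-- `b` is the value at `p` of the Lie bracket `[X, Y]`. -/
def IsLieBracketAt (X Y : ∀ p, bTangent S Z p) (p : M) (b : bTangent S Z p) : Prop :=
  (∀ h, S.SmoothAt h p →
    bDeriv b h = bDeriv (X p) (fun z => bDeriv (Y z) h) - bDeriv (Y p) (fun z => bDeriv (X z) h)) ∧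
  ∀ f, IsDefiningAt S Z f p → bLogDeriv b f =
    bDeriv (X p) (fun z => bLogDeriv (Y z) f) - bDeriv (Y p) (fun z => bLogDeriv (X z) f)

/-- `r = X (λ Y) - Y (λ X) - λ [X, Y]` at `p`, where `X`, `Y` are smooth `b`-vector fields near `p`
with `X p = v`, `Y p = w`. -/
def IsExtDerivAt (lam : ∀ p, Module.Dual ℝ (bTangent S Z p)) (p : M) (v w : bTangent S Z p)
    (r : ℝ) : Prop :=
  ∃ (X Y : ∀ p, bTangent S Z p) (b : bTangent S Z p), IsSmoothFieldAt X p ∧ IsSmoothFieldAt Y p ∧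
    X p = v ∧ Y p = w ∧ IsLieBracketAt X Y p b ∧
    r = bDeriv (X p) (fun z => lam z (Y z)) - bDeriv (Y p) (fun z => lam z (X z)) - lam p b

open Classical in
/-- The exterior derivative `dλ` of a `b`-form `λ` of degree one. -/
def bExtDeriv (lam : ∀ p, Module.Dual ℝ (bTangent S Z p)) (p : M) (v w : bTangent S Z p) : ℝ :=
  if h : ∃ r, IsExtDerivAt lam p v w r then h.choose else 0

/-- A family of nondegenerate alternating bilinear forms on the `b`-tangent spaces. -/
def IsNondegenerate (σ : ∀ p, bTangent S Z p → bTangent S Z p → ℝ) : Prop :=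
  ∀ p, ∃ B : bTangent S Z p →ₗ[ℝ] Module.Dual ℝ (bTangent S Z p),
    (∀ v w, B v w = σ p v w) ∧ (∀ v, σ p v v = 0) ∧ Function.Bijective B

/-- `v` is the `b`-Hamiltonian vector of `F` at `p`: `σ(v, ·) = dF`. -/
def IsHamiltonianAt (σ : ∀ p, bTangent S Z p → bTangent S Z p → ℝ) (F : M → ℝ) (p : M)
    (v : bTangent S Z p) : Prop :=
  ∀ w, σ p v w = bDeriv w F

open Classical in
/-- The Poisson bracket `{F, K} = σ(X_F, X_K)` of a `b`-symplectic form `σ`. -/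
def poisson (σ : ∀ p, bTangent S Z p → bTangent S Z p → ℝ) (F K : M → ℝ) (p : M) : ℝ :=
  if h : ∃ r, ∃ v w, IsHamiltonianAt σ F p v ∧ IsHamiltonianAt σ K p w ∧ r = σ p v w then h.choose
  else 0

variable (S Z)

/-- The total space of the `b`-cotangent bundle of `(M, Z)`: a point `α` lies over `α.proj`, and
`α.cov` is a linear form on the fibre of the `b`-tangent bundle. -/
structure BCotangent where
  proj : M
  cov : Module.Dual ℝ (bTangent S Z proj)

variable {S Z}

/-- The fibrewise linear function on the `b`-cotangent bundle defined by a `b`-vector field. -/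
def BCotangent.pair (X : ∀ p, bTangent S Z p) (α : BCotangent S Z) : ℝ := α.cov (X α.proj)

/-- The coarsest topology for which the bundle projection and the fibrewise linear functions of
smooth local `b`-vector fields are continuous. -/
instance : TopologicalSpace (BCotangent S Z) :=
  TopologicalSpace.generateFrom {A | ∃ (U : Set M) (O : Set ℝ) (X : ∀ p, bTangent S Z p),
    IsOpen U ∧ IsOpen O ∧ (∀ p ∈ U, IsSmoothFieldAt X p) ∧
    A = {α | α.proj ∈ U ∧ BCotangent.pair X α ∈ O}}

theorem isSmoothFieldAt_zero (p : M) : IsSmoothFieldAt (0 : ∀ p, bTangent S Z p) p := by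
  have h0 : ∀ y, S.SmoothAt (fun _ => (0 : ℝ)) y := fun y => (S.alg y).zero_mem
  refine Eventually.of_forall fun y => ⟨fun h _ => ?_, fun f _ => ?_⟩
  · convert h0 y using 2 with z
    simp only [bDeriv]
    split_ifs <;> rfl
  · convert h0 y using 2 with z
    simp only [bLogDeriv]
    split_ifs <;> rfl

theorem BCotangent.continuous_proj : Continuous (BCotangent.proj : BCotangent S Z → M) := by
  refine continuous_def.2 fun U hU => TopologicalSpace.isOpen_generateFrom_of_mem ?_
  refine ⟨U, univ, 0, hU, isOpen_univ, fun p _ => isSmoothFieldAt_zero p, ?_⟩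
  ext α
  simp

theorem BCotangent.continuousAt_pair {X : ∀ p, bTangent S Z p} {α : BCotangent S Z}
    (hX : IsSmoothFieldAt X α.proj) : ContinuousAt (BCotangent.pair X) α := by
  obtain ⟨U, hU, hUo, hα⟩ := eventually_nhds_iff.1 (eventually_eventually_nhds.2 hX)
  refine continuousAt_def.2 fun A hA => ?_
  obtain ⟨O, hOA, hOo, hO⟩ := mem_nhds_iff.1 hA
  refine mem_of_superset (IsOpen.mem_nhds (TopologicalSpace.isOpen_generateFrom_of_mem
    ⟨U, O, X, hUo, hOo, hU, rfl⟩) ⟨hα, hO⟩) ?_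
  rintro β ⟨-, hβ⟩
  exact hOA hβ

variable (S Z)

/-- The smooth structure of the `b`-cotangent bundle, generated by the smooth functions on the base
and the fibrewise linear functions of smooth `b`-vector fields. -/
def BCotangent.str : SmoothStr (BCotangent S Z) :=
  SmoothStr.generated
    (fun α => {f | (∃ h, S.SmoothAt h α.proj ∧ f = h ∘ BCotangent.proj) ∨
      ∃ X : ∀ p, bTangent S Z p, IsSmoothFieldAt X α.proj ∧ f = BCotangent.pair X})
    (by
      rintro α _ (⟨h, hh, rfl⟩ | ⟨X, hX, rfl⟩)
      · filter_upwards [BCotangent.continuous_proj.continuousAt.eventually (S.eventually hh)]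
          with β hβ
        exact Or.inl ⟨h, hβ, rfl⟩
      · filter_upwards [BCotangent.continuous_proj.continuousAt.eventually
          (eventually_eventually_nhds.2 hX)] with β hβ
        exact Or.inr ⟨X, hβ, rfl⟩)
    (by
      rintro α _ (⟨h, hh, rfl⟩ | ⟨X, hX, rfl⟩)
      · exact (S.continuousAt hh).comp BCotangent.continuous_proj.continuousAt
      · exact BCotangent.continuousAt_pair hX)

/-- The critical hypersurface `ᵇT*M|_Z` of the `b`-cotangent bundle. -/
def BCotangent.crit : Set (BCotangent S Z) := BCotangent.proj ⁻¹' Z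

/-- The `b`-Liouville form `⟨λ_α, v⟩ = ⟨α, π_* v⟩`. -/
def liouville (α : BCotangent S Z) :
    Module.Dual ℝ (bTangent (BCotangent.str S Z) (BCotangent.crit S Z) α) :=
  α.cov ∘ₗ bMap (BCotangent.str S Z) (BCotangent.crit S Z) S Z BCotangent.proj α

/-- The canonical `b`-symplectic form `ω = -dλ` on the `b`-cotangent bundle. -/
def canonicalForm (α : BCotangent S Z)
    (v w : bTangent (BCotangent.str S Z) (BCotangent.crit S Z) α) : ℝ :=
  -bExtDeriv (liouville S Z) α v w

end BGeometry

/-- `br` is a Poisson bracket on the sheaf of smooth functions of `(X, S)`. -/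
structure IsPoissonBracket {X : Type*} [TopologicalSpace X] (S : SmoothStr X)
    (br : (X → ℝ) → (X → ℝ) → X → ℝ) : Prop where
  smoothAt : ∀ {F K x}, S.SmoothAt F x → S.SmoothAt K x → S.SmoothAt (br F K) x
  skew : ∀ {F K x}, S.SmoothAt F x → S.SmoothAt K x → br F K x = -br K F x
  add_left : ∀ {F K L x}, S.SmoothAt F x → S.SmoothAt K x → S.SmoothAt L x →
    br (F + K) L x = br F L x + br K L x
  smul_left : ∀ {F K x} (c : ℝ), S.SmoothAt F x → S.SmoothAt K x → br (c • F) K x = c * br F K x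
  leibniz : ∀ {F K L x}, S.SmoothAt F x → S.SmoothAt K x → S.SmoothAt L x →
    br (F * K) L x = F x * br K L x + K x * br F L x
  jacobi : ∀ {F K L x}, S.SmoothAt F x → S.SmoothAt K x → S.SmoothAt L x →
    br F (br K L) x + br K (br L F) x + br L (br F K) x = 0

/-! ### `b`-Lie groups -/

section Lie

variable (E : Type*) [NormedAddCommGroup E] [NormedSpace ℝ E]
  {G : Type*} [TopologicalSpace G] [ChartedSpace E G] [Group G]

/-- The differential at the identity of a function on `G` (with `T_1 G = E`). -/
def diffOne (f : G → ℝ) : E →L[ℝ] ℝ := mfderiv 𝓘(ℝ, E) 𝓘(ℝ, ℝ) f 1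

/-- The Lie algebra `𝔥` of the embedded Lie subgroup `H`: its tangent space at the identity, as a
subspace of `T_1 G = E`. -/
def lieAlg (H : Subgroup G) : Submodule ℝ E where
  carrier := {X | ∀ f : G → ℝ, (∀ᶠ x in 𝓝 (1 : G), ContMDiffAt 𝓘(ℝ, E) 𝓘(ℝ, ℝ) ∞ f x) →
    (∀ᶠ x in 𝓝 (1 : G), x ∈ H → f x = 0) → diffOne E f X = 0}
  add_mem' {X Y} hX hY f hf h0 := by simp [hX f hf h0, hY f hf h0]
  zero_mem' f _ _ := by simp
  smul_mem' c X hX f hf h0 := by simp [hX f hf h0]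

variable (G) in
/-- The Lie bracket of the Lie algebra of `G` (that of left-invariant vector fields). -/
def lieBracketOne (X Y : E) : E :=
  Bracket.bracket (L := GroupLieAlgebra 𝓘(ℝ, E) G) (M := GroupLieAlgebra 𝓘(ℝ, E) G) X Y

variable {E}
variable [LieGroup 𝓘(ℝ, E) ∞ G]

theorem diffOne_mul_left (Y : E) {f : G → ℝ} {g : G}
    (hf : ContMDiffAt 𝓘(ℝ, E) 𝓘(ℝ, ℝ) ∞ f g) :
    diffOne E (fun x => f (g * x)) Y =
      (show E →L[ℝ] ℝ from mfderiv 𝓘(ℝ, E) 𝓘(ℝ, ℝ) f g)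
        (mulInvariantVectorField (I := 𝓘(ℝ, E)) (G := G) Y g) := by
  have h2 : MDifferentiableAt 𝓘(ℝ, E) 𝓘(ℝ, E) (fun x => g * x) (1 : G) :=
    (contMDiff_mul_left (I := 𝓘(ℝ, E)) (n := ∞)).contMDiffAt.mdifferentiableAt (by simp)
  have h3 := mfderiv_comp_of_eq (y := g) (x := (1 : G)) (f := fun x => g * x)
    (hf.mdifferentiableAt (by simp)) h2 (mul_one g)
  have h4 : (mfderiv 𝓘(ℝ, E) 𝓘(ℝ, ℝ) (f ∘ fun x => g * x) 1 : E →L[ℝ] ℝ) =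
    (show E →L[ℝ] ℝ from mfderiv 𝓘(ℝ, E) 𝓘(ℝ, ℝ) f g).comp
    (show E →L[ℝ] E from mfderiv 𝓘(ℝ, E) 𝓘(ℝ, E) (fun x => g * x) 1) := by
    rw [h3]; congr 1; rw [mul_one]
  exact DFunLike.congr_fun h4 Y

theorem contMDiffAt_diffOne (Y : E) {f : G → ℝ} {g : G}
    (hf : ContMDiffAt 𝓘(ℝ, E) 𝓘(ℝ, ℝ) ∞ f g) :
    ContMDiffAt 𝓘(ℝ, E) 𝓘(ℝ, ℝ) ∞ (fun g : G => diffOne E (fun x => f (g * x)) Y) g := by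
  have : IsManifold 𝓘(ℝ, E) 1 G := IsManifold.of_le (n := ∞) (by simp)
  have h0 : ContMDiffAt (𝓘(ℝ, E).prod 𝓘(ℝ, E)) 𝓘(ℝ, ℝ) ∞
      (Function.uncurry fun g x : G => f (g * x)) (g, 1) := by
    have : ContMDiffAt 𝓘(ℝ, E) 𝓘(ℝ, ℝ) ∞ f ((fun p : G × G => p.1 * p.2) (g, 1)) := by
      simpa using hf
    exact this.comp (g, (1 : G)) (contMDiff_mul 𝓘(ℝ, E) ∞).contMDiffAt
  have h1 := ContMDiffAt.mfderiv (m := ∞) (fun g x : G => f (g * x)) (fun _ => (1 : G)) h0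
    contMDiffAt_const (by simp)
  have h2 := h1.clm_apply (contMDiffAt_const (c := Y))
  refine h2.congr_of_eventuallyEq ?_
  refine Eventually.of_forall fun z => ?_
  have h3 := inTangentCoordinates_eq (I := 𝓘(ℝ, E)) (I' := 𝓘(ℝ, ℝ)) (x₀ := g) (x := z)
    (fun _ : G => (1 : G)) (fun x => f (x * 1))
    (fun x => diffOne E (fun y => f (x * y)))
    (mem_chart_source E (1 : G)) (by simp only [chartAt_self_eq, OpenPartialHomeomorph.refl_source, mem_univ])
  have h4 := (tangentBundleCore 𝓘(ℝ, E) G).coordChange_self (achart E (1 : G)) 1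
    (mem_chart_source E (1 : G)) Y
  have h5 := DFunLike.congr_fun h3 Y
  refine Eq.trans ?_ h5.symm
  rw [ContinuousLinearMap.comp_apply, ContinuousLinearMap.comp_apply, h4]
  simp only [tangentBundleCore_coordChange_model_space]
  rfl

theorem lie_mem [FiniteDimensional ℝ E] (H : Subgroup G) {X Y : E} (hX : X ∈ lieAlg E H) (hY : Y ∈ lieAlg E H) :
    lieBracketOne E G X Y ∈ lieAlg E H := by
  intro f hf h0
  have : IsManifold 𝓘(ℝ, E) 1 G := IsManifold.of_le (n := ∞) (by simp)
  have inst3 : LieGroup 𝓘(ℝ, E) (minSmoothness ℝ 3) G := LieGroup.of_le (n := ∞) (by simp; exact WithTop.coe_le_coe.2 le_top)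
  have key : ∀ Z ∈ lieAlg E H, ∀ W ∈ lieAlg E H,
    diffOne E (fun g => diffOne E (fun x => f (g * x)) Z) W = 0 := by
    intro Z hZ W hW
    refine hW _ ?_ ?_
    · filter_upwards [hf] with g hg using contMDiffAt_diffOne Z hg
    · filter_upwards [eventually_eventually_nhds.2 hf, eventually_eventually_nhds.2 h0]
        with g h1 h2 hg
      have : ContinuousAt (fun x => g * x) (1 : G) :=
        (contMDiff_mul_left (I := 𝓘(ℝ, E)) (n := ∞)).continuous.continuousAt
      have h3 : Tendsto (fun x => g * x) (𝓝 (1 : G)) (𝓝 g) := by simpa [ContinuousAt] using this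
      refine hZ _ ?_ ?_
      · filter_upwards [h3.eventually h1] with x hx
        exact hx.comp x (contMDiff_mul_left (I := 𝓘(ℝ, E)) (n := ∞)).contMDiffAt
      · filter_upwards [h3.eventually h2] with x hx hxH
        exact hx (H.mul_mem hg hxH)
  set c := extChartAt 𝓘(ℝ, E) (1 : G) with hcdef
  have hd : ∀ k : G → ℝ, MDifferentiableAt 𝓘(ℝ, E) 𝓘(ℝ, ℝ) k 1 →
      diffOne E k = fderiv ℝ (k ∘ c.symm) (c 1) := by
    intro k hk
    have h := hk.mfderiv
    refine Eq.trans (b := fderivWithin ℝ (writtenInExtChartAt 𝓘(ℝ, E) 𝓘(ℝ, ℝ) 1 k)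
      (range 𝓘(ℝ, E)) (c 1)) h ?_
    rw [modelWithCornersSelf_coe, range_id, fderivWithin_univ]
    rfl
  set V : E → E → E := fun Z => (VectorField.mpullbackWithin 𝓘(ℝ, E) 𝓘(ℝ, E) c.symm
        (mulInvariantVectorField (I := 𝓘(ℝ, E)) (G := G) Z) (range 𝓘(ℝ, E))) with hV
  have hid : (mfderiv 𝓘(ℝ, E) 𝓘(ℝ, E) c 1 : E →L[ℝ] E) = ContinuousLinearMap.id ℝ E := by
    have h := (mdifferentiableAt_extChartAt (I := 𝓘(ℝ, E)) (mem_chart_source E (1 : G))).mfderiv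
    refine Eq.trans (b := fderivWithin ℝ (writtenInExtChartAt 𝓘(ℝ, E) 𝓘(ℝ, E) 1 c)
      (range 𝓘(ℝ, E)) (c 1)) h ?_
    rw [modelWithCornersSelf_coe, range_id, fderivWithin_univ]
    have h1 : writtenInExtChartAt 𝓘(ℝ, E) 𝓘(ℝ, E) 1 c =ᶠ[𝓝 (c 1)] id := by
      filter_upwards [extChartAt_target_mem_nhds (I := 𝓘(ℝ, E)) (1 : G)] with y hy
      exact c.right_inv hy
    rw [h1.fderiv_eq, fderiv_id]
  have hA : ∀ Z : E, (fun y => fderiv ℝ (f ∘ c.symm) y (V Z y)) =ᶠ[𝓝 (c 1)]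
      ((fun g => diffOne E (fun x => f (g * x)) Z) ∘ c.symm) := by
    intro Z
    have hcont : Tendsto c.symm (𝓝 (c 1)) (𝓝 (1 : G)) := by
      have := continuousAt_extChartAt_symm (I := 𝓘(ℝ, E)) (1 : G)
      rwa [ContinuousAt, extChartAt_to_inv] at this
    filter_upwards [extChartAt_target_mem_nhds (I := 𝓘(ℝ, E)) (1 : G), hcont.eventually hf]
      with y hy hfy
    have h1 := diffOne_mul_left Z hfy
    refine Eq.trans ?_ h1.symm
    have hcd : MDifferentiableAt 𝓘(ℝ, E) 𝓘(ℝ, E) c.symm y := by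
      have := mdifferentiableWithinAt_extChartAt_symm (I := 𝓘(ℝ, E)) hy
      rwa [modelWithCornersSelf_coe, range_id, mdifferentiableWithinAt_univ] at this
    have h2 : (fderiv ℝ (f ∘ c.symm) y) =
        (show E →L[ℝ] ℝ from mfderiv 𝓘(ℝ, E) 𝓘(ℝ, ℝ) f (c.symm y)).comp
        (show E →L[ℝ] E from mfderiv 𝓘(ℝ, E) 𝓘(ℝ, E) c.symm y) := by
      rw [← mfderiv_eq_fderiv]
      exact mfderiv_comp y (hfy.mdifferentiableAt (by simp)) hcd
    have h3 := isInvertible_mfderivWithin_extChartAt_symm (I := 𝓘(ℝ, E)) hy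
    have h4 : V Z y = (show E →L[ℝ] E from mfderiv 𝓘(ℝ, E) 𝓘(ℝ, E) c.symm y).inverse
        (mulInvariantVectorField (I := 𝓘(ℝ, E)) (G := G) Z (c.symm y)) := by
      rw [hV, ← mfderivWithin_univ]
      simp only [VectorField.mpullbackWithin, modelWithCornersSelf_coe, range_id]
      rfl
    rw [modelWithCornersSelf_coe, range_id, mfderivWithin_univ] at h3
    have h5 : (show E →L[ℝ] E from mfderiv 𝓘(ℝ, E) 𝓘(ℝ, E) c.symm y).IsInvertible := h3
    rw [h2, h4, ContinuousLinearMap.comp_apply]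
    have gen : ∀ (A : E →L[ℝ] E), A.IsInvertible → ∀ w, A (A.inverse w) = w := by
      rintro _ ⟨e, rfl⟩ w
      simp
    exact congrArg _ (gen _ h5 _)
  have hB : ∀ Z : E, V Z (c 1) = Z := by
    intro Z
    have h := (VectorField.eventuallyEq_mpullback_mpullbackWithin_extChartAt (s := univ)
      (x := (1 : G)) (mulInvariantVectorField (I := 𝓘(ℝ, E)) (G := G) Z)).self_of_nhdsWithin
        (mem_univ _)
    have h1 : mulInvariantVectorField (I := 𝓘(ℝ, E)) (G := G) Z 1 = Z := by
      have h2 : (fun x : G => 1 * x) = id := by ext; simp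
      have h3 : (mfderiv 𝓘(ℝ, E) 𝓘(ℝ, E) (fun x : G => 1 * x) 1 : E →L[ℝ] E) =
          ContinuousLinearMap.id ℝ E := by
        rw [h2]; exact mfderiv_id
      exact DFunLike.congr_fun h3 Z
    have h4 : (mfderiv 𝓘(ℝ, E) 𝓘(ℝ, E) c 1 : E →L[ℝ] E).inverse (V Z (c 1)) = Z :=
      h.symm.trans h1
    rw [hid] at h4
    have h5 : (ContinuousLinearMap.id ℝ E).inverse (V Z (c 1)) = V Z (c 1) :=
      DFunLike.congr_fun ContinuousLinearMap.inverse_id _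
    exact h5.symm.trans h4
  have hC : ∀ Z : E, DifferentiableAt (𝕜 := ℝ) (E := E) (F := E) (V Z) (c 1) := by
    intro Z
    have h0 : ContMDiffWithinAt 𝓘(ℝ, E) 𝓘(ℝ, E).tangent 1
      (fun g : G ↦ (mulInvariantVectorField (I := 𝓘(ℝ, E)) Z g : TangentBundle 𝓘(ℝ, E) G)) univ 1 :=
      ((contMDiffAt_mulInvariantVectorField (I := 𝓘(ℝ, E)) (G := G) Z).of_le
        (by simp)).contMDiffWithinAt
    have h1 := VectorField.contMDiffWithinAt_mpullbackWithin_extChartAt_symm h0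
      uniqueMDiffOn_univ (mem_univ _) (n := 2) (by norm_num)
    rw [preimage_univ, inter_univ] at h1
    have h2 := h1.contMDiffAt (extChartAt_target_mem_nhds (I := 𝓘(ℝ, E)) (1 : G))
    have h3 : ContDiffAt (𝕜 := ℝ) (E := E) (F := E) 1 (V Z) (c 1) :=
      contMDiffAt_vectorSpace_iff_contDiffAt.1 h2
    exact ContDiffAt.differentiableAt (𝕜 := ℝ) (E := E) (F := E) h3 (by simp)
  have hD : lieBracketOne E G X Y = VectorField.lieBracket ℝ (E := E) (V X) (V Y) (c 1) := by
    have h : lieBracketOne E G X Y = (mfderiv 𝓘(ℝ, E) 𝓘(ℝ, E) c 1 : E →L[ℝ] E).inverse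
      (VectorField.lieBracketWithin ℝ (E := E) (V X) (V Y)
         (c.symm ⁻¹' univ ∩ range 𝓘(ℝ, E)) (c 1)) := rfl
    have h1 : (VectorField.lieBracketWithin ℝ (E := E) (V X) (V Y)
         (c.symm ⁻¹' univ ∩ range 𝓘(ℝ, E)) (c 1)) = VectorField.lieBracket ℝ (E := E) (V X) (V Y) (c 1) := by
      rw [modelWithCornersSelf_coe, range_id, preimage_univ, univ_inter,
        VectorField.lieBracketWithin_univ]
    refine h.trans ?_
    rw [h1, hid]
    have h2 : ∀ w : E, (ContinuousLinearMap.id ℝ E).inverse w = w := fun w =>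
      DFunLike.congr_fun ContinuousLinearMap.inverse_id w
    exact h2 _
  have hsm : ContDiffAt ℝ ∞ (f ∘ c.symm) (c 1) := by
    have h1 := (contMDiffOn_extChartAt_symm (I := 𝓘(ℝ, E)) (n := ∞) (1 : G)).contMDiffAt
      (extChartAt_target_mem_nhds (I := 𝓘(ℝ, E)) (1 : G))
    have h2 : ContMDiffAt 𝓘(ℝ, E) 𝓘(ℝ, ℝ) ∞ f (c.symm (c 1)) := by
      rw [hcdef, extChartAt_to_inv]; exact hf.self_of_nhds
    exact (h2.comp _ h1).contDiffAt
  rw [hd f (hf.self_of_nhds.mdifferentiableAt (by simp)), hD,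
    VectorField.fderiv_apply_lieBracket hsm (by simp; exact WithTop.coe_le_coe.2 le_top) (hC Y) (hC X),
    (hA Y).fderiv_eq, (hA X).fderiv_eq, hB, hB,
    ← hd _ ((contMDiffAt_diffOne Y hf.self_of_nhds).mdifferentiableAt (by simp)),
    ← hd _ ((contMDiffAt_diffOne X hf.self_of_nhds).mdifferentiableAt (by simp)),
    key Y hY X hX, key X hX Y hY, sub_zero]

variable (E)

/-- `(G, H)` is a `b`-Lie group: `H` is closed and an embedded hypersurface of `G`. -/
structure IsBLieGroup (H : Subgroup G) : Prop where
  isClosed : IsClosed (H : Set G)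
  isHypersurface : IsHypersurface (SmoothStr.ofManifold E G) (H : Set G)

variable (H : Subgroup G)

/-- The fibre at `g` of the `b`-tangent bundle of `(G, H)`. -/
abbrev BTangentG (g : G) := bTangent (SmoothStr.ofManifold E G) (H : Set G) g

/-- The `b`-cotangent bundle of `(G, H)`. -/
abbrev BCotangentG := BCotangent (SmoothStr.ofManifold E G) (H : Set G)

/-- `G/H`, the space of right cosets `Hg`, i.e. of orbits of `H` acting by left translations. -/
abbrev CosetSpace := Quotient (QuotientGroup.rightRel H)

/-- The projection `π : G → G/H`. -/
def toCoset (g : G) : CosetSpace H := Quotient.mk _ g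

/-- The smooth structure of `G/H`. -/
def cosetStr : SmoothStr (CosetSpace H) :=
  (SmoothStr.ofManifold E G).quot (toCoset H) isQuotientMap_quotient_mk'

/-- The critical hypersurface `{[e]}` of `G/H`. -/
def critPt : Set (CosetSpace H) := {toCoset H 1}

/-- The `b`-cotangent bundle of `(G/H, [e])`. -/
abbrev BCotangentCoset := BCotangent (cosetStr E H) (critPt H)

/-- The `b`-differential of `L_h : x ↦ h x`. -/
def leftMap (h g : G) : BTangentG E H g →ₗ[ℝ] BTangentG E H (h * g) :=
  bMap (SmoothStr.ofManifold E G) H (SmoothStr.ofManifold E G) H (fun x => h * x) g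

/-- The orbit relation of the cotangent lift `α ↦ (L_{h⁻¹})^* α` of the action of `H` on `G` by left
translations: `β` is the image of `α` under `h` when it lies over `h g` and `(L_h)^* β = α`. -/
def cotangentLiftRel (α β : BCotangentG E H) : Prop :=
  ∃ h ∈ H, ∃ b : Module.Dual ℝ (BTangentG E H (h * α.proj)),
    β = ⟨h * α.proj, b⟩ ∧ ∀ v, b (leftMap E H h α.proj v) = α.cov v

/-- The reduced space `(ᵇT*G)/H`. -/
abbrev Reduced := Quot (cotangentLiftRel E H)

/-- The quotient map `ᵇT*G → (ᵇT*G)/H`. -/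
def toReduced (α : BCotangentG E H) : Reduced E H := Quot.mk _ α

/-- The smooth structure of `(ᵇT*G)/H`. -/
def reducedStr : SmoothStr (Reduced E H) :=
  (BCotangent.str (SmoothStr.ofManifold E G) (H : Set G)).quot (toReduced E H) isQuotientMap_quot_mk

/-- The projection `(ᵇT*G)/H → G/H`. -/
def reducedProj : Reduced E H → CosetSpace H :=
  Quot.lift (fun α => toCoset H α.proj) (by
    rintro α β ⟨h, hh, b, rfl, -⟩
    exact Quotient.sound (QuotientGroup.rightRel_apply.2 (by simpa using hh)))

/-- The canonical Poisson bracket of `ᵇT*G`. -/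
def canonicalBracket (F K : BCotangentG E H → ℝ) : BCotangentG E H → ℝ :=
  poisson (canonicalForm (SmoothStr.ofManifold E G) (H : Set G)) F K

/-- The reduced bracket on `(ᵇT*G)/H`: the bracket of the pullbacks to `ᵇT*G`, evaluated at some
representative. -/
def reducedBracket (F K : Reduced E H → ℝ) (y : Reduced E H) : ℝ :=
  canonicalBracket E H (F ∘ toReduced E H) (K ∘ toReduced E H) (Quot.out y)

/-! ### Minimal coupling -/

/-- `v` is the value at `g` of the fundamental `b`-vector field `ζ^X` of the action of `H`, the
smooth `b`-vector field with `(ζ^X f)(g) = d/dt f(e^{tX} g)` at `t = 0`. -/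
def IsFundamentalAt (X : E) (g : G) (v : BTangentG E H g) : Prop :=
  ∃ Y : ∀ g, BTangentG E H g, IsSmoothFieldAt Y g ∧ Y g = v ∧
    ∀ᶠ z in 𝓝 g, ∀ f, (SmoothStr.ofManifold E G).SmoothAt f z →
      bDeriv (Y z) f = diffOne E (fun x => f (x * z)) X

open Classical in
/-- The infinitesimal action `ζ_g : 𝔥 → ᵇT_g G`. -/
def fundamental (g : G) : lieAlg E H →ₗ[ℝ] BTangentG E H g :=
  if h : ∃ ζ : lieAlg E H →ₗ[ℝ] BTangentG E H g, ∀ X : lieAlg E H, IsFundamentalAt E H (X : E) g (ζ X)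
  then h.choose else 0

/-- The adjoint action of `G` on its Lie algebra. -/
def adjoint (h : G) : E →L[ℝ] E := mfderiv 𝓘(ℝ, E) 𝓘(ℝ, E) (fun x : G => h * x * h⁻¹) 1

/-- A principal `H`-`b`-connection `θ ∈ ᵇΩ¹(G; 𝔥)` for `π : G → G/H`. -/
structure BConnection where
  form : ∀ g : G, BTangentG E H g →ₗ[ℝ] lieAlg E H
  smooth : ∀ (Y : ∀ g, BTangentG E H g) (g : G), IsSmoothFieldAt Y g →
    ∀ μ : StrongDual ℝ (lieAlg E H),
      (SmoothStr.ofManifold E G).SmoothAt (fun z => μ (form z (Y z))) g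
  vertical : ∀ (g : G) (X : lieAlg E H), form g (fundamental E H g X) = X
  equivariant : ∀ h ∈ H, ∀ (g : G) (v : BTangentG E H g),
    (form (h * g) (leftMap E H h g v) : E) = adjoint E h (form g v)

/-- The annihilator `ℋ° ⊂ ᵇT*G` of the vertical directions. -/
def annihilator : Set (BCotangentG E H) := {α | ∀ X, α.cov (fundamental E H α.proj X) = 0}

section LinearAlgebra

variable {V W : Type*} [AddCommGroup V] [Module ℝ V] [NormedAddCommGroup W] [NormedSpace ℝ W]
  {ζ : W →ₗ[ℝ] V} {θ : V →ₗ[ℝ] W}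

theorem split_vertical (h : ∀ X, θ (ζ X) = X) (a : Module.Dual ℝ V) (X : W) :
    (a - a ∘ₗ ζ ∘ₗ θ) (ζ X) = 0 := by simp [h]

theorem split_left [FiniteDimensional ℝ W] (a : Module.Dual ℝ V) :
    a - a ∘ₗ ζ ∘ₗ θ + (LinearMap.toContinuousLinearMap (a ∘ₗ ζ)).toLinearMap ∘ₗ θ = a := by
  ext v
  simp

theorem split_right_fst (h : ∀ X, θ (ζ X) = X) (b : Module.Dual ℝ V) (hb : ∀ X, b (ζ X) = 0)
    (μ : StrongDual ℝ W) :
    (b + μ.toLinearMap ∘ₗ θ) - (b + μ.toLinearMap ∘ₗ θ) ∘ₗ ζ ∘ₗ θ = b := by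
  ext v
  simp [h, hb]

theorem split_right_snd [FiniteDimensional ℝ W] (h : ∀ X, θ (ζ X) = X) (b : Module.Dual ℝ V) (hb : ∀ X, b (ζ X) = 0)
    (μ : StrongDual ℝ W) :
    LinearMap.toContinuousLinearMap ((b + μ.toLinearMap ∘ₗ θ) ∘ₗ ζ) = μ := by
  ext v
  simp [h, hb]

end LinearAlgebra

variable {E H} in
/-- The minimal coupling map `ψ_θ : ᵇT*G → ℋ° × 𝔥*`, `α ↦ (α - α ∘ ζ ∘ θ, α ∘ ζ)`, with inverse
`(β, μ) ↦ β + μ ∘ θ`. -/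
def minimalCoupling [FiniteDimensional ℝ E] (θ : BConnection E H) :
    BCotangentG E H ≃ annihilator E H × StrongDual ℝ (lieAlg E H) where
  toFun α := (⟨⟨α.proj, α.cov - α.cov ∘ₗ fundamental E H α.proj ∘ₗ θ.form α.proj⟩,
      fun X => split_vertical (ζ := fundamental E H α.proj) (θ := θ.form α.proj) (θ.vertical α.proj) α.cov X⟩,
    LinearMap.toContinuousLinearMap (α.cov ∘ₗ fundamental E H α.proj))
  invFun p := ⟨p.1.1.proj, p.1.1.cov + p.2.toLinearMap ∘ₗ θ.form p.1.1.proj⟩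
  left_inv α := congrArg (BCotangent.mk α.proj) (split_left (ζ := fundamental E H α.proj) (θ := θ.form α.proj) α.cov)
  right_inv p := Prod.ext
    (Subtype.ext (congrArg (BCotangent.mk p.1.1.proj)
      (split_right_fst (ζ := fundamental E H p.1.1.proj) (θ := θ.form p.1.1.proj)
        (θ.vertical p.1.1.proj) p.1.1.cov p.1.2 p.2)))
    (split_right_snd (ζ := fundamental E H p.1.1.proj) (θ := θ.form p.1.1.proj)
        (θ.vertical p.1.1.proj) p.1.1.cov p.1.2 p.2)

/-- The smooth structure of `ℋ° × 𝔥*`. -/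
def couplingStr : SmoothStr (annihilator E H × StrongDual ℝ (lieAlg E H)) :=
  ((BCotangent.str (SmoothStr.ofManifold E G) (H : Set G)).sub (annihilator E H)).prod
    (SmoothStr.std (StrongDual ℝ (lieAlg E H)))

/-- The projection `ℋ° × 𝔥* → G`. -/
def couplingBase (p : annihilator E H × StrongDual ℝ (lieAlg E H)) : G := p.1.1.proj

/-- The critical hypersurface of `ℋ° × 𝔥*`. -/
def couplingCrit : Set (annihilator E H × StrongDual ℝ (lieAlg E H)) :=
  couplingBase E H ⁻¹' (H : Set G)

open Classical in
/-- The projection `π̄ : ℋ° → ᵇT*(G/H)`, `(π̄ α)(π_* v) = α v`. -/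
def annihilatorProj (α : annihilator E H) : BCotangentCoset E H :=
  ⟨toCoset H α.1.proj,
    if h : ∃ b : Module.Dual ℝ (bTangent (cosetStr E H) (critPt H) (toCoset H α.1.proj)),
      ∀ v, b (bMap (SmoothStr.ofManifold E G) H (cosetStr E H) (critPt H) (toCoset H) α.1.proj v) =
        α.1.cov v
    then h.choose else 0⟩

variable {E H} in
/-- The `b`-form `λ^θ` on `ℋ° × 𝔥*`, `λ^θ_{(α, μ)}(w) = μ (θ (τ_* w))`. -/
def couplingOneForm (θ : BConnection E H)
    (p : annihilator E H × StrongDual ℝ (lieAlg E H)) :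
    Module.Dual ℝ (bTangent (couplingStr E H) (couplingCrit E H) p) :=
  p.2.toLinearMap ∘ₗ θ.form (couplingBase E H p) ∘ₗ
    bMap (couplingStr E H) (couplingCrit E H) (SmoothStr.ofManifold E G) H (couplingBase E H) p

variable {E H} in
/-- The `b`-symplectic form `π̄^* ω_{G/H} - dλ^θ` on `ℋ° × 𝔥*`. -/
def couplingForm (θ : BConnection E H)
    (p : annihilator E H × StrongDual ℝ (lieAlg E H))
    (v w : bTangent (couplingStr E H) (couplingCrit E H) p) : ℝ :=
  canonicalForm (cosetStr E H) (critPt H) (annihilatorProj E H p.1)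
    (bMap (couplingStr E H) (couplingCrit E H) (BCotangent.str (cosetStr E H) (critPt H))
      (BCotangent.crit (cosetStr E H) (critPt H)) (fun p => annihilatorProj E H p.1) p v)
    (bMap (couplingStr E H) (couplingCrit E H) (BCotangent.str (cosetStr E H) (critPt H))
      (BCotangent.crit (cosetStr E H) (critPt H)) (fun p => annihilatorProj E H p.1) p w)
  - bExtDeriv (couplingOneForm θ) p v w

variable {E H} in
/-- The bracket of functions on `(ᵇT*G)/H`, pulled back to `ᵇT*G`, which is induced by minimal
coupling: functions on `(ᵇT*G)/H` are identified through `ψ_θ` with the `H`-invariant functions on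
`ℋ° × 𝔥*`, i.e. with the functions on `ℋ° ×_H 𝔥*`, and `ℋ° × 𝔥*` carries the Poisson bracket of
`π̄^* ω_{G/H} - dλ^θ`. -/
def couplingBracket [FiniteDimensional ℝ E] (θ : BConnection E H) (F K : Reduced E H → ℝ)
    (α : BCotangentG E H) : ℝ :=
  poisson (couplingForm θ) (F ∘ toReduced E H ∘ (minimalCoupling θ).symm)
    (K ∘ toReduced E H ∘ (minimalCoupling θ).symm) (minimalCoupling θ α)

/-! ### The local model `𝔥* × ᵇT*(G/H)` -/

variable [FiniteDimensional ℝ E]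

variable {E H} in
/-- The differential at `μ` of a function on `𝔥*`, as an element of `𝔥 = 𝔥**`. -/
def dualGradient (f : StrongDual ℝ (lieAlg E H) → ℝ) (μ : StrongDual ℝ (lieAlg E H)) :
    lieAlg E H :=
  (Module.evalEquiv ℝ (lieAlg E H)).symm
    ((fderiv ℝ f μ).toLinearMap ∘ₗ LinearMap.toContinuousLinearMap.toLinearMap)

variable {E H} in
/-- The minus Lie-Poisson bracket `{f, k}(μ) = -⟨μ, [df_μ, dk_μ]⟩` on `𝔥*`. -/
def lieMinus (f k : StrongDual ℝ (lieAlg E H) → ℝ) (μ : StrongDual ℝ (lieAlg E H)) : ℝ :=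
  -μ ⟨lieBracketOne E G (dualGradient f μ) (dualGradient k μ),
    lie_mem H (dualGradient f μ).2 (dualGradient k μ).2⟩

/-- The smooth structure of `𝔥* × ᵇT*(G/H)`. -/
def modelStr : SmoothStr (StrongDual ℝ (lieAlg E H) × BCotangentCoset E H) :=
  (SmoothStr.std (StrongDual ℝ (lieAlg E H))).prod (BCotangent.str (cosetStr E H) (critPt H))

/-- The sum of the minus Lie-Poisson bracket on `𝔥*` and the canonical bracket on `ᵇT*(G/H)`. -/
def modelBracket (f k : StrongDual ℝ (lieAlg E H) × BCotangentCoset E H → ℝ)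
    (p : StrongDual ℝ (lieAlg E H) × BCotangentCoset E H) : ℝ :=
  lieMinus (fun μ => f (μ, p.2)) (fun μ => k (μ, p.2)) p.1 +
    poisson (canonicalForm (cosetStr E H) (critPt H)) (fun b => f (p.1, b)) (fun b => k (p.1, b)) p.2

/-- Over `V ⊂ G/H`, the reduced space `(ᵇT*G)/H` with its Poisson bracket is isomorphic to
`𝔥* × ᵇT*V`, by a Poisson diffeomorphism over `V`. -/
def IsPoissonTrivialOver (V : Set (CosetSpace H)) : Prop :=
  ∃ Φ : OpenPartialHomeomorph (Reduced E H) (StrongDual ℝ (lieAlg E H) × BCotangentCoset E H),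
    Φ.source = reducedProj E H ⁻¹' V ∧ Φ.target = {p | p.2.proj ∈ V} ∧
    (∀ y ∈ Φ.source, (Φ y).2.proj = reducedProj E H y) ∧
    (∀ y ∈ Φ.source, ∀ f, (modelStr E H).SmoothAt f (Φ y) ↔ (reducedStr E H).SmoothAt (f ∘ Φ) y) ∧
    ∀ y ∈ Φ.source, ∀ f k, (modelStr E H).SmoothAt f (Φ y) → (modelStr E H).SmoothAt k (Φ y) →
      reducedBracket E H (f ∘ Φ) (k ∘ Φ) y = modelBracket E H f k (Φ y)

end Lie

end BLie

end

open BLie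

open Set Filter Topology
open scoped Manifold ContDiff

noncomputable section

namespace BLie

/-! ### Calculus in coordinate spaces -/

section

open MeasureTheory


/-! Everything is local over `G/H`. The implicit function theorem gives a curve `c` through the
identity transverse to `H`, and near `[e]` each group element is uniquely `h c(r)` with `h ∈ H`;
right translation carries this picture to the other cosets (`exists_slice`). Over a small `V ⊂ G/H`
the group is thus `H × J` for an open set `J` of real numbers. Left translation by `H` acts on the
first factor only, and the part of `H` over `V` is `{τ = 0}`, where `τ` is the second coordinate.

The `b`-tangent bundle has there an `H`-invariant frame: the fields `A X`, `X ∈ 𝔥`, which are the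
left-invariant fields of the factor `H`, and `B = τ ∂_τ`. They satisfy `[A X, A Y] = A [X, Y]` and
`[A X, B] = 0` (`bDeriv_A_lie`, `bDeriv_A_B_comm`), together with `A X τ = 0` and `B τ = τ`. The
functions `⟨α, A X⟩`, `τ`, `⟨α, B⟩` on `ᵇT*G` are therefore invariant. They separate the orbits
(`toModel_of_rel`, `toReduced_eq`), and with the smooth section `ofModel` they become coordinates on
`(ᵇT*G)/H`.

The canonical bracket of two fibrewise linear functions is minus the function of the Lie bracket
(`poisson_pair_pair`), and `{⟨α, Y⟩, h} = -Y h` for `h` on the base. So these coordinates have the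
brackets `-⟨μ, [X, Y]⟩`, `0` and `{ξ, τ} = -τ` (`poisson_u_u`). They are exactly the brackets of the
linear functions on `𝔥*` and of the canonical coordinates `t, ξ` of `ᵇT*V` (`modelBracket_eq_sum`),
and by the chain rule the comparison map is Poisson. This also shows that the bracket descends,
since the result depends only on the image in the model. The axioms of a Poisson bracket are
inherited from `ᵇT*G`.

On `ᵇT*M` all computations use the frame `x₀ ∂₀, ∂₁, …`, which commutes (`BChart.bd_comm`), and its
dual coframe `d log |x₀|, dx₁, …`, which is closed. Hence `λ = ∑ ξᵢ κᵢ` has `ω = ∑ κᵢ ∧ dξᵢ`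
(`bExtDeriv_eq_sum`, `canonicalForm_eq_sum`), which is nondegenerate. The bracket has constant
coefficients in the induced frame of `ᵇT*M`, so the Jacobi identity reduces to the symmetry of
second derivatives.

For minimal coupling, the inverse of `ψ_θ` is `(β, μ) ↦ β + μ ∘ θ`. In a chart whose first
coordinate is `τ`, the annihilator consists of the multiples `β(B) d log |τ|`, so the fibre
coordinates become `δᵢ₀ β(B) + μ(θ(eᵢ))`. The first summand contributes `π̄^* ω_{G/H}` and the
second `-dλ^θ` (`couplingForm_eq`). Thus `ψ_θ` is a symplectic diffeomorphism, and brackets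
correspond. -/

theorem exists_contDiff_eventuallyEq {W : Type*} [NormedAddCommGroup W] [NormedSpace ℝ W]
    [FiniteDimensional ℝ W] {F : W → ℝ} {p : W} (hF : ∀ᶠ z in 𝓝 p, ContDiffAt ℝ ∞ F z) :
    ∃ F' : W → ℝ, ContDiff ℝ ∞ F' ∧ F' =ᶠ[𝓝 p] F := by
  obtain ⟨r, hr, h⟩ := Metric.nhds_basis_closedBall.eventually_iff.1 hF
  -- The cutoff is `1` near `p` and vanishes outside the ball on which `F` is smooth. A global
  -- representative of the germ is needed because `SmoothStr.comp` only admits globally smooth outer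
  -- functions.
  let χ : ContDiffBump p := ⟨r / 2, r, by linarith, by linarith⟩
  refine ⟨fun z => χ z * F z, contDiff_iff_contDiffAt.2 fun z => ?_, ?_⟩
  · by_cases hz : z ∈ Metric.closedBall p r
    · exact χ.contDiffAt.mul (h hz)
    · have h1 : (fun z => χ z * F z) =ᶠ[𝓝 z] fun _ => 0 := by
        filter_upwards [Metric.isClosed_closedBall.isOpen_compl.mem_nhds hz] with y hy
        rw [χ.zero_of_le_dist, zero_mul]
        simp only [mem_compl_iff, Metric.mem_closedBall, not_le] at hy
        exact hy.le
      exact contDiffAt_const.congr_of_eventuallyEq h1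
  · filter_upwards [χ.eventuallyEq_one] with z hz
    simp [hz]

/-- The integral is the value at `0` of the convolution of the indicator of `(0, 1]` with `y ↦ F (x,
-y)`. Convolution with a smooth compactly supported function depends smoothly on parameters. -/
theorem contDiff_intervalIntegral_param {W : Type*} [NormedAddCommGroup W] [NormedSpace ℝ W]
    {F : W × ℝ → ℝ} (hF : ContDiff ℝ ∞ F) :
    ContDiff ℝ ∞ fun x => ∫ t in (0 : ℝ)..1, F (x, t) := by
  -- The cutoff makes the support compact. It equals `1` on `[-1, 1]`, so the integral is unchanged.
  let χ : ContDiffBump (0 : ℝ) := ⟨1, 2, by norm_num, by norm_num⟩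
  have key := contDiffOn_convolution_right_with_param (𝕜 := ℝ) (n := ⊤) (μ := volume)
    (ContinuousLinearMap.mul ℝ ℝ) (f := indicator (Ioc (0 : ℝ) 1) fun _ => (1 : ℝ))
    (g := fun (x : W) y => χ y * F (x, -y)) (s := univ) (k := Metric.closedBall 0 2)
    isOpen_univ (isCompact_closedBall _ _) (by
      intro p x _ hx
      rw [χ.zero_of_le_dist, zero_mul]
      simp only [Metric.mem_closedBall, not_le] at hx
      exact hx.le)
    ((locallyIntegrable_const (1 : ℝ)).indicator measurableSet_Ioc) (by
      refine ContDiff.contDiffOn ?_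
      exact (χ.contDiff.comp contDiff_snd).mul
        (hF.comp (contDiff_fst.prodMk contDiff_snd.neg)))
  have h2 : ContDiff ℝ ∞ fun x : W =>
      (convolution (indicator (Ioc (0 : ℝ) 1) fun _ => (1 : ℝ)) (fun y => χ y * F (x, -y))
        (ContinuousLinearMap.mul ℝ ℝ) volume) (0 : ℝ) := by
    rw [univ_prod_univ, contDiffOn_univ] at key
    exact key.comp (contDiff_id.prodMk contDiff_const)
  convert h2 using 2 with x
  rw [convolution_def, intervalIntegral.integral_of_le zero_le_one,
    ← integral_indicator measurableSet_Ioc]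
  congr 1
  ext t
  by_cases ht : t ∈ Ioc (0 : ℝ) 1
  · have h1 : χ (-t) = 1 := χ.one_of_mem_closedBall (by
      simp [χ, abs_le]; constructor <;> linarith [ht.1, ht.2])
    simp [ht, h1]
  · simp [ht]

section Pi

variable {ι : Type*} [Fintype ι] [DecidableEq ι]

/-- The `i`-th partial derivative. -/
def pd (F : (ι → ℝ) → ℝ) (z : ι → ℝ) (i : ι) : ℝ := fderiv ℝ F z (Pi.single i 1)

theorem fderiv_eq_sum_pd (F : (ι → ℝ) → ℝ) (z v : ι → ℝ) :
    fderiv ℝ F z v = ∑ i, v i * pd F z i := by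
  conv_lhs => rw [← Finset.univ_sum_single v]
  rw [map_sum]
  refine Finset.sum_congr rfl fun i _ => ?_
  rw [pd, ← smul_eq_mul, ← map_smul]
  congr 1
  ext j
  by_cases h : j = i
  · subst h; simp
  · simp [h]

theorem contDiff_pd {F : (ι → ℝ) → ℝ} (hF : ContDiff ℝ ∞ F) (i : ι) :
    ContDiff ℝ ∞ fun z => pd F z i :=
  (hF.fderiv_right (m := ∞) (by simp)).clm_apply contDiff_const

theorem contDiffAt_pd {F : (ι → ℝ) → ℝ} {z : ι → ℝ} (hF : ContDiffAt ℝ ∞ F z) (i : ι) :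
    ContDiffAt ℝ ∞ (fun z => pd F z i) z :=
  (hF.fderiv_right (m := ∞) (by simp)).clm_apply contDiffAt_const

theorem pd_comm {F : (ι → ℝ) → ℝ} {z : ι → ℝ} (hF : ContDiffAt ℝ ∞ F z) (i j : ι) :
    pd (fun y => pd F y i) z j = pd (fun y => pd F y j) z i := by
  have h1 : DifferentiableAt ℝ (fderiv ℝ F) z :=
    (hF.fderiv_right (m := ∞) (by simp)).differentiableAt (by simp)
  have h2 := hF.isSymmSndFDerivAt (by simp; exact WithTop.coe_le_coe.2 le_top)
  have h3 : ∀ i j, pd (fun y => pd F y i) z j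
      = fderiv ℝ (fderiv ℝ F) z (Pi.single j 1) (Pi.single i 1) := by
    intro i j
    simp only [pd]
    rw [fderiv_clm_apply h1 (differentiableAt_const _)]
    simp
  rw [h3, h3, h2.eq]

/-- **Hadamard's lemma**, along an affine retraction. -/
theorem exists_hadamard {F : (ι → ℝ) → ℝ} (hF : ContDiff ℝ ∞ F) {a : (ι → ℝ) → ι → ℝ}
    (ha : ContDiff ℝ ∞ a) :
    ∃ G : ι → (ι → ℝ) → ℝ, (∀ i, ContDiff ℝ ∞ (G i)) ∧
      (∀ x, F x = F (a x) + ∑ i, (x i - a x i) * G i x) ∧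
      ∀ x, a x = x → ∀ i, G i x = pd F x i := by
  -- The derivative of `F` is integrated along the segment from `a x` to `x`; at a fixed point of
  -- `a` the segment is constant.
  refine ⟨fun i x => ∫ t in (0 : ℝ)..1, pd F (a x + t • (x - a x)) i, fun i => ?_, fun x => ?_, ?_⟩
  · refine contDiff_intervalIntegral_param (F := fun q => pd F (a q.1 + q.2 • (q.1 - a q.1)) i) ?_
    refine (contDiff_pd hF i).comp ?_
    have h1 : ContDiff ℝ ∞ fun q : (ι → ℝ) × ℝ => a q.1 := ha.comp contDiff_fst
    exact h1.add (contDiff_snd.smul (contDiff_fst.sub h1))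
  · have hd : ∀ t : ℝ, HasDerivAt (fun t : ℝ => F (a x + t • (x - a x)))
        (∑ i, (x i - a x i) * pd F (a x + t • (x - a x)) i) t := by
      intro t
      have h1 : HasDerivAt (fun t : ℝ => a x + t • (x - a x)) (x - a x) t := by
        simpa using ((hasDerivAt_id t).smul_const (x - a x)).const_add (a x)
      have h2 := ((hF.differentiable (by simp)) (a x + t • (x - a x))).hasFDerivAt.comp_hasDerivAt
        t h1
      rw [fderiv_eq_sum_pd] at h2
      exact h2
    have hc : ∀ i, Continuous fun t : ℝ => pd F (a x + t • (x - a x)) i := fun i =>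
      (contDiff_pd hF i).continuous.comp (by fun_prop)
    have h3 := intervalIntegral.integral_eq_sub_of_hasDerivAt (a := 0) (b := 1)
      (fun t _ => hd t) (Continuous.intervalIntegrable (by fun_prop) _ _)
    rw [intervalIntegral.integral_finsetSum] at h3
    · simp only [intervalIntegral.integral_const_mul, one_smul, zero_smul, add_zero] at h3
      rw [h3]
      simp
    · exact fun i _ => Continuous.intervalIntegrable (by fun_prop) _ _
  · intro x hx i
    simp [hx]

/-- A local diffeomorphism with prescribed `i`-th component. -/
theorem exists_straightening (F : (ι → ℝ) → ℝ) {p : ι → ℝ} (i : ι)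
    (hF : ∀ᶠ z in 𝓝 p, ContDiffAt ℝ ∞ F z) (hd : pd F p i ≠ 0) :
    ∃ Θ : OpenPartialHomeomorph (ι → ℝ) (ι → ℝ), p ∈ Θ.source ∧
      (∀ z, Θ z = Function.update z i (F z)) ∧
      (∀ z ∈ Θ.source, ContDiffAt ℝ ∞ Θ z) ∧ ∀ z ∈ Θ.target, ContDiffAt ℝ ∞ Θ.symm z := by
  set ψ : (ι → ℝ) → ι → ℝ := fun z => Function.update z i (F z) with hψ
  have hsm : ∀ z, ContDiffAt ℝ ∞ F z → ContDiffAt ℝ ∞ ψ z := by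
    intro z hz
    refine contDiffAt_pi.2 fun j => ?_
    by_cases h : j = i
    · subst h; simpa [hψ] using hz
    · simpa [hψ, h] using contDiffAt_pi.1 contDiffAt_id j
  have hder : ∀ z, ContDiffAt ℝ ∞ F z → pd F z i ≠ 0 →
      ∃ L : (ι → ℝ) ≃L[ℝ] (ι → ℝ), HasFDerivAt ψ (L : (ι → ℝ) →L[ℝ] (ι → ℝ)) z := by
    intro z hz hz'
    have h1 := ((hsm z hz).differentiableAt (by simp)).hasFDerivAt
    have h2 : ∀ v j, fderiv ℝ ψ z v j = if j = i then fderiv ℝ F z v else v j := by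
      intro v j
      have h3 := (hasFDerivAt_pi'.1 h1) j
      have h4 : HasFDerivAt (fun x => ψ x j) (if j = i then fderiv ℝ F z else
          ContinuousLinearMap.proj j) z := by
        by_cases h : j = i
        · subst h
          simpa [hψ] using (hz.differentiableAt (by simp)).hasFDerivAt
        · simpa [hψ, h] using hasFDerivAt_apply (𝕜 := ℝ) j z
      have h5 := DFunLike.congr_fun (h3.unique h4) v
      rw [ContinuousLinearMap.comp_apply] at h5
      refine Eq.trans h5 ?_
      split_ifs <;> rfl
    -- A kernel vector has all coordinates other than `i` equal to `0`; on it `dF` is `∂ᵢF` times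
    -- the remaining coordinate.
    have hinj : Function.Injective (fderiv ℝ ψ z) := by
      rw [injective_iff_map_eq_zero]
      intro v hv
      have h6 : ∀ j, j ≠ i → v j = 0 := by
        intro j hj
        have := h2 v j
        simpa [hv, hj] using this.symm
      have h7 : fderiv ℝ F z v = 0 := by
        have := h2 v i
        simpa [hv] using this.symm
      rw [fderiv_eq_sum_pd, Finset.sum_eq_single i (fun j _ hj => by simp [h6 j hj]) (by simp)] at h7
      ext j
      by_cases h : j = i
      · subst h; exact (mul_eq_zero.1 h7).resolve_right hz'
      · exact h6 j h
    let L := (LinearEquiv.ofInjectiveEndo (fderiv ℝ ψ z).toLinearMap hinj).toContinuousLinearEquiv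
    have hL : (L : (ι → ℝ) →L[ℝ] (ι → ℝ)) = fderiv ℝ ψ z := by
      ext v : 1
      rfl
    exact ⟨L, hL ▸ h1⟩
  have hFp := hF.self_of_nhds
  obtain ⟨L, hL⟩ := hder p hFp hd
  let Θ₀ := (hsm p hFp).toOpenPartialHomeomorph ψ hL (by simp)
  -- The source is shrunk to where the differential is invertible, so that the inverse is smooth on
  -- the whole target and not only at the image of `p`.
  have hgood : ∀ᶠ z in 𝓝 p, ContDiffAt ℝ ∞ F z ∧ pd F z i ≠ 0 :=
    hF.and ((contDiffAt_pd hFp i).continuousAt.eventually_ne hd)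
  obtain ⟨O, hO, hOo, hpO⟩ := eventually_nhds_iff.1 hgood
  refine ⟨Θ₀.restrOpen O hOo, ⟨(hsm p hFp).mem_toOpenPartialHomeomorph_source hL (by simp), hpO⟩,
    fun z => rfl, fun z hz => hsm z (hO z hz.2).1, fun z hz => ?_⟩
  have hz' := (Θ₀.restrOpen O hOo).map_target hz
  obtain ⟨L', hL'⟩ := hder _ (hO _ hz'.2).1 (hO _ hz'.2).2
  exact (Θ₀.restrOpen O hOo).contDiffAt_symm hz hL' (hsm _ (hO _ hz'.2).1)

end Pi


end

/-! ### Closure properties of smooth functions -/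

namespace SmoothStr

section Algebra

variable {X : Type*} [TopologicalSpace X] {S : SmoothStr X} {f g : X → ℝ} {p : X}

theorem SmoothAt.add (hf : S.SmoothAt f p) (hg : S.SmoothAt g p) :
    S.SmoothAt (fun y => f y + g y) p := (S.alg p).add_mem hf hg

theorem SmoothAt.mul (hf : S.SmoothAt f p) (hg : S.SmoothAt g p) :
    S.SmoothAt (fun y => f y * g y) p := (S.alg p).mul_mem hf hg

theorem smoothAt_const (c : ℝ) : S.SmoothAt (fun _ => c) p := (S.alg p).algebraMap_mem c

theorem SmoothAt.sub (hf : S.SmoothAt f p) (hg : S.SmoothAt g p) :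
    S.SmoothAt (fun y => f y - g y) p := (S.alg p).sub_mem hf hg

theorem SmoothAt.const_mul (c : ℝ) (hf : S.SmoothAt f p) : S.SmoothAt (fun y => c * f y) p :=
  (smoothAt_const c).mul hf

theorem SmoothAt.sum {α : Type*} {s : Finset α} {f : α → X → ℝ}
    (hf : ∀ a ∈ s, S.SmoothAt (f a) p) : S.SmoothAt (fun y => ∑ a ∈ s, f a y) p := by
  have := (S.alg p).sum_mem hf
  have h : (fun y => ∑ a ∈ s, f a y) = ∑ a ∈ s, f a := by
    ext y
    simp
  rwa [h]

/-- Only the germ of `F` at the image point matters, and this germ has a globally smooth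
representative. -/
theorem comp_local {ι : Type} [Fintype ι] {F : (ι → ℝ) → ℝ} {g : ι → X → ℝ}
    (hF : ∀ᶠ z in 𝓝 (fun i => g i p), ContDiffAt ℝ ∞ F z) (hg : ∀ i, S.SmoothAt (g i) p) :
    S.SmoothAt (fun y => F fun i => g i y) p := by
  obtain ⟨F', hF', h⟩ := exists_contDiff_eventuallyEq hF
  refine S.congr (S.comp hF' hg) ?_
  have hc : ContinuousAt (fun y i => g i y) p := continuousAt_pi.2 fun i => S.continuousAt (hg i)
  exact hc.eventually h

theorem SmoothAt.inv (hf : S.SmoothAt f p) (h0 : f p ≠ 0) : S.SmoothAt (fun y => (f y)⁻¹) p := by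
  refine comp_local (ι := Unit) (F := fun z => (z ())⁻¹) (g := fun _ => f) ?_ fun _ => hf
  have : ContinuousAt (fun z : Unit → ℝ => z ()) (fun _ => f p) :=
    (continuous_apply ()).continuousAt
  filter_upwards [this.eventually_ne (by simpa using h0)] with z hz
  exact (contDiff_apply ℝ ℝ ()).contDiffAt.inv hz

theorem SmoothAt.div (hf : S.SmoothAt f p) (hg : S.SmoothAt g p) (h0 : g p ≠ 0) :
    S.SmoothAt (fun y => f y / g y) p := by
  simpa only [div_eq_mul_inv] using hf.mul (hg.inv h0)

end Algebra

end SmoothStr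

/-! ### Derivations -/

section Derivation

variable {M : Type*} [TopologicalSpace M] {S : SmoothStr M} {p : M}

open Classical in
/-- A linear form on the smooth germs, extended by `0`. -/
def derivAt (D : Module.Dual ℝ (S.alg p)) (h : M → ℝ) : ℝ :=
  if hh : S.SmoothAt h p then D ⟨h, hh⟩ else 0

theorem derivAt_of (D : Module.Dual ℝ (S.alg p)) {h : M → ℝ} (hh : S.SmoothAt h p) :
    derivAt D h = D ⟨h, hh⟩ := by
  rw [derivAt, dif_pos hh]

variable {D : Module.Dual ℝ (S.alg p)} {f g : M → ℝ}

theorem derivAt_add (hf : S.SmoothAt f p) (hg : S.SmoothAt g p) :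
    derivAt D (fun y => f y + g y) = derivAt D f + derivAt D g := by
  rw [derivAt_of D hf, derivAt_of D hg, derivAt_of D (hf.add hg), ← map_add]
  rfl

theorem derivAt_sub (hf : S.SmoothAt f p) (hg : S.SmoothAt g p) :
    derivAt D (fun y => f y - g y) = derivAt D f - derivAt D g := by
  rw [derivAt_of D hf, derivAt_of D hg, derivAt_of D (hf.sub hg), ← map_sub]
  rfl

theorem derivAt_const_mul (c : ℝ) (hf : S.SmoothAt f p) :
    derivAt D (fun y => c * f y) = c * derivAt D f := by
  rw [derivAt_of D hf, derivAt_of D (hf.const_mul c), ← smul_eq_mul, ← map_smul]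
  rfl

theorem derivAt_sum {α : Type*} {s : Finset α} {f : α → M → ℝ}
    (hf : ∀ a ∈ s, S.SmoothAt (f a) p) :
    derivAt D (fun y => ∑ a ∈ s, f a y) = ∑ a ∈ s, derivAt D (f a) := by
  classical
  induction s using Finset.induction_on with
  | empty =>
    have := derivAt_const_mul (D := D) 0 (SmoothStr.smoothAt_const (S := S) (p := p) 0)
    simpa using this
  | insert a s ha ih =>
    simp only [Finset.sum_insert ha]
    rw [derivAt_add (hf a (Finset.mem_insert_self _ _))
      (SmoothStr.SmoothAt.sum fun b hb => hf b (Finset.mem_insert_of_mem hb)),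
      ih fun b hb => hf b (Finset.mem_insert_of_mem hb)]

theorem IsDerivationAt.mul (hD : IsDerivationAt S p D) (hf : S.SmoothAt f p)
    (hg : S.SmoothAt g p) :
    derivAt D (fun y => f y * g y) = f p * derivAt D g + g p * derivAt D f := by
  rw [derivAt_of D hf, derivAt_of D hg, derivAt_of D (hf.mul hg), ← hD ⟨f, hf⟩ ⟨g, hg⟩]
  rfl

theorem IsDerivationAt.const (hD : IsDerivationAt S p D) (c : ℝ) :
    derivAt D (fun _ => c) = 0 := by
  have h1 : derivAt D (fun _ => (1 : ℝ)) = 0 := by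
    have := hD.mul (SmoothStr.smoothAt_const (S := S) (p := p) 1)
      (SmoothStr.smoothAt_const (S := S) (p := p) 1)
    simp only [mul_one, one_mul] at this
    linarith
  have := derivAt_const_mul (D := D) c (SmoothStr.smoothAt_const (S := S) (p := p) 1)
  simpa [h1] using this

/-- Derivations act on functions rather than on germs, so locality has to be proved. The indicator
`χ` of `{f = g}` has a constant germ at `p`. From `χ² = χ` follows `Dχ = 0`, and then `χ (f - g) =
0` gives `Df = Dg`. -/
theorem IsDerivationAt.congr (hD : IsDerivationAt S p D) (h : f =ᶠ[𝓝 p] g) :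
    derivAt D f = derivAt D g := by
  classical
  by_cases hf : S.SmoothAt f p
  · have hg := S.congr hf h
    let χ : M → ℝ := fun y => if f y = g y then 1 else 0
    have hχ1 : χ =ᶠ[𝓝 p] fun _ => 1 := by
      filter_upwards [h] with y hy
      simp [χ, hy]
    have hχ : S.SmoothAt χ p := S.congr (SmoothStr.smoothAt_const 1) hχ1.symm
    have hχp : χ p = 1 := hχ1.self_of_nhds
    have h1 : derivAt D χ = 0 := by
      have := hD.mul hχ hχ
      have h2 : (fun y => χ y * χ y) = χ := by
        ext y
        simp only [χ]
        split_ifs <;> simp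
      rw [h2, hχp] at this
      linarith
    have h2 := hD.mul hχ (hf.sub hg)
    have h3 : (fun y => χ y * (f y - g y)) = fun _ => 0 := by
      ext y
      simp only [χ]
      split_ifs with hy <;> simp [hy]
    rw [h3, hD.const, h1, hχp, derivAt_sub hf hg] at h2
    linarith
  · have hg : ¬ S.SmoothAt g p := fun hg => hf (S.congr hg h.symm)
    rw [derivAt, derivAt, dif_neg hf, dif_neg hg]

/-- Hadamard's lemma about the image point writes `F` as a constant plus increments of the
coordinates times smooth factors. By Leibniz only the values of the factors at the point survive,
and these are the partial derivatives. -/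
theorem IsDerivationAt.comp (hD : IsDerivationAt S p D) {ι : Type} [Fintype ι] [DecidableEq ι]
    {F : (ι → ℝ) → ℝ} {g : ι → M → ℝ} (hF : ∀ᶠ z in 𝓝 (fun i => g i p), ContDiffAt ℝ ∞ F z)
    (hg : ∀ i, S.SmoothAt (g i) p) :
    derivAt D (fun y => F fun i => g i y) = ∑ i, pd F (fun i => g i p) i * derivAt D (g i) := by
  obtain ⟨F', hF', h⟩ := exists_contDiff_eventuallyEq hF
  have hc : ContinuousAt (fun y i => g i y) p := continuousAt_pi.2 fun i => S.continuousAt (hg i)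
  have h1 : ∀ i, pd F (fun i => g i p) i = pd F' (fun i => g i p) i := fun i => by
    rw [pd, pd, h.fderiv_eq]
  obtain ⟨G, hG, hGF, hG1⟩ := exists_hadamard hF' (a := fun _ i => g i p) contDiff_const
  have h2 : (fun y => F fun i => g i y) =ᶠ[𝓝 p] fun y => F' (fun i => g i p) +
      ∑ i, (g i y - g i p) * G i fun i => g i y := by
    filter_upwards [hc.eventually h] with y hy
    rw [← hy, hGF]
  have hs : ∀ i, S.SmoothAt (fun y => g i y - g i p) p := fun i =>
    (hg i).sub (SmoothStr.smoothAt_const _)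
  have hGs : ∀ i, S.SmoothAt (fun y => G i fun i => g i y) p := fun i => S.comp (hG i) hg
  rw [hD.congr h2, derivAt_add (SmoothStr.smoothAt_const _)
    (SmoothStr.SmoothAt.sum fun i _ => (hs i).mul (hGs i)), hD.const, zero_add,
    derivAt_sum fun i _ => (hs i).mul (hGs i)]
  refine Finset.sum_congr rfl fun i _ => ?_
  rw [hD.mul (hs i) (hGs i), sub_self, zero_mul, zero_add, hG1 _ rfl, h1,
    derivAt_sub (hg i) (SmoothStr.smoothAt_const _), hD.const, sub_zero]

end Derivation

/-! ### Charts -/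

/-- A chart of a smooth structure, with values in `ι → ℝ`. -/
structure Chart {X : Type*} [TopologicalSpace X] (S : SmoothStr X) (ι : Type) [Fintype ι] where
  e : OpenPartialHomeomorph X (ι → ℝ)
  smooth_iff : ∀ y ∈ e.source, ∀ f : X → ℝ,
    S.SmoothAt f y ↔ ∀ᶠ z in 𝓝 (e y), ContDiffAt ℝ ∞ (f ∘ e.symm) z

namespace Chart

variable {X : Type*} [TopologicalSpace X] {S : SmoothStr X} {ι : Type} [Fintype ι]

/-- A chart is given by smooth coordinates in which the smooth functions are smooth. -/
def ofSmooth (e : OpenPartialHomeomorph X (ι → ℝ))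
    (h1 : ∀ y ∈ e.source, ∀ i, S.SmoothAt (fun z => e z i) y)
    (h2 : ∀ y ∈ e.source, ∀ f, S.SmoothAt f y → ∀ᶠ z in 𝓝 (e y), ContDiffAt ℝ ∞ (f ∘ e.symm) z) :
    Chart S ι where
  e := e
  smooth_iff y hy f := by
    refine ⟨h2 y hy f, fun h => ?_⟩
    refine S.congr (SmoothStr.comp_local (g := fun i z => e z i) h (h1 y hy)) ?_
    filter_upwards [e.open_source.mem_nhds hy] with z hz
    exact congrArg f (e.left_inv hz)

variable (c : Chart S ι)

/-- The coordinate functions. -/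
def x (i : ι) : X → ℝ := fun z => c.e z i

theorem smoothAt_x {p : X} (hp : p ∈ c.e.source) (i : ι) : S.SmoothAt (c.x i) p := by
  rw [c.smooth_iff p hp]
  filter_upwards [c.e.open_target.mem_nhds (c.e.map_source hp)] with z hz
  refine ((contDiff_apply ℝ ℝ i).contDiffAt).congr_of_eventuallyEq ?_
  filter_upwards [c.e.open_target.mem_nhds hz] with w hw
  simp [x, c.e.right_inv hw]

theorem exists_eq_comp {p : X} (hp : p ∈ c.e.source) (h : X → ℝ) :
    h =ᶠ[𝓝 p] fun y => (h ∘ c.e.symm) fun i => c.x i y := by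
  filter_upwards [c.e.open_source.mem_nhds hp] with z hz
  exact congrArg h (c.e.left_inv hz).symm

/-- The restriction of a chart to an open set. -/
def restr {U : Set X} (hU : IsOpen U) : Chart S ι where
  e := c.e.restrOpen U hU
  smooth_iff y hy f := c.smooth_iff y hy.1 f

variable [DecidableEq ι]

/-- The partial derivatives in a chart. -/
def d (i : ι) (h : X → ℝ) (p : X) : ℝ := pd (h ∘ c.e.symm) (c.e p) i

variable {c} {p : X} {f h : X → ℝ}

theorem smoothAt_d (hp : p ∈ c.e.source) (hh : S.SmoothAt h p) (i : ι) :
    S.SmoothAt (c.d i h) p := by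
  rw [c.smooth_iff p hp] at hh ⊢
  filter_upwards [hh, c.e.open_target.mem_nhds (c.e.map_source hp)] with z hz hz'
  refine (contDiffAt_pd hz i).congr_of_eventuallyEq ?_
  filter_upwards [c.e.open_target.mem_nhds hz'] with w hw
  simp [d, c.e.right_inv hw]

theorem d_comm (hp : p ∈ c.e.source) (hh : S.SmoothAt h p) (i j : ι) :
    c.d i (c.d j h) p = c.d j (c.d i h) p := by
  have h1 := ((c.smooth_iff p hp h).1 hh).self_of_nhds
  have h2 : ∀ k, c.d k h ∘ c.e.symm =ᶠ[𝓝 (c.e p)] fun z => pd (h ∘ c.e.symm) z k := by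
    intro k
    filter_upwards [c.e.open_target.mem_nhds (c.e.map_source hp)] with w hw
    simp [d, c.e.right_inv hw]
  have h3 : ∀ k l, c.d l (c.d k h) p = pd (fun z => pd (h ∘ c.e.symm) z k) (c.e p) l := by
    intro k l
    rw [d, pd, (h2 k).fderiv_eq]
    rfl
  rw [h3, h3, pd_comm h1]

theorem d_congr (hp : p ∈ c.e.source) (hfh : f =ᶠ[𝓝 p] h) (i : ι) : c.d i f p = c.d i h p := by
  rw [d, d, pd, pd]
  have : f ∘ c.e.symm =ᶠ[𝓝 (c.e p)] h ∘ c.e.symm := by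
    have h1 : Tendsto c.e.symm (𝓝 (c.e p)) (𝓝 p) := by
      simpa [ContinuousAt, c.e.left_inv hp] using c.e.symm.continuousAt (c.e.map_source hp)
    exact h1.eventually hfh
  rw [this.fderiv_eq]

/-- A derivation is determined by its values on the coordinates. -/
theorem derivAt_eq_sum (hp : p ∈ c.e.source) {D : Module.Dual ℝ (S.alg p)}
    (hD : IsDerivationAt S p D) (hh : S.SmoothAt h p) :
    derivAt D h = ∑ i, c.d i h p * derivAt D (c.x i) := by
  rw [hD.congr (c.exists_eq_comp hp h), hD.comp ((c.smooth_iff p hp h).1 hh)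
    fun i => c.smoothAt_x hp i]
  rfl

theorem d_x (hp : p ∈ c.e.source) (i j : ι) : c.d i (c.x j) p = if i = j then 1 else 0 := by
  have h1 : c.x j ∘ c.e.symm =ᶠ[𝓝 (c.e p)] fun z => z j := by
    filter_upwards [c.e.open_target.mem_nhds (c.e.map_source hp)] with w hw
    simp [x, c.e.right_inv hw]
  rw [d, pd, h1.fderiv_eq, (hasFDerivAt_apply (𝕜 := ℝ) j (c.e p)).fderiv]
  simp [Pi.single_apply, eq_comm]

omit [DecidableEq ι] in
theorem differentiableAt (hp : p ∈ c.e.source) (hh : S.SmoothAt h p) :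
    DifferentiableAt ℝ (h ∘ c.e.symm) (c.e p) :=
  ((c.smooth_iff p hp h).1 hh).self_of_nhds.differentiableAt (by simp)

variable (c) in
/-- The partial derivatives at `p` as derivations. -/
def dual (hp : p ∈ c.e.source) (i : ι) : Module.Dual ℝ (S.alg p) where
  toFun h := c.d i h.1 p
  map_add' f g := by
    have : (f + g).1 ∘ c.e.symm = (f.1 ∘ c.e.symm) + (g.1 ∘ c.e.symm) := rfl
    rw [d, pd, this, fderiv_add (differentiableAt hp f.2) (differentiableAt hp g.2)]
    rfl
  map_smul' a f := by
    have : (a • f).1 ∘ c.e.symm = a • (f.1 ∘ c.e.symm) := rfl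
    rw [d, pd, this, fderiv_const_smul (differentiableAt hp f.2)]
    rfl

theorem isDerivationAt_dual (hp : p ∈ c.e.source) (i : ι) : IsDerivationAt S p (c.dual hp i) := by
  intro f g
  have : (f * g).1 ∘ c.e.symm = (f.1 ∘ c.e.symm) * (g.1 ∘ c.e.symm) := rfl
  change c.d i _ p = _ * c.d i _ p + _ * c.d i _ p
  rw [d, pd, this, fderiv_mul (differentiableAt hp f.2) (differentiableAt hp g.2)]
  simp [d, pd, c.e.left_inv hp]

theorem derivAt_dual (hp : p ∈ c.e.source) (i : ι) (hh : S.SmoothAt h p) :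
    derivAt (c.dual hp i) h = c.d i h p := derivAt_of _ hh

/-- Division by a coordinate. On the hyperplane it is Hadamard's lemma for the retraction that sets
the `i`-th coordinate to `0`, where `h` vanishes; off the hyperplane the coordinate is invertible.
-/
theorem exists_eq_mul_x (hp : p ∈ c.e.source) (i : ι) (hh : S.SmoothAt h p)
    (h0 : ∀ᶠ y in 𝓝 p, c.x i y = 0 → h y = 0) :
    ∃ u, S.SmoothAt u p ∧ h =ᶠ[𝓝 p] fun y => u y * c.x i y := by
  have hxs := c.smoothAt_x hp i
  by_cases hx : c.x i p = 0
  · obtain ⟨F, hF, hFh⟩ := exists_contDiff_eventuallyEq ((c.smooth_iff p hp h).1 hh)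
    have ha : ContDiff ℝ ∞ fun z : ι → ℝ => Function.update z i 0 := by
      refine contDiff_pi.2 fun j => ?_
      by_cases hj : j = i
      · subst hj; simpa using contDiff_const
      · simpa [hj] using contDiff_apply ℝ ℝ j
    obtain ⟨G, hG, hGF, -⟩ := exists_hadamard hF ha
    refine ⟨fun y => G i fun j => c.x j y, S.comp (hG i) fun j => c.smoothAt_x hp j, ?_⟩
    have hap : Function.update (c.e p) i 0 = c.e p := by
      rw [← hx]; exact Function.update_eq_self i _
    have hsymm : Tendsto c.e.symm (𝓝 (c.e p)) (𝓝 p) := by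
      simpa [ContinuousAt, c.e.left_inv hp] using c.e.symm.continuousAt (c.e.map_source hp)
    have htend : Tendsto (fun y => Function.update (c.e y) i 0) (𝓝 p) (𝓝 (c.e p)) := by
      have := (ha.continuous.tendsto (c.e p)).comp (c.e.continuousAt hp)
      rwa [hap] at this
    filter_upwards [c.e.open_source.mem_nhds hp, (c.e.continuousAt hp).eventually hFh,
      htend.eventually hFh, htend.eventually (hsymm.eventually h0),
      htend.eventually (c.e.open_target.mem_nhds (c.e.map_source hp))] with y h1 h2 h3 h4 h5
    have h6 : h (c.e.symm (Function.update (c.e y) i 0)) = 0 := by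
      refine h4 ?_
      have : c.e (c.e.symm (Function.update (c.e y) i 0)) = _ := c.e.right_inv h5
      simp [x, this]
    have h7 := hGF (c.e y)
    rw [h2, h3, Finset.sum_eq_single i (fun j _ hj => by simp [hj]) (by simp)] at h7
    simp only [Function.comp_apply, c.e.left_inv h1, h6, zero_add, Function.update_self,
      sub_zero] at h7
    rw [h7, mul_comm]
    rfl
  · refine ⟨fun y => h y / c.x i y, hh.div hxs hx, ?_⟩
    filter_upwards [(S.continuousAt hxs).eventually_ne hx] with y hy
    rw [div_mul_cancel₀ _ hy]

/-- The complement of the hyperplane is dense, as one sees along the `i`-th coordinate line, and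
smooth functions are continuous. This makes quotients by a defining function unique as germs. -/
theorem eventuallyEq_of_mul_x (hp : p ∈ c.e.source) (i : ι) (hf : S.SmoothAt f p)
    (hh : S.SmoothAt h p) (h0 : ∀ᶠ y in 𝓝 p, c.x i y ≠ 0 → f y = h y) :
    f =ᶠ[𝓝 p] h := by
  filter_upwards [eventually_eventually_nhds.2 h0, S.eventually hf, S.eventually hh,
    c.e.open_source.mem_nhds hp] with q h1 h2 h3 hq
  by_cases hx : c.x i q = 0
  · let γ : ℝ → X := fun s => c.e.symm (c.e q + s • Pi.single i 1)
    have h4 : Tendsto (fun s : ℝ => c.e q + s • (Pi.single i 1 : ι → ℝ)) (𝓝 0) (𝓝 (c.e q)) := by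
      have : Continuous fun s : ℝ => c.e q + s • (Pi.single i 1 : ι → ℝ) := by fun_prop
      simpa using this.tendsto 0
    have hγ : Tendsto γ (𝓝[≠] 0) (𝓝 q) := by
      have h5 : Tendsto c.e.symm (𝓝 (c.e q)) (𝓝 q) := by
        simpa [ContinuousAt, c.e.left_inv hq] using c.e.symm.continuousAt (c.e.map_source hq)
      exact (h5.comp h4).mono_left nhdsWithin_le_nhds
    refine tendsto_nhds_unique_of_eventuallyEq ((S.continuousAt h2).tendsto.comp hγ)
      ((S.continuousAt h3).tendsto.comp hγ) ?_
    filter_upwards [hγ.eventually h1, self_mem_nhdsWithin,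
      (h4.eventually (c.e.open_target.mem_nhds (c.e.map_source hq))).filter_mono nhdsWithin_le_nhds]
      with s hs hs0 hst
    refine hs ?_
    have h7 : c.e (γ s) = c.e q + s • Pi.single i 1 := c.e.right_inv hst
    have h8 : c.e q i = 0 := hx
    simpa [x, h7, h8] using hs0
  · exact h1.self_of_nhds hx

end Chart

section

variable {M N : Type*} [TopologicalSpace M] [TopologicalSpace N] {S : SmoothStr M} {Z : Set M}
  {T : SmoothStr N} {ZN : Set N} {p : M}

theorem IsDerivationAt.smul {D : Module.Dual ℝ (S.alg p)} (hD : IsDerivationAt S p D) (a : ℝ) :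
    IsDerivationAt S p (a • D) := fun f g => by
  simp only [LinearMap.smul_apply, smul_eq_mul, hD f g]
  ring

theorem IsDerivationAt.div {D : Module.Dual ℝ (S.alg p)} (hD : IsDerivationAt S p D) {f u : M → ℝ}
    (hf : S.SmoothAt f p) (hu : S.SmoothAt u p) (h0 : u p ≠ 0) :
    derivAt D (fun y => f y / u y) = (derivAt D f - f p / u p * derivAt D u) / u p := by
  have h1 := hD.mul (hf.div hu h0) hu
  have h2 : (fun y => f y / u y * u y) =ᶠ[𝓝 p] f := by
    filter_upwards [(S.continuousAt hu).eventually_ne h0] with y hy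
    rw [div_mul_cancel₀ _ hy]
  rw [hD.congr h2] at h1
  rw [h1]
  field_simp
  ring

/-! ### `b`-tangent vectors -/

theorem bDeriv_eq (v : bTangent S Z p) (h : M → ℝ) : bDeriv v h = derivAt v.1.1 h := rfl

theorem bDeriv_congr (v : bTangent S Z p) {f g : M → ℝ} (h : f =ᶠ[𝓝 p] g) :
    bDeriv v f = bDeriv v g := v.2.1.congr h

theorem bDeriv_add (v : bTangent S Z p) {f g : M → ℝ} (hf : S.SmoothAt f p)
    (hg : S.SmoothAt g p) : bDeriv v (fun y => f y + g y) = bDeriv v f + bDeriv v g :=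
  derivAt_add hf hg

theorem bDeriv_mul (v : bTangent S Z p) {f g : M → ℝ} (hf : S.SmoothAt f p)
    (hg : S.SmoothAt g p) :
    bDeriv v (fun y => f y * g y) = f p * bDeriv v g + g p * bDeriv v f :=
  v.2.1.mul hf hg

theorem bDeriv_const_mul (v : bTangent S Z p) (a : ℝ) {f : M → ℝ} (hf : S.SmoothAt f p) :
    bDeriv v (fun y => a * f y) = a * bDeriv v f :=
  derivAt_const_mul a hf

theorem bDeriv_const (v : bTangent S Z p) (a : ℝ) : bDeriv v (fun _ => a) = 0 :=
  v.2.1.const a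

theorem bDeriv_sum (v : bTangent S Z p) {α : Type*} {s : Finset α} {f : α → M → ℝ}
    (hf : ∀ a ∈ s, S.SmoothAt (f a) p) :
    bDeriv v (fun y => ∑ a ∈ s, f a y) = ∑ a ∈ s, bDeriv v (f a) :=
  derivAt_sum hf

theorem bDeriv_div (v : bTangent S Z p) {f u : M → ℝ} (hf : S.SmoothAt f p)
    (hu : S.SmoothAt u p) (h0 : u p ≠ 0) :
    bDeriv v (fun y => f y / u y) = (bDeriv v f - f p / u p * bDeriv v u) / u p :=
  v.2.1.div hf hu h0

theorem bDeriv_comp (v : bTangent S Z p) {ι : Type} [Fintype ι] [DecidableEq ι]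
    {F : (ι → ℝ) → ℝ} {g : ι → M → ℝ} (hF : ∀ᶠ z in 𝓝 (fun i => g i p), ContDiffAt ℝ ∞ F z)
    (hg : ∀ i, S.SmoothAt (g i) p) :
    bDeriv v (fun y => F fun i => g i y) = ∑ i, pd F (fun i => g i p) i * bDeriv v (g i) :=
  v.2.1.comp hF hg

/-- The derivative along `v` is linear in `v`. -/
def bDerivₗ (h : M → ℝ) : bTangent S Z p →ₗ[ℝ] ℝ where
  toFun v := bDeriv v h
  map_add' v w := by
    by_cases hh : S.SmoothAt h p
    · simp only [bDeriv, dif_pos hh]; rfl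
    · simp only [bDeriv, dif_neg hh, add_zero]
  map_smul' a v := by
    by_cases hh : S.SmoothAt h p
    · simp only [bDeriv, dif_pos hh]; rfl
    · simp only [bDeriv, dif_neg hh, smul_zero]

/-- The logarithmic derivative along `v` is linear in `v`. -/
def bLogDerivₗ (f : M → ℝ) : bTangent S Z p →ₗ[ℝ] ℝ where
  toFun v := bLogDeriv v f
  map_add' v w := by
    by_cases hh : IsDefiningAt S Z f p
    · simp only [bLogDeriv, dif_pos hh]; rfl
    · simp only [bLogDeriv, dif_neg hh, add_zero]
  map_smul' a v := by
    by_cases hh : IsDefiningAt S Z f p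
    · simp only [bLogDeriv, dif_pos hh]; rfl
    · simp only [bLogDeriv, dif_neg hh, smul_zero]

theorem bDeriv_defining (v : bTangent S Z p) {f : M → ℝ} (hf : IsDefiningAt S Z f p) :
    bDeriv v f = f p * bLogDeriv v f := by
  rw [bDeriv, dif_pos hf.1, bLogDeriv, dif_pos hf]
  exact v.2.2.1 ⟨f, hf⟩

theorem bLogDeriv_unit (v : bTangent S Z p) {f f' u : M → ℝ} (hf : IsDefiningAt S Z f p)
    (hf' : IsDefiningAt S Z f' p) (hu : S.SmoothAt u p) (h0 : u p ≠ 0)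
    (h : f' =ᶠ[𝓝 p] fun y => u y * f y) :
    bLogDeriv v f' = bLogDeriv v f + bDeriv v u / u p := by
  rw [bLogDeriv, dif_pos hf', bLogDeriv, dif_pos hf, bDeriv, dif_pos hu]
  exact v.2.2.2 ⟨f, hf⟩ ⟨f', hf'⟩ ⟨u, hu⟩ h0 h

theorem bTangent_ext {v w : bTangent S Z p} (h1 : ∀ h, S.SmoothAt h p → bDeriv v h = bDeriv w h)
    (h2 : ∀ f, IsDefiningAt S Z f p → bLogDeriv v f = bLogDeriv w f) : v = w := by
  refine Subtype.ext (Prod.ext (LinearMap.ext fun h => ?_) (funext fun f => ?_))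
  · have := h1 h.1 h.2
    have hh : S.SmoothAt h.1 p := h.2
    rwa [bDeriv, bDeriv, dif_pos hh, dif_pos hh] at this
  · have := h2 f.1 f.2
    rwa [bLogDeriv, bLogDeriv, dif_pos f.2, dif_pos f.2] at this

theorem bDeriv_bMap {φ : M → N} (hφ : IsBMapAt S Z T ZN φ p) (v : bTangent S Z p) {h : N → ℝ}
    (hh : T.SmoothAt h (φ p)) : bDeriv (bMap S Z T ZN φ p v) h = bDeriv v (h ∘ φ) := by
  rw [bMap, dif_pos hφ, bDeriv, dif_pos hh, bDeriv, dif_pos (hφ.1 h hh)]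
  rfl

theorem bLogDeriv_bMap {φ : M → N} (hφ : IsBMapAt S Z T ZN φ p) (v : bTangent S Z p) {f : N → ℝ}
    (hf : IsDefiningAt T ZN f (φ p)) : bLogDeriv (bMap S Z T ZN φ p v) f = bLogDeriv v (f ∘ φ) := by
  rw [bMap, dif_pos hφ, bLogDeriv, dif_pos hf, bLogDeriv, dif_pos (hφ.2.1 f hf)]
  rfl

theorem IsDefiningAt.congr {f g : M → ℝ} (hf : IsDefiningAt S Z f p) (h : f =ᶠ[𝓝 p] g) :
    IsDefiningAt S Z g p := by
  obtain ⟨hs, hz, hd⟩ := hf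
  refine ⟨S.congr hs h, ?_, fun hp => ?_⟩
  · filter_upwards [hz, h] with y h1 h2
    rw [h1, h2]
  · obtain ⟨D, hD, hD0⟩ := hd hp
    refine ⟨D, hD, ?_⟩
    rwa [← derivAt_of D, ← hD.congr h, derivAt_of D hs]

/-- Equality of germs is a change of defining function by the unit `1`. -/
theorem bLogDeriv_congr (v : bTangent S Z p) {f g : M → ℝ} (h : f =ᶠ[𝓝 p] g) :
    bLogDeriv v f = bLogDeriv v g := by
  by_cases hf : IsDefiningAt S Z f p
  · rw [bLogDeriv_unit v hf (hf.congr h) (SmoothStr.smoothAt_const 1) one_ne_zero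
      (by simpa using h.symm), bDeriv_const]
    simp
  · have hg : ¬ IsDefiningAt S Z g p := fun hg => hf (hg.congr h.symm)
    rw [bLogDeriv, bLogDeriv, dif_neg hf, dif_neg hg]

end

/-! ### Adapted charts -/

/-- A chart of `(M, Z)` in which `Z` is a coordinate hyperplane. -/
structure BChart {M : Type*} [TopologicalSpace M] (S : SmoothStr M) (Z : Set M) (ι : Type)
    [Fintype ι] extends Chart S ι where
  i0 : ι
  crit : ∀ y ∈ e.source, y ∈ Z ↔ e y i0 = 0

namespace BChart

variable {M : Type*} [TopologicalSpace M] {S : SmoothStr M} {Z : Set M} {ι : Type} [Fintype ι]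

/-- The restriction of an adapted chart to an open set. -/
def restr (c : BChart S Z ι) {U : Set M} (hU : IsOpen U) : BChart S Z ι where
  toChart := c.toChart.restr hU
  i0 := c.i0
  crit y hy := c.crit y hy.1

variable [DecidableEq ι] {c : BChart S Z ι} {p : M} {f h : M → ℝ}

variable (c) in
/-- The coordinate defining `Z`. -/
def x0 : M → ℝ := c.x c.i0

omit [DecidableEq ι] in
theorem smoothAt_x0 (hp : p ∈ c.e.source) : S.SmoothAt c.x0 p := c.smoothAt_x hp _

/-- At a point of `Z` the derivation `∂₀` sends `u x₀` to `u p ≠ 0`. -/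
theorem isDefiningAt_of_unit (hp : p ∈ c.e.source) {u : M → ℝ} (hu : S.SmoothAt u p)
    (h0 : u p ≠ 0) (h : f =ᶠ[𝓝 p] fun y => u y * c.x0 y) : IsDefiningAt S Z f p := by
  have hs := S.congr (hu.mul (smoothAt_x0 hp)) h.symm
  refine ⟨hs, ?_, fun hpZ => ⟨c.dual hp c.i0, Chart.isDerivationAt_dual hp _, ?_⟩⟩
  · filter_upwards [h, c.e.open_source.mem_nhds hp, (S.continuousAt hu).eventually_ne h0]
      with y h1 h2 h3
    rw [h1, c.crit y h2]
    simp [h3, x0, Chart.x]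
  · rw [← derivAt_of _ hs, (Chart.isDerivationAt_dual hp _).congr h,
      (Chart.isDerivationAt_dual hp _).mul hu (smoothAt_x0 hp),
      Chart.derivAt_dual hp _ (smoothAt_x0 hp), x0, Chart.d_x hp]
    have : c.x c.i0 p = 0 := (c.crit p hp).1 hpZ
    simp [this, h0]

theorem isDefiningAt_x0 (hp : p ∈ c.e.source) : IsDefiningAt S Z c.x0 p :=
  isDefiningAt_of_unit hp (SmoothStr.smoothAt_const 1) one_ne_zero (by simp)

/-- Division by `x₀` gives `f = u x₀`. If `u p` were `0` at a point of `Z`, Leibniz would make every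
derivation kill `f`; off `Z` the function `f` does not vanish. All questions about defining
functions thereby reduce to `x₀`. -/
theorem _root_.BLie.IsDefiningAt.exists_unit (hf : IsDefiningAt S Z f p) (c : BChart S Z ι)
    (hp : p ∈ c.e.source) :
    ∃ u, S.SmoothAt u p ∧ u p ≠ 0 ∧ f =ᶠ[𝓝 p] fun y => u y * c.x0 y := by
  obtain ⟨hs, hz, hd⟩ := hf
  obtain ⟨u, hu, hfu⟩ := Chart.exists_eq_mul_x hp c.i0 hs (by
    filter_upwards [hz, c.e.open_source.mem_nhds hp] with y h1 h2 h3
    exact h1.1 ((c.crit y h2).2 h3))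
  refine ⟨u, hu, fun h0 => ?_, hfu⟩
  by_cases hpZ : p ∈ Z
  · obtain ⟨D, hD, hD0⟩ := hd hpZ
    have hx : c.x c.i0 p = 0 := (c.crit p hp).1 hpZ
    rw [← derivAt_of D hs, hD.congr hfu, hD.mul hu (c.smoothAt_x hp _), h0, hx] at hD0
    simp at hD0
  · have h1 := hfu.self_of_nhds
    simp only [h0, zero_mul] at h1
    exact hpZ (hz.self_of_nhds.2 h1)

/-- The condition on the differential is imposed at one point only; it persists because the unit in
`f = u x₀` stays nonzero. -/
theorem _root_.BLie.IsDefiningAt.eventually (hf : IsDefiningAt S Z f p) (c : BChart S Z ι)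
    (hp : p ∈ c.e.source) : ∀ᶠ y in 𝓝 p, IsDefiningAt S Z f y := by
  obtain ⟨u, hu, h0, h⟩ := hf.exists_unit c hp
  filter_upwards [S.eventually hu, (S.continuousAt hu).eventually_ne h0,
    eventually_eventually_nhds.2 h, c.e.open_source.mem_nhds hp] with y h1 h2 h3 h4
  exact isDefiningAt_of_unit h4 h1 h2 h3

/-- The `b`-tangent vector with given derivation and logarithmic derivative of `x0`. -/
def mkVec (hp : p ∈ c.e.source) (D : Module.Dual ℝ (S.alg p)) (hD : IsDerivationAt S p D) (l : ℝ)
    (hl : derivAt D c.x0 = c.x0 p * l) : bTangent S Z p :=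
  -- The value on `log |f|` is forced by `log |f| = log |x₀| + log |u|` for `f = u x₀`.
  ⟨(D, fun f => l + derivAt D (f.2.exists_unit c hp).choose / (f.2.exists_unit c hp).choose p), hD, by
    rintro ⟨f, hf⟩
    obtain ⟨h1, h2, h3⟩ := (hf.exists_unit c hp).choose_spec
    change D ⟨f, hf.1⟩ = _
    rw [← derivAt_of D hf.1, hD.congr h3, hD.mul h1 (smoothAt_x0 hp), hl]
    have := h3.self_of_nhds
    simp only at this ⊢
    rw [this]
    field_simp, by
    rintro ⟨f, hf⟩ ⟨f', hf'⟩ ⟨u, hu⟩ h0 h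
    obtain ⟨h1, h2, h3⟩ := (hf.exists_unit c hp).choose_spec
    obtain ⟨k1, k2, k3⟩ := (hf'.exists_unit c hp).choose_spec
    -- The chosen units of `f'` and `f` differ by the factor `u` off `x₀ = 0`, hence as germs by
    -- density.
    have h4 : (hf'.exists_unit c hp).choose =ᶠ[𝓝 p] fun y => u y * (hf.exists_unit c hp).choose y := by
      refine Chart.eventuallyEq_of_mul_x hp c.i0 k1 (SmoothStr.SmoothAt.mul hu h1) ?_
      filter_upwards [h, h3, k3] with y e1 e2 e3 e4
      refine mul_right_cancel₀ e4 ?_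
      refine e3.symm.trans (e1.trans ?_)
      rw [mul_assoc]
      exact congrArg _ e2
    change l + derivAt D (hf'.exists_unit c hp).choose / (hf'.exists_unit c hp).choose p =
      l + derivAt D (hf.exists_unit c hp).choose / (hf.exists_unit c hp).choose p + D ⟨u, hu⟩ / u p
    rw [h4.self_of_nhds, hD.congr h4, hD.mul hu h1, ← derivAt_of D hu]
    have h0' : u p ≠ 0 := h0
    field_simp
    ring⟩

theorem bDeriv_mkVec (hp : p ∈ c.e.source) {D : Module.Dual ℝ (S.alg p)}
    (hD : IsDerivationAt S p D) {l : ℝ} (hl : derivAt D c.x0 = c.x0 p * l) :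
    bDeriv (mkVec (Z := Z) hp D hD l hl) h = derivAt D h := rfl

theorem bLogDeriv_mkVec (hp : p ∈ c.e.source) {D : Module.Dual ℝ (S.alg p)}
    (hD : IsDerivationAt S p D) {l : ℝ} (hl : derivAt D c.x0 = c.x0 p * l) :
    bLogDeriv (mkVec (Z := Z) hp D hD l hl) c.x0 = l := by
  have hx := isDefiningAt_x0 (c := c) hp
  rw [bLogDeriv, dif_pos hx]
  obtain ⟨h1, h2, h3⟩ := (hx.exists_unit c hp).choose_spec
  have h4 : (hx.exists_unit c hp).choose =ᶠ[𝓝 p] fun _ => 1 := by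
    refine Chart.eventuallyEq_of_mul_x hp c.i0 h1 (SmoothStr.smoothAt_const 1) ?_
    filter_upwards [h3] with y e1 e2
    refine mul_right_cancel₀ e2 ?_
    rw [one_mul]
    exact e1.symm
  change l + derivAt D (hx.exists_unit c hp).choose / (hx.exists_unit c hp).choose p = l
  rw [hD.congr h4, hD.const]
  simp

variable (c) in
/-- The coordinates of a `b`-tangent vector in the frame `x₀ ∂₀, ∂₁, …`. -/
def coord (p : M) : bTangent S Z p →ₗ[ℝ] (ι → ℝ) :=
  LinearMap.pi fun i => if i = c.i0 then bLogDerivₗ c.x0 else bDerivₗ (c.x i)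

theorem coord_i0 (v : bTangent S Z p) : c.coord p v c.i0 = bLogDeriv v c.x0 := by
  simp [coord, bLogDerivₗ]

theorem coord_ne (v : bTangent S Z p) {i : ι} (hi : i ≠ c.i0) :
    c.coord p v i = bDeriv v (c.x i) := by
  simp [coord, hi, bDerivₗ]

variable (c) in
/-- The weight of the `i`-th direction. -/
def wt (i : ι) (p : M) : ℝ := if i = c.i0 then c.x0 p else 1

theorem smoothAt_wt (hp : p ∈ c.e.source) (i : ι) : S.SmoothAt (c.wt i) p := by
  by_cases hi : i = c.i0
  · have : c.wt i = c.x0 := by ext; simp [wt, hi]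
    rw [this]; exact smoothAt_x0 hp
  · have : c.wt i = fun _ => 1 := by ext; simp [wt, hi]
    rw [this]; exact SmoothStr.smoothAt_const 1

variable (c) in
/-- The derivatives in the directions of the frame `x₀ ∂₀, ∂₁, …`. -/
def bd (i : ι) (h : M → ℝ) (p : M) : ℝ := c.wt i p * c.d i h p

theorem smoothAt_bd (hp : p ∈ c.e.source) (hh : S.SmoothAt h p) (i : ι) :
    S.SmoothAt (c.bd i h) p := (smoothAt_wt hp i).mul (Chart.smoothAt_d hp hh i)

theorem bDeriv_x (hp : p ∈ c.e.source) (v : bTangent S Z p) (i : ι) :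
    bDeriv v (c.x i) = c.wt i p * c.coord p v i := by
  by_cases hi : i = c.i0
  · subst hi
    rw [coord_i0, wt, if_pos rfl]
    exact bDeriv_defining v (isDefiningAt_x0 hp)
  · rw [coord_ne v hi, wt, if_neg hi, one_mul]

theorem bDeriv_eq_sum (hp : p ∈ c.e.source) (v : bTangent S Z p) (hh : S.SmoothAt h p) :
    bDeriv v h = ∑ i, c.coord p v i * c.bd i h p := by
  rw [bDeriv_eq, Chart.derivAt_eq_sum hp v.2.1 hh]
  refine Finset.sum_congr rfl fun i _ => ?_
  rw [← bDeriv_eq, bDeriv_x hp, bd]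
  ring

/-- The coordinates determine all derivatives, and through `f = u x₀` also the logarithmic
derivatives of all defining functions. -/
theorem coord_injective (hp : p ∈ c.e.source) : Function.Injective (c.coord p) := by
  intro v w hvw
  have h1 : ∀ h, S.SmoothAt h p → bDeriv v h = bDeriv w h := fun h hh => by
    rw [bDeriv_eq_sum hp v hh, bDeriv_eq_sum hp w hh, hvw]
  refine bTangent_ext h1 fun f hf => ?_
  obtain ⟨u, hu, h0, h⟩ := hf.exists_unit c hp
  rw [bLogDeriv_unit v (isDefiningAt_x0 hp) hf hu h0 h,
    bLogDeriv_unit w (isDefiningAt_x0 hp) hf hu h0 h, h1 u hu, ← coord_i0, ← coord_i0, hvw]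

open Classical in
variable (c) in
/-- The frame `x₀ ∂₀, ∂₁, …`. -/
def frame (p : M) (i : ι) : bTangent S Z p :=
  if hp : p ∈ c.e.source then
    mkVec hp (c.wt i p • c.dual hp i)
      ((Chart.isDerivationAt_dual hp i).smul _)
      (if i = c.i0 then 1 else 0) (by
        rw [derivAt_of _ (smoothAt_x0 hp), LinearMap.smul_apply, ← derivAt_of _ (smoothAt_x0 hp),
          Chart.derivAt_dual hp _ (smoothAt_x0 hp), x0, Chart.d_x hp, wt]
        split_ifs <;> simp [x0])
  else 0

theorem bDeriv_frame (hp : p ∈ c.e.source) (hh : S.SmoothAt h p) (i : ι) :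
    bDeriv (c.frame p i) h = c.bd i h p := by
  rw [frame, dif_pos hp, bDeriv_mkVec, derivAt_of _ hh, LinearMap.smul_apply, ← derivAt_of _ hh,
    Chart.derivAt_dual hp _ hh]
  rfl

theorem coord_frame (hp : p ∈ c.e.source) (i j : ι) :
    c.coord p (c.frame p j) i = if i = j then 1 else 0 := by
  by_cases hi : i = c.i0
  · subst hi
    rw [coord_i0, frame, dif_pos hp, bLogDeriv_mkVec]
    simp [eq_comm]
  · rw [coord_ne _ hi, bDeriv_frame hp (c.smoothAt_x hp i), bd, Chart.d_x hp, wt]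
    rcases eq_or_ne i j with rfl | hij
    · simp [hi]
    · simp [hij, hij.symm]

variable (c) in
/-- The vector with given coordinates. -/
def vec (p : M) (a : ι → ℝ) : bTangent S Z p := ∑ i, a i • c.frame p i

theorem coord_vec (hp : p ∈ c.e.source) (a : ι → ℝ) : c.coord p (c.vec p a) = a := by
  ext i
  simp [vec, coord_frame hp]

theorem vec_coord (hp : p ∈ c.e.source) (v : bTangent S Z p) : c.vec p (c.coord p v) = v :=
  coord_injective hp (coord_vec hp _)

variable (c) in
/-- The coordinate isomorphism on the fibre of the `b`-tangent bundle. -/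
def coordEquiv (hp : p ∈ c.e.source) : bTangent S Z p ≃ₗ[ℝ] (ι → ℝ) :=
  LinearEquiv.ofBijective (c.coord p)
    ⟨coord_injective hp, fun a => ⟨c.vec p a, coord_vec hp a⟩⟩

theorem bLogDeriv_eq (hp : p ∈ c.e.source) (v : bTangent S Z p) (hf : IsDefiningAt S Z f p)
    {u : M → ℝ} (hu : S.SmoothAt u p) (h0 : u p ≠ 0) (h : f =ᶠ[𝓝 p] fun y => u y * c.x0 y) :
    bLogDeriv v f = c.coord p v c.i0 + bDeriv v u / u p := by
  rw [bLogDeriv_unit v (isDefiningAt_x0 hp) hf hu h0 h, coord_i0]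

theorem smoothAt_coord (hp : p ∈ c.e.source) {X : ∀ p, bTangent S Z p} (hX : IsSmoothFieldAt X p)
    (i : ι) : S.SmoothAt (fun z => c.coord z (X z) i) p := by
  by_cases hi : i = c.i0
  · subst hi
    simpa only [coord_i0] using hX.self_of_nhds.2 _ (isDefiningAt_x0 hp)
  · simpa only [coord_ne _ hi] using hX.self_of_nhds.1 _ (c.smoothAt_x hp i)

theorem smoothAt_bDeriv (hp : p ∈ c.e.source) {X : ∀ p, bTangent S Z p}
    (hX : ∀ i, S.SmoothAt (fun z => c.coord z (X z) i) p) (hh : S.SmoothAt h p) :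
    S.SmoothAt (fun z => bDeriv (X z) h) p := by
  refine S.congr (SmoothStr.SmoothAt.sum (s := Finset.univ) fun i _ =>
    (hX i).mul (smoothAt_bd hp hh i)) ?_
  filter_upwards [S.eventually hh, c.e.open_source.mem_nhds hp] with z h1 h2
  rw [bDeriv_eq_sum h2 _ h1]

/-- Derivatives are combinations of the coordinates with smooth coefficients, and `log |u x₀|`
contributes the `i0` coordinate plus the smooth term `X u / u`. -/
theorem isSmoothFieldAt_iff (hp : p ∈ c.e.source) {X : ∀ p, bTangent S Z p} :
    IsSmoothFieldAt X p ↔ ∀ i, S.SmoothAt (fun z => c.coord z (X z) i) p := by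
  refine ⟨fun h i => smoothAt_coord hp h i, fun h => ?_⟩
  filter_upwards [eventually_all.2 fun i => S.eventually (h i), c.e.open_source.mem_nhds hp]
    with y hy hy'
  refine ⟨fun g hg => smoothAt_bDeriv hy' hy hg, fun f hf => ?_⟩
  obtain ⟨u, hu, h0, hfu⟩ := hf.exists_unit c hy'
  refine S.congr ((hy c.i0).add ((smoothAt_bDeriv hy' hy hu).div hu h0)) ?_
  filter_upwards [hf.eventually c hy', S.eventually hu, (S.continuousAt hu).eventually_ne h0,
    eventually_eventually_nhds.2 hfu, c.e.open_source.mem_nhds hy'] with z h1 h2 h3 h4 h5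
  rw [bLogDeriv_eq h5 _ h1 h2 h3 h4]

theorem isSmoothFieldAt_vec (hp : p ∈ c.e.source) {a : ι → M → ℝ}
    (ha : ∀ i, S.SmoothAt (a i) p) : IsSmoothFieldAt (fun z => c.vec z fun i => a i z) p := by
  refine (isSmoothFieldAt_iff hp).2 fun i => S.congr (ha i) ?_
  filter_upwards [c.e.open_source.mem_nhds hp] with z hz
  rw [coord_vec hz]

theorem exists_isSmoothFieldAt (hp : p ∈ c.e.source) (v : bTangent S Z p) :
    ∃ X : ∀ p, bTangent S Z p, IsSmoothFieldAt X p ∧ X p = v :=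
  ⟨_, isSmoothFieldAt_vec hp fun i => SmoothStr.smoothAt_const (c.coord p v i), vec_coord hp v⟩

theorem bd_congr (hp : p ∈ c.e.source) (hfh : f =ᶠ[𝓝 p] h) (i : ι) : c.bd i f p = c.bd i h p := by
  rw [bd, bd, Chart.d_congr hp hfh]

theorem bd_mul (hp : p ∈ c.e.source) (hf : S.SmoothAt f p) (hh : S.SmoothAt h p) (i : ι) :
    c.bd i (fun y => f y * h y) p = f p * c.bd i h p + h p * c.bd i f p := by
  rw [← bDeriv_frame hp (hf.mul hh), ← bDeriv_frame hp hf, ← bDeriv_frame hp hh, bDeriv_mul _ hf hh]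

/-- The weight of a direction depends at most on the coordinate of that same direction, so distinct
frame fields commute. This keeps structure functions out of the formulas for Lie brackets and makes
the canonical bracket one with constant coefficients. -/
theorem bd_comm (hp : p ∈ c.e.source) (hh : S.SmoothAt h p) (i j : ι) :
    c.bd i (c.bd j h) p = c.bd j (c.bd i h) p := by
  rcases eq_or_ne i j with rfl | hij
  · rfl
  have h1 : ∀ k l, k ≠ l → c.bd k (c.bd l h) p = c.wt k p * c.wt l p * c.d k (c.d l h) p := by
    intro k l hkl
    have h2 : c.bd k (c.wt l) p = 0 := by
      by_cases hl : l = c.i0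
      · have : c.wt l = c.x l := by ext; simp [wt, hl, x0]
        rw [this, bd, Chart.d_x hp, if_neg hkl, mul_zero]
      · have : c.wt l = fun _ => 1 := by ext; simp [wt, hl]
        rw [this, ← bDeriv_frame hp (SmoothStr.smoothAt_const 1), bDeriv_const]
    have h3 : c.bd k (c.bd l h) p = c.bd k (fun y => c.wt l y * c.d l h y) p := rfl
    rw [h3, bd_mul hp (smoothAt_wt hp l) (Chart.smoothAt_d hp hh l), h2, bd]
    ring
  rw [h1 i j hij, h1 j i hij.symm, Chart.d_comm hp hh]
  ring

/-- The coordinates of a Lie bracket. -/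
theorem isLieBracketAt_vec (hp : p ∈ c.e.source) {X Y : ∀ p, bTangent S Z p}
    (hX : IsSmoothFieldAt X p) (hY : IsSmoothFieldAt Y p) :
    IsLieBracketAt X Y p (c.vec p fun i => bDeriv (X p) (fun z => c.coord z (Y z) i) -
      bDeriv (Y p) (fun z => c.coord z (X z) i)) := by
  have key : ∀ h, S.SmoothAt h p → bDeriv (c.vec p fun i =>
      bDeriv (X p) (fun z => c.coord z (Y z) i) - bDeriv (Y p) (fun z => c.coord z (X z) i)) h =
      bDeriv (X p) (fun z => bDeriv (Y z) h) - bDeriv (Y p) (fun z => bDeriv (X z) h) := by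
    intro h hh
    have h1 : ∀ {X Y : ∀ p, bTangent S Z p}, IsSmoothFieldAt X p → IsSmoothFieldAt Y p →
        bDeriv (X p) (fun z => bDeriv (Y z) h) =
        ∑ j, bDeriv (X p) (fun z => c.coord z (Y z) j) * c.bd j h p +
        ∑ j, ∑ i, c.coord p (Y p) j * c.coord p (X p) i * c.bd i (c.bd j h) p := by
      intro X Y hX hY
      have h2 : (fun z => bDeriv (Y z) h) =ᶠ[𝓝 p] fun z => ∑ j, c.coord z (Y z) j * c.bd j h z := by
        filter_upwards [S.eventually hh, c.e.open_source.mem_nhds hp] with z k1 k2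
        rw [bDeriv_eq_sum k2 _ k1]
      rw [bDeriv_congr _ h2, bDeriv_sum _ fun j _ =>
        (smoothAt_coord hp hY j).mul (smoothAt_bd hp hh j), ← Finset.sum_add_distrib]
      refine Finset.sum_congr rfl fun j _ => ?_
      rw [bDeriv_mul _ (smoothAt_coord hp hY j) (smoothAt_bd hp hh j),
        bDeriv_eq_sum hp (X p) (smoothAt_bd hp hh j), Finset.mul_sum, add_comm, mul_comm]
      simp only [mul_assoc]
    rw [bDeriv_eq_sum hp _ hh, coord_vec hp, h1 hX hY, h1 hY hX]
    rw [Finset.sum_comm (f := fun j i => c.coord p (X p) j * c.coord p (Y p) i *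
      c.bd i (c.bd j h) p)]
    -- By commutation of the frame, the second-order terms of the two iterated derivatives agree and
    -- cancel.
    have h3 : ∀ i j, c.coord p (X p) i * c.coord p (Y p) j * c.bd j (c.bd i h) p =
        c.coord p (Y p) j * c.coord p (X p) i * c.bd i (c.bd j h) p := by
      intro i j
      rw [bd_comm hp hh j i]
      ring
    simp only [h3, sub_mul, Finset.sum_sub_distrib]
    ring
  refine ⟨key, fun f hf => ?_⟩
  obtain ⟨u, hu, h0, hfu⟩ := hf.exists_unit c hp
  -- With `f = u x₀`, the quotient rule for `Y u / u` yields, besides `X (Y u) / u`, a term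
  -- symmetric in `X` and `Y`, which drops out of the commutator.
  have h1 : ∀ {X Y : ∀ p, bTangent S Z p}, IsSmoothFieldAt X p → IsSmoothFieldAt Y p →
      bDeriv (X p) (fun z => bLogDeriv (Y z) f) =
      bDeriv (X p) (fun z => c.coord z (Y z) c.i0) +
      (bDeriv (X p) (fun z => bDeriv (Y z) u) - bDeriv (Y p) u / u p * bDeriv (X p) u) / u p := by
    intro X Y hX hY
    have hYu := hY.self_of_nhds.1 u hu
    have h2 : (fun z => bLogDeriv (Y z) f) =ᶠ[𝓝 p] fun z =>
        c.coord z (Y z) c.i0 + bDeriv (Y z) u / u z := by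
      filter_upwards [hf.eventually c hp, S.eventually hu, (S.continuousAt hu).eventually_ne h0,
        eventually_eventually_nhds.2 hfu, c.e.open_source.mem_nhds hp] with z k1 k2 k3 k4 k5
      rw [bLogDeriv_eq k5 _ k1 k2 k3 k4]
    rw [bDeriv_congr _ h2, bDeriv_add _ (smoothAt_coord hp hY _) (hYu.div hu h0),
      bDeriv_div _ hYu hu h0]
  rw [bLogDeriv_eq hp _ hf hu h0 hfu, coord_vec hp, h1 hX hY, h1 hY hX, key u hu]
  field_simp
  ring

end BChart

section

variable {M N : Type*} [TopologicalSpace M] [TopologicalSpace N] {S : SmoothStr M} {Z : Set M}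
  {T : SmoothStr N} {ZN : Set N} {p : M}

/-! ### `b`-maps -/

theorem IsDefiningAt.unit_mul {f u : M → ℝ} (hf : IsDefiningAt S Z f p) (hu : S.SmoothAt u p)
    (h0 : u p ≠ 0) : IsDefiningAt S Z (fun y => u y * f y) p := by
  obtain ⟨hs, hz, hd⟩ := hf
  refine ⟨hu.mul hs, ?_, fun hp => ?_⟩
  · filter_upwards [hz, (S.continuousAt hu).eventually_ne h0] with y h1 h2
    simp [h1, h2]
  · obtain ⟨D, hD, hD0⟩ := hd hp
    refine ⟨D, hD, ?_⟩
    have : f p = 0 := hz.self_of_nhds.1 hp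
    rw [← derivAt_of D (hu.mul hs), hD.mul hu hs, this, derivAt_of D hs]
    simp [h0, hD0]

theorem Chart.smoothAt_comp {ι : Type} [Fintype ι] (c : Chart T ι) {φ : M → N}
    (hp : φ p ∈ c.e.source) (hφ : ContinuousAt φ p) (hx : ∀ i, S.SmoothAt (c.x i ∘ φ) p)
    {h : N → ℝ} (hh : T.SmoothAt h (φ p)) : S.SmoothAt (h ∘ φ) p := by
  refine S.congr (SmoothStr.comp_local ((c.smooth_iff _ hp h).1 hh) hx) ?_
  exact hφ.eventually (c.exists_eq_comp hp h).symm

/-- It suffices to test the coordinates: every defining function is a unit times `x₀`, and units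
pull back to units. -/
theorem BChart.isBMapAt {ι : Type} [Fintype ι] [DecidableEq ι] (c : BChart T ZN ι) {φ : M → N}
    (hp : φ p ∈ c.e.source) (hφ : ContinuousAt φ p) (hx : ∀ i, S.SmoothAt (c.x i ∘ φ) p)
    (h0 : IsDefiningAt S Z (c.x0 ∘ φ) p) : IsBMapAt S Z T ZN φ p := by
  have hs : ∀ h, T.SmoothAt h (φ p) → S.SmoothAt (h ∘ φ) p := fun h hh =>
    c.smoothAt_comp hp hφ hx hh
  refine ⟨hs, fun f hf => ?_, hφ⟩
  obtain ⟨u, hu, hu0, hfu⟩ := hf.exists_unit c hp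
  exact (h0.unit_mul (hs u hu) hu0).congr (EventuallyEq.symm (hφ.eventually hfu))

/-! ### The exterior derivative -/

/-- A `b`-form of degree one which is near `p` of the form `dg` or `d log |f|`. -/
def IsExactAt (κ : ∀ p, Module.Dual ℝ (bTangent S Z p)) (p : M) : Prop :=
  (∃ g, S.SmoothAt g p ∧ ∀ᶠ z in 𝓝 p, ∀ v, κ z v = bDeriv v g) ∨
    ∃ f, IsDefiningAt S Z f p ∧ ∀ᶠ z in 𝓝 p, ∀ v, κ z v = bLogDeriv v f

theorem IsExactAt.smoothAt {κ : ∀ p, Module.Dual ℝ (bTangent S Z p)} (hκ : IsExactAt κ p)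
    {X : ∀ p, bTangent S Z p} (hX : IsSmoothFieldAt X p) :
    S.SmoothAt (fun z => κ z (X z)) p := by
  obtain ⟨g, hg, h⟩ | ⟨f, hf, h⟩ := hκ
  · refine S.congr (hX.self_of_nhds.1 g hg) ?_
    filter_upwards [h] with z hz
    rw [hz]
  · refine S.congr (hX.self_of_nhds.2 f hf) ?_
    filter_upwards [h] with z hz
    rw [hz]

/-- This is `dκ = 0`. A Lie bracket is defined by commutators on smooth functions and on logarithms
of defining functions, which covers both kinds of exact forms. -/
theorem IsExactAt.lieBracket {κ : ∀ p, Module.Dual ℝ (bTangent S Z p)} (hκ : IsExactAt κ p)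
    {X Y : ∀ p, bTangent S Z p} {b : bTangent S Z p} (hb : IsLieBracketAt X Y p b) :
    κ p b = bDeriv (X p) (fun z => κ z (Y z)) - bDeriv (Y p) (fun z => κ z (X z)) := by
  obtain ⟨g, hg, h⟩ | ⟨f, hf, h⟩ := hκ
  · rw [h.self_of_nhds, hb.1 g hg]
    congr 1 <;> refine bDeriv_congr _ ?_ <;> filter_upwards [h] with z hz <;> rw [hz]
  · rw [h.self_of_nhds, hb.2 f hf]
    congr 1 <;> refine bDeriv_congr _ ?_ <;> filter_upwards [h] with z hz <;> rw [hz]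

/-- Pullback commutes with `d` and with `d log`. The hypothesis `hd` keeps `f` a defining function
at the image points near `φ p`. -/
theorem IsExactAt.comp {κ : ∀ p, Module.Dual ℝ (bTangent T ZN p)} {φ : M → N}
    (hφ : ∀ᶠ z in 𝓝 p, IsBMapAt S Z T ZN φ z) (hκ : IsExactAt κ (φ p))
    (hd : ∀ f, IsDefiningAt T ZN f (φ p) → ∀ᶠ y in 𝓝 (φ p), IsDefiningAt T ZN f y) :
    IsExactAt (fun z => κ (φ z) ∘ₗ bMap S Z T ZN φ z) p := by
  have hp := hφ.self_of_nhds
  obtain ⟨g, hg, h⟩ | ⟨f, hf, h⟩ := hκ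
  · refine Or.inl ⟨g ∘ φ, hp.1 g hg, ?_⟩
    filter_upwards [hφ, hp.2.2.eventually h, hp.2.2.eventually (T.eventually hg)] with z h1 h2 h3 v
    rw [LinearMap.comp_apply, h2, bDeriv_bMap h1 v h3]
  · refine Or.inr ⟨f ∘ φ, hp.2.1 f hf, ?_⟩
    filter_upwards [hφ, hp.2.2.eventually h, hp.2.2.eventually (hd f hf)] with z h1 h2 h3 v
    rw [LinearMap.comp_apply, h2, bLogDeriv_bMap h1 v h3]

/-- Since the `κ a` are closed, the derivatives of `κ a (X)` and `κ a (Y)` cancel against the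
bracket term. What remains is `∑ df ∧ κ`, which involves the fields only through their values at
`p`. -/
theorem IsExtDerivAt.eq_sum {lam : ∀ p, Module.Dual ℝ (bTangent S Z p)} {α : Type*} [Fintype α]
    {f : α → M → ℝ} {κ : α → ∀ p, Module.Dual ℝ (bTangent S Z p)} (hf : ∀ a, S.SmoothAt (f a) p)
    (hκ : ∀ a, IsExactAt (κ a) p) (h : ∀ᶠ z in 𝓝 p, ∀ v, lam z v = ∑ a, f a z * κ a z v)
    {v w : bTangent S Z p} {r : ℝ} (hr : IsExtDerivAt lam p v w r) :
    r = ∑ a, (bDeriv v (f a) * κ a p w - bDeriv w (f a) * κ a p v) := by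
  obtain ⟨X, Y, b, hX, hY, rfl, rfl, hb, rfl⟩ := hr
  have key : ∀ X Y : ∀ p, bTangent S Z p, IsSmoothFieldAt Y p →
      bDeriv (X p) (fun z => lam z (Y z)) =
      ∑ a, (f a p * bDeriv (X p) (fun z => κ a z (Y z)) + κ a p (Y p) * bDeriv (X p) (f a)) := by
    intro X Y hY
    have h1 : (fun z => lam z (Y z)) =ᶠ[𝓝 p] fun z => ∑ a, f a z * κ a z (Y z) := by
      filter_upwards [h] with z hz
      rw [hz]
    rw [bDeriv_congr _ h1, bDeriv_sum _ fun a _ => (hf a).mul ((hκ a).smoothAt hY)]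
    exact Finset.sum_congr rfl fun a _ => bDeriv_mul _ (hf a) ((hκ a).smoothAt hY)
  rw [key X Y hY, key Y X hX, h.self_of_nhds, ← Finset.sum_sub_distrib, ← Finset.sum_sub_distrib]
  refine Finset.sum_congr rfl fun a _ => ?_
  rw [(hκ a).lieBracket hb]
  ring

/-- The chart only provides fields extending `v` and `w` and a bracket of them. The choice made in
the definition of `bExtDeriv` is harmless, because every admissible value equals this sum. -/
theorem bExtDeriv_eq_sum {ι : Type} [Fintype ι] [DecidableEq ι] (c : BChart S Z ι)
    (hp : p ∈ c.e.source) {lam : ∀ p, Module.Dual ℝ (bTangent S Z p)} {α : Type*} [Fintype α]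
    {f : α → M → ℝ} {κ : α → ∀ p, Module.Dual ℝ (bTangent S Z p)} (hf : ∀ a, S.SmoothAt (f a) p)
    (hκ : ∀ a, IsExactAt (κ a) p) (h : ∀ᶠ z in 𝓝 p, ∀ v, lam z v = ∑ a, f a z * κ a z v)
    (v w : bTangent S Z p) :
    bExtDeriv lam p v w = ∑ a, (bDeriv v (f a) * κ a p w - bDeriv w (f a) * κ a p v) := by
  obtain ⟨X, hX, hXv⟩ := c.exists_isSmoothFieldAt hp v
  obtain ⟨Y, hY, hYw⟩ := c.exists_isSmoothFieldAt hp w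
  have hex : ∃ r, IsExtDerivAt lam p v w r :=
    ⟨_, X, Y, _, hX, hY, hXv, hYw, c.isLieBracketAt_vec hp hX hY, rfl⟩
  rw [bExtDeriv, dif_pos hex]
  exact hex.choose_spec.eq_sum hf hκ h

/-! ### Hamiltonian vectors -/

variable {σ : ∀ p, bTangent S Z p → bTangent S Z p → ℝ}

theorem IsNondegenerate.exists_hamiltonian (hσ : IsNondegenerate σ) (F : M → ℝ) (p : M) :
    ∃ v, IsHamiltonianAt σ F p v := by
  obtain ⟨B, hB, -, hb⟩ := hσ p
  obtain ⟨v, hv⟩ := hb.2 (bDerivₗ F)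
  exact ⟨v, fun w => by rw [← hB, hv]; rfl⟩

theorem IsNondegenerate.hamiltonian_unique (hσ : IsNondegenerate σ) {F : M → ℝ} {p : M}
    {v w : bTangent S Z p} (hv : IsHamiltonianAt σ F p v) (hw : IsHamiltonianAt σ F p w) :
    v = w := by
  obtain ⟨B, hB, -, hb⟩ := hσ p
  refine hb.1 (LinearMap.ext fun u => ?_)
  rw [hB, hB, hv, hw]

/-- Hamiltonian vectors are unique, so the chosen value is `σ(X_F, X_K) = dF(X_K)`. -/
theorem IsNondegenerate.poisson_eq (hσ : IsNondegenerate σ) {F K : M → ℝ} {p : M}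
    {v w : bTangent S Z p} (hv : IsHamiltonianAt σ F p v) (hw : IsHamiltonianAt σ K p w) :
    poisson σ F K p = bDeriv w F := by
  have hex : ∃ r, ∃ v w, IsHamiltonianAt σ F p v ∧ IsHamiltonianAt σ K p w ∧ r = σ p v w :=
    ⟨_, v, w, hv, hw, rfl⟩
  rw [poisson, dif_pos hex]
  obtain ⟨v', w', h1, h2, h3⟩ := hex.choose_spec
  rw [h3, hσ.hamiltonian_unique h1 hv, hσ.hamiltonian_unique h2 hw, hv]

/-- A bilinear form in Darboux coordinates. -/
theorem exists_bijective_of_darboux {V : Type*} [AddCommGroup V] [Module ℝ V] {ι : Type}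
    [Fintype ι] [DecidableEq ι] (φ : V ≃ₗ[ℝ] (ι ⊕ ι → ℝ)) (σ : V → V → ℝ)
    (h : ∀ v w, σ v w = ∑ i, (φ v (.inl i) * φ w (.inr i) - φ v (.inr i) * φ w (.inl i))) :
    ∃ B : V →ₗ[ℝ] Module.Dual ℝ V, (∀ v w, B v w = σ v w) ∧ (∀ v, σ v v = 0) ∧
      Function.Bijective B := by
  let B : V →ₗ[ℝ] Module.Dual ℝ V := LinearMap.mk₂ ℝ
    (fun v w => ∑ i, (φ v (.inl i) * φ w (.inr i) - φ v (.inr i) * φ w (.inl i)))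
    (fun v v' w => by
      rw [← Finset.sum_add_distrib]
      refine Finset.sum_congr rfl fun i _ => ?_
      simp only [map_add, Pi.add_apply]; ring)
    (fun a v w => by
      rw [Finset.smul_sum]
      refine Finset.sum_congr rfl fun i _ => ?_
      simp only [map_smul, Pi.smul_apply, smul_eq_mul]; ring)
    (fun v w w' => by
      rw [← Finset.sum_add_distrib]
      refine Finset.sum_congr rfl fun i _ => ?_
      simp only [map_add, Pi.add_apply]; ring)
    (fun a v w => by
      rw [Finset.smul_sum]
      refine Finset.sum_congr rfl fun i _ => ?_
      simp only [map_smul, Pi.smul_apply, smul_eq_mul]; ring)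
  have hfin : FiniteDimensional ℝ V := φ.symm.finiteDimensional
  have hinj : Function.Injective B := by
    rw [injective_iff_map_eq_zero]
    intro v hv
    have hv' : ∀ w, ∑ i, (φ v (.inl i) * φ w (.inr i) - φ v (.inr i) * φ w (.inl i)) = 0 :=
      fun w => DFunLike.congr_fun hv w
    refine φ.injective (funext fun a => ?_)
    rw [map_zero]
    rcases a with j | j
    · have := hv' (φ.symm (Pi.single (.inr j) 1))
      simpa [Pi.single_apply] using this
    · have := hv' (φ.symm (Pi.single (.inl j) 1))
      simpa [Pi.single_apply] using this
  refine ⟨B, fun v w => (h v w).symm, fun v => ?_, hinj,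
    (LinearMap.injective_iff_surjective_of_finrank_eq_finrank
      (Subspace.dual_finrank_eq).symm).1 hinj⟩
  rw [h]
  exact Finset.sum_eq_zero fun i _ => by ring

end

/-! ### Canonical coordinates on the `b`-cotangent bundle -/

namespace BChart

variable {M : Type*} [TopologicalSpace M] {S : SmoothStr M} {Z : Set M} {ι : Type} [Fintype ι]
  [DecidableEq ι] {c : BChart S Z ι} {p : M} {f h : M → ℝ}

variable (c) in
/-- The covector with given coordinates. -/
def covec (p : M) (a : ι → ℝ) : Module.Dual ℝ (bTangent S Z p) :=
  ∑ i, a i • (LinearMap.proj i ∘ₗ c.coord p)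

theorem covec_apply (a : ι → ℝ) (v : bTangent S Z p) :
    c.covec p a v = ∑ i, a i * c.coord p v i := by
  simp [covec]

theorem apply_eq_sum (hp : p ∈ c.e.source) (b : Module.Dual ℝ (bTangent S Z p))
    (v : bTangent S Z p) : b v = ∑ i, b (c.frame p i) * c.coord p v i := by
  conv_lhs => rw [← vec_coord hp v]
  simp [vec, mul_comm]

theorem covec_frame (hp : p ∈ c.e.source) (b : Module.Dual ℝ (bTangent S Z p)) :
    (c.covec p fun i => b (c.frame p i)) = b :=
  LinearMap.ext fun v => by rw [covec_apply, apply_eq_sum hp b v]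

theorem covec_apply_frame (hp : p ∈ c.e.source) (a : ι → ℝ) (i : ι) :
    c.covec p a (c.frame p i) = a i := by
  simp [covec_apply, coord_frame hp]

theorem isSmoothFieldAt_frame (hp : p ∈ c.e.source) (i : ι) :
    IsSmoothFieldAt (fun z => c.frame z i) p := by
  refine (isSmoothFieldAt_iff hp).2 fun j => S.congr
    (SmoothStr.smoothAt_const (if j = i then 1 else 0)) ?_
  filter_upwards [c.e.open_source.mem_nhds hp] with z hz
  rw [coord_frame hz]

variable (c) in
/-- The point of the `b`-cotangent bundle with given coordinates. -/
def cotangentSymm (z : ι ⊕ ι → ℝ) : BCotangent S Z :=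
  ⟨c.e.symm (z ∘ .inl), c.covec _ (z ∘ .inr)⟩

theorem pair_cotangentSymm (X : ∀ p, bTangent S Z p) (z : ι ⊕ ι → ℝ) :
    BCotangent.pair X (c.cotangentSymm z) =
      ∑ i, z (.inr i) * c.coord _ (X (c.e.symm (z ∘ .inl))) i := by
  rw [BCotangent.pair]
  exact covec_apply _ _

omit [DecidableEq ι] in
theorem contDiff_comp_inl : ContDiff ℝ ∞ fun z : ι ⊕ ι → ℝ => z ∘ Sum.inl :=
  contDiff_pi.2 fun i => contDiff_apply ℝ ℝ (Sum.inl i)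

variable (c) in
/-- The coordinates of the `b`-cotangent bundle. -/
def cotangentFun (α : BCotangent S Z) : ι ⊕ ι → ℝ :=
  Sum.elim (c.e α.proj) fun i => α.cov (c.frame α.proj i)

omit [DecidableEq ι] in
theorem eventually_contDiffAt_comp (hp : p ∈ c.e.source) (hh : S.SmoothAt h p) {z : ι ⊕ ι → ℝ}
    (hz : z ∘ Sum.inl = c.e p) :
    ∀ᶠ w in 𝓝 z, ContDiffAt ℝ ∞ (fun w : ι ⊕ ι → ℝ => h (c.e.symm (w ∘ .inl))) w := by
  have h1 : Tendsto (fun z : ι ⊕ ι → ℝ => z ∘ Sum.inl) (𝓝 z) (𝓝 (c.e p)) := by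
    rw [← hz]; exact contDiff_comp_inl.continuous.tendsto z
  filter_upwards [h1.eventually ((c.smooth_iff p hp h).1 hh)] with w hw
  exact ContDiffAt.comp (g := h ∘ c.e.symm) w hw contDiff_comp_inl.contDiffAt

variable (c) in
/-- The open partial homeomorphism underlying the chart of the `b`-cotangent bundle. -/
def cotangentHomeo : OpenPartialHomeomorph (BCotangent S Z) (ι ⊕ ι → ℝ) where
  toFun := c.cotangentFun
  invFun := c.cotangentSymm
  source := BCotangent.proj ⁻¹' c.e.source
  target := {z | z ∘ .inl ∈ c.e.target}
  map_source' α hα := c.e.map_source hα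
  map_target' z hz := c.e.map_target hz
  left_inv' := by
    rintro ⟨p, b⟩ hα
    have h1 : ∀ q, q = p → (⟨q, c.covec q fun i => b (c.frame p i)⟩ : BCotangent S Z) = ⟨p, b⟩ := by
      rintro q rfl
      rw [covec_frame hα]
    exact h1 _ (c.e.left_inv hα)
  right_inv' z hz := by
    have h1 := c.e.right_inv hz
    ext a
    rcases a with i | i
    · exact congrFun h1 i
    · exact covec_apply_frame (c.e.map_target hz) _ i
  open_source := BCotangent.continuous_proj.isOpen_preimage _ c.e.open_source
  open_target := c.e.open_target.preimage contDiff_comp_inl.continuous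
  continuousOn_toFun := by
    intro α hα
    refine ContinuousAt.continuousWithinAt (continuousAt_pi.2 fun a => ?_)
    rcases a with i | i
    · exact (S.continuousAt (c.smoothAt_x hα i)).comp BCotangent.continuous_proj.continuousAt
    · exact BCotangent.continuousAt_pair (isSmoothFieldAt_frame hα i)
  continuousOn_invFun := by
    -- Continuity is tested on the generating sets, where the linear function of a field `X` reads
    -- as the sum of fibre coordinates times the smooth coefficients of `X`.
    refine continuousOn_to_generateFrom_iff.2 ?_
    rintro z hz _ ⟨U, O, X, hU, hO, hX, rfl⟩ ⟨hzU, hzO⟩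
    have hz' : c.e.symm (z ∘ .inl) ∈ c.e.source := c.e.map_target hz
    have h1 : ContinuousAt (fun w : ι ⊕ ι → ℝ => c.e.symm (w ∘ Sum.inl)) z :=
      ContinuousAt.comp (g := c.e.symm) (c.e.symm.continuousAt hz)
        contDiff_comp_inl.continuous.continuousAt
    have h2 : ContinuousAt (fun w => BCotangent.pair X (c.cotangentSymm w)) z := by
      simp only [pair_cotangentSymm]
      refine tendsto_finsetSum _ fun i _ => ?_
      refine ((continuous_apply (Sum.inr i)).continuousAt).mul ?_
      have h3 := S.continuousAt (smoothAt_coord (c := c) hz' (hX _ hzU) i)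
      exact ContinuousAt.comp (f := fun w : ι ⊕ ι → ℝ => c.e.symm (w ∘ Sum.inl)) h3 h1
    refine mem_nhdsWithin_of_mem_nhds ?_
    filter_upwards [h1 (hU.mem_nhds hzU), h2 (hO.mem_nhds hzO)] with w k1 k2
    exact ⟨k1, k2⟩

variable (c) in
/-- The chart of the `b`-cotangent bundle induced by an adapted chart. -/
def cotangent : BChart (BCotangent.str S Z) (BCotangent.crit S Z) (ι ⊕ ι) where
  toChart := Chart.ofSmooth c.cotangentHomeo
    (by
      rintro α hα (i | i)
      · exact ⟨Unit, inferInstance, fun z => z (), fun _ => c.x i ∘ BCotangent.proj,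
          contDiff_apply ℝ ℝ (), fun _ => Or.inl ⟨c.x i, c.smoothAt_x hα i, rfl⟩, EventuallyEq.rfl⟩
      · exact ⟨Unit, inferInstance, fun z => z (), fun _ => BCotangent.pair fun z => c.frame z i,
          contDiff_apply ℝ ℝ (), fun _ => Or.inr ⟨_, isSmoothFieldAt_frame hα i, rfl⟩,
          EventuallyEq.rfl⟩)
    (by
      rintro α hα f ⟨κ, _, F, g, hF, hg, hfg⟩
      have hα' : α.proj ∈ c.e.source := hα
      -- A smooth function is locally a smooth function of finitely many generators, so only
      -- generators need to be checked in coordinates.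
      have hgs : ∀ k, ∀ᶠ z in 𝓝 (c.cotangentHomeo α),
          ContDiffAt ℝ ∞ (g k ∘ c.cotangentHomeo.symm) z := by
        intro k
        obtain ⟨h, hh, hk⟩ | ⟨X, hX, hk⟩ := hg k
        · rw [hk]
          exact eventually_contDiffAt_comp hα' hh rfl
        · rw [hk]
          have h1 := eventually_all.2 fun i => eventually_contDiffAt_comp (c := c)
            (z := c.cotangentHomeo α) hα' (smoothAt_coord hα' hX i) rfl
          filter_upwards [h1] with w hw
          have h2 : BCotangent.pair X ∘ c.cotangentHomeo.symm = fun z =>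
            ∑ i, z (.inr i) * c.coord _ (X (c.e.symm (z ∘ .inl))) i :=
              funext fun z => pair_cotangentSymm X z
          rw [h2]
          exact ContDiffAt.sum fun i _ => ((contDiff_apply ℝ ℝ (Sum.inr i)).contDiffAt).mul (hw i)
      have h1 : Tendsto c.cotangentHomeo.symm (𝓝 (c.cotangentHomeo α)) (𝓝 α) := by
        simpa [ContinuousAt, c.cotangentHomeo.left_inv hα] using
          c.cotangentHomeo.symm.continuousAt (c.cotangentHomeo.map_source hα)
      filter_upwards [eventually_all.2 hgs, eventually_eventually_nhds.2 (h1.eventually hfg)]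
        with w hw1 hw2
      exact (hF.contDiffAt.comp w (contDiffAt_pi.2 hw1)).congr_of_eventuallyEq hw2)
  i0 := .inl c.i0
  crit α hα := c.crit α.proj hα

theorem cotangent_x_inl (i : ι) : c.cotangent.x (.inl i) = c.x i ∘ BCotangent.proj := rfl

theorem cotangent_x_inr (i : ι) :
    c.cotangent.x (.inr i) = BCotangent.pair fun z => c.frame z i := rfl

variable {α : BCotangent S Z}

theorem isBMapAt_proj (hα : α.proj ∈ c.e.source) :
    IsBMapAt (BCotangent.str S Z) (BCotangent.crit S Z) S Z BCotangent.proj α :=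
  c.isBMapAt hα BCotangent.continuous_proj.continuousAt
    (fun i => c.cotangent.smoothAt_x (p := α) hα (.inl i)) (isDefiningAt_x0 (c := c.cotangent) hα)

theorem coord_bMap_proj (hα : α.proj ∈ c.e.source)
    (v : bTangent (BCotangent.str S Z) (BCotangent.crit S Z) α) (i : ι) :
    c.coord α.proj (bMap _ _ S Z BCotangent.proj α v) i = c.cotangent.coord α v (.inl i) := by
  by_cases hi : i = c.i0
  · subst hi
    rw [coord_i0, bLogDeriv_bMap (isBMapAt_proj hα) v (isDefiningAt_x0 hα)]
    exact (coord_i0 (c := c.cotangent) v).symm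
  · rw [coord_ne _ hi, bDeriv_bMap (isBMapAt_proj hα) v (c.smoothAt_x hα i),
      coord_ne (c := c.cotangent) v (i := .inl i) (fun h => hi (Sum.inl_injective h))]
    rfl

theorem bDeriv_cotangent_inr (v : bTangent (BCotangent.str S Z) (BCotangent.crit S Z) α) (i : ι) :
    bDeriv v (BCotangent.pair fun z => c.frame z i) = c.cotangent.coord α v (.inr i) := by
  rw [coord_ne (c := c.cotangent) v (i := .inr i) (fun h => Sum.inr_ne_inl h)]
  rfl

variable (c) in
/-- The coordinate forms `d log |x₀|, dx₁, …`. -/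
def coform (i : ι) (p : M) : Module.Dual ℝ (bTangent S Z p) := LinearMap.proj i ∘ₗ c.coord p

theorem isExactAt_coform (hp : p ∈ c.e.source) (i : ι) : IsExactAt (c.coform i) p := by
  by_cases hi : i = c.i0
  · subst hi
    exact Or.inr ⟨c.x0, isDefiningAt_x0 hp, Eventually.of_forall fun z v => coord_i0 v⟩
  · exact Or.inl ⟨c.x i, c.smoothAt_x hp i, Eventually.of_forall fun z v => coord_ne v hi⟩

theorem liouville_eq_sum (hα : α.proj ∈ c.e.source)
    (v : bTangent (BCotangent.str S Z) (BCotangent.crit S Z) α) :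
    liouville S Z α v = ∑ i, BCotangent.pair (fun z => c.frame z i) α *
      (c.coform i α.proj ∘ₗ bMap _ _ S Z BCotangent.proj α) v := by
  rw [liouville, LinearMap.comp_apply, apply_eq_sum hα]
  rfl

theorem eventually_isBMapAt_proj (hα : α.proj ∈ c.e.source) :
    ∀ᶠ β in 𝓝 α, IsBMapAt (BCotangent.str S Z) (BCotangent.crit S Z) S Z BCotangent.proj β := by
  filter_upwards [c.cotangent.e.open_source.mem_nhds hα] with β hβ
  exact isBMapAt_proj hβ

theorem smoothAt_pair_frame (hα : α.proj ∈ c.e.source) (i : ι) :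
    (BCotangent.str S Z).SmoothAt (BCotangent.pair fun z => c.frame z i) α :=
  c.cotangent.smoothAt_x (p := α) hα (.inr i)

/-- The canonical form in coordinates. -/
theorem canonicalForm_eq_sum (hα : α.proj ∈ c.e.source)
    (v w : bTangent (BCotangent.str S Z) (BCotangent.crit S Z) α) :
    canonicalForm S Z α v w = ∑ i, (c.cotangent.coord α v (.inl i) * c.cotangent.coord α w (.inr i) -
      c.cotangent.coord α v (.inr i) * c.cotangent.coord α w (.inl i)) := by
  -- Here `λ = ∑ ξᵢ κᵢ`, with `ξᵢ` the pairing with the frame and `κᵢ` the pullback of the exact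
  -- coframe of the base.
  rw [canonicalForm, bExtDeriv_eq_sum c.cotangent (p := α) hα
    (fun i => smoothAt_pair_frame hα i)
    (fun i => (isExactAt_coform (c := c) hα i).comp (eventually_isBMapAt_proj hα)
      fun f hf => hf.eventually c hα) (by
        filter_upwards [c.cotangent.e.open_source.mem_nhds hα] with β hβ v
        exact liouville_eq_sum hβ v), ← Finset.sum_neg_distrib]
  refine Finset.sum_congr rfl fun i _ => ?_
  have h1 : ∀ v, (c.coform i α.proj ∘ₗ bMap _ _ S Z BCotangent.proj α) v =
    c.cotangent.coord α v (.inl i) := fun v => coord_bMap_proj hα v i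
  rw [h1, h1, bDeriv_cotangent_inr, bDeriv_cotangent_inr]
  ring

end BChart

/-! ### Nondegeneracy and the canonical bracket in coordinates -/

section

variable {M : Type*} [TopologicalSpace M] {S : SmoothStr M} {Z : Set M}

theorem isNondegenerate_canonicalForm {ι : Type} [Fintype ι] [DecidableEq ι]
    (h : ∀ p, ∃ c : BChart S Z ι, p ∈ c.e.source) : IsNondegenerate (canonicalForm S Z) := by
  intro α
  obtain ⟨c, hc⟩ := h α.proj
  exact exists_bijective_of_darboux (c.cotangent.coordEquiv (p := α) hc) _
    fun v w => BChart.canonicalForm_eq_sum hc v w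

variable {ι : Type} [Fintype ι] [DecidableEq ι] {c : BChart S Z ι} {α : BCotangent S Z}

/-- The canonical Poisson bracket in coordinates. -/
theorem BChart.poisson_eq_sum (hσ : IsNondegenerate (canonicalForm S Z)) (hα : α.proj ∈ c.e.source)
    {F K : BCotangent S Z → ℝ} (hF : (BCotangent.str S Z).SmoothAt F α)
    (hK : (BCotangent.str S Z).SmoothAt K α) :
    poisson (canonicalForm S Z) F K α = ∑ i,
      (c.cotangent.bd (.inl i) F α * c.cotangent.bd (.inr i) K α -
        c.cotangent.bd (.inr i) F α * c.cotangent.bd (.inl i) K α) := by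
  -- From `ω = ∑ κᵢ ∧ dξᵢ`, the Hamiltonian vector of `F` has base components `∂F/∂ξᵢ` and fibre
  -- components minus the derivatives of `F` along the base directions of the frame.
  have hH : ∀ F, (BCotangent.str S Z).SmoothAt F α → IsHamiltonianAt (canonicalForm S Z) F α
      (c.cotangent.vec α (Sum.elim (fun i => c.cotangent.bd (.inr i) F α)
        fun i => -c.cotangent.bd (.inl i) F α)) := by
    intro F hF w
    rw [canonicalForm_eq_sum hα, coord_vec (c := c.cotangent) hα,
      bDeriv_eq_sum (c := c.cotangent) hα w hF, Fintype.sum_sum_type, ← Finset.sum_add_distrib]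
    refine Finset.sum_congr rfl fun i _ => ?_
    simp only [Sum.elim_inl, Sum.elim_inr]
    ring
  rw [hσ.poisson_eq (hH F hF) (hH K hK), bDeriv_eq_sum (c := c.cotangent) hα _ hF,
    coord_vec (c := c.cotangent) hα, Fintype.sum_sum_type, ← Finset.sum_add_distrib]
  refine Finset.sum_congr rfl fun i _ => ?_
  simp only [Sum.elim_inl, Sum.elim_inr]
  ring

end

section

variable {M : Type*} [TopologicalSpace M] {S : SmoothStr M} {Z : Set M} {p : M}

theorem smoothAt_comp_proj {α : BCotangent S Z} {h : M → ℝ} (hh : S.SmoothAt h α.proj) :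
    (BCotangent.str S Z).SmoothAt (h ∘ BCotangent.proj) α :=
  ⟨Unit, inferInstance, fun z => z (), fun _ => h ∘ BCotangent.proj,
    contDiff_apply ℝ ℝ (), fun _ => Or.inl ⟨h, hh, rfl⟩, EventuallyEq.rfl⟩

theorem smoothAt_pair {α : BCotangent S Z} {X : ∀ p, bTangent S Z p}
    (hX : IsSmoothFieldAt X α.proj) : (BCotangent.str S Z).SmoothAt (BCotangent.pair X) α :=
  ⟨Unit, inferInstance, fun z => z (), fun _ => BCotangent.pair X,
    contDiff_apply ℝ ℝ (), fun _ => Or.inr ⟨X, hX, rfl⟩, EventuallyEq.rfl⟩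

/-! ### Poisson brackets of nondegenerate forms -/

variable {σ : ∀ p, bTangent S Z p → bTangent S Z p → ℝ}

theorem IsNondegenerate.poisson_eq_bDeriv (hσ : IsNondegenerate σ) (F : M → ℝ) {K : M → ℝ} {p : M}
    {w : bTangent S Z p} (hw : IsHamiltonianAt σ K p w) : poisson σ F K p = bDeriv w F := by
  obtain ⟨v, hv⟩ := hσ.exists_hamiltonian F p
  exact hσ.poisson_eq hv hw

theorem IsNondegenerate.poisson_skew (hσ : IsNondegenerate σ) (F K : M → ℝ) (p : M) :
    poisson σ F K p = -poisson σ K F p := by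
  obtain ⟨v, hv⟩ := hσ.exists_hamiltonian F p
  obtain ⟨w, hw⟩ := hσ.exists_hamiltonian K p
  rw [hσ.poisson_eq hv hw, hσ.poisson_eq hw hv, ← hv, ← hw]
  obtain ⟨B, hB, h0, -⟩ := hσ p
  have h1 := h0 (v + w)
  rw [← hB, map_add] at h1
  simp only [map_add, LinearMap.add_apply, hB, h0] at h1
  linarith

theorem IsNondegenerate.poisson_congr (hσ : IsNondegenerate σ) {F F' K K' : M → ℝ} {p : M}
    (hF : F =ᶠ[𝓝 p] F') (hK : K =ᶠ[𝓝 p] K') : poisson σ F K p = poisson σ F' K' p := by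
  obtain ⟨w, hw⟩ := hσ.exists_hamiltonian K p
  have hw' : IsHamiltonianAt σ K' p w := fun u => by rw [hw u, bDeriv_congr u hK]
  rw [hσ.poisson_eq_bDeriv F hw, hσ.poisson_eq_bDeriv F' hw', bDeriv_congr w hF]

theorem IsNondegenerate.poisson_comp_left (hσ : IsNondegenerate σ) {ι : Type} [Fintype ι]
    [DecidableEq ι] {F : (ι → ℝ) → ℝ} {g : ι → M → ℝ}
    (hF : ∀ᶠ z in 𝓝 (fun i => g i p), ContDiffAt ℝ ∞ F z) (hg : ∀ i, S.SmoothAt (g i) p)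
    (K : M → ℝ) :
    poisson σ (fun y => F fun i => g i y) K p =
      ∑ i, pd F (fun i => g i p) i * poisson σ (g i) K p := by
  obtain ⟨w, hw⟩ := hσ.exists_hamiltonian K p
  simp only [hσ.poisson_eq_bDeriv _ hw]
  exact bDeriv_comp w hF hg

/-- The chain rule for Poisson brackets. -/
theorem IsNondegenerate.poisson_comp (hσ : IsNondegenerate σ) {ι : Type} [Fintype ι]
    [DecidableEq ι] {F K : (ι → ℝ) → ℝ} {g : ι → M → ℝ}
    (hF : ∀ᶠ z in 𝓝 (fun i => g i p), ContDiffAt ℝ ∞ F z)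
    (hK : ∀ᶠ z in 𝓝 (fun i => g i p), ContDiffAt ℝ ∞ K z) (hg : ∀ i, S.SmoothAt (g i) p) :
    poisson σ (fun y => F fun i => g i y) (fun y => K fun i => g i y) p =
      ∑ i, ∑ j, pd F (fun i => g i p) i * pd K (fun i => g i p) j * poisson σ (g i) (g j) p := by
  rw [hσ.poisson_comp_left hF hg]
  refine Finset.sum_congr rfl fun i _ => ?_
  rw [hσ.poisson_skew, hσ.poisson_comp_left hK hg, ← Finset.sum_neg_distrib, Finset.mul_sum]
  refine Finset.sum_congr rfl fun j _ => ?_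
  rw [hσ.poisson_skew (g j) (g i)]
  ring

end

/-- The Jacobi identity for a constant bivector in Darboux form, in terms of the first and second
derivatives of the functions. -/
theorem jacobi_of_symmetric {ι : Type} [Fintype ι] (s : ι ⊕ ι → ℝ) (hs : ∀ a, s a.swap = -s a)
    (F K L : ι ⊕ ι → ℝ) (F' K' L' : ι ⊕ ι → ι ⊕ ι → ℝ) (hF : ∀ a b, F' a b = F' b a)
    (hK : ∀ a b, K' a b = K' b a) (hL : ∀ a b, L' a b = L' b a) :
    (∑ a : ι ⊕ ι, s a * F a * ∑ b : ι ⊕ ι, s b * (K' a.swap b * L b.swap + K b * L' a.swap b.swap)) +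
    (∑ a : ι ⊕ ι, s a * K a * ∑ b : ι ⊕ ι, s b * (L' a.swap b * F b.swap + L b * F' a.swap b.swap)) +
    (∑ a : ι ⊕ ι, s a * L a * ∑ b : ι ⊕ ι, s b * (F' a.swap b * K b.swap + F b * K' a.swap b.swap)) = 0 := by
  have hsw : ∀ f : ι ⊕ ι → ℝ, ∑ a, f a = ∑ a : ι ⊕ ι, f a.swap := fun f =>
    ((Equiv.sumComm ι ι).sum_comp f).symm
  -- This sum collects the terms with the second derivatives of the middle function; the three
  -- double brackets produce six sums of this kind, with alternating signs.
  let t : (ι ⊕ ι → ℝ) → (ι ⊕ ι → ι ⊕ ι → ℝ) → (ι ⊕ ι → ℝ) → ℝ := fun F K' L =>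
    ∑ a : ι ⊕ ι, ∑ b : ι ⊕ ι, s a * s b * F a * K' a.swap b * L b.swap
  have h1 : ∀ F K L : ι ⊕ ι → ℝ, ∀ K' L' : ι ⊕ ι → ι ⊕ ι → ℝ,
      (∑ a : ι ⊕ ι, s a * F a * ∑ b : ι ⊕ ι, s b * (K' a.swap b * L b.swap + K b * L' a.swap b.swap)) =
      t F K' L - t F L' K := by
    intro F K L K' L'
    simp only [t, ← Finset.sum_sub_distrib]
    refine Finset.sum_congr rfl fun a _ => ?_
    have h2 : ∑ b : ι ⊕ ι, s b * (K b * L' a.swap b.swap) = -∑ b : ι ⊕ ι, s b * (K b.swap * L' a.swap b) := by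
      rw [hsw, ← Finset.sum_neg_distrib]
      refine Finset.sum_congr rfl fun b _ => ?_
      rw [hs, Sum.swap_swap]
      ring
    simp only [mul_add, Finset.sum_add_distrib] at h2 ⊢
    rw [h2, Finset.sum_sub_distrib, Finset.mul_sum, mul_neg, Finset.mul_sum, ← sub_eq_add_neg]
    congr 1 <;> exact Finset.sum_congr rfl fun b _ => by ring
  -- Exchanging the summation indices and swapping conjugate indices changes two signs, and the
  -- second derivatives are symmetric. Hence the six sums cancel in pairs.
  have h3 : ∀ F L : ι ⊕ ι → ℝ, ∀ K' : ι ⊕ ι → ι ⊕ ι → ℝ, (∀ a b, K' a b = K' b a) →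
      t F K' L = t L K' F := by
    intro F L K' hK
    simp only [t]
    rw [Finset.sum_comm, hsw]
    refine Finset.sum_congr rfl fun a _ => ?_
    rw [hsw]
    refine Finset.sum_congr rfl fun b _ => ?_
    rw [hs, hs, Sum.swap_swap, Sum.swap_swap, hK]
    ring
  rw [h1, h1, h1, h3 F L K' hK, h3 K F L' hL, h3 L K F' hF]
  ring

/-! ### Jacobi identity and brackets of fibrewise linear functions -/

namespace BChart

variable {M : Type*} [TopologicalSpace M] {S : SmoothStr M} {Z : Set M} {ι : Type} [Fintype ι]
  [DecidableEq ι] {c : BChart S Z ι} {α : BCotangent S Z}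

/-- The signs of the canonical bracket in coordinates. -/
def sgn : ι ⊕ ι → ℝ := Sum.elim 1 (-1)

theorem poisson_eq_sgn (hσ : IsNondegenerate (canonicalForm S Z)) (hα : α.proj ∈ c.e.source)
    {F K : BCotangent S Z → ℝ} (hF : (BCotangent.str S Z).SmoothAt F α)
    (hK : (BCotangent.str S Z).SmoothAt K α) :
    poisson (canonicalForm S Z) F K α = ∑ a : ι ⊕ ι, sgn a * (c.cotangent.bd a F α *
      c.cotangent.bd a.swap K α) := by
  rw [poisson_eq_sum hσ hα hF hK, Fintype.sum_sum_type, ← Finset.sum_add_distrib]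
  refine Finset.sum_congr rfl fun i _ => ?_
  simp [sgn]
  ring

theorem eventually_poisson_eq_sgn (hσ : IsNondegenerate (canonicalForm S Z))
    (hα : α.proj ∈ c.e.source) {F K : BCotangent S Z → ℝ}
    (hF : (BCotangent.str S Z).SmoothAt F α) (hK : (BCotangent.str S Z).SmoothAt K α) :
    poisson (canonicalForm S Z) F K =ᶠ[𝓝 α] fun β => ∑ a : ι ⊕ ι, sgn a * (c.cotangent.bd a F β *
      c.cotangent.bd a.swap K β) := by
  filter_upwards [(BCotangent.str S Z).eventually hF, (BCotangent.str S Z).eventually hK,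
    c.cotangent.e.open_source.mem_nhds hα] with β h1 h2 h3
  exact poisson_eq_sgn hσ h3 h1 h2

theorem smoothAt_poisson (hσ : IsNondegenerate (canonicalForm S Z)) (hα : α.proj ∈ c.e.source)
    {F K : BCotangent S Z → ℝ} (hF : (BCotangent.str S Z).SmoothAt F α)
    (hK : (BCotangent.str S Z).SmoothAt K α) :
    (BCotangent.str S Z).SmoothAt (poisson (canonicalForm S Z) F K) α :=
  (BCotangent.str S Z).congr (SmoothStr.SmoothAt.sum fun a _ => SmoothStr.SmoothAt.const_mul _
    ((smoothAt_bd (c := c.cotangent) hα hF a).mul (smoothAt_bd (c := c.cotangent) hα hK a.swap)))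
    (eventually_poisson_eq_sgn hσ hα hF hK).symm

/-- In the commuting frame of the cotangent chart the bracket has constant coefficients, so a double
bracket contains only first and second frame derivatives and `jacobi_of_symmetric` applies. -/
theorem jacobi_canonicalForm (hσ : IsNondegenerate (canonicalForm S Z)) (hα : α.proj ∈ c.e.source)
    {F K L : BCotangent S Z → ℝ} (hF : (BCotangent.str S Z).SmoothAt F α)
    (hK : (BCotangent.str S Z).SmoothAt K α) (hL : (BCotangent.str S Z).SmoothAt L α) :
    poisson (canonicalForm S Z) F (poisson (canonicalForm S Z) K L) α +
    poisson (canonicalForm S Z) K (poisson (canonicalForm S Z) L F) α +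
    poisson (canonicalForm S Z) L (poisson (canonicalForm S Z) F K) α = 0 := by
  have hα' : α ∈ c.cotangent.e.source := hα
  have key : ∀ {F K L : BCotangent S Z → ℝ}, (BCotangent.str S Z).SmoothAt F α →
      (BCotangent.str S Z).SmoothAt K α → (BCotangent.str S Z).SmoothAt L α →
      poisson (canonicalForm S Z) F (poisson (canonicalForm S Z) K L) α =
      ∑ a : ι ⊕ ι, sgn a * c.cotangent.bd a F α * ∑ b : ι ⊕ ι, sgn b *
        (c.cotangent.bd a.swap (c.cotangent.bd b K) α * c.cotangent.bd b.swap L α +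
          c.cotangent.bd b K α * c.cotangent.bd a.swap (c.cotangent.bd b.swap L) α) := by
    intro F K L hF hK hL
    rw [poisson_eq_sgn hσ hα hF (smoothAt_poisson hσ hα hK hL)]
    refine Finset.sum_congr rfl fun a _ => ?_
    have hs : ∀ b, (BCotangent.str S Z).SmoothAt (fun β => c.cotangent.bd b K β *
      c.cotangent.bd b.swap L β) α := fun b =>
        (smoothAt_bd hα' hK b).mul (smoothAt_bd hα' hL b.swap)
    rw [bd_congr hα' (eventually_poisson_eq_sgn hσ hα hK hL), mul_assoc,
      ← bDeriv_frame hα' (SmoothStr.SmoothAt.sum fun b _ => (hs b).const_mul _),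
      bDeriv_sum _ fun b _ => (hs b).const_mul _]
    congr 2
    refine Finset.sum_congr rfl fun b _ => ?_
    rw [bDeriv_const_mul _ _ (hs b), bDeriv_frame hα' (hs b),
      bd_mul hα' (smoothAt_bd hα' hK b) (smoothAt_bd hα' hL b.swap)]
    ring
  rw [key hF hK hL, key hK hL hF, key hL hF hK]
  refine jacobi_of_symmetric sgn ?_ (fun a => c.cotangent.bd a F α)
    (fun a => c.cotangent.bd a K α) (fun a => c.cotangent.bd a L α)
    (fun a b => c.cotangent.bd a (c.cotangent.bd b F) α)
    (fun a b => c.cotangent.bd a (c.cotangent.bd b K) α)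
    (fun a b => c.cotangent.bd a (c.cotangent.bd b L) α)
    (fun a b => bd_comm hα' hF a b) (fun a b => bd_comm hα' hK a b) (fun a b => bd_comm hα' hL a b)
  rintro (i | i) <;> simp [sgn]

theorem bd_comp_proj (hα : α.proj ∈ c.e.source) {h : M → ℝ} (hh : S.SmoothAt h α.proj)
    (a : ι ⊕ ι) : c.cotangent.bd a (h ∘ BCotangent.proj) α =
      Sum.elim (fun i => c.bd i h α.proj) 0 a := by
  have hα' : α ∈ c.cotangent.e.source := hα
  rw [← bDeriv_frame hα' (smoothAt_comp_proj hh), ← bDeriv_bMap (isBMapAt_proj hα) _ hh,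
    bDeriv_eq_sum hα _ hh]
  simp only [coord_bMap_proj hα, coord_frame hα']
  rcases a with i | i <;> simp

theorem bd_pair_frame (hα : α.proj ∈ c.e.source) (i : ι) (a : ι ⊕ ι) :
    c.cotangent.bd a (BCotangent.pair fun z => c.frame z i) α = if a = .inr i then 1 else 0 := by
  have hα' : α ∈ c.cotangent.e.source := hα
  rw [← bDeriv_frame hα' (smoothAt_pair_frame hα i), bDeriv_cotangent_inr, coord_frame hα']
  simp [eq_comm]

theorem pair_eq_sum (hα : α.proj ∈ c.e.source) (X : ∀ p, bTangent S Z p) :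
    BCotangent.pair X α = ∑ j, BCotangent.pair (fun z => c.frame z j) α *
      c.coord α.proj (X α.proj) j := apply_eq_sum hα _ _

theorem bd_pair (hα : α.proj ∈ c.e.source) {X : ∀ p, bTangent S Z p}
    (hX : IsSmoothFieldAt X α.proj) (a : ι ⊕ ι) :
    c.cotangent.bd a (BCotangent.pair X) α =
      Sum.elim (fun i => ∑ j, α.cov (c.frame α.proj j) *
        c.bd i (fun z => c.coord z (X z) j) α.proj) (fun i => c.coord α.proj (X α.proj) i) a := by
  have hα' : α ∈ c.cotangent.e.source := hα
  have h1 : BCotangent.pair X =ᶠ[𝓝 α] fun β => ∑ j, BCotangent.pair (fun z => c.frame z j) β *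
      ((fun z => c.coord z (X z) j) ∘ BCotangent.proj) β := by
    filter_upwards [c.cotangent.e.open_source.mem_nhds hα'] with β hβ
    exact pair_eq_sum hβ X
  have hs1 : ∀ j, (BCotangent.str S Z).SmoothAt ((fun z => c.coord z (X z) j) ∘ BCotangent.proj) α :=
    fun j => smoothAt_comp_proj (smoothAt_coord hα hX j)
  have hs2 := fun j => (smoothAt_pair_frame hα j).mul (hs1 j)
  rw [bd_congr hα' h1, ← bDeriv_frame hα' (SmoothStr.SmoothAt.sum fun j _ => hs2 j),
    bDeriv_sum _ fun j _ => hs2 j]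
  have h2 : ∀ j, bDeriv (c.cotangent.frame α a) (fun β => BCotangent.pair (fun z => c.frame z j) β *
      ((fun z => c.coord z (X z) j) ∘ BCotangent.proj) β) = α.cov (c.frame α.proj j) *
        Sum.elim (fun i => c.bd i (fun z => c.coord z (X z) j) α.proj) 0 a +
        c.coord α.proj (X α.proj) j * if a = .inr j then 1 else 0 := by
    intro j
    rw [bDeriv_frame hα' (hs2 j), bd_mul hα' (smoothAt_pair_frame hα j) (hs1 j), bd_pair_frame hα,
      bd_comp_proj hα (smoothAt_coord hα hX j)]
    rfl
  simp only [h2]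
  rcases a with i | i <;> simp

/-- The bracket of two fibrewise linear functions. -/
theorem poisson_pair_pair (hσ : IsNondegenerate (canonicalForm S Z)) (hα : α.proj ∈ c.e.source)
    {X Y : ∀ p, bTangent S Z p} (hX : IsSmoothFieldAt X α.proj) (hY : IsSmoothFieldAt Y α.proj)
    {b : bTangent S Z α.proj} (hb : ∀ j, c.coord α.proj b j =
      bDeriv (X α.proj) (fun z => c.coord z (Y z) j) -
        bDeriv (Y α.proj) (fun z => c.coord z (X z) j)) :
    poisson (canonicalForm S Z) (BCotangent.pair X) (BCotangent.pair Y) α = -α.cov b := by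
  rw [poisson_eq_sum hσ hα (smoothAt_pair hX) (smoothAt_pair hY), apply_eq_sum hα]
  simp only [bd_pair hα hX, bd_pair hα hY, Sum.elim_inl, Sum.elim_inr, hb,
    bDeriv_eq_sum hα _ (smoothAt_coord hα hX _), bDeriv_eq_sum hα _ (smoothAt_coord hα hY _),
    mul_sub, Finset.sum_sub_distrib, Finset.sum_mul, Finset.mul_sum, neg_sub]
  congr 1
  · rw [Finset.sum_comm]
    exact Finset.sum_congr rfl fun i _ => Finset.sum_congr rfl fun j _ => by ring
  · rw [Finset.sum_comm]
    exact Finset.sum_congr rfl fun i _ => Finset.sum_congr rfl fun j _ => by ring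

theorem poisson_pair_comp_proj (hσ : IsNondegenerate (canonicalForm S Z))
    (hα : α.proj ∈ c.e.source) {X : ∀ p, bTangent S Z p} (hX : IsSmoothFieldAt X α.proj)
    {h : M → ℝ} (hh : S.SmoothAt h α.proj) :
    poisson (canonicalForm S Z) (BCotangent.pair X) (h ∘ BCotangent.proj) α =
      -bDeriv (X α.proj) h := by
  rw [poisson_eq_sum hσ hα (smoothAt_pair hX) (smoothAt_comp_proj hh), bDeriv_eq_sum hα _ hh,
    ← Finset.sum_neg_distrib]
  refine Finset.sum_congr rfl fun i _ => ?_
  rw [bd_pair hα hX, bd_pair hα hX, bd_comp_proj hα hh, bd_comp_proj hα hh]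
  simp

end BChart

/-! ### Adapting a chart to a function -/

namespace Chart

variable {X : Type*} [TopologicalSpace X] {S : SmoothStr X} {ι : Type} [Fintype ι]

/-- The composition of a chart with a diffeomorphism between open sets of coordinate spaces. -/
def trans {κ : Type} [Fintype κ] (c : Chart S ι) (Θ : OpenPartialHomeomorph (ι → ℝ) (κ → ℝ))
    (h1 : ∀ z ∈ Θ.source, ContDiffAt ℝ ∞ Θ z) (h2 : ∀ z ∈ Θ.target, ContDiffAt ℝ ∞ Θ.symm z) :
    Chart S κ where
  e := c.e.trans Θ
  smooth_iff y hy f := by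
    rw [OpenPartialHomeomorph.trans_source] at hy
    rw [c.smooth_iff y hy.1]
    have hy2 : c.e y ∈ Θ.source := hy.2
    have e1 : Tendsto Θ (𝓝 (c.e y)) (𝓝 (Θ (c.e y))) := Θ.continuousAt hy2
    have e2 : Tendsto Θ.symm (𝓝 (Θ (c.e y))) (𝓝 (c.e y)) := by
      simpa [ContinuousAt, Θ.left_inv hy2] using Θ.symm.continuousAt (Θ.map_source hy2)
    constructor
    · intro h
      filter_upwards [e2.eventually h, Θ.open_target.mem_nhds (Θ.map_source hy2)] with z hz hz'
      exact hz.comp z (h2 z hz')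
    · intro h
      filter_upwards [e1.eventually h, Θ.open_source.mem_nhds hy2] with z hz hz'
      refine (hz.comp z (h1 z hz')).congr_of_eventuallyEq ?_
      filter_upwards [Θ.open_source.mem_nhds hz'] with w hw
      simp [Θ.left_inv hw]

variable [DecidableEq ι]

/-- A smooth function with nonzero differential is the first coordinate of an adapted chart. -/
theorem exists_bChart (c : Chart S ι) {p : X} (hp : p ∈ c.e.source) {f : X → ℝ}
    (hf : S.SmoothAt f p) (i : ι) (hd : c.d i f p ≠ 0) {Z : Set X}
    (hZ : ∀ᶠ y in 𝓝 p, y ∈ Z ↔ f y = 0) :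
    ∃ b : BChart S Z ι, p ∈ b.e.source ∧ b.i0 = i ∧ ∀ y ∈ b.e.source, b.x0 y = f y := by
  obtain ⟨Θ, hΘp, hΘ, hΘ1, hΘ2⟩ := exists_straightening (f ∘ c.e.symm) i
    ((c.smooth_iff p hp f).1 hf) hd
  obtain ⟨U, hU, hUo, hpU⟩ := eventually_nhds_iff.1 hZ
  have h0 : ∀ y ∈ ((c.trans Θ hΘ1 hΘ2).restr hUo).e.source, Θ (c.e y) i = f y := by
    intro y hy
    rw [hΘ, Function.update_self, Function.comp_apply, c.e.left_inv hy.1.1]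
  refine ⟨⟨(c.trans Θ hΘ1 hΘ2).restr hUo, i, fun y hy => ?_⟩, ⟨⟨hp, hΘp⟩, hpU⟩, rfl, h0⟩
  rw [hU y hy.2, ← h0 y hy]
  rfl

/-- If all partial derivatives vanished, the chain rule would contradict `f (γ s) = s`, whose
derivative is `1`. -/
theorem exists_d_ne_zero_of_curve (c : Chart S ι) {γ : ℝ → X} {r : ℝ} (hp : γ r ∈ c.e.source)
    {f : X → ℝ} (hf : S.SmoothAt f (γ r)) (hγ : ContinuousAt γ r)
    (hγ' : ∀ i, DifferentiableAt ℝ (c.x i ∘ γ) r) (hd : ∀ᶠ s in 𝓝 r, f (γ s) = s) :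
    ∃ i, c.d i f (γ r) ≠ 0 := by
  by_contra! h
  have h1 : fderiv ℝ (f ∘ c.e.symm) (c.e (γ r)) = 0 := by
    ext v
    rw [fderiv_eq_sum_pd]
    exact Finset.sum_eq_zero fun i _ => by
      rw [show pd (f ∘ c.e.symm) (c.e (γ r)) i = 0 from h i, mul_zero]
  have h2 : HasFDerivAt (f ∘ c.e.symm) (0 : (ι → ℝ) →L[ℝ] ℝ) (c.e (γ r)) := by
    rw [← h1]; exact (differentiableAt hp hf).hasFDerivAt
  have h3 : DifferentiableAt ℝ (fun s => c.e (γ s)) r := differentiableAt_pi.2 hγ'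
  have h4 := h2.comp_hasDerivAt r h3.hasDerivAt
  have h5 : (f ∘ c.e.symm) ∘ (fun s => c.e (γ s)) =ᶠ[𝓝 r] id := by
    filter_upwards [hd, hγ (c.e.open_source.mem_nhds hp)] with s h6 h7
    have h8 : c.e.symm (c.e (γ s)) = γ s := c.e.left_inv h7
    simp [h8, h6]
  have h6 := (h4.congr_of_eventuallyEq h5.symm).unique (hasDerivAt_id r)
  simp at h6

end Chart

/-! ### Charts of manifolds -/

section Manifold

variable {E : Type*} [NormedAddCommGroup E] [NormedSpace ℝ E] [FiniteDimensional ℝ E]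
  {M : Type*} [TopologicalSpace M] [ChartedSpace E M] [IsManifold 𝓘(ℝ, E) ∞ M]

variable (E) in
/-- The chart at a point of a manifold, in linear coordinates of the model space. -/
def manifoldChart (p : M) : Chart (SmoothStr.ofManifold E M) (Fin (Module.finrank ℝ E)) where
  e := (chartAt E p).transHomeomorph (Module.finBasis ℝ E).equivFunL.toHomeomorph
  smooth_iff y hy f := by
    set L := (Module.finBasis ℝ E).equivFunL
    set φ := (chartAt E p).transHomeomorph L.toHomeomorph
    have hy' : y ∈ φ.source := hy
    have e1 : Tendsto φ (𝓝 y) (𝓝 (φ y)) := φ.continuousAt hy'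
    have e2 : Tendsto φ.symm (𝓝 (φ y)) (𝓝 y) := by
      simpa [ContinuousAt, φ.left_inv hy'] using φ.symm.continuousAt (φ.map_source hy')
    constructor
    · intro h
      filter_upwards [e2.eventually h, φ.open_target.mem_nhds (φ.map_source hy')] with z hz hz'
      rw [← contMDiffAt_iff_contDiffAt]
      refine ContMDiffAt.comp z hz ?_
      have h1 : ContMDiffAt 𝓘(ℝ, E) 𝓘(ℝ, E) ∞ (chartAt E p).symm (L.symm z) :=
        contMDiffAt_symm_of_mem_maximalAtlas (IsManifold.chart_mem_maximalAtlas p) hz'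
      exact h1.comp z (L.symm.contDiff.contMDiff).contMDiffAt
    · intro h
      filter_upwards [e1.eventually h, φ.open_source.mem_nhds hy'] with z hz hz'
      rw [← contMDiffAt_iff_contDiffAt] at hz
      have h1 : ContMDiffAt 𝓘(ℝ, E) 𝓘(ℝ, E) ∞ (chartAt E p) z :=
        contMDiffAt_of_mem_maximalAtlas (IsManifold.chart_mem_maximalAtlas p) hz'
      have h2 : ContMDiffAt 𝓘(ℝ, E) 𝓘(ℝ, Fin (Module.finrank ℝ E) → ℝ) ∞ φ z :=
        ((L.contDiff.contMDiff).contMDiffAt).comp z h1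
      refine (hz.comp z h2).congr_of_eventuallyEq ?_
      filter_upwards [φ.open_source.mem_nhds hz'] with w hw
      simp only [Function.comp_apply, φ.left_inv hw]

theorem mem_manifoldChart_source (p : M) : p ∈ (manifoldChart E p).e.source :=
  mem_chart_source E p

theorem contMDiffAt_manifoldChart_symm {p : M} {z : Fin (Module.finrank ℝ E) → ℝ}
    (hz : z ∈ (manifoldChart E p).e.target) :
    ContMDiffAt 𝓘(ℝ, Fin (Module.finrank ℝ E) → ℝ) 𝓘(ℝ, E) ∞ (manifoldChart E p).e.symm z := by
  have h1 : ContMDiffAt 𝓘(ℝ, E) 𝓘(ℝ, E) ∞ (chartAt E p).symm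
      ((Module.finBasis ℝ E).equivFunL.symm z) := contMDiffAt_symm_of_mem_maximalAtlas (IsManifold.chart_mem_maximalAtlas p) hz
  exact h1.comp z ((Module.finBasis ℝ E).equivFunL.symm.contDiff.contMDiff).contMDiffAt

end Manifold

/-! ### Topology of the coset space -/

section Coset

variable {G : Type*} [Group G] {H : Subgroup G}

theorem toCoset_eq_iff {g g' : G} : toCoset H g = toCoset H g' ↔ g' * g⁻¹ ∈ H := by
  rw [toCoset, toCoset, Quotient.eq, QuotientGroup.rightRel_apply]

theorem toCoset_mul_left {h : G} (hh : h ∈ H) (g : G) : toCoset H (h * g) = toCoset H g := by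
  rw [toCoset_eq_iff, mul_inv_rev, mul_inv_cancel_left]
  exact H.inv_mem hh

variable [TopologicalSpace G]

theorem continuous_toCoset : Continuous (toCoset H) := continuous_quotient_mk'

variable [IsTopologicalGroup G]

theorem isOpenQuotientMap_toCoset : IsOpenQuotientMap (toCoset H) where
  surjective := Quotient.mk_surjective
  continuous := continuous_toCoset
  isOpenMap U hU := by
    rw [← (isQuotientMap_quotient_mk' (s := QuotientGroup.rightRel H)).isOpen_preimage]
    -- The saturation of an open set is the union of its left translates by `H`.
    have h1 : (toCoset H) ⁻¹' (toCoset H '' U) = ⋃ h : H, (fun x => (h : G) * x) ⁻¹' U := by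
      ext g
      simp only [mem_preimage, mem_image, mem_iUnion]
      constructor
      · rintro ⟨u, hu, hug⟩
        have := H.inv_mem (toCoset_eq_iff.1 hug)
        exact ⟨⟨u * g⁻¹, by simpa using this⟩, by simpa using hu⟩
      · rintro ⟨h, hh⟩
        exact ⟨_, hh, toCoset_mul_left h.2 g⟩
    exact h1 ▸ isOpen_iUnion fun h => hU.preimage (continuous_const_mul (h : G))

/-- The quotient map is open, so it is enough that the equivalence relation is closed; it is the
preimage of the closed set `H` under `(g, g') ↦ g' g⁻¹`. -/
theorem t2Space_cosetSpace (hH : IsClosed (H : Set G)) : T2Space (CosetSpace H) := by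
  rw [t2Space_iff_of_isOpenQuotientMap isOpenQuotientMap_toCoset]
  have h1 : {q : G × G | toCoset H q.1 = toCoset H q.2} = (fun q : G × G => q.2 * q.1⁻¹) ⁻¹' H := by
    ext q
    exact toCoset_eq_iff
  rw [h1]
  exact hH.preimage (by fun_prop)

end Coset

/-! ### Local sections of `G → G/H` -/

section Lie

variable {E : Type*} [NormedAddCommGroup E] [NormedSpace ℝ E]
  {G : Type*} [TopologicalSpace G] [ChartedSpace E G]

theorem smoothAt_comp_of_contMDiff {f : G → ℝ} {m : G → G} {g : G}
    (hf : (SmoothStr.ofManifold E G).SmoothAt f (m g)) (hm : ContMDiff 𝓘(ℝ, E) 𝓘(ℝ, E) ∞ m) :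
    (SmoothStr.ofManifold E G).SmoothAt (fun z => f (m z)) g := by
  filter_upwards [hm.continuous.continuousAt.eventually hf] with z hz
  exact hz.comp z hm.contMDiffAt

variable [Group G] [LieGroup 𝓘(ℝ, E) ∞ G] {H : Subgroup G}

variable (E H) in
/-- A local trivialization of `G → G/H`, given by a coordinate `t` of `G/H` on `V` and a smooth
section `c` in this coordinate. -/
structure Slice where
  V : Set (CosetSpace H)
  J : Set ℝ
  t : CosetSpace H → ℝ
  c : ℝ → G
  isOpen_V : IsOpen V
  isOpen_J : IsOpen J
  t_mem : ∀ y ∈ V, t y ∈ J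
  c_mem : ∀ r ∈ J, toCoset H (c r) ∈ V
  t_c : ∀ r ∈ J, t (toCoset H (c r)) = r
  c_t : ∀ y ∈ V, toCoset H (c (t y)) = y
  smooth_c : ∀ r ∈ J, ContMDiffAt 𝓘(ℝ, ℝ) 𝓘(ℝ, E) ∞ c r
  smooth_t : ∀ g, toCoset H g ∈ V →
    (SmoothStr.ofManifold E G).SmoothAt (fun z => t (toCoset H z)) g
  crit : ∀ y ∈ V, y ∈ critPt H ↔ t y = 0

/-- Translation of a local trivialization, off the critical point. -/
def Slice.translate (s : Slice E H) (hH : IsClosed (H : Set G)) (hs : ∀ r ∈ s.J, r + 1 ≠ 0) (a : G) :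
    Slice E H :=
  let ρ : CosetSpace H → CosetSpace H := Quotient.map' (fun g => g * a⁻¹) (by
    intro g g' h
    rw [QuotientGroup.rightRel_apply] at h ⊢
    simpa [mul_assoc] using h)
  have hρ : ∀ g, ρ (toCoset H g) = toCoset H (g * a⁻¹) := fun g => rfl
  have hρc : Continuous ρ := continuous_quot_lift _ (continuous_toCoset.comp
    (contMDiff_mul_right (I := 𝓘(ℝ, E)) (n := ∞) (a := a⁻¹)).continuous)
  have hρa : ∀ g, ρ (toCoset H (g * a)) = toCoset H g := fun g => by rw [hρ, mul_inv_cancel_right]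
  have hcrit : IsClosed (critPt H) := by
    have : IsTopologicalGroup G := topologicalGroup_of_lieGroup 𝓘(ℝ, E) ∞
    have := t2Space_cosetSpace hH
    exact isClosed_singleton
  have hc : ∀ r, r - 1 ∈ s.J → ContMDiffAt 𝓘(ℝ, ℝ) 𝓘(ℝ, E) ∞ (fun r => s.c (r - 1) * a) r :=
    fun r hr => by
      have h1 : ContMDiffAt 𝓘(ℝ, ℝ) 𝓘(ℝ, E) ∞ (fun r : ℝ => s.c (r - 1)) r :=
        (s.smooth_c _ hr).comp r ((contDiff_id.sub contDiff_const).contMDiff).contMDiffAt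
      exact h1.mul contMDiffAt_const
  -- The slice is moved by right multiplication with `a`. The critical point is removed and the
  -- coordinate is shifted by `1`, hence nonzero by `hs`, so that both sides of `crit` are false on
  -- the new domain.
  { V := ρ ⁻¹' s.V ∩ (critPt H)ᶜ
    J := {r | r - 1 ∈ s.J ∧ toCoset H (s.c (r - 1) * a) ∉ critPt H}
    t := fun y => s.t (ρ y) + 1
    c := fun r => s.c (r - 1) * a
    isOpen_V := (s.isOpen_V.preimage hρc).inter hcrit.isOpen_compl
    isOpen_J := by
      rw [isOpen_iff_mem_nhds]
      rintro r ⟨hr, hr'⟩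
      filter_upwards [(s.isOpen_J.preimage (continuous_sub_right 1)).mem_nhds hr,
        (continuous_toCoset.continuousAt.comp (hc r hr).continuousAt)
          (hcrit.isOpen_compl.mem_nhds hr')] with u h1 h2
      exact ⟨h1, h2⟩
    t_mem := by
      rintro y ⟨hy, hy'⟩
      obtain ⟨g, rfl⟩ := Quotient.mk_surjective y
      refine ⟨by simpa using s.t_mem _ hy, ?_⟩
      have h1 : toCoset H (s.c (s.t (toCoset H (g * a⁻¹)))) = toCoset H (g * a⁻¹) := s.c_t _ hy
      have h2 : toCoset H (s.c (s.t (toCoset H (g * a⁻¹)) + 1 - 1) * a) = toCoset H g := by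
        rw [add_sub_cancel_right]
        rw [toCoset_eq_iff] at h1 ⊢
        simpa [mul_assoc] using h1
      exact fun h3 => hy' (show toCoset H g ∈ critPt H from h2 ▸ h3)
    c_mem := by
      rintro r ⟨hr, hr'⟩
      refine ⟨?_, hr'⟩
      rw [mem_preimage, hρa]
      exact s.c_mem _ hr
    t_c := by
      rintro r ⟨hr, -⟩
      simp only [hρa]
      rw [s.t_c _ hr, sub_add_cancel]
    c_t := by
      rintro y ⟨hy, -⟩
      obtain ⟨g, rfl⟩ := Quotient.mk_surjective y
      have h1 : toCoset H (s.c (s.t (toCoset H (g * a⁻¹)))) = toCoset H (g * a⁻¹) := s.c_t _ hy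
      rw [add_sub_cancel_right]
      change toCoset H (s.c (s.t (toCoset H (g * a⁻¹))) * a) = toCoset H g
      rw [toCoset_eq_iff] at h1 ⊢
      simpa [mul_assoc] using h1
    smooth_c := fun r hr => hc r hr.1
    smooth_t := by
      rintro g ⟨hg, -⟩
      exact (smoothAt_comp_of_contMDiff (m := fun g => g * a⁻¹) (s.smooth_t (g * a⁻¹) hg)
        contMDiff_mul_right).add (SmoothStr.smoothAt_const 1)
    crit := by
      rintro y ⟨hy, hy'⟩
      exact iff_of_false hy' (hs _ (s.t_mem _ hy)) }

section

variable [FiniteDimensional ℝ E]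

/-- A smooth curve through the identity which is transverse to `H`, with the function which
measures the position of the cosets along it. -/
theorem exists_transversal (hH : IsHypersurface (SmoothStr.ofManifold E G) (H : Set G)) :
    ∃ (γ : ℝ → G) (τ : G → ℝ) (U : Set G) (ε : ℝ), 0 < ε ∧ IsOpen U ∧ 1 ∈ U ∧ γ 0 = 1 ∧
      (∀ t, |t| < ε → ContMDiffAt 𝓘(ℝ, ℝ) 𝓘(ℝ, E) ∞ γ t) ∧
      (∀ g ∈ U, (SmoothStr.ofManifold E G).SmoothAt τ g) ∧
      ∀ g ∈ U, ∀ t, |t| < ε → (g * γ t ∈ H ↔ t = τ g) := by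
  obtain ⟨f, hf, hz, hd⟩ := hH 1 H.one_mem
  obtain ⟨D, hD, hD0⟩ := hd H.one_mem
  set x := manifoldChart E (1 : G) with hx
  have h1x : (1 : G) ∈ x.e.source := mem_manifoldChart_source 1
  obtain ⟨i, hi⟩ : ∃ i, x.d i f 1 ≠ 0 := by
    by_contra! h
    rw [← derivAt_of D hf, Chart.derivAt_eq_sum h1x hD hf] at hD0
    exact hD0 (Finset.sum_eq_zero fun i _ => by rw [h i, zero_mul])
  -- The curve is a coordinate line in a direction along which the defining function has nonzero
  -- derivative.
  set γ : ℝ → G := fun t => x.e.symm (x.e 1 + t • Pi.single i 1) with hγ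
  have hγ0 : γ 0 = 1 := by simp [hγ, x.e.left_inv h1x]
  have hline : ContDiff ℝ ∞ fun t : ℝ => x.e 1 + t • (Pi.single i 1 : Fin _ → ℝ) :=
    contDiff_const.add (contDiff_id.smul contDiff_const)
  have hlt : ∀ᶠ t in 𝓝 (0 : ℝ), x.e 1 + t • (Pi.single i 1 : Fin _ → ℝ) ∈ x.e.target :=
    hline.continuous.continuousAt.eventually (x.e.open_target.mem_nhds
      (by simpa using x.e.map_source h1x))
  have hγs : ∀ᶠ t in 𝓝 (0 : ℝ), ContMDiffAt 𝓘(ℝ, ℝ) 𝓘(ℝ, E) ∞ γ t := by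
    filter_upwards [hlt] with t ht
    exact (contMDiffAt_manifoldChart_symm ht).comp t hline.contMDiff.contMDiffAt
  let z₀ : Option (Fin (Module.finrank ℝ E)) → ℝ := fun o => o.elim 0 (x.e 1)
  -- The coordinates `some j` are those of `g`, the coordinate `none` is the parameter `t`, and `P`
  -- is `g γ(t)`. The equation `f (g γ(t)) = 0` is to be solved for `t`.
  let P : (Option (Fin (Module.finrank ℝ E)) → ℝ) → G := fun z =>
    x.e.symm (fun j => z (some j)) * γ (z none)
  have hres : ContDiff ℝ ∞ fun (z : Option (Fin (Module.finrank ℝ E)) → ℝ) j => z (some j) :=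
    contDiff_pi.2 fun j => contDiff_apply ℝ ℝ (some j)
  have hP0 : P z₀ = 1 := by simp [P, z₀, hγ0, x.e.left_inv h1x]
  have hnone : Tendsto (fun z : Option (Fin (Module.finrank ℝ E)) → ℝ => z none) (𝓝 z₀) (𝓝 0) :=
    (continuous_apply none).tendsto z₀
  have hPs : ∀ᶠ z in 𝓝 z₀,
      ContMDiffAt 𝓘(ℝ, Option (Fin (Module.finrank ℝ E)) → ℝ) 𝓘(ℝ, E) ∞ P z := by
    filter_upwards [hres.continuous.continuousAt.eventually (x.e.open_target.mem_nhds
        (show (fun j => z₀ (some j)) ∈ x.e.target from x.e.map_source h1x)),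
      hnone.eventually hγs] with z h1 h2
    refine ContMDiffAt.mul ?_ ?_
    · exact (contMDiffAt_manifoldChart_symm h1).comp z hres.contMDiff.contMDiffAt
    · exact ContMDiffAt.comp (g := γ) z h2 (contDiff_apply ℝ ℝ none).contMDiff.contMDiffAt
  have hPt : Tendsto P (𝓝 z₀) (𝓝 1) := by
    have := hPs.self_of_nhds.continuousAt
    rwa [ContinuousAt, hP0] at this
  have hF : ∀ᶠ z in 𝓝 z₀, ContDiffAt ℝ ∞ (f ∘ P) z := by
    filter_upwards [hPs, hPt.eventually hf] with z h1 h2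
    exact (h2.comp z h1).contDiffAt
  let o₁ : Option (Fin (Module.finrank ℝ E)) → ℝ := Pi.single none 1
  -- Along the `none` direction through `z₀` the map `P` runs through `γ`, so this derivative is
  -- `∂ᵢf` at the identity.
  have hFd : pd (f ∘ P) z₀ none ≠ 0 := by
    have h1 : HasDerivAt (fun t : ℝ => z₀ + t • o₁)
        o₁ 0 := by
      simpa using ((hasDerivAt_id (0 : ℝ)).smul_const
        o₁).const_add z₀
    have h2 : HasFDerivAt (f ∘ P) (fderiv ℝ (f ∘ P) z₀)
        (z₀ + (0 : ℝ) • o₁) := by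
      rw [zero_smul, add_zero]
      exact (hF.self_of_nhds.differentiableAt (by simp)).hasFDerivAt
    have h3 := h2.comp_hasDerivAt (0 : ℝ) h1
    have h4 : HasDerivAt (fun t : ℝ => x.e 1 + t • (Pi.single i 1 : Fin _ → ℝ))
        (Pi.single i 1) 0 := by
      simpa using ((hasDerivAt_id (0 : ℝ)).smul_const
        (Pi.single i 1 : Fin (Module.finrank ℝ E) → ℝ)).const_add (x.e 1)
    have h5 : HasFDerivAt (f ∘ x.e.symm) (fderiv ℝ (f ∘ x.e.symm) (x.e 1))
        (x.e 1 + (0 : ℝ) • (Pi.single i 1 : Fin _ → ℝ)) := by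
      rw [zero_smul, add_zero]
      exact (Chart.differentiableAt h1x hf).hasFDerivAt
    have h6 := h5.comp_hasDerivAt (0 : ℝ) h4
    have h7 : (f ∘ P) ∘ (fun t : ℝ => z₀ + t • o₁) =
        (f ∘ x.e.symm) ∘ fun t : ℝ => x.e 1 + t • (Pi.single i 1 : Fin _ → ℝ) := by
      funext t
      have h8 : (fun j => (z₀ + t • o₁) (some j)) = x.e 1 := by
        funext j; simp [z₀, o₁]
      simp only [Function.comp_apply, P, h8, x.e.left_inv h1x, one_mul]
      simp [z₀, hγ, o₁]
    rw [h7] at h3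
    rw [pd, h3.unique h6]
    exact hi
  obtain ⟨Θ, hΘp, hΘ, hΘ1, hΘ2⟩ := exists_straightening (f ∘ P) none hF hFd
  -- This is the point `(x(g), 0)`. Its preimage under `Θ` keeps the coordinates of `g` and has as
  -- `none` component the parameter at which `f (g γ(t))` vanishes.
  let ζ : G → Option (Fin (Module.finrank ℝ E)) → ℝ := fun g o => o.elim 0 (x.e g)
  have hζs : ∀ g ∈ x.e.source, ∀ o, (SmoothStr.ofManifold E G).SmoothAt (fun g => ζ g o) g := by
    rintro g hg (_ | j)
    · exact SmoothStr.smoothAt_const 0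
    · exact x.smoothAt_x hg j
  have hζc : ContinuousAt ζ 1 := continuousAt_pi.2 fun o =>
    (SmoothStr.ofManifold E G).continuousAt (hζs 1 h1x o)
  have hf1 : f 1 = 0 := hz.self_of_nhds.1 H.one_mem
  have hΘ0 : Θ z₀ = z₀ := by
    rw [hΘ, Function.comp_apply, hP0, hf1]
    exact Function.update_eq_self_iff.2 rfl
  have hζ1 : ζ 1 ∈ Θ.target := by
    have := Θ.map_source hΘp
    rwa [hΘ0] at this
  let q : G → ℝ → Option (Fin (Module.finrank ℝ E)) → ℝ := fun g t o => o.elim t (x.e g)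
  have hqc : ContinuousAt (fun p : G × ℝ => q p.1 p.2) (1, 0) := by
    refine continuousAt_pi.2 fun o => ?_
    rcases o with _ | j
    · exact continuousAt_snd
    · exact ContinuousAt.comp (f := Prod.fst) (g := fun g => x.e g j)
        ((SmoothStr.ofManifold E G).continuousAt (x.smoothAt_x h1x j)) continuousAt_fst
  have hev1 : ∀ᶠ g in 𝓝 (1 : G), g ∈ x.e.source ∧ ζ g ∈ Θ.target :=
    (x.e.open_source.eventually_mem h1x).and (hζc.eventually (Θ.open_target.mem_nhds hζ1))
  have hev2 : ∀ᶠ p in 𝓝 ((1 : G), (0 : ℝ)), q p.1 p.2 ∈ Θ.source ∧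
      (P (q p.1 p.2) ∈ H ↔ f (P (q p.1 p.2)) = 0) := by
    have hq0 : q 1 0 = z₀ := rfl
    have h1 : Tendsto (fun p : G × ℝ => q p.1 p.2) (𝓝 (1, 0)) (𝓝 z₀) := hqc
    exact h1.eventually ((Θ.open_source.eventually_mem hΘp).and (hPt.eventually hz))
  rw [nhds_prod_eq] at hev2
  obtain ⟨A, hA, B, hB, hAB⟩ := eventually_prod_iff.1 hev2
  obtain ⟨U, hU, hUo, h1U⟩ := eventually_nhds_iff.1 (hA.and hev1)
  obtain ⟨ε, hε, hεB⟩ := Metric.eventually_nhds_iff.1 (hB.and hγs)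
  have habs : ∀ t : ℝ, |t| < ε → dist t 0 < ε := fun t ht => by rwa [Real.dist_0_eq_abs]
  refine ⟨γ, fun g => Θ.symm (ζ g) none, U, ε, hε, hUo, h1U, hγ0,
    fun t ht => (hεB (habs t ht)).2, fun g hg => ?_, fun g hg t ht => ?_⟩
  · obtain ⟨-, hgx, hgΘ⟩ := hU g hg
    refine SmoothStr.comp_local (F := fun z => Θ.symm z none) (g := fun o g => ζ g o) ?_ (hζs g hgx)
    filter_upwards [Θ.open_target.mem_nhds hgΘ] with z hz
    exact contDiffAt_pi.1 (hΘ2 z hz) none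
  · obtain ⟨hgA, hgx, hgΘ⟩ := hU g hg
    obtain ⟨hqs, hqH⟩ := hAB hgA (hεB (habs t ht)).1
    have hPq : P (q g t) = g * γ t := by
      change x.e.symm (x.e g) * γ t = _
      rw [x.e.left_inv hgx]
    simp only at hqH hqs
    rw [← hPq, hqH]
    constructor
    · intro h
      have h1 : Θ (q g t) = ζ g := by
        rw [hΘ, Function.comp_apply, h]
        funext o
        rcases o with _ | j <;> simp [q, ζ]
      change t = Θ.symm (ζ g) none
      rw [← h1, Θ.left_inv hqs]
      rfl
    · intro h
      have h1 : Θ (Θ.symm (ζ g)) = ζ g := Θ.right_inv hgΘ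
      have h2 : Θ.symm (ζ g) = q g t := by
        funext o
        rcases o with _ | j
        · exact h.symm
        · have := congrFun h1 (some j)
          rw [hΘ] at this
          have h3 : Θ.symm (ζ g) (some j) = ζ g (some j) := by simpa using this
          exact h3
      rw [h2, hΘ] at h1
      simpa [ζ] using congrFun h1 none

/-- A local trivialization at the critical point. -/
theorem exists_slice_one (hH : IsHypersurface (SmoothStr.ofManifold E G) (H : Set G)) :
    ∃ s : Slice E H, toCoset H 1 ∈ s.V ∧ ∀ r ∈ s.J, r + 1 ≠ 0 := by
  classical
  obtain ⟨γ, τ, U, ε, hε, hU, h1U, hγ0, hγ, hτ, hγτ⟩ := exists_transversal hH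
  have : IsTopologicalGroup G := topologicalGroup_of_lieGroup 𝓘(ℝ, E) ∞
  have hc : ∀ t, |t| < ε → ContMDiffAt 𝓘(ℝ, ℝ) 𝓘(ℝ, E) ∞ (fun t => (γ t)⁻¹) t := fun t ht =>
    (hγ t ht).inv
  have hτ1 : τ 1 = 0 := by
    refine ((hγτ 1 h1U 0 (by simpa)).1 ?_).symm
    rw [hγ0, mul_one]
    exact H.one_mem
  obtain ⟨δ', hδ', hδU⟩ : ∃ δ > 0, ∀ t : ℝ, |t| < δ → (γ t)⁻¹ ∈ U := by
    have h1 : Tendsto (fun t => (γ t)⁻¹) (𝓝 0) (𝓝 1) := by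
      have := (hc 0 (by simpa)).continuousAt
      rwa [ContinuousAt, hγ0, inv_one] at this
    obtain ⟨δ, hδ, h2⟩ := Metric.eventually_nhds_iff.1 (h1.eventually (hU.mem_nhds h1U))
    exact ⟨δ, hδ, fun t ht => h2 (by rwa [Real.dist_0_eq_abs])⟩
  -- The bound `δ'` keeps `γ(t)⁻¹` in `U`, `ε` keeps the characterization of `τ` valid, and `1`
  -- ensures `r + 1 ≠ 0` on `J`, as translated slices require.
  set δ := min (min δ' ε) 1 with hδ
  have hδ0 : 0 < δ := lt_min (lt_min hδ' hε) one_pos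
  have hδ1 : ∀ t : ℝ, |t| < δ → |t| < ε := fun t ht =>
    ht.trans_le ((min_le_left _ _).trans (min_le_right _ _))
  have hδ2 : ∀ t : ℝ, |t| < δ → (γ t)⁻¹ ∈ U := fun t ht =>
    hδU t (ht.trans_le ((min_le_left _ _).trans (min_le_left _ _)))
  set U' := {g | g ∈ U ∧ |τ g| < δ} with hU'
  have hU'o : IsOpen U' := by
    rw [isOpen_iff_mem_nhds]
    rintro g ⟨hg, hg'⟩
    filter_upwards [hU.mem_nhds hg, ((SmoothStr.ofManifold E G).continuousAt
      (hτ g hg)).abs.eventually (gt_mem_nhds hg')] with z h1 h2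
    exact ⟨h1, h2⟩
  have hτc : ∀ t : ℝ, |t| < δ → τ (γ t)⁻¹ = t := fun t ht =>
    ((hγτ _ (hδ2 t ht) t (hδ1 t ht)).1 (by simp)).symm
  have hτH : ∀ g ∈ U', g * γ (τ g) ∈ H := fun g hg =>
    (hγτ g hg.1 _ (hδ1 _ hg.2)).2 rfl
  -- If `g' = x g` with `x ∈ H`, then `g' γ(τ g) ∈ H`, and the parameter with this property is
  -- unique. Hence `τ` descends to cosets.
  have hτeq : ∀ g ∈ U', ∀ g' ∈ U', toCoset H g = toCoset H g' → τ g' = τ g := by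
    intro g hg g' hg' h
    refine ((hγτ g' hg'.1 _ (hδ1 _ hg.2)).1 ?_).symm
    have h1 := H.mul_mem (toCoset_eq_iff.1 h) (hτH g hg)
    simpa [mul_assoc] using h1
  let t : CosetSpace H → ℝ := fun y => if h : ∃ g ∈ U', toCoset H g = y then τ h.choose else 0
  have ht : ∀ g ∈ U', t (toCoset H g) = τ g := by
    intro g hg
    have hex : ∃ g' ∈ U', toCoset H g' = toCoset H g := ⟨g, hg, rfl⟩
    have h1 : t (toCoset H g) = τ hex.choose := dif_pos hex
    rw [h1]
    exact hτeq g hg _ hex.choose_spec.1 hex.choose_spec.2.symm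
  have hcU : ∀ r : ℝ, |r| < δ → (γ r)⁻¹ ∈ U' := fun r hr => ⟨hδ2 r hr, by rwa [hτc r hr]⟩
  have hct : ∀ g ∈ U', toCoset H (γ (τ g))⁻¹ = toCoset H g := fun g hg => by
    rw [toCoset_eq_iff, inv_inv]
    exact hτH g hg
  refine ⟨{
    V := toCoset H '' U'
    J := {r | |r| < δ}
    t := t
    -- The relation `g γ(τ g) ∈ H` says that `g` lies in the coset of `γ(τ g)⁻¹`.
    c := fun r => (γ r)⁻¹
    isOpen_V := (isOpenQuotientMap_toCoset).isOpenMap _ hU'o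
    isOpen_J := isOpen_lt continuous_abs continuous_const
    t_mem := ?_
    c_mem := fun r hr => ⟨_, hcU r hr, rfl⟩
    t_c := fun r hr => by rw [ht _ (hcU r hr), hτc r hr]
    c_t := ?_
    smooth_c := fun r hr => hc r (hδ1 r hr)
    smooth_t := ?_
    crit := ?_ }, ⟨1, ⟨h1U, by simpa [hτ1]⟩, rfl⟩, fun r hr => ?_⟩
  · rintro _ ⟨g, hg, rfl⟩
    rw [ht g hg]
    exact hg.2
  · rintro _ ⟨g, hg, rfl⟩
    rw [ht g hg]
    exact hct g hg
  -- A point of the saturation of `U'` is moved into `U'` by left translation with `u g⁻¹ ∈ H`,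
  -- which does not change the coset.
  · rintro g ⟨u, hu, hug⟩
    have h1 := smoothAt_comp_of_contMDiff (m := fun z => u * g⁻¹ * z) (g := g)
      (by simpa using hτ u hu.1) (contMDiff_mul_left (I := 𝓘(ℝ, E)))
    refine (SmoothStr.ofManifold E G).congr h1 ?_
    have h2 : ContinuousAt (fun z => u * g⁻¹ * z) g := by fun_prop
    filter_upwards [h2.eventually (hU'o.mem_nhds (by simpa using hu))] with z hz
    have h3 : u * g⁻¹ ∈ H := by simpa using H.inv_mem (toCoset_eq_iff.1 hug)
    rw [← ht _ hz, toCoset_mul_left h3]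
  · rintro _ ⟨g, hg, rfl⟩
    rw [ht g hg, critPt, mem_singleton_iff]
    constructor
    · intro h
      rw [hτeq 1 ⟨h1U, by simpa [hτ1]⟩ g hg h.symm, hτ1]
    · intro h
      have := hct g hg
      rw [h, hγ0, inv_one] at this
      exact this.symm
  · have h1 : |r| < 1 := lt_of_lt_of_le (show |r| < δ from hr) (min_le_right _ _)
    have := (abs_lt.1 h1).1
    linarith

/-- `G → G/H` is locally trivial. -/
theorem exists_slice (hH : IsBLieGroup E H) (y : CosetSpace H) : ∃ s : Slice E H, y ∈ s.V := by
  obtain ⟨s, hs1, hs2⟩ := exists_slice_one hH.isHypersurface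
  by_cases hy : y ∈ critPt H
  · exact ⟨s, by rwa [mem_singleton_iff.1 hy]⟩
  · obtain ⟨a, rfl⟩ := Quotient.mk_surjective y
    refine ⟨s.translate hH.isClosed hs2 a, ?_, hy⟩
    change toCoset H (a * a⁻¹) ∈ s.V
    rwa [mul_inv_cancel]

end

end Lie

/-! ### Derivatives at the identity of the group -/

section DiffOne

variable {E : Type*} [NormedAddCommGroup E] [NormedSpace ℝ E]
  {G : Type*} [TopologicalSpace G] [ChartedSpace E G] [Group G]

/-- The tangent space at `1` is identified with `E` through the preferred chart at `1`, so the
manifold derivative is by construction the derivative in this chart. -/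
theorem diffOne_eq_fderiv [IsManifold 𝓘(ℝ, E) 1 G] {k : G → ℝ}
    (hk : MDifferentiableAt 𝓘(ℝ, E) 𝓘(ℝ, ℝ) k 1) :
    diffOne E k = fderiv ℝ (k ∘ (chartAt E (1 : G)).symm) (chartAt E (1 : G) 1) := by
  have h := hk.mfderiv
  refine Eq.trans (b := fderivWithin ℝ (writtenInExtChartAt 𝓘(ℝ, E) 𝓘(ℝ, ℝ) 1 k)
    (range 𝓘(ℝ, E)) (extChartAt 𝓘(ℝ, E) (1 : G) 1)) h ?_
  rw [modelWithCornersSelf_coe, range_id, fderivWithin_univ]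
  rfl

theorem diffOne_congr {f k : G → ℝ} (h : f =ᶠ[𝓝 1] k) : diffOne E f = diffOne E k := by
  rw [diffOne, diffOne]
  exact h.mfderiv_eq

variable [LieGroup 𝓘(ℝ, E) ∞ G]

theorem diffOne_eq {k : G → ℝ} (hk : ContMDiffAt 𝓘(ℝ, E) 𝓘(ℝ, ℝ) ∞ k 1) :
    diffOne E k = fderiv ℝ (k ∘ (chartAt E (1 : G)).symm) (chartAt E (1 : G) 1) := by
  have : IsManifold 𝓘(ℝ, E) 1 G := IsManifold.of_le (n := ∞) (by simp)
  exact diffOne_eq_fderiv (hk.mdifferentiableAt (by simp))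

theorem differentiableAt_chart {k : G → ℝ} (hk : ContMDiffAt 𝓘(ℝ, E) 𝓘(ℝ, ℝ) ∞ k 1) :
    DifferentiableAt ℝ (k ∘ (chartAt E (1 : G)).symm) (chartAt E (1 : G) 1) := by
  have h1 : ContMDiffAt 𝓘(ℝ, E) 𝓘(ℝ, ℝ) ∞ k
      ((chartAt E (1 : G)).symm (chartAt E (1 : G) 1)) := by
    rwa [(chartAt E (1 : G)).left_inv (mem_chart_source E (1 : G))]
  have h2 := h1.comp _ (contMDiffAt_symm_of_mem_maximalAtlas
    (IsManifold.chart_mem_maximalAtlas (1 : G)) (mem_chart_target E (1 : G)))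
  exact (contMDiffAt_iff_contDiffAt.1 h2).differentiableAt (by simp)

theorem diffOne_add {f k : G → ℝ} (hf : ContMDiffAt 𝓘(ℝ, E) 𝓘(ℝ, ℝ) ∞ f 1)
    (hk : ContMDiffAt 𝓘(ℝ, E) 𝓘(ℝ, ℝ) ∞ k 1) :
    diffOne E (fun x => f x + k x) = diffOne E f + diffOne E k := by
  rw [diffOne_eq hf, diffOne_eq hk, diffOne_eq (k := fun x => f x + k x) (hf.add hk)]
  exact fderiv_add (differentiableAt_chart hf) (differentiableAt_chart hk)

theorem diffOne_sub {f k : G → ℝ} (hf : ContMDiffAt 𝓘(ℝ, E) 𝓘(ℝ, ℝ) ∞ f 1)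
    (hk : ContMDiffAt 𝓘(ℝ, E) 𝓘(ℝ, ℝ) ∞ k 1) :
    diffOne E (fun x => f x - k x) = diffOne E f - diffOne E k := by
  rw [diffOne_eq hf, diffOne_eq hk, diffOne_eq (k := fun x => f x - k x) (hf.sub hk)]
  exact fderiv_sub (differentiableAt_chart hf) (differentiableAt_chart hk)

theorem diffOne_mul {f k : G → ℝ} (hf : ContMDiffAt 𝓘(ℝ, E) 𝓘(ℝ, ℝ) ∞ f 1)
    (hk : ContMDiffAt 𝓘(ℝ, E) 𝓘(ℝ, ℝ) ∞ k 1) :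
    diffOne E (fun x => f x * k x) = f 1 • diffOne E k + k 1 • diffOne E f := by
  rw [diffOne_eq hf, diffOne_eq hk, diffOne_eq (k := fun x => f x * k x) (hf.mul hk)]
  have h := fderiv_mul (differentiableAt_chart hf) (differentiableAt_chart hk)
  simp only [Function.comp_apply, (chartAt E (1 : G)).left_inv (mem_chart_source E (1 : G))] at h
  exact h

omit [LieGroup 𝓘(ℝ, E) ∞ G] in
theorem diffOne_const (a : ℝ) : diffOne E (fun _ : G => a) = 0 := mfderiv_const

/-- The derivation of the germs at `m 1` along the image of `X` under the differential of `m`. -/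
def pushDeriv {m : G → G} (hm : ContMDiffAt 𝓘(ℝ, E) 𝓘(ℝ, E) ∞ m 1) {g : G} (hg : m 1 = g)
    (X : E) : Module.Dual ℝ ((SmoothStr.ofManifold E G).alg g) where
  toFun f := diffOne E (f.1 ∘ m) X
  map_add' f k := by
    have h1 : ∀ f : (SmoothStr.ofManifold E G).alg g,
        ContMDiffAt 𝓘(ℝ, E) 𝓘(ℝ, ℝ) ∞ (f.1 ∘ m) 1 := fun f =>
      ContMDiffAt.comp 1 (hg ▸ f.2.self_of_nhds) hm
    exact DFunLike.congr_fun (diffOne_add (h1 f) (h1 k)) X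
  map_smul' a f := by
    have h1 : ContMDiffAt 𝓘(ℝ, E) 𝓘(ℝ, ℝ) ∞ (f.1 ∘ m) 1 :=
      ContMDiffAt.comp 1 (hg ▸ f.2.self_of_nhds) hm
    have h2 := DFunLike.congr_fun (diffOne_mul (contMDiffAt_const (c := a)) h1) X
    simp only [diffOne_const, smul_zero, add_zero] at h2
    exact h2

theorem isDerivationAt_pushDeriv {m : G → G} (hm : ContMDiffAt 𝓘(ℝ, E) 𝓘(ℝ, E) ∞ m 1) {g : G}
    (hg : m 1 = g) (X : E) : IsDerivationAt (SmoothStr.ofManifold E G) g (pushDeriv hm hg X) := by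
  intro f k
  have h1 : ∀ f : (SmoothStr.ofManifold E G).alg g,
      ContMDiffAt 𝓘(ℝ, E) 𝓘(ℝ, ℝ) ∞ (f.1 ∘ m) 1 := fun f =>
    ContMDiffAt.comp 1 (hg ▸ f.2.self_of_nhds) hm
  have h2 := DFunLike.congr_fun (diffOne_mul (h1 f) (h1 k)) X
  subst hg
  exact h2

theorem derivAt_pushDeriv {m : G → G} (hm : ContMDiffAt 𝓘(ℝ, E) 𝓘(ℝ, E) ∞ m 1) {g : G}
    (hg : m 1 = g) (X : E) {f : G → ℝ} (hf : (SmoothStr.ofManifold E G).SmoothAt f g) :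
    derivAt (pushDeriv hm hg X) f = diffOne E (f ∘ m) X := derivAt_of _ hf

/-- The derivative along `Y` in the second variable depends smoothly on the first variable. -/
theorem contMDiffAt_diffOne_param {M : Type*} {E' : Type*} [NormedAddCommGroup E']
    [NormedSpace ℝ E'] [TopologicalSpace M] [ChartedSpace E' M] [IsManifold 𝓘(ℝ, E') ∞ M]
    (Y : E) {k : M → G → ℝ} {p : M}
    (hk : ContMDiffAt (𝓘(ℝ, E').prod 𝓘(ℝ, E)) 𝓘(ℝ, ℝ) ∞ (Function.uncurry k) (p, 1)) :
    ContMDiffAt 𝓘(ℝ, E') 𝓘(ℝ, ℝ) ∞ (fun z => diffOne E (k z) Y) p := by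
  have h1 := ContMDiffAt.mfderiv (m := ∞) k (fun _ => (1 : G)) hk contMDiffAt_const (by simp)
  have h2 := h1.clm_apply (contMDiffAt_const (c := Y))
  refine h2.congr_of_eventuallyEq ?_
  refine Eventually.of_forall fun z => ?_
  have : IsManifold 𝓘(ℝ, E) 1 G := IsManifold.of_le (n := ∞) (by simp)
  have h3 := inTangentCoordinates_eq (I := 𝓘(ℝ, E)) (I' := 𝓘(ℝ, ℝ)) (x₀ := p) (x := z)
    (fun _ : M => (1 : G)) (fun x => k x 1) (fun x => diffOne E (k x))
    (mem_chart_source E (1 : G)) (by simp only [chartAt_self_eq, OpenPartialHomeomorph.refl_source, mem_univ])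
  have h4 := (tangentBundleCore 𝓘(ℝ, E) G).coordChange_self (achart E (1 : G)) 1
    (mem_chart_source E (1 : G)) Y
  have h5 := DFunLike.congr_fun h3 Y
  refine Eq.trans ?_ h5.symm
  rw [ContinuousLinearMap.comp_apply, ContinuousLinearMap.comp_apply, h4]
  simp only [tangentBundleCore_coordChange_model_space]
  rfl

/-- The second derivatives along a Lie bracket. -/
theorem diffOne_lieBracketOne [FiniteDimensional ℝ E] (X Y : E) {f : G → ℝ}
    (hf : ∀ᶠ x in 𝓝 (1 : G), ContMDiffAt 𝓘(ℝ, E) 𝓘(ℝ, ℝ) ∞ f x) :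
    diffOne E f (lieBracketOne E G X Y) =
      diffOne E (fun g => diffOne E (fun x => f (g * x)) Y) X -
      diffOne E (fun g => diffOne E (fun x => f (g * x)) X) Y := by
  have : IsManifold 𝓘(ℝ, E) 1 G := IsManifold.of_le (n := ∞) (by simp)
  have inst3 : LieGroup 𝓘(ℝ, E) (minSmoothness ℝ 3) G := LieGroup.of_le (n := ∞) (by simp; exact WithTop.coe_le_coe.2 le_top)
  set c := extChartAt 𝓘(ℝ, E) (1 : G) with hcdef
  have hd : ∀ k : G → ℝ, MDifferentiableAt 𝓘(ℝ, E) 𝓘(ℝ, ℝ) k 1 →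
      diffOne E k = fderiv ℝ (k ∘ c.symm) (c 1) := fun k hk => diffOne_eq_fderiv hk
  -- The left-invariant field of `Z`, read in the chart at `1`.
  set V : E → E → E := fun Z => (VectorField.mpullbackWithin 𝓘(ℝ, E) 𝓘(ℝ, E) c.symm
        (mulInvariantVectorField (I := 𝓘(ℝ, E)) (G := G) Z) (range 𝓘(ℝ, E))) with hV
  have hid : (mfderiv 𝓘(ℝ, E) 𝓘(ℝ, E) c 1 : E →L[ℝ] E) = ContinuousLinearMap.id ℝ E := by
    have h := (mdifferentiableAt_extChartAt (I := 𝓘(ℝ, E)) (mem_chart_source E (1 : G))).mfderiv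
    refine Eq.trans (b := fderivWithin ℝ (writtenInExtChartAt 𝓘(ℝ, E) 𝓘(ℝ, E) 1 c)
      (range 𝓘(ℝ, E)) (c 1)) h ?_
    rw [modelWithCornersSelf_coe, range_id, fderivWithin_univ]
    have h1 : writtenInExtChartAt 𝓘(ℝ, E) 𝓘(ℝ, E) 1 c =ᶠ[𝓝 (c 1)] id := by
      filter_upwards [extChartAt_target_mem_nhds (I := 𝓘(ℝ, E)) (1 : G)] with y hy
      exact c.right_inv hy
    rw [h1.fderiv_eq, fderiv_id]
  -- Differentiating `f` along a left-invariant field at `g` is differentiating `x ↦ f (g x)` at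
  -- `1`.
  have hA : ∀ Z : E, (fun y => fderiv ℝ (f ∘ c.symm) y (V Z y)) =ᶠ[𝓝 (c 1)]
      ((fun g => diffOne E (fun x => f (g * x)) Z) ∘ c.symm) := by
    intro Z
    have hcont : Tendsto c.symm (𝓝 (c 1)) (𝓝 (1 : G)) := by
      have := continuousAt_extChartAt_symm (I := 𝓘(ℝ, E)) (1 : G)
      rwa [ContinuousAt, extChartAt_to_inv] at this
    filter_upwards [extChartAt_target_mem_nhds (I := 𝓘(ℝ, E)) (1 : G), hcont.eventually hf]
      with y hy hfy
    have h1 := diffOne_mul_left Z hfy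
    refine Eq.trans ?_ h1.symm
    have hcd : MDifferentiableAt 𝓘(ℝ, E) 𝓘(ℝ, E) c.symm y := by
      have := mdifferentiableWithinAt_extChartAt_symm (I := 𝓘(ℝ, E)) hy
      rwa [modelWithCornersSelf_coe, range_id, mdifferentiableWithinAt_univ] at this
    have h2 : (fderiv ℝ (f ∘ c.symm) y) =
        (show E →L[ℝ] ℝ from mfderiv 𝓘(ℝ, E) 𝓘(ℝ, ℝ) f (c.symm y)).comp
        (show E →L[ℝ] E from mfderiv 𝓘(ℝ, E) 𝓘(ℝ, E) c.symm y) := by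
      rw [← mfderiv_eq_fderiv]
      exact mfderiv_comp y (hfy.mdifferentiableAt (by simp)) hcd
    have h3 := isInvertible_mfderivWithin_extChartAt_symm (I := 𝓘(ℝ, E)) hy
    have h4 : V Z y = (show E →L[ℝ] E from mfderiv 𝓘(ℝ, E) 𝓘(ℝ, E) c.symm y).inverse
        (mulInvariantVectorField (I := 𝓘(ℝ, E)) (G := G) Z (c.symm y)) := by
      rw [hV, ← mfderivWithin_univ]
      simp only [VectorField.mpullbackWithin, modelWithCornersSelf_coe, range_id]
      rfl
    rw [modelWithCornersSelf_coe, range_id, mfderivWithin_univ] at h3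
    have h5 : (show E →L[ℝ] E from mfderiv 𝓘(ℝ, E) 𝓘(ℝ, E) c.symm y).IsInvertible := h3
    rw [h2, h4, ContinuousLinearMap.comp_apply]
    have gen : ∀ (A : E →L[ℝ] E), A.IsInvertible → ∀ w, A (A.inverse w) = w := by
      rintro _ ⟨e, rfl⟩ w
      simp
    exact congrArg _ (gen _ h5 _)
  have hB : ∀ Z : E, V Z (c 1) = Z := by
    intro Z
    have h := (VectorField.eventuallyEq_mpullback_mpullbackWithin_extChartAt (s := univ)
      (x := (1 : G)) (mulInvariantVectorField (I := 𝓘(ℝ, E)) (G := G) Z)).self_of_nhdsWithin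
        (mem_univ _)
    have h1 : mulInvariantVectorField (I := 𝓘(ℝ, E)) (G := G) Z 1 = Z := by
      have h2 : (fun x : G => 1 * x) = id := by ext; simp
      have h3 : (mfderiv 𝓘(ℝ, E) 𝓘(ℝ, E) (fun x : G => 1 * x) 1 : E →L[ℝ] E) =
          ContinuousLinearMap.id ℝ E := by
        rw [h2]; exact mfderiv_id
      exact DFunLike.congr_fun h3 Z
    have h4 : (mfderiv 𝓘(ℝ, E) 𝓘(ℝ, E) c 1 : E →L[ℝ] E).inverse (V Z (c 1)) = Z :=
      h.symm.trans h1
    rw [hid] at h4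
    have h5 : (ContinuousLinearMap.id ℝ E).inverse (V Z (c 1)) = V Z (c 1) :=
      DFunLike.congr_fun ContinuousLinearMap.inverse_id _
    exact h5.symm.trans h4
  have hC : ∀ Z : E, DifferentiableAt (𝕜 := ℝ) (E := E) (F := E) (V Z) (c 1) := by
    intro Z
    have h0 : ContMDiffWithinAt 𝓘(ℝ, E) 𝓘(ℝ, E).tangent 1
      (fun g : G ↦ (mulInvariantVectorField (I := 𝓘(ℝ, E)) Z g : TangentBundle 𝓘(ℝ, E) G)) univ 1 :=
      ((contMDiffAt_mulInvariantVectorField (I := 𝓘(ℝ, E)) (G := G) Z).of_le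
        (by simp)).contMDiffWithinAt
    have h1 := VectorField.contMDiffWithinAt_mpullbackWithin_extChartAt_symm h0
      uniqueMDiffOn_univ (mem_univ _) (n := 2) (by norm_num)
    rw [preimage_univ, inter_univ] at h1
    have h2 := h1.contMDiffAt (extChartAt_target_mem_nhds (I := 𝓘(ℝ, E)) (1 : G))
    have h3 : ContDiffAt (𝕜 := ℝ) (E := E) (F := E) 1 (V Z) (c 1) :=
      contMDiffAt_vectorSpace_iff_contDiffAt.1 h2
    exact ContDiffAt.differentiableAt (𝕜 := ℝ) (E := E) (F := E) h3 (by simp)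
  have hD : lieBracketOne E G X Y = VectorField.lieBracket ℝ (E := E) (V X) (V Y) (c 1) := by
    have h : lieBracketOne E G X Y = (mfderiv 𝓘(ℝ, E) 𝓘(ℝ, E) c 1 : E →L[ℝ] E).inverse
      (VectorField.lieBracketWithin ℝ (E := E) (V X) (V Y)
         (c.symm ⁻¹' univ ∩ range 𝓘(ℝ, E)) (c 1)) := rfl
    have h1 : (VectorField.lieBracketWithin ℝ (E := E) (V X) (V Y)
         (c.symm ⁻¹' univ ∩ range 𝓘(ℝ, E)) (c 1)) = VectorField.lieBracket ℝ (E := E) (V X) (V Y) (c 1) := by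
      rw [modelWithCornersSelf_coe, range_id, preimage_univ, univ_inter,
        VectorField.lieBracketWithin_univ]
    refine h.trans ?_
    rw [h1, hid]
    have h2 : ∀ w : E, (ContinuousLinearMap.id ℝ E).inverse w = w := fun w =>
      DFunLike.congr_fun ContinuousLinearMap.inverse_id w
    exact h2 _
  have hsm : ContDiffAt ℝ ∞ (f ∘ c.symm) (c 1) := by
    have h1 := (contMDiffOn_extChartAt_symm (I := 𝓘(ℝ, E)) (n := ∞) (1 : G)).contMDiffAt
      (extChartAt_target_mem_nhds (I := 𝓘(ℝ, E)) (1 : G))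
    have h2 : ContMDiffAt 𝓘(ℝ, E) 𝓘(ℝ, ℝ) ∞ f (c.symm (c 1)) := by
      rw [hcdef, extChartAt_to_inv]; exact hf.self_of_nhds
    exact (h2.comp _ h1).contDiffAt
  -- In the chart the claim is `[V, W] f = V (W f) - W (V f)` for vector fields on a vector space.
  rw [hd f (hf.self_of_nhds.mdifferentiableAt (by simp)), hD,
    VectorField.fderiv_apply_lieBracket hsm (by simp; exact WithTop.coe_le_coe.2 le_top) (hC Y) (hC X),
    (hA Y).fderiv_eq, (hA X).fderiv_eq, hB, hB,
    ← hd _ ((contMDiffAt_diffOne Y hf.self_of_nhds).mdifferentiableAt (by simp)),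
    ← hd _ ((contMDiffAt_diffOne X hf.self_of_nhds).mdifferentiableAt (by simp))]

/-- Mixed derivatives of a function of a group element and a real number. -/
theorem diffOne_deriv_comm {k : G → ℝ → ℝ} {r : ℝ} (X : E)
    (hk : ContMDiffAt (𝓘(ℝ, E).prod 𝓘(ℝ, ℝ)) 𝓘(ℝ, ℝ) ∞ (Function.uncurry k) (1, r))
    (hk' : ∀ᶠ s in 𝓝 r, ContMDiffAt 𝓘(ℝ, E) 𝓘(ℝ, ℝ) ∞ (fun x => k x s) 1)
    (hd : ContMDiffAt 𝓘(ℝ, E) 𝓘(ℝ, ℝ) ∞ (fun x => deriv (k x) r) 1) :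
    diffOne E (fun x => deriv (k x) r) X = deriv (fun s => diffOne E (fun x => k x s) X) r := by
  set c := chartAt E (1 : G)
  have hc : c.symm (c 1) = 1 := c.left_inv (mem_chart_source E (1 : G))
  -- Read in the chart, the two sides are the two mixed second derivatives of `K`, which agree by
  -- symmetry.
  set K : E × ℝ → ℝ := fun q => k (c.symm q.1) q.2 with hKdef
  have hK : ContDiffAt ℝ ∞ K (c 1, r) := by
    rw [← contMDiffAt_iff_contDiffAt]
    have h1 : ContMDiffAt 𝓘(ℝ, E) 𝓘(ℝ, E) ∞ c.symm (c 1) :=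
      contMDiffAt_symm_of_mem_maximalAtlas (IsManifold.chart_mem_maximalAtlas 1)
        (mem_chart_target E (1 : G))
    have h2 : ContMDiffAt 𝓘(ℝ, E × ℝ) (𝓘(ℝ, E).prod 𝓘(ℝ, ℝ)) ∞
        (fun q : E × ℝ => (c.symm q.1, q.2)) (c 1, r) := by
      exact ContMDiffAt.prodMk
        (ContMDiffAt.comp (g := c.symm) (f := Prod.fst) (c 1, r) h1
          contDiff_fst.contMDiff.contMDiffAt)
        contDiff_snd.contMDiff.contMDiffAt
    have h3 : ContMDiffAt (𝓘(ℝ, E).prod 𝓘(ℝ, ℝ)) 𝓘(ℝ, ℝ) ∞ (Function.uncurry k)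
        (c.symm (c 1), r) := by rwa [hc]
    exact h3.comp (c 1, r) h2
  have hdiff : ∀ᶠ q in 𝓝 (c 1, r), DifferentiableAt ℝ K q := by
    have h0 : ContDiffAt ℝ 1 K (c 1, r) := hK.of_le (by simp)
    filter_upwards [h0.eventually (by simp)] with q hq
    exact hq.differentiableAt (by simp)
  have hK' : DifferentiableAt ℝ (fderiv ℝ K) (c 1, r) :=
    (hK.fderiv_right (m := ∞) (by simp)).differentiableAt (by simp)
  have hsymm := hK.isSymmSndFDerivAt (by simp; exact WithTop.coe_le_coe.2 le_top)
  have e1 : ∀ w s, DifferentiableAt ℝ K (w, s) → deriv (k (c.symm w)) s = fderiv ℝ K (w, s) (0, 1) := by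
    intro w s hq
    have h1 : HasDerivAt (fun s : ℝ => (w, s)) ((0 : E), (1 : ℝ)) s :=
      (hasDerivAt_const s w).prodMk (hasDerivAt_id s)
    exact (hq.hasFDerivAt.comp_hasDerivAt s h1).deriv
  have e2 : ∀ s, DifferentiableAt ℝ K (c 1, s) →
      fderiv ℝ ((fun x => k x s) ∘ c.symm) (c 1) X = fderiv ℝ K (c 1, s) (X, 0) := by
    intro s hq
    have h1 : HasFDerivAt (fun w : E => (w, s)) (ContinuousLinearMap.inl ℝ E ℝ) (c 1) :=
      (hasFDerivAt_id (c 1)).prodMk (hasFDerivAt_const s (c 1))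
    have h2 := (hq.hasFDerivAt.comp (c 1) h1).fderiv
    have h3 : ((fun x => k x s) ∘ c.symm) = K ∘ fun w : E => (w, s) := rfl
    rw [h3, h2]
    rfl
  have hl : Tendsto (fun w : E => (w, r)) (𝓝 (c 1)) (𝓝 (c 1, r)) :=
    (Continuous.prodMk_left r).tendsto (c 1)
  have hr : Tendsto (fun s : ℝ => (c 1, s)) (𝓝 r) (𝓝 (c 1, r)) :=
    (Continuous.prodMk_right (c 1)).tendsto r
  have l1 : diffOne E (fun x => deriv (k x) r) X = fderiv ℝ (fderiv ℝ K) (c 1, r) (X, 0) (0, 1) := by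
    rw [diffOne_eq hd]
    have h1 : ((fun x => deriv (k x) r) ∘ c.symm) =ᶠ[𝓝 (c 1)] fun w => fderiv ℝ K (w, r) (0, 1) := by
      filter_upwards [hl.eventually hdiff] with w hw
      exact e1 w r hw
    have h2 : HasFDerivAt (fun w : E => (w, r)) (ContinuousLinearMap.inl ℝ E ℝ) (c 1) :=
      (hasFDerivAt_id (c 1)).prodMk (hasFDerivAt_const r (c 1))
    have h3 := (hK'.hasFDerivAt.comp (c 1) h2).clm_apply
      (hasFDerivAt_const ((0 : E), (1 : ℝ)) (c 1))
    rw [h1.fderiv_eq]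
    refine (DFunLike.congr_fun h3.fderiv X).trans ?_
    simp
  have l2 : deriv (fun s => diffOne E (fun x => k x s) X) r =
      fderiv ℝ (fderiv ℝ K) (c 1, r) (0, 1) (X, 0) := by
    have h1 : (fun s => diffOne E (fun x => k x s) X) =ᶠ[𝓝 r] fun s => fderiv ℝ K (c 1, s) (X, 0) := by
      filter_upwards [hr.eventually hdiff, hk'] with s hs hs'
      rw [diffOne_eq hs']
      exact e2 s hs
    have h2 : HasDerivAt (fun s : ℝ => (c 1, s)) ((0 : E), (1 : ℝ)) r :=
      (hasDerivAt_const r (c 1)).prodMk (hasDerivAt_id r)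
    have h3 := (hK'.hasFDerivAt.comp_hasDerivAt r h2).clm_apply
      (hasDerivAt_const r (X, (0 : ℝ)))
    rw [h1.deriv_eq]
    refine h3.deriv.trans ?_
    simp
  rw [l1, l2, hsymm.eq]

end DiffOne

/-- The derivative in a real variable depends smoothly on parameters. -/
theorem contMDiffAt_deriv_param {M : Type*} {E' : Type*} [NormedAddCommGroup E']
    [NormedSpace ℝ E'] [TopologicalSpace M] [ChartedSpace E' M] [IsManifold 𝓘(ℝ, E') ∞ M]
    {k : M → ℝ → ℝ} {τ : M → ℝ} {p : M} (hτ : ContMDiffAt 𝓘(ℝ, E') 𝓘(ℝ, ℝ) ∞ τ p)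
    (hk : ContMDiffAt (𝓘(ℝ, E').prod 𝓘(ℝ, ℝ)) 𝓘(ℝ, ℝ) ∞ (Function.uncurry k) (p, τ p)) :
    ContMDiffAt 𝓘(ℝ, E') 𝓘(ℝ, ℝ) ∞ (fun z => deriv (k z) (τ z)) p := by
  have h1 := ContMDiffAt.mfderiv (m := ∞) k τ hk hτ (by simp)
  have h2 := h1.clm_apply (contMDiffAt_const (c := (1 : ℝ)))
  refine h2.congr_of_eventuallyEq (Eventually.of_forall fun z => ?_)
  have h3 : (mfderiv 𝓘(ℝ, ℝ) 𝓘(ℝ, ℝ) (k z) (τ z) : ℝ →L[ℝ] ℝ) = fderiv ℝ (k z) (τ z) :=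
    mfderiv_eq_fderiv
  have h4 := inTangentCoordinates_eq (I := 𝓘(ℝ, ℝ)) (I' := 𝓘(ℝ, ℝ)) τ (fun z => k z (τ z))
    (fun z => mfderiv 𝓘(ℝ, ℝ) 𝓘(ℝ, ℝ) (k z) (τ z)) (x₀ := p) (x := z)
    (mem_univ _) (mem_univ _)
  rw [tangentBundleCore_coordChange_model_space, tangentBundleCore_coordChange_model_space] at h4
  refine Eq.symm ((DFunLike.congr_fun h4 (1 : ℝ)).trans ?_)
  exact DFunLike.congr_fun h3 (1 : ℝ)

/-- A Hausdorff space with charts of `n` coordinates is an `n`-dimensional manifold. -/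
theorem SmoothStr.isManifold_of_chart {X : Type*} [TopologicalSpace X] [T2Space X]
    {S : SmoothStr X} {ι : Type} [Fintype ι] (h : ∀ x, ∃ c : Chart S ι, x ∈ c.e.source) {n : ℕ}
    (hn : Fintype.card ι = n) : S.IsManifold n := by
  refine ⟨inferInstance, fun x => ?_⟩
  obtain ⟨c, hx⟩ := h x
  let L : (ι → ℝ) ≃L[ℝ] EuclideanSpace ℝ (Fin n) := ContinuousLinearEquiv.ofFinrankEq (by simp [hn])
  refine ⟨c.e.transHomeomorph L.toHomeomorph, hx, fun y hy f => ?_⟩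
  rw [c.smooth_iff y hy]
  have e1 : Tendsto L (𝓝 (c.e y)) (𝓝 (L (c.e y))) := L.continuous.tendsto _
  have e2 : Tendsto L.symm (𝓝 (L (c.e y))) (𝓝 (c.e y)) := by
    simpa using L.symm.continuous.tendsto (L (c.e y))
  constructor
  · intro h
    change ∀ᶠ z in 𝓝 (L (c.e y)), ContDiffAt ℝ ∞ ((f ∘ c.e.symm) ∘ L.symm) z
    filter_upwards [e2.eventually h] with z hz
    exact hz.comp z L.symm.contDiff.contDiffAt
  · intro h
    have h' : ∀ᶠ z in 𝓝 (L (c.e y)), ContDiffAt ℝ ∞ ((f ∘ c.e.symm) ∘ L.symm) z := h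
    filter_upwards [e1.eventually h'] with z hz
    have h2 := hz.comp z L.contDiff.contDiffAt
    have h3 : ((f ∘ c.e.symm) ∘ L.symm) ∘ L = f ∘ c.e.symm := by
      funext w; simp
    rwa [h3] at h2

/-! ### Continuity and coefficients in charts -/

section

variable {M : Type*} [TopologicalSpace M] {S : SmoothStr M} {Z : Set M} {ι : Type} [Fintype ι]

theorem Chart.continuousAt_of_x (c : Chart S ι) {X : Type*} [TopologicalSpace X] {φ : X → M} {p : X}
    (hs : ∀ᶠ q in 𝓝 p, φ q ∈ c.e.source) (hx : ∀ i, ContinuousAt (c.x i ∘ φ) p) :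
    ContinuousAt φ p := by
  have h1 : ContinuousAt (fun q => c.e (φ q)) p := continuousAt_pi.2 hx
  have h2 := (c.e.symm.continuousAt (c.e.map_source hs.self_of_nhds)).comp (f := fun q => c.e (φ q)) h1
  refine h2.congr ?_
  filter_upwards [hs] with q hq
  exact c.e.left_inv hq

theorem Chart.isHypersurface [DecidableEq ι] (h : ∀ p, ∃ c : BChart S Z ι, p ∈ c.e.source) :
    IsHypersurface S Z := fun p _ => by
  obtain ⟨c, hp⟩ := h p
  exact ⟨_, BChart.isDefiningAt_x0 hp⟩

/-- Beyond its derivation, a `b`-tangent vector carries a single additional number, the logarithmic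
derivative of one defining function. -/
theorem BChart.bTangent_ext [DecidableEq ι] (c : BChart S Z ι) {p : M} (hp : p ∈ c.e.source) {f : M → ℝ}
    (hf : ∀ᶠ y in 𝓝 p, c.x0 y = f y) {v w : bTangent S Z p} (h0 : bLogDeriv v f = bLogDeriv w f)
    (h : ∀ k, S.SmoothAt k p → bDeriv v k = bDeriv w k) : v = w := by
  refine BChart.coord_injective hp (funext fun i => ?_)
  by_cases hi : i = c.i0
  · subst hi
    rw [coord_i0, coord_i0, bLogDeriv_congr v hf, bLogDeriv_congr w hf, h0]
  · rw [coord_ne _ hi, coord_ne _ hi, h _ (c.smoothAt_x hp i)]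

theorem BChart.isSmoothFieldAt_of_bLogDeriv [DecidableEq ι] (c : BChart S Z ι) {p : M} (hp : p ∈ c.e.source) {f : M → ℝ}
    (hf : ∀ᶠ y in 𝓝 p, c.x0 y = f y) {Y : ∀ p, bTangent S Z p}
    (h0 : S.SmoothAt (fun z => bLogDeriv (Y z) f) p)
    (h : ∀ k, S.SmoothAt k p → S.SmoothAt (fun z => bDeriv (Y z) k) p) : IsSmoothFieldAt Y p := by
  refine (BChart.isSmoothFieldAt_iff hp).2 fun i => ?_
  by_cases hi : i = c.i0
  · subst hi
    refine S.congr h0 ?_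
    filter_upwards [eventually_eventually_nhds.2 hf] with z hz
    rw [coord_i0, bLogDeriv_congr (Y z) hz]
  · refine S.congr (h _ (c.smoothAt_x hp i)) (Eventually.of_forall fun z => ?_)
    simp only [coord_ne _ hi]

/-- The coefficients of a smooth field in a frame of smooth fields are smooth. -/
theorem BChart.smoothAt_coeff [DecidableEq ι] (c : BChart S Z ι) {p : M} (hp : p ∈ c.e.source)
    {κ : Type} [Fintype κ] [DecidableEq κ] (eκ : κ ≃ ι)
    {Y : κ → ∀ p, bTangent S Z p} (hY : ∀ i, IsSmoothFieldAt (Y i) p)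
    (hli : LinearIndependent ℝ fun i => Y i p) {a : κ → M → ℝ} {X : ∀ p, bTangent S Z p}
    (hX : IsSmoothFieldAt X p) (h : ∀ᶠ z in 𝓝 p, X z = ∑ i, a i z • Y i z) (i : κ) :
    S.SmoothAt (a i) p := by
  let A : M → Matrix κ κ ℝ := fun z => Matrix.of fun k j => c.coord z (Y j z) (eκ k)
  have hA : ∀ k j, S.SmoothAt (fun z => A z k j) p := fun k j => smoothAt_coord hp (hY j) _
  -- A determinant is a polynomial in the entries, so smooth entries give a smooth determinant.
  have hdet : ∀ B : M → Matrix κ κ ℝ, (∀ k j, S.SmoothAt (fun z => B z k j) p) →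
      S.SmoothAt (fun z => (B z).det) p := by
    intro B hB
    refine S.congr (S.comp (ι := κ × κ) (F := fun w => (Matrix.of fun k j => w (k, j)).det)
      (g := fun q z => B z q.1 q.2) ?_ fun q => hB q.1 q.2) (Eventually.of_forall fun z => rfl)
    simp only [Matrix.det_apply]
    refine ContDiff.sum fun σ _ => ContDiff.const_smul _ (contDiff_prod fun k _ => ?_)
    exact contDiff_apply ℝ ℝ ((σ k, k) : κ × κ)
  have h0 : (A p).det ≠ 0 := by
    have h1 : LinearIndependent ℝ fun i => (c.coord p) (Y i p) :=
      hli.map' _ (LinearMap.ker_eq_bot.2 (coord_injective hp))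
    have h2 : LinearIndependent ℝ (A p).col := by
      have h3 := h1.map' (LinearMap.funLeft ℝ ℝ eκ)
        (LinearMap.ker_eq_bot.2 (LinearMap.funLeft_injective_of_surjective ℝ ℝ _ eκ.surjective))
      exact h3
    exact ((Matrix.isUnit_iff_isUnit_det _).1 (Matrix.linearIndependent_cols_iff_isUnit.1 h2)).ne_zero
  -- Cramer's rule for the linear system that expresses `X` in the frame `Y`.
  have h1 : a i =ᶠ[𝓝 p] fun z => ((A z).updateCol i fun k => c.coord z (X z) (eκ k)).det / (A z).det := by
    filter_upwards [h, (S.continuousAt (hdet A hA)).eventually_ne h0] with z hz hz0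
    have h2 : (A z).mulVec (fun j => a j z) = fun k => c.coord z (X z) (eκ k) := by
      funext k
      rw [hz, map_sum, Finset.sum_apply]
      exact Finset.sum_congr rfl fun j _ => by
        rw [map_smul, Pi.smul_apply, smul_eq_mul, mul_comm]; rfl
    rw [← h2, eq_div_iff hz0, ← Matrix.cramer_apply, Matrix.cramer_eq_adjugate_mulVec,
      Matrix.mulVec_mulVec, Matrix.adjugate_mul, Matrix.smul_mulVec, Matrix.one_mulVec]
    simp [mul_comm]
  refine S.congr (SmoothStr.SmoothAt.div (hdet _ fun k j => ?_) (hdet A hA) h0) h1.symm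
  simp only [Matrix.updateCol_apply]
  split_ifs
  · exact smoothAt_coord hp hX _
  · exact hA k j

end

/-! ### The product structure `H × J` of a slice -/

section Lie

variable {E : Type*} [NormedAddCommGroup E] [NormedSpace ℝ E]
  {G : Type*} [TopologicalSpace G] [ChartedSpace E G] [Group G] {H : Subgroup G}

namespace Slice

variable (s : Slice E H)

/-- The coordinate of the base, as a function on the group. -/
def τ (g : G) : ℝ := s.t (toCoset H g)

/-- The part of the group over the domain of the trivialization. -/
def dom : Set G := toCoset H ⁻¹' s.V

/-- The component in `H` of a group element. -/
def h (g : G) : G := g * (s.c (s.τ g))⁻¹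

variable {s} {g : G}

theorem isOpen_dom : IsOpen s.dom := s.isOpen_V.preimage continuous_toCoset

theorem τ_mem (hg : g ∈ s.dom) : s.τ g ∈ s.J := s.t_mem _ hg

theorem h_mem (hg : g ∈ s.dom) : s.h g ∈ H := toCoset_eq_iff.1 (s.c_t _ hg)

theorem h_mul_c : s.h g * s.c (s.τ g) = g := by simp [h]

theorem τ_mul_left {x : G} (hx : x ∈ H) : s.τ (x * g) = s.τ g := by rw [τ, τ, toCoset_mul_left hx]

theorem h_mul_left {x : G} (hx : x ∈ H) : s.h (x * g) = x * s.h g := by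
  rw [h, h, τ_mul_left hx, mul_assoc]

theorem mul_left_mem {x : G} (hx : x ∈ H) : x * g ∈ s.dom ↔ g ∈ s.dom := by
  rw [dom, mem_preimage, mem_preimage, toCoset_mul_left hx]

theorem c_mem_dom {r : ℝ} (hr : r ∈ s.J) : s.c r ∈ s.dom := s.c_mem r hr

theorem τ_c {r : ℝ} (hr : r ∈ s.J) : s.τ (s.c r) = r := s.t_c r hr

theorem h_c {r : ℝ} (hr : r ∈ s.J) : s.h (s.c r) = 1 := by rw [h, τ_c hr, mul_inv_cancel]

theorem τ_mul_c {x : G} (hx : x ∈ H) {r : ℝ} (hr : r ∈ s.J) : s.τ (x * s.c r) = r := by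
  rw [τ_mul_left hx, τ_c hr]

theorem h_mul_c_of_mem {x : G} (hx : x ∈ H) {r : ℝ} (hr : r ∈ s.J) : s.h (x * s.c r) = x := by
  rw [h_mul_left hx, h_c hr, mul_one]

theorem smoothAt_τ (hg : g ∈ s.dom) : (SmoothStr.ofManifold E G).SmoothAt s.τ g := s.smooth_t g hg

theorem contMDiffAt_τ (hg : g ∈ s.dom) : ContMDiffAt 𝓘(ℝ, E) 𝓘(ℝ, ℝ) ∞ s.τ g :=
  (smoothAt_τ hg).self_of_nhds

theorem contMDiffAt_c_τ (hg : g ∈ s.dom) :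
    ContMDiffAt 𝓘(ℝ, E) 𝓘(ℝ, E) ∞ (fun g => s.c (s.τ g)) g :=
  (s.smooth_c _ (τ_mem hg)).comp g (contMDiffAt_τ hg)

theorem mem_iff_τ (hg : g ∈ s.dom) : g ∈ H ↔ s.τ g = 0 := by
  rw [τ, ← s.crit _ hg, critPt, mem_singleton_iff, eq_comm, toCoset_eq_iff, inv_one, mul_one]

end Slice

variable [LieGroup 𝓘(ℝ, E) ∞ G]

/-- Smoothness of the pullback near one representative spreads to the whole coset, because the
pullback is invariant under left translations by `H`, which are diffeomorphisms. -/
theorem smoothAt_coset_iff {f : CosetSpace H → ℝ} {g : G} :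
    (cosetStr E H).SmoothAt f (toCoset H g) ↔
      (SmoothStr.ofManifold E G).SmoothAt (f ∘ toCoset H) g := by
  have : IsTopologicalGroup G := topologicalGroup_of_lieGroup 𝓘(ℝ, E) ∞
  constructor
  · rintro ⟨U, hU, h⟩
    exact h g (mem_of_mem_nhds hU)
  · intro h
    obtain ⟨W, hW, hWo, hgW⟩ := eventually_nhds_iff.1 ((SmoothStr.ofManifold E G).eventually h)
    refine ⟨toCoset H '' W, (isOpenQuotientMap_toCoset.isOpenMap W hWo).mem_nhds ⟨g, hgW, rfl⟩, ?_⟩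
    rintro x ⟨w, hw, hwx⟩
    have h1 : w * x⁻¹ ∈ H := toCoset_eq_iff.1 hwx.symm
    have h2 := smoothAt_comp_of_contMDiff (m := fun z => w * x⁻¹ * z) (g := x)
      (by simpa using hW w hw) (contMDiff_mul_left (I := 𝓘(ℝ, E)))
    refine (SmoothStr.ofManifold E G).congr h2 (Eventually.of_forall fun z => ?_)
    exact congrArg f (toCoset_mul_left h1 z)

namespace Slice

variable {s : Slice E H} {g : G}

theorem contMDiffAt_h (hg : g ∈ s.dom) : ContMDiffAt 𝓘(ℝ, E) 𝓘(ℝ, E) ∞ s.h g :=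
  contMDiffAt_id.mul (contMDiffAt_c_τ hg).inv

theorem smoothAt_t {y : CosetSpace H} (hy : y ∈ s.V) : (cosetStr E H).SmoothAt s.t y := by
  obtain ⟨g, rfl⟩ := Quotient.mk_surjective y
  exact smoothAt_coset_iff.2 (s.smooth_t g hy)

variable (s) in
/-- The adapted chart of the coset space. -/
def chart : BChart (cosetStr E H) (critPt H) Unit where
  toChart := Chart.ofSmooth
    { toFun := fun y _ => s.t y
      invFun := fun z => toCoset H (s.c (z ()))
      source := s.V
      target := {z | z () ∈ s.J}
      map_source' := fun y hy => s.t_mem y hy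
      map_target' := fun z hz => s.c_mem _ hz
      left_inv' := fun y hy => s.c_t y hy
      right_inv' := fun z hz => funext fun _ => s.t_c _ hz
      open_source := s.isOpen_V
      open_target := s.isOpen_J.preimage (continuous_apply ())
      continuousOn_toFun := fun y hy => (continuousAt_pi.2 fun _ =>
        (cosetStr E H).continuousAt (smoothAt_t hy)).continuousWithinAt
      continuousOn_invFun := fun z hz => (continuous_toCoset.continuousAt.comp
        (ContinuousAt.comp (f := fun z : Unit → ℝ => z ()) (s.smooth_c _ hz).continuousAt
          (continuous_apply ()).continuousAt)).continuousWithinAt }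
    (fun y hy _ => smoothAt_t hy)
    (fun y hy f hf => by
      have hy' : s.t y ∈ s.J := s.t_mem y hy
      rw [← s.c_t y hy, smoothAt_coset_iff] at hf
      have h1 : Tendsto (fun z : Unit → ℝ => z ()) (𝓝 fun _ => s.t y) (𝓝 (s.t y)) :=
        (continuous_apply ()).tendsto _
      have h2 : Tendsto (fun z : Unit → ℝ => s.c (z ())) (𝓝 fun _ => s.t y) (𝓝 (s.c (s.t y))) :=
        (s.smooth_c _ hy').continuousAt.tendsto.comp h1
      filter_upwards [h2.eventually hf, h1.eventually (s.isOpen_J.mem_nhds hy')] with z h3 h4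
      rw [← contMDiffAt_iff_contDiffAt]
      exact ContMDiffAt.comp (g := f ∘ toCoset H) (f := fun z : Unit → ℝ => s.c (z ())) z h3
        (ContMDiffAt.comp (g := s.c) (f := fun z : Unit → ℝ => z ()) z
        (s.smooth_c _ h4) (contDiff_apply ℝ ℝ ()).contMDiff.contMDiffAt))
  i0 := ()
  crit := s.crit

section

variable [FiniteDimensional ℝ E]

/-- The function `τ` has nonzero differential since `τ (h(g) c(r)) = r`, so it can be made the first
coordinate of a chart adapted to `H`. -/
theorem exists_bChart (hg : g ∈ s.dom) :
    ∃ b : BChart (SmoothStr.ofManifold E G) (H : Set G) (Fin (Module.finrank ℝ E)),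
      g ∈ b.e.source ∧ b.e.source ⊆ s.dom ∧ ∀ y ∈ b.e.source, b.x0 y = s.τ y := by
  set γ : ℝ → G := fun r => s.h g * s.c r
  have hγ0 : γ (s.τ g) = g := h_mul_c
  have hγs : ContMDiffAt 𝓘(ℝ, ℝ) 𝓘(ℝ, E) ∞ γ (s.τ g) :=
    contMDiffAt_const.mul (s.smooth_c _ (τ_mem hg))
  have hgc : γ (s.τ g) ∈ (manifoldChart E g).e.source := hγ0.symm ▸ mem_manifoldChart_source g
  obtain ⟨i, hi⟩ := Chart.exists_d_ne_zero_of_curve (manifoldChart E g) hgc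
    (f := s.τ) (hγ0.symm ▸ smoothAt_τ hg) hγs.continuousAt
    (fun i => by
      have h1 : ContMDiffAt 𝓘(ℝ, E) 𝓘(ℝ, ℝ) ∞ ((manifoldChart E g).x i) (γ (s.τ g)) :=
        ((manifoldChart E g).smoothAt_x hgc i).self_of_nhds
      exact (h1.comp _ hγs).contDiffAt.differentiableAt (by simp))
    (by
      filter_upwards [s.isOpen_J.mem_nhds (τ_mem hg)] with r hr
      exact τ_mul_c (h_mem hg) hr)
  rw [hγ0] at hi
  obtain ⟨b, hb, -, hb0⟩ := Chart.exists_bChart (manifoldChart E g) (mem_manifoldChart_source g)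
    (smoothAt_τ hg) i hi (Z := (H : Set G)) (by
      filter_upwards [isOpen_dom.mem_nhds hg] with y hy
      exact mem_iff_τ hy)
  exact ⟨b.restr isOpen_dom, ⟨hb, hg⟩, fun y hy => hy.2, fun y hy => hb0 y hy.1⟩

theorem isDefiningAt_τ (hg : g ∈ s.dom) :
    IsDefiningAt (SmoothStr.ofManifold E G) (H : Set G) s.τ g := by
  obtain ⟨b, hb, -, hb0⟩ := exists_bChart hg
  exact (BChart.isDefiningAt_x0 hb).congr (by
    filter_upwards [b.e.open_source.mem_nhds hb] with y hy using hb0 y hy)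

theorem bTangent_ext (hg : g ∈ s.dom) {v w : BTangentG E H g}
    (h0 : bLogDeriv v s.τ = bLogDeriv w s.τ)
    (h : ∀ k, (SmoothStr.ofManifold E G).SmoothAt k g → bDeriv v k = bDeriv w k) : v = w := by
  obtain ⟨b, hb, -, hb0⟩ := exists_bChart hg
  exact b.bTangent_ext hb (by
    filter_upwards [b.e.open_source.mem_nhds hb] with y hy using hb0 y hy) h0 h

theorem isSmoothFieldAt (hg : g ∈ s.dom) {Y : ∀ g, BTangentG E H g}
    (h0 : (SmoothStr.ofManifold E G).SmoothAt (fun z => bLogDeriv (Y z) s.τ) g)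
    (h : ∀ k, (SmoothStr.ofManifold E G).SmoothAt k g →
      (SmoothStr.ofManifold E G).SmoothAt (fun z => bDeriv (Y z) k) g) : IsSmoothFieldAt Y g := by
  obtain ⟨b, hb, -, hb0⟩ := exists_bChart hg
  exact b.isSmoothFieldAt_of_bLogDeriv hb (by
    filter_upwards [b.e.open_source.mem_nhds hb] with y hy using hb0 y hy) h0 h

/-- A derivation at `g` with prescribed logarithmic derivative of the defining function. -/
theorem exists_vec (hg : g ∈ s.dom) {D : Module.Dual ℝ ((SmoothStr.ofManifold E G).alg g)}
    (hD : IsDerivationAt (SmoothStr.ofManifold E G) g D) {l : ℝ} (hl : derivAt D s.τ = s.τ g * l) :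
    ∃ v : BTangentG E H g, bLogDeriv v s.τ = l ∧ ∀ k, bDeriv v k = derivAt D k := by
  obtain ⟨b, hb, -, hb0⟩ := exists_bChart hg
  have h1 : b.x0 =ᶠ[𝓝 g] s.τ := by
    filter_upwards [b.e.open_source.mem_nhds hb] with y hy using hb0 y hy
  have hl' : derivAt D b.x0 = b.x0 g * l := by rw [hD.congr h1, hl, hb0 g hb]
  refine ⟨BChart.mkVec hb D hD l hl', ?_, fun k => BChart.bDeriv_mkVec hb hD hl'⟩
  rw [← bLogDeriv_congr _ h1, BChart.bLogDeriv_mkVec]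

end

end Slice

end Lie

/-! ### The invariant frame of a slice -/

section Lie

variable {E : Type*} [NormedAddCommGroup E] [NormedSpace ℝ E]
  {G : Type*} [TopologicalSpace G] [ChartedSpace E G] [Group G] [LieGroup 𝓘(ℝ, E) ∞ G]
  {H : Subgroup G}

/-- The derivative along a vector of `𝔥` depends only on the values on `H`. -/
theorem diffOne_eq_of_eqOn {X : E} (hX : X ∈ lieAlg E H) {F K : G → ℝ}
    (hF : (SmoothStr.ofManifold E G).SmoothAt F 1) (hK : (SmoothStr.ofManifold E G).SmoothAt K 1)
    (h : ∀ᶠ x in 𝓝 (1 : G), x ∈ H → F x = K x) : diffOne E F X = diffOne E K X := by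
  have h1 := hX (fun x => F x - K x) (hF.sub hK) (by
    filter_upwards [h] with x hx hxH
    rw [hx hxH, sub_self])
  rw [diffOne_sub hF.self_of_nhds hK.self_of_nhds, sub_apply] at h1
  exact sub_eq_zero.1 h1

theorem diffOne_const_mul (a : ℝ) {F : G → ℝ} (hF : (SmoothStr.ofManifold E G).SmoothAt F 1)
    (X : E) : diffOne E (fun x => a * F x) X = a * diffOne E F X := by
  rw [diffOne_mul contMDiffAt_const hF.self_of_nhds, diffOne_const]
  simp

theorem contMDiff_mul_mul (a b : G) : ContMDiff 𝓘(ℝ, E) 𝓘(ℝ, E) ∞ fun x : G => a * x * b :=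
  (contMDiff_mul_left (I := 𝓘(ℝ, E)) (n := ∞) (a := a)).mul contMDiff_const

/-- A vector which is annihilated by all differentials vanishes. -/
theorem eq_zero_of_diffOne [FiniteDimensional ℝ E] {X : E}
    (h : ∀ F : G → ℝ, (SmoothStr.ofManifold E G).SmoothAt F 1 → diffOne E F X = 0) : X = 0 := by
  set L := (Module.finBasis ℝ E).equivFunL
  refine L.injective ?_
  rw [map_zero]
  funext i
  have h1 : (SmoothStr.ofManifold E G).SmoothAt ((manifoldChart E (1 : G)).x i) 1 :=
    (manifoldChart E (1 : G)).smoothAt_x (mem_manifoldChart_source 1) i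
  have h2 := h _ h1
  rw [diffOne_eq h1.self_of_nhds] at h2
  have h3 : (manifoldChart E (1 : G)).x i ∘ (chartAt E (1 : G)).symm =ᶠ[𝓝 (chartAt E (1 : G) 1)]
      ((ContinuousLinearMap.proj i).comp L.toContinuousLinearMap : E →L[ℝ] ℝ) := by
    filter_upwards [(chartAt E (1 : G)).open_target.mem_nhds (mem_chart_target E (1 : G))]
      with w hw
    change L (chartAt E (1 : G) ((chartAt E (1 : G)).symm w)) i = L w i
    rw [(chartAt E (1 : G)).right_inv hw]
  rw [h3.fderiv_eq, ContinuousLinearMap.fderiv] at h2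
  exact h2

namespace Slice

variable (s : Slice E H)

open Classical in
/-- The invariant vertical field which is `X` along the section: the velocity at `x = 1` in the
direction `X` of `x ↦ h(g) x c(τ(g))`. -/
def A (X : lieAlg E H) (g : G) : BTangentG E H g :=
  if h : ∃ v : BTangentG E H g, bLogDeriv v s.τ = 0 ∧
      ∀ k, (SmoothStr.ofManifold E G).SmoothAt k g →
        bDeriv v k = diffOne E (fun x => k (s.h g * x * s.c (s.τ g))) X then h.choose else 0

open Classical in
/-- The invariant field `τ ∂_τ` along the translates of the section. -/
def B (g : G) : BTangentG E H g :=
  if h : ∃ v : BTangentG E H g, bLogDeriv v s.τ = 1 ∧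
      ∀ k, (SmoothStr.ofManifold E G).SmoothAt k g →
        bDeriv v k = s.τ g * deriv (fun r => k (s.h g * s.c r)) (s.τ g) then h.choose else 0

variable {s} {g : G}

theorem smoothAt_comp_h_c {k : G → ℝ}
    (hk : (SmoothStr.ofManifold E G).SmoothAt k g) :
    (SmoothStr.ofManifold E G).SmoothAt (fun x => k (s.h g * x * s.c (s.τ g))) 1 :=
  smoothAt_comp_of_contMDiff (m := fun x => s.h g * x * s.c (s.τ g))
    (by rwa [mul_one, h_mul_c]) (contMDiff_mul_mul _ _)

theorem contMDiffAt_curve (hg : g ∈ s.dom) (x : G) :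
    ContMDiffAt 𝓘(ℝ, ℝ) 𝓘(ℝ, E) ∞ (fun r => x * s.c r) (s.τ g) :=
  contMDiffAt_const.mul (s.smooth_c _ (τ_mem hg))

theorem differentiableAt_curve (hg : g ∈ s.dom) {k : G → ℝ}
    (hk : (SmoothStr.ofManifold E G).SmoothAt k g) :
    DifferentiableAt ℝ (fun r => k (s.h g * s.c r)) (s.τ g) := by
  have h1 : ContMDiffAt 𝓘(ℝ, E) 𝓘(ℝ, ℝ) ∞ k (s.h g * s.c (s.τ g)) := by
    rw [h_mul_c]; exact hk.self_of_nhds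
  exact (h1.comp (s.τ g) (contMDiffAt_curve hg _)).contDiffAt.differentiableAt (by simp)

variable [FiniteDimensional ℝ E]

/-- The map `m` sends `H` into a level set of `τ`, and a derivative along a vector of `𝔥` sees only
values on `H`. So the derivation kills `τ`, and the logarithmic derivative `0` is compatible with
it. -/
theorem exists_vertical (hg : g ∈ s.dom) {m : G → G} (hm : ContMDiff 𝓘(ℝ, E) 𝓘(ℝ, E) ∞ m)
    (hm1 : m 1 = g) (hmτ : ∀ x ∈ H, s.τ (m x) = s.τ g) (X : lieAlg E H) :
    ∃ v : BTangentG E H g, bLogDeriv v s.τ = 0 ∧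
      ∀ k, (SmoothStr.ofManifold E G).SmoothAt k g → bDeriv v k = diffOne E (k ∘ m) X := by
  obtain ⟨v, h0, h1⟩ := exists_vec hg (isDerivationAt_pushDeriv hm.contMDiffAt hm1 (X : E)) (l := 0) (by
    rw [derivAt_pushDeriv _ _ _ (smoothAt_τ hg), diffOne_eq_of_eqOn X.2 (F := s.τ ∘ m) (K := fun _ => s.τ g)
      (smoothAt_comp_of_contMDiff (f := s.τ) (m := m) (by rw [hm1]; exact smoothAt_τ hg) hm) (SmoothStr.smoothAt_const _)
      (Eventually.of_forall hmτ), diffOne_const]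
    simp)
  exact ⟨v, h0, fun k hk => by rw [h1, derivAt_pushDeriv _ _ _ hk]⟩

theorem A_spec (X : lieAlg E H) (hg : g ∈ s.dom) : bLogDeriv (s.A X g) s.τ = 0 ∧
    ∀ k, (SmoothStr.ofManifold E G).SmoothAt k g →
      bDeriv (s.A X g) k = diffOne E (fun x => k (s.h g * x * s.c (s.τ g))) X := by
  have h := exists_vertical hg (contMDiff_mul_mul (s.h g) (s.c (s.τ g)))
    (by rw [mul_one, h_mul_c]) (fun x hx => τ_mul_c (H.mul_mem (h_mem hg) hx) (τ_mem hg)) X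
  rw [A, dif_pos (by exact h)]
  exact Exists.choose_spec h

theorem bLogDeriv_A (X : lieAlg E H) (hg : g ∈ s.dom) : bLogDeriv (s.A X g) s.τ = 0 :=
  (A_spec X hg).1

theorem bDeriv_A (X : lieAlg E H) (hg : g ∈ s.dom) {k : G → ℝ}
    (hk : (SmoothStr.ofManifold E G).SmoothAt k g) :
    bDeriv (s.A X g) k = diffOne E (fun x => k (s.h g * x * s.c (s.τ g))) X := (A_spec X hg).2 k hk

theorem bDeriv_A_τ (X : lieAlg E H) (hg : g ∈ s.dom) : bDeriv (s.A X g) s.τ = 0 := by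
  rw [bDeriv_defining _ (isDefiningAt_τ hg), bLogDeriv_A X hg, mul_zero]

/-- Since `τ (h(g) c(r)) = r`, the derivation `τ ∂_τ` sends `τ` to `τ`. The logarithmic derivative
`1` is thus compatible with it, including on `H`, where the derivation itself is zero. -/
theorem B_spec (hg : g ∈ s.dom) : bLogDeriv (s.B g) s.τ = 1 ∧
    ∀ k, (SmoothStr.ofManifold E G).SmoothAt k g →
      bDeriv (s.B g) k = s.τ g * deriv (fun r => k (s.h g * s.c r)) (s.τ g) := by
  let D : Module.Dual ℝ ((SmoothStr.ofManifold E G).alg g) :=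
    { toFun := fun k => s.τ g * deriv (fun r => k.1 (s.h g * s.c r)) (s.τ g)
      map_add' := fun k l => by
        rw [← mul_add]
        exact congrArg _ (deriv_add (differentiableAt_curve hg k.2) (differentiableAt_curve hg l.2))
      map_smul' := fun a k => by
        have h1 : deriv (fun r => (a • k).1 (s.h g * s.c r)) (s.τ g) =
            a * deriv (fun r => k.1 (s.h g * s.c r)) (s.τ g) :=
          deriv_const_mul a (differentiableAt_curve hg k.2)
        rw [h1, RingHom.id_apply, smul_eq_mul]
        ring }
  have hD : IsDerivationAt (SmoothStr.ofManifold E G) g D := by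
    intro k l
    have h1 : deriv (fun r => (k * l).1 (s.h g * s.c r)) (s.τ g) = _ :=
      deriv_mul (differentiableAt_curve hg k.2) (differentiableAt_curve hg l.2)
    rw [h_mul_c] at h1
    change s.τ g * deriv (fun r => (k * l).1 (s.h g * s.c r)) (s.τ g) =
      k.1 g * (s.τ g * _) + l.1 g * (s.τ g * _)
    rw [h1]
    ring
  have hDe : ∀ k, (SmoothStr.ofManifold E G).SmoothAt k g →
      derivAt D k = s.τ g * deriv (fun r => k (s.h g * s.c r)) (s.τ g) := fun k hk => derivAt_of _ hk
  have h : ∃ v : BTangentG E H g, bLogDeriv v s.τ = 1 ∧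
    ∀ k, (SmoothStr.ofManifold E G).SmoothAt k g →
      bDeriv v k = s.τ g * deriv (fun r => k (s.h g * s.c r)) (s.τ g) := by
    obtain ⟨v, h0, h1⟩ := exists_vec hg hD (l := 1) (by
      rw [hDe _ (smoothAt_τ hg)]
      have h1 : (fun r => s.τ (s.h g * s.c r)) =ᶠ[𝓝 (s.τ g)] id := by
        filter_upwards [s.isOpen_J.mem_nhds (τ_mem hg)] with r hr
        exact τ_mul_c (h_mem hg) hr
      rw [h1.deriv_eq, deriv_id])
    exact ⟨v, h0, fun k hk => by rw [h1, hDe k hk]⟩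
  rw [B, dif_pos h]
  exact Exists.choose_spec h

theorem bLogDeriv_B (hg : g ∈ s.dom) : bLogDeriv (s.B g) s.τ = 1 := (B_spec hg).1

theorem bDeriv_B (hg : g ∈ s.dom) {k : G → ℝ} (hk : (SmoothStr.ofManifold E G).SmoothAt k g) :
    bDeriv (s.B g) k = s.τ g * deriv (fun r => k (s.h g * s.c r)) (s.τ g) := (B_spec hg).2 k hk

theorem bDeriv_B_τ (hg : g ∈ s.dom) : bDeriv (s.B g) s.τ = s.τ g := by
  rw [bDeriv_defining _ (isDefiningAt_τ hg), bLogDeriv_B hg, mul_one]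

omit [FiniteDimensional ℝ E] in
theorem smoothAt_diffOne_param {m : G → G → G}
    (hm : ∀ z ∈ s.dom, ContMDiffAt (𝓘(ℝ, E).prod 𝓘(ℝ, E)) 𝓘(ℝ, E) ∞ (Function.uncurry m) (z, 1))
    (hm1 : ∀ z, m z 1 = z) (hg : g ∈ s.dom) {k : G → ℝ}
    (hk : (SmoothStr.ofManifold E G).SmoothAt k g) (X : E) :
    (SmoothStr.ofManifold E G).SmoothAt (fun z => diffOne E (fun x => k (m z x)) X) g := by
  filter_upwards [isOpen_dom.mem_nhds hg, hk] with z hz hkz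
  refine contMDiffAt_diffOne_param (k := fun z x => k (m z x)) X ?_
  exact ContMDiffAt.comp (g := k) (f := Function.uncurry m) (z, (1 : G))
    (by rw [Function.uncurry_apply_pair, hm1]; exact hkz) (hm z hz)

theorem isSmoothFieldAt_of_diffOne {m : G → G → G}
    (hm : ∀ z ∈ s.dom, ContMDiffAt (𝓘(ℝ, E).prod 𝓘(ℝ, E)) 𝓘(ℝ, E) ∞ (Function.uncurry m) (z, 1))
    (hm1 : ∀ z, m z 1 = z) (hg : g ∈ s.dom) {Y : ∀ g, BTangentG E H g} (X : E)
    (hY : ∀ z ∈ s.dom, bLogDeriv (Y z) s.τ = 0 ∧ ∀ k, (SmoothStr.ofManifold E G).SmoothAt k z →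
      bDeriv (Y z) k = diffOne E (fun x => k (m z x)) X) : IsSmoothFieldAt Y g := by
  refine isSmoothFieldAt hg ?_ fun k hk => ?_
  · refine (SmoothStr.ofManifold E G).congr (SmoothStr.smoothAt_const 0) ?_
    filter_upwards [isOpen_dom.mem_nhds hg] with z hz
    exact (hY z hz).1.symm
  · refine (SmoothStr.ofManifold E G).congr (smoothAt_diffOne_param hm hm1 hg hk X) ?_
    filter_upwards [isOpen_dom.mem_nhds hg, (SmoothStr.ofManifold E G).eventually hk] with z hz hkz
    exact ((hY z hz).2 k hkz).symm

omit [FiniteDimensional ℝ E] in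
theorem contMDiffAt_h_mul_c (hg : g ∈ s.dom) :
    ContMDiffAt (𝓘(ℝ, E).prod 𝓘(ℝ, E)) 𝓘(ℝ, E) ∞
      (Function.uncurry fun z x => s.h z * x * s.c (s.τ z)) (g, 1) := by
  have h1 : ContMDiffAt (𝓘(ℝ, E).prod 𝓘(ℝ, E)) 𝓘(ℝ, E) ∞ (fun q : G × G => s.h q.1) (g, 1) :=
    ContMDiffAt.comp (g := s.h) (f := Prod.fst) (g, (1 : G)) (contMDiffAt_h hg) contMDiffAt_fst
  have h2 : ContMDiffAt (𝓘(ℝ, E).prod 𝓘(ℝ, E)) 𝓘(ℝ, E) ∞ (fun q : G × G => s.c (s.τ q.1)) (g, 1) :=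
    ContMDiffAt.comp (g := fun g => s.c (s.τ g)) (f := Prod.fst) (g, (1 : G)) (contMDiffAt_c_τ hg)
      contMDiffAt_fst
  exact (h1.mul contMDiffAt_snd).mul h2

theorem isSmoothFieldAt_A (X : lieAlg E H) (hg : g ∈ s.dom) : IsSmoothFieldAt (s.A X) g :=
  isSmoothFieldAt_of_diffOne (m := fun z x => s.h z * x * s.c (s.τ z))
    (fun _ hz => contMDiffAt_h_mul_c hz) (fun z => by rw [mul_one, h_mul_c]) hg X
    fun _ hz => A_spec X hz

omit [FiniteDimensional ℝ E] in
theorem smoothAt_deriv_curve (hg : g ∈ s.dom) {k : G → ℝ}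
    (hk : (SmoothStr.ofManifold E G).SmoothAt k g) :
    (SmoothStr.ofManifold E G).SmoothAt (fun z => deriv (fun r => k (s.h z * s.c r)) (s.τ z)) g := by
  filter_upwards [isOpen_dom.mem_nhds hg, hk] with z hz hkz
  refine contMDiffAt_deriv_param (k := fun z r => k (s.h z * s.c r)) (contMDiffAt_τ hz) ?_
  have h1 : ContMDiffAt (𝓘(ℝ, E).prod 𝓘(ℝ, ℝ)) 𝓘(ℝ, E) ∞ (fun q : G × ℝ => s.h q.1) (z, s.τ z) :=
    ContMDiffAt.comp (g := s.h) (f := Prod.fst) (z, s.τ z) (contMDiffAt_h hz) contMDiffAt_fst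
  have h2 : ContMDiffAt (𝓘(ℝ, E).prod 𝓘(ℝ, ℝ)) 𝓘(ℝ, E) ∞ (fun q : G × ℝ => s.c q.2) (z, s.τ z) :=
    ContMDiffAt.comp (g := s.c) (f := Prod.snd) (z, s.τ z) (s.smooth_c _ (τ_mem hz))
      contMDiffAt_snd
  exact ContMDiffAt.comp (g := k) (z, s.τ z) (by dsimp only; rw [h_mul_c]; exact hkz) (h1.mul h2)

theorem isSmoothFieldAt_B (hg : g ∈ s.dom) : IsSmoothFieldAt s.B g := by
  refine isSmoothFieldAt hg ?_ fun k hk => ?_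
  · refine (SmoothStr.ofManifold E G).congr (SmoothStr.smoothAt_const 1) ?_
    filter_upwards [isOpen_dom.mem_nhds hg] with z hz
    exact (bLogDeriv_B hz).symm
  · refine (SmoothStr.ofManifold E G).congr ((smoothAt_τ hg).mul (smoothAt_deriv_curve hg hk)) ?_
    filter_upwards [isOpen_dom.mem_nhds hg, (SmoothStr.ofManifold E G).eventually hk] with z hz hkz
    exact (bDeriv_B hz hkz).symm

/-- Iterated derivatives along vertical fields. -/
theorem bDeriv_A_bDeriv_A (X Y : lieAlg E H) (hg : g ∈ s.dom) {k : G → ℝ}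
    (hk : (SmoothStr.ofManifold E G).SmoothAt k g) :
    bDeriv (s.A X g) (fun z => bDeriv (s.A Y z) k) =
      diffOne E (fun x => diffOne E (fun y => k (s.h g * (x * y) * s.c (s.τ g))) Y) X := by
  have h1 : (fun z => bDeriv (s.A Y z) k) =ᶠ[𝓝 g]
      fun z => diffOne E (fun y => k (s.h z * y * s.c (s.τ z))) Y := by
    filter_upwards [isOpen_dom.mem_nhds hg, (SmoothStr.ofManifold E G).eventually hk] with z hz hkz
    exact bDeriv_A Y hz hkz
  have h2 := smoothAt_diffOne_param (s := s) (m := fun z x => s.h z * x * s.c (s.τ z))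
    (fun _ hz => contMDiffAt_h_mul_c hz) (fun z => by rw [mul_one, h_mul_c]) hg hk (Y : E)
  rw [bDeriv_congr _ h1, bDeriv_A X hg h2]
  -- The identity `h (h(g) x c(τ)) = h(g) x` is available for `x ∈ H` only, which suffices for a
  -- derivative along a vector of `𝔥`.
  refine diffOne_eq_of_eqOn X.2 (smoothAt_comp_h_c (s := s) h2) ?_ (Eventually.of_forall fun x hx => ?_)
  · filter_upwards [smoothAt_comp_h_c (s := s) hk] with x hx using contMDiffAt_diffOne (Y : E) hx
  · rw [τ_mul_c (H.mul_mem (h_mem hg) hx) (τ_mem hg),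
      h_mul_c_of_mem (H.mul_mem (h_mem hg) hx) (τ_mem hg)]
    simp only [mul_assoc]

/-- In the product structure the `A X` are the left-invariant fields of the factor `H`, so their
commutators are governed by the bracket of left-invariant fields. -/
theorem bDeriv_A_lie (X Y Z : lieAlg E H) (hZ : (Z : E) = lieBracketOne E G X Y) (hg : g ∈ s.dom)
    {k : G → ℝ} (hk : (SmoothStr.ofManifold E G).SmoothAt k g) :
    bDeriv (s.A Z g) k = bDeriv (s.A X g) (fun z => bDeriv (s.A Y z) k) -
      bDeriv (s.A Y g) (fun z => bDeriv (s.A X z) k) := by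
  rw [bDeriv_A_bDeriv_A X Y hg hk, bDeriv_A_bDeriv_A Y X hg hk, bDeriv_A Z hg hk, hZ,
    diffOne_lieBracketOne (X : E) (Y : E) (smoothAt_comp_h_c (s := s) hk)]

/-- The two fields act on different factors of `H × J`: mixed derivatives of `(x, r) ↦ k (h(g) x
c(r))` commute, and the factor `τ` is constant along `A X`. -/
theorem bDeriv_A_B_comm (X : lieAlg E H) (hg : g ∈ s.dom) {k : G → ℝ}
    (hk : (SmoothStr.ofManifold E G).SmoothAt k g) :
    bDeriv (s.A X g) (fun z => bDeriv (s.B z) k) = bDeriv (s.B g) (fun z => bDeriv (s.A X z) k) := by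
  have h1 : (fun z => bDeriv (s.B z) k) =ᶠ[𝓝 g]
      fun z => s.τ z * deriv (fun r => k (s.h z * s.c r)) (s.τ z) := by
    filter_upwards [isOpen_dom.mem_nhds hg, (SmoothStr.ofManifold E G).eventually hk] with z hz hkz
    exact bDeriv_B hz hkz
  have h2 : (fun z => bDeriv (s.A X z) k) =ᶠ[𝓝 g]
      fun z => diffOne E (fun y => k (s.h z * y * s.c (s.τ z))) X := by
    filter_upwards [isOpen_dom.mem_nhds hg, (SmoothStr.ofManifold E G).eventually hk] with z hz hkz
    exact bDeriv_A X hz hkz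
  have h3 := (smoothAt_τ hg).mul (smoothAt_deriv_curve hg hk)
  have h4 := smoothAt_diffOne_param (s := s) (m := fun z x => s.h z * x * s.c (s.τ z))
    (fun _ hz => contMDiffAt_h_mul_c hz) (fun z => by rw [mul_one, h_mul_c]) hg hk (X : E)
  rw [bDeriv_congr _ h1, bDeriv_congr _ h2, bDeriv_A X hg h3, bDeriv_B hg h4]
  have hku : ∀ᶠ q in 𝓝 ((1 : G), s.τ g), ContMDiffAt (𝓘(ℝ, E).prod 𝓘(ℝ, ℝ)) 𝓘(ℝ, ℝ) ∞
      (Function.uncurry fun x r => k (s.h g * x * s.c r)) q := by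
    have hm : ∀ q : G × ℝ, q.2 ∈ s.J → ContMDiffAt (𝓘(ℝ, E).prod 𝓘(ℝ, ℝ)) 𝓘(ℝ, E) ∞
        (fun q : G × ℝ => s.h g * q.1 * s.c q.2) q := fun q hq =>
      (contMDiffAt_const.mul contMDiffAt_fst).mul
        (ContMDiffAt.comp (g := s.c) (f := Prod.snd) q (s.smooth_c _ hq) contMDiffAt_snd)
    have h5 : Tendsto (fun q : G × ℝ => s.h g * q.1 * s.c q.2) (𝓝 (1, s.τ g)) (𝓝 g) := by
      have := (hm (1, s.τ g) (τ_mem hg)).continuousAt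
      simpa only [ContinuousAt, mul_one, h_mul_c] using this
    filter_upwards [h5.eventually hk, (s.isOpen_J.preimage continuous_snd).mem_nhds (τ_mem hg)]
      with q h6 h7
    exact ContMDiffAt.comp (g := k) q h6 (hm q h7)
  have hx : Tendsto (fun x : G => (x, s.τ g)) (𝓝 1) (𝓝 (1, s.τ g)) :=
    (Continuous.prodMk_left (s.τ g)).tendsto 1
  have hr : Tendsto (fun r : ℝ => ((1 : G), r)) (𝓝 (s.τ g)) (𝓝 (1, s.τ g)) :=
    (Continuous.prodMk_right (1 : G)).tendsto (s.τ g)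
  have h6 : (SmoothStr.ofManifold E G).SmoothAt
      (fun x => deriv (fun r => k (s.h g * x * s.c r)) (s.τ g)) 1 := by
    filter_upwards [hx.eventually hku] with x hx
    exact contMDiffAt_deriv_param (k := fun x r => k (s.h g * x * s.c r)) contMDiffAt_const hx
  have h7 := diffOne_deriv_comm (k := fun x r => k (s.h g * x * s.c r)) (X : E) hku.self_of_nhds
    (by
      filter_upwards [hr.eventually hku] with r hr
      exact ContMDiffAt.comp (f := fun x : G => (x, r)) 1 hr
        (contMDiffAt_id.prodMk contMDiffAt_const)) h6.self_of_nhds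
  have h8 : (fun r => diffOne E (fun y => k (s.h (s.h g * s.c r) * y *
      s.c (s.τ (s.h g * s.c r)))) (X : E)) =ᶠ[𝓝 (s.τ g)]
      fun r => diffOne E (fun x => k (s.h g * x * s.c r)) X := by
    filter_upwards [s.isOpen_J.mem_nhds (τ_mem hg)] with r hr
    rw [τ_mul_c (h_mem hg) hr, h_mul_c_of_mem (h_mem hg) hr]
  rw [h8.deriv_eq, ← h7, ← diffOne_const_mul _ h6]
  refine diffOne_eq_of_eqOn X.2 (smoothAt_comp_h_c (s := s) h3) (h6.const_mul _)
    (Eventually.of_forall fun x hx => ?_)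
  rw [τ_mul_c (H.mul_mem (h_mem hg) hx) (τ_mem hg),
    h_mul_c_of_mem (H.mul_mem (h_mem hg) hx) (τ_mem hg)]

end Slice

end Lie

section

variable {M : Type*} [TopologicalSpace M] {S : SmoothStr M} {Z : Set M} {p : M}

theorem bDeriv_vec_add (v w : bTangent S Z p) (h : M → ℝ) :
    bDeriv (v + w) h = bDeriv v h + bDeriv w h := (bDerivₗ h).map_add v w

theorem bDeriv_vec_smul (a : ℝ) (v : bTangent S Z p) (h : M → ℝ) :
    bDeriv (a • v) h = a * bDeriv v h := (bDerivₗ h).map_smul a v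

theorem bDeriv_vec_zero (h : M → ℝ) : bDeriv (0 : bTangent S Z p) h = 0 := (bDerivₗ h).map_zero

theorem bLogDeriv_vec_add (v w : bTangent S Z p) (f : M → ℝ) :
    bLogDeriv (v + w) f = bLogDeriv v f + bLogDeriv w f := (bLogDerivₗ f).map_add v w

theorem bLogDeriv_vec_smul (a : ℝ) (v : bTangent S Z p) (f : M → ℝ) :
    bLogDeriv (a • v) f = a * bLogDeriv v f := (bLogDerivₗ f).map_smul a v

theorem bLogDeriv_vec_zero (f : M → ℝ) : bLogDeriv (0 : bTangent S Z p) f = 0 :=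
  (bLogDerivₗ f).map_zero

end

/-! ### Covectors in the invariant frame and the dimension of `𝔥` -/

section Lie

variable {E : Type*} [NormedAddCommGroup E] [NormedSpace ℝ E] [FiniteDimensional ℝ E]
  {G : Type*} [TopologicalSpace G] [ChartedSpace E G] [Group G] [LieGroup 𝓘(ℝ, E) ∞ G]
  {H : Subgroup G}

namespace Slice

variable {s : Slice E H} {g : G}

open Classical in
variable (s) in
/-- The vertical fields `A X`, as a linear map in `X`. -/
def Aₗ (g : G) : lieAlg E H →ₗ[ℝ] BTangentG E H g :=
  if hg : g ∈ s.dom then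
    { toFun := fun X => s.A X g
      map_add' := fun X Y => bTangent_ext hg
        (by rw [bLogDeriv_vec_add, bLogDeriv_A _ hg, bLogDeriv_A _ hg, bLogDeriv_A _ hg, add_zero])
        fun k hk => by
          rw [bDeriv_vec_add, bDeriv_A _ hg hk, bDeriv_A _ hg hk, bDeriv_A _ hg hk]
          exact map_add _ _ _
      map_smul' := fun a X => bTangent_ext hg
        (by rw [bLogDeriv_vec_smul, bLogDeriv_A _ hg, bLogDeriv_A _ hg, mul_zero])
        fun k hk => by
          rw [bDeriv_vec_smul, bDeriv_A _ hg hk, bDeriv_A _ hg hk]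
          exact map_smul _ _ _ }
  else 0

theorem Aₗ_apply (hg : g ∈ s.dom) (X : lieAlg E H) : s.Aₗ g X = s.A X g := by
  rw [Aₗ, dif_pos hg]
  rfl

variable (s) in
/-- The frame of the `b`-tangent bundle of `G` given by the fields `A X` and `B`. -/
def frame (g : G) : lieAlg E H × ℝ →ₗ[ℝ] BTangentG E H g :=
  (s.Aₗ g).coprod (LinearMap.toSpanSingleton ℝ _ (s.B g))

theorem frame_apply (hg : g ∈ s.dom) (q : lieAlg E H × ℝ) :
    s.frame g q = s.A q.1 g + q.2 • s.B g := by
  rw [frame, LinearMap.coprod_apply, Aₗ_apply hg, LinearMap.toSpanSingleton_apply]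

theorem bLogDeriv_frame (hg : g ∈ s.dom) (q : lieAlg E H × ℝ) :
    bLogDeriv (s.frame g q) s.τ = q.2 := by
  rw [frame_apply hg, bLogDeriv_vec_add, bLogDeriv_vec_smul, bLogDeriv_A _ hg, bLogDeriv_B hg,
    zero_add, mul_one]

/-- The coefficient of `B` is read off by `d log |τ|`. If `A X` vanishes at `g`, testing on `z ↦ F
(h(g)⁻¹ z c(τ)⁻¹)` shows that every differential at `1` kills `X`. -/
theorem injective_frame (hg : g ∈ s.dom) : Function.Injective (s.frame g) := by
  rw [← LinearMap.ker_eq_bot, LinearMap.ker_eq_bot']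
  rintro ⟨X, a⟩ h
  have ha : a = 0 := by
    have h1 := bLogDeriv_frame hg (X, a)
    rwa [h, bLogDeriv_vec_zero, eq_comm] at h1
  subst ha
  have hX : (X : E) = 0 := by
    refine eq_zero_of_diffOne (G := G) fun F hF => ?_
    have h1 : (SmoothStr.ofManifold E G).SmoothAt
        (fun z => F ((s.h g)⁻¹ * z * (s.c (s.τ g))⁻¹)) g := by
      refine smoothAt_comp_of_contMDiff (m := fun z => (s.h g)⁻¹ * z * (s.c (s.τ g))⁻¹) ?_
        (contMDiff_mul_mul _ _)
      have h2 : (s.h g)⁻¹ * g * (s.c (s.τ g))⁻¹ = 1 := by simp [Slice.h]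
      rwa [h2]
    have h2 := bDeriv_A X hg h1
    have h3 : s.A X g = 0 := by simpa [frame_apply hg] using h
    rw [h3, bDeriv_vec_zero] at h2
    refine Eq.trans ?_ h2.symm
    congr 2
    funext x
    congr 1
    group
  ext1
  · exact Subtype.ext hX
  · rfl

theorem finrank_bTangent (hg : g ∈ s.dom) :
    Module.Finite ℝ (BTangentG E H g) ∧ Module.finrank ℝ (BTangentG E H g) = Module.finrank ℝ E := by
  obtain ⟨b, hb, -, -⟩ := exists_bChart hg
  exact ⟨Module.Finite.equiv (b.coordEquiv hb).symm, by
    rw [(b.coordEquiv hb).finrank_eq]; simp⟩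

/-- The Lie algebra of `H` has codimension one. -/
theorem _root_.BLie.IsBLieGroup.finrank_lieAlg (hH : IsBLieGroup E H) :
    Module.finrank ℝ (lieAlg E H) + 1 = Module.finrank ℝ E := by
  obtain ⟨s, hs⟩ := exists_slice hH (toCoset H 1)
  have h1 : (1 : G) ∈ s.dom := hs
  refine le_antisymm ?_ ?_
  · obtain ⟨h2, h3⟩ := finrank_bTangent h1
    have h4 := LinearMap.finrank_le_finrank_of_injective (injective_frame h1)
    rwa [h3, Module.finrank_prod, Module.finrank_self] at h4
  · set L : E →ₗ[ℝ] ℝ := (diffOne E s.τ).toLinearMap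
    -- A function vanishing on `H` near `1` is `u τ`, and `τ 1 = 0`, so its differential at `1` is a
    -- multiple of `dτ`. Hence the kernel of `dτ` is contained in `𝔥`; the other inequality comes
    -- from injectivity of the frame.
    have h2 : LinearMap.ker L ≤ lieAlg E H := by
      intro X hX F hF h0
      obtain ⟨b, hb, -, hb0⟩ := exists_bChart h1
      have hbτ : ∀ᶠ y in 𝓝 (1 : G), b.x0 y = s.τ y := by
        filter_upwards [b.e.open_source.mem_nhds hb] with y hy using hb0 y hy
      obtain ⟨u, hu, he⟩ := Chart.exists_eq_mul_x (c := b.toChart) hb b.i0 (h := F) hF (by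
        filter_upwards [h0, b.e.open_source.mem_nhds hb] with y hy hys hy0
        exact hy ((b.crit y hys).2 hy0))
      have he' : F =ᶠ[𝓝 1] fun y => u y * s.τ y := by
        filter_upwards [he, hbτ] with y hy hy'
        rw [hy, ← hy']
        rfl
      have hL : diffOne E s.τ X = 0 := hX
      rw [diffOne_congr he', diffOne_mul hu.self_of_nhds (contMDiffAt_τ h1), add_apply, smul_apply,
        smul_apply, hL, (mem_iff_τ h1).1 H.one_mem]
      simp
    have h3 := LinearMap.finrank_range_add_finrank_ker L
    have h4 := Submodule.finrank_mono h2
    have h5 : Module.finrank ℝ (LinearMap.range L) ≤ 1 := by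
      simpa using Submodule.finrank_le (LinearMap.range L)
    omega

theorem bijective_frame (hd : Module.finrank ℝ (lieAlg E H) + 1 = Module.finrank ℝ E)
    (hg : g ∈ s.dom) : Function.Bijective (s.frame g) := by
  obtain ⟨h2, h3⟩ := finrank_bTangent hg
  refine ⟨injective_frame hg, (LinearMap.injective_iff_surjective_of_finrank_eq_finrank ?_).1
    (injective_frame hg)⟩
  rw [h3, Module.finrank_prod, Module.finrank_self, hd]

/-- A covector is determined by its values on the frame. -/
theorem dual_ext (hd : Module.finrank ℝ (lieAlg E H) + 1 = Module.finrank ℝ E) (hg : g ∈ s.dom)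
    {a b : Module.Dual ℝ (BTangentG E H g)} (hA : ∀ X, a (s.A X g) = b (s.A X g))
    (hB : a (s.B g) = b (s.B g)) : a = b := by
  refine LinearMap.ext fun v => ?_
  obtain ⟨q, rfl⟩ := (bijective_frame hd hg).2 v
  rw [frame_apply hg, map_add, map_add, hA, map_smul, map_smul, hB]

theorem exists_dual (hd : Module.finrank ℝ (lieAlg E H) + 1 = Module.finrank ℝ E) (hg : g ∈ s.dom)
    (μ : Module.Dual ℝ (lieAlg E H)) (ξ : ℝ) :
    ∃ a : Module.Dual ℝ (BTangentG E H g), (∀ X, a (s.A X g) = μ X) ∧ a (s.B g) = ξ := by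
  let e := LinearEquiv.ofBijective _ (bijective_frame hd hg)
  have he : ∀ q, e.symm (s.frame g q) = q := fun q => e.symm_apply_apply q
  refine ⟨(μ.coprod (LinearMap.toSpanSingleton ℝ ℝ ξ)) ∘ₗ e.symm.toLinearMap, fun X => ?_, ?_⟩
  · have h1 : s.A X g = s.frame g (X, 0) := by simp [frame_apply hg]
    rw [h1, LinearMap.comp_apply, LinearEquiv.coe_coe, he]
    simp
  · have h1 : s.B g = s.frame g (0, 1) := by
      rw [frame_apply hg, ← Aₗ_apply hg]; simp
    rw [h1, LinearMap.comp_apply, LinearEquiv.coe_coe, he]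
    simp

/-- The defining function `τ` is invariant under left translation by `H`. -/
theorem isBMapAt_left {x : G} (hx : x ∈ H) (hg : g ∈ s.dom) :
    IsBMapAt (SmoothStr.ofManifold E G) (H : Set G) (SmoothStr.ofManifold E G) (H : Set G)
      (fun y => x * y) g := by
  obtain ⟨b, hb, -, hb0⟩ := exists_bChart ((mul_left_mem hx).2 hg)
  have hc : ContMDiff 𝓘(ℝ, E) 𝓘(ℝ, E) ∞ fun y : G => x * y := contMDiff_mul_left
  refine b.isBMapAt hb hc.continuous.continuousAt
    (fun i => smoothAt_comp_of_contMDiff (f := b.x i) (b.smoothAt_x hb i) hc) ?_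
  refine (isDefiningAt_τ hg).congr ?_
  filter_upwards [hc.continuous.continuousAt.eventually (b.e.open_source.mem_nhds hb)] with y hy
  rw [Function.comp_apply, hb0 _ hy, τ_mul_left hx]

/-- Left translation by `x ∈ H` multiplies `h(g)` by `x` and fixes `τ(g)`, so it carries the maps
that define the invariant fields into one another. -/
theorem leftMap_A {x : G} (hx : x ∈ H) (hg : g ∈ s.dom) (X : lieAlg E H) :
    leftMap E H x g (s.A X g) = s.A X (x * g) := by
  have hg' := (mul_left_mem (s := s) hx).2 hg
  refine bTangent_ext hg' ?_ fun k hk => ?_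
  · rw [leftMap, bLogDeriv_bMap (isBMapAt_left hx hg) _ (isDefiningAt_τ hg'), bLogDeriv_A X hg',
      bLogDeriv_congr (f := s.τ ∘ fun y => x * y) (g := s.τ) _ (Eventually.of_forall fun y => τ_mul_left hx), bLogDeriv_A X hg]
  · rw [leftMap, bDeriv_bMap (isBMapAt_left hx hg) _ hk, bDeriv_A X hg'  hk,
      bDeriv_A X hg (k := k ∘ fun y => x * y)
        (smoothAt_comp_of_contMDiff (f := k) hk contMDiff_mul_left), τ_mul_left hx,
      h_mul_left hx]
    simp only [Function.comp_apply, mul_assoc]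

theorem leftMap_B {x : G} (hx : x ∈ H) (hg : g ∈ s.dom) :
    leftMap E H x g (s.B g) = s.B (x * g) := by
  have hg' := (mul_left_mem (s := s) hx).2 hg
  refine bTangent_ext hg' ?_ fun k hk => ?_
  · rw [leftMap, bLogDeriv_bMap (isBMapAt_left hx hg) _ (isDefiningAt_τ hg'), bLogDeriv_B hg',
      bLogDeriv_congr (f := s.τ ∘ fun y => x * y) (g := s.τ) _ (Eventually.of_forall fun y => τ_mul_left hx), bLogDeriv_B hg]
  · rw [leftMap, bDeriv_bMap (isBMapAt_left hx hg) _ hk, bDeriv_B hg' hk,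
      bDeriv_B hg (k := k ∘ fun y => x * y)
        (smoothAt_comp_of_contMDiff (f := k) hk contMDiff_mul_left), τ_mul_left hx, h_mul_left hx]
    simp only [Function.comp_apply, mul_assoc]

/-- The coefficients of a smooth field in the frame are smooth. -/
theorem smoothAt_frame_symm (hd : Module.finrank ℝ (lieAlg E H) + 1 = Module.finrank ℝ E)
    (hg : g ∈ s.dom) {X : ∀ g, BTangentG E H g} (hX : IsSmoothFieldAt X g)
    {q : G → lieAlg E H × ℝ} (hq : ∀ᶠ z in 𝓝 g, X z = s.frame z (q z)) :
    (∀ j, (SmoothStr.ofManifold E G).SmoothAt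
      (fun z => (Module.finBasis ℝ (lieAlg E H)).repr (q z).1 j) g) ∧
    (SmoothStr.ofManifold E G).SmoothAt (fun z => (q z).2) g := by
  obtain ⟨b, hb, -, -⟩ := exists_bChart hg
  set β := Module.finBasis ℝ (lieAlg E H)
  -- The frame is indexed by `Option`: `none` stands for `B` and `some j` for the field of the
  -- `j`-th basis vector of `𝔥`.
  let Y : Option (Fin (Module.finrank ℝ (lieAlg E H))) → ∀ z, BTangentG E H z := fun o z =>
    o.elim (s.B z) fun j => s.A (β j) z
  have hY : ∀ o, IsSmoothFieldAt (Y o) g := by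
    rintro (_ | j)
    · exact isSmoothFieldAt_B hg
    · exact isSmoothFieldAt_A _ hg
  let a : Option (Fin (Module.finrank ℝ (lieAlg E H))) → G → ℝ := fun o z =>
    o.elim (q z).2 fun j => β.repr (q z).1 j
  have hsum : ∀ z ∈ s.dom, ∀ p : lieAlg E H × ℝ, s.frame z p =
      ∑ o : Option (Fin (Module.finrank ℝ (lieAlg E H))),
        (o.elim p.2 fun j => β.repr p.1 j : ℝ) • Y o z := by
    intro z hz p
    rw [Fintype.sum_option, frame_apply hz, add_comm]
    congr 1
    conv_lhs => rw [← β.sum_repr p.1, ← Aₗ_apply hz, map_sum]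
    exact Finset.sum_congr rfl fun j _ => by rw [map_smul, Aₗ_apply hz]; rfl
  have h1 := fun i => b.smoothAt_coeff hb (Fintype.equivOfCardEq (by simp [hd])) hY (by
    rw [Fintype.linearIndependent_iff]
    intro w hw
    let p : lieAlg E H × ℝ := (∑ j, w (some j) • β j, w none)
    have h2 : (fun o : Option (Fin (Module.finrank ℝ (lieAlg E H))) =>
        (o.elim p.2 fun j => β.repr p.1 j : ℝ)) = w := by
      funext o
      rcases o with _ | j
      · rfl
      · simp [p, Finsupp.single_apply]
    have h3 := hsum g hg p
    have h4 : ∀ o, (o.elim p.2 fun j => β.repr p.1 j : ℝ) = w o := congrFun h2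
    simp only [h4, hw] at h3
    have h5 : p = 0 := injective_frame hg (h3.trans (map_zero _).symm)
    intro o
    rw [← h4 o, h5]
    rcases o with _ | j <;> simp) hX (a := a) (by
      filter_upwards [hq, isOpen_dom.mem_nhds hg] with z hz hzd
      rw [hz]
      exact hsum z hzd (q z)) i
  exact ⟨fun j => h1 (some j), h1 none⟩

end Slice

end Lie

/-! ### Charts of products and of normed spaces -/

section Product

variable {X Y : Type*} [TopologicalSpace X] [TopologicalSpace Y] {S : SmoothStr X} {T : SmoothStr Y}
  {ι κ : Type} [Fintype ι] [Fintype κ]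

theorem SmoothStr.smoothAt_fst {f : X → ℝ} {p : X × Y} (hf : S.SmoothAt f p.1) :
    (S.prod T).SmoothAt (fun q => f q.1) p :=
  ⟨Unit, inferInstance, fun z => z (), fun _ q => f q.1, contDiff_apply ℝ ℝ (),
    fun _ => Or.inl ⟨f, hf, rfl⟩, EventuallyEq.rfl⟩

theorem SmoothStr.smoothAt_snd {f : Y → ℝ} {p : X × Y} (hf : T.SmoothAt f p.2) :
    (S.prod T).SmoothAt (fun q => f q.2) p :=
  ⟨Unit, inferInstance, fun z => z (), fun _ q => f q.2, contDiff_apply ℝ ℝ (),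
    fun _ => Or.inr ⟨f, hf, rfl⟩, EventuallyEq.rfl⟩

namespace Chart

/-- The product of two charts. -/
def prod (c : Chart S ι) (d : Chart T κ) : Chart (S.prod T) (ι ⊕ κ) :=
  Chart.ofSmooth ((c.e.prod d.e).transHomeomorph Homeomorph.sumArrowHomeomorphProdArrow.symm)
    (by
      rintro y hy (i | i)
      · exact SmoothStr.smoothAt_fst (c.smoothAt_x hy.1 i)
      · exact SmoothStr.smoothAt_snd (d.smoothAt_x hy.2 i))
    (by
      rintro y hy f ⟨α, _, F, g, hF, hg, hfg⟩
      set e := (c.e.prod d.e).transHomeomorph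
        (Homeomorph.sumArrowHomeomorphProdArrow (X := ℝ) (ι := ι) (ι' := κ)).symm
      have hy' : y ∈ e.source := hy
      have hl : ContDiff ℝ ∞ fun z : ι ⊕ κ → ℝ => z ∘ Sum.inl :=
        contDiff_pi.2 fun i => contDiff_apply ℝ ℝ (Sum.inl i)
      have hr : ContDiff ℝ ∞ fun z : ι ⊕ κ → ℝ => z ∘ Sum.inr :=
        contDiff_pi.2 fun i => contDiff_apply ℝ ℝ (Sum.inr i)
      have hgs : ∀ k, ∀ᶠ z in 𝓝 (e y), ContDiffAt ℝ ∞ (g k ∘ e.symm) z := by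
        intro k
        obtain ⟨h, hh, hk⟩ | ⟨h, hh, hk⟩ := hg k
        · have h1 : Tendsto (fun z : ι ⊕ κ → ℝ => z ∘ Sum.inl) (𝓝 (e y)) (𝓝 (c.e y.1)) :=
            hl.continuous.tendsto (e y)
          filter_upwards [h1.eventually ((c.smooth_iff _ hy.1 h).1 hh)] with z hz
          rw [hk]
          exact ContDiffAt.comp (g := h ∘ c.e.symm) (f := fun z : ι ⊕ κ → ℝ => z ∘ Sum.inl) z hz
            hl.contDiffAt
        · have h1 : Tendsto (fun z : ι ⊕ κ → ℝ => z ∘ Sum.inr) (𝓝 (e y)) (𝓝 (d.e y.2)) :=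
            hr.continuous.tendsto (e y)
          filter_upwards [h1.eventually ((d.smooth_iff _ hy.2 h).1 hh)] with z hz
          rw [hk]
          exact ContDiffAt.comp (g := h ∘ d.e.symm) (f := fun z : ι ⊕ κ → ℝ => z ∘ Sum.inr) z hz
            hr.contDiffAt
      have h1 : Tendsto e.symm (𝓝 (e y)) (𝓝 y) := by
        simpa [ContinuousAt, e.left_inv hy'] using e.symm.continuousAt (e.map_source hy')
      filter_upwards [eventually_all.2 hgs, eventually_eventually_nhds.2 (h1.eventually hfg)]
        with w hw1 hw2
      exact (hF.contDiffAt.comp w (contDiffAt_pi.2 hw1)).congr_of_eventuallyEq hw2)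

/-- The linear chart of a normed space given by linear coordinates. -/
def ofEquiv {W : Type*} [NormedAddCommGroup W] [NormedSpace ℝ W] (L : W ≃L[ℝ] (ι → ℝ)) :
    Chart (SmoothStr.std W) ι where
  e := L.toHomeomorph.toOpenPartialHomeomorph
  smooth_iff y _ f := by
    have e1 : Tendsto L (𝓝 y) (𝓝 (L y)) := L.continuous.tendsto y
    have e2 : Tendsto L.symm (𝓝 (L y)) (𝓝 y) := by
      simpa using L.symm.continuous.tendsto (L y)
    constructor
    · intro h
      change ∀ᶠ z in 𝓝 (L y), ContDiffAt ℝ ∞ (f ∘ L.symm) z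
      filter_upwards [e2.eventually h] with z hz
      exact hz.comp z L.symm.contDiff.contDiffAt
    · intro h
      have h' : ∀ᶠ z in 𝓝 (L y), ContDiffAt ℝ ∞ (f ∘ L.symm) z := h
      filter_upwards [e1.eventually h'] with z hz
      have h2 := hz.comp z L.contDiff.contDiffAt
      have h3 : (f ∘ L.symm) ∘ L = f := by
        funext w; simp
      rwa [h3] at h2

end Chart

end Product

/-! ### The comparison map to the local model and its section -/

section Lie

variable {E : Type*} [NormedAddCommGroup E] [NormedSpace ℝ E] [FiniteDimensional ℝ E]
  {G : Type*} [TopologicalSpace G] [ChartedSpace E G] [Group G]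
  (H : Subgroup G)

variable (E) in
/-- The linear coordinates of the dual of the Lie algebra. -/
def dualCoord : StrongDual ℝ (lieAlg E H) ≃L[ℝ] (Fin (Module.finrank ℝ (lieAlg E H)) → ℝ) :=
  (LinearMap.toContinuousLinearMap.symm.trans
    ((Module.finBasis ℝ (lieAlg E H)).constr ℝ).symm).toContinuousLinearEquiv

theorem dualCoord_apply (μ : StrongDual ℝ (lieAlg E H)) (j : Fin (Module.finrank ℝ (lieAlg E H))) :
    dualCoord E H μ j = μ (Module.finBasis ℝ (lieAlg E H) j) := rfl

variable [LieGroup 𝓘(ℝ, E) ∞ G] {H}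

namespace Slice

variable (s : Slice E H)

/-- The chart of `𝔥* × ᵇT*(G/H)` over the domain of the trivialization. -/
def modelChart : Chart (modelStr E H) (Fin (Module.finrank ℝ (lieAlg E H)) ⊕ (Unit ⊕ Unit)) :=
  (Chart.ofEquiv (dualCoord E H)).prod s.chart.cotangent.toChart

/-- The map of `ᵇT*G` to `𝔥* × ᵇT*(G/H)` given by the invariant frame. -/
def toModel (α : BCotangentG E H) : StrongDual ℝ (lieAlg E H) × BCotangentCoset E H :=
  (LinearMap.toContinuousLinearMap (α.cov ∘ₗ s.Aₗ α.proj),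
    ⟨toCoset H α.proj, s.chart.covec _ fun _ => α.cov (s.B α.proj)⟩)

/-- The coordinates of `toModel`. -/
def u : Fin (Module.finrank ℝ (lieAlg E H)) ⊕ (Unit ⊕ Unit) → BCotangentG E H → ℝ :=
  Sum.elim (fun j => BCotangent.pair (s.A (Module.finBasis ℝ (lieAlg E H) j)))
    (Sum.elim (fun _ => s.τ ∘ BCotangent.proj) fun _ => BCotangent.pair s.B)

variable {s} {α : BCotangentG E H}

theorem mem_modelChart_source {p : StrongDual ℝ (lieAlg E H) × BCotangentCoset E H} :
    p ∈ s.modelChart.e.source ↔ p.2.proj ∈ s.V :=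
  ⟨fun h => h.2, fun h => ⟨mem_univ _, h⟩⟩

theorem x_toModel (hα : α.proj ∈ s.dom) (i : Fin (Module.finrank ℝ (lieAlg E H)) ⊕ (Unit ⊕ Unit)) :
    s.modelChart.x i (s.toModel α) = s.u i α := by
  rcases i with j | (_ | _)
  · exact congrArg α.cov (Aₗ_apply hα _)
  · rfl
  · exact BChart.covec_apply_frame (c := s.chart) hα (fun _ => α.cov (s.B α.proj)) ()

theorem smoothAt_u (hα : α.proj ∈ s.dom)
    (i : Fin (Module.finrank ℝ (lieAlg E H)) ⊕ (Unit ⊕ Unit)) :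
    (BCotangent.str (SmoothStr.ofManifold E G) (H : Set G)).SmoothAt (s.u i) α := by
  rcases i with j | (_ | _)
  · exact smoothAt_pair (isSmoothFieldAt_A _ hα)
  · exact smoothAt_comp_proj (smoothAt_τ hα)
  · exact smoothAt_pair (isSmoothFieldAt_B hα)

omit [FiniteDimensional ℝ E] [LieGroup 𝓘(ℝ, E) ∞ G] in
theorem eventually_mem_dom (hα : α.proj ∈ s.dom) : ∀ᶠ β in 𝓝 α, β.proj ∈ s.dom :=
  BCotangent.continuous_proj.continuousAt.eventually (isOpen_dom.mem_nhds hα)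

theorem smoothAt_x_toModel (hα : α.proj ∈ s.dom)
    (i : Fin (Module.finrank ℝ (lieAlg E H)) ⊕ (Unit ⊕ Unit)) :
    (BCotangent.str (SmoothStr.ofManifold E G) (H : Set G)).SmoothAt
      (s.modelChart.x i ∘ s.toModel) α := by
  refine SmoothStr.congr _ (smoothAt_u hα i) ?_
  filter_upwards [eventually_mem_dom hα] with β hβ
  exact (x_toModel hβ i).symm

theorem toModel_mem (hα : α.proj ∈ s.dom) : s.toModel α ∈ s.modelChart.e.source :=
  mem_modelChart_source.2 hα

theorem continuousAt_toModel (hα : α.proj ∈ s.dom) : ContinuousAt s.toModel α :=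
  s.modelChart.continuousAt_of_x ((eventually_mem_dom hα).mono fun _ h => toModel_mem h)
    fun i => SmoothStr.continuousAt _ (smoothAt_x_toModel hα i)

theorem smoothAt_comp_toModel (hα : α.proj ∈ s.dom)
    {f : StrongDual ℝ (lieAlg E H) × BCotangentCoset E H → ℝ}
    (hf : (modelStr E H).SmoothAt f (s.toModel α)) :
    (BCotangent.str (SmoothStr.ofManifold E G) (H : Set G)).SmoothAt (f ∘ s.toModel) α :=
  s.modelChart.smoothAt_comp (toModel_mem hα) (continuousAt_toModel hα) (smoothAt_x_toModel hα) hf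

open Classical in
variable (s) in
/-- The section of `toModel` over the curve `c`. -/
def ofModel (p : StrongDual ℝ (lieAlg E H) × BCotangentCoset E H) : BCotangentG E H :=
  ⟨s.c (s.t p.2.proj), if h : ∃ a : Module.Dual ℝ (BTangentG E H (s.c (s.t p.2.proj))),
    (∀ X, a (s.A X _) = p.1 X) ∧ a (s.B _) = p.2.cov (s.chart.frame p.2.proj ()) then h.choose
    else 0⟩

section

variable {p : StrongDual ℝ (lieAlg E H) × BCotangentCoset E H}

omit [FiniteDimensional ℝ E] in
theorem ofModel_proj_mem (hp : p.2.proj ∈ s.V) : (s.ofModel p).proj ∈ s.dom :=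
  c_mem_dom (s.t_mem _ hp)

variable (hd : Module.finrank ℝ (lieAlg E H) + 1 = Module.finrank ℝ E)

include hd in
-- The frame is a basis, so a covector with the prescribed values exists and the default value in
-- `ofModel` is not taken.
theorem ofModel_spec (hp : p.2.proj ∈ s.V) :
    (∀ X, (s.ofModel p).cov (s.A X _) = p.1 X) ∧
      (s.ofModel p).cov (s.B _) = p.2.cov (s.chart.frame p.2.proj ()) := by
  have h := exists_dual hd (ofModel_proj_mem hp) p.1.toLinearMap (p.2.cov (s.chart.frame p.2.proj ()))
  have h1 : s.ofModel p = ⟨s.c (s.t p.2.proj), h.choose⟩ := congrArg (BCotangent.mk _) (dif_pos h)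
  rw [h1]
  exact h.choose_spec

include hd in
theorem toModel_ofModel (hp : p.2.proj ∈ s.V) : s.toModel (s.ofModel p) = p := by
  obtain ⟨μ, y, b⟩ := p
  have hy : y ∈ s.V := hp
  have h0 := ofModel_proj_mem hp
  obtain ⟨h1, h2⟩ := ofModel_spec hd hp
  refine s.modelChart.e.injOn (toModel_mem h0) (mem_modelChart_source.2 hp) (funext fun i => ?_)
  change s.modelChart.x i _ = s.modelChart.x i _
  rw [x_toModel h0]
  rcases i with j | (_ | _)
  · exact h1 _
  · exact τ_c (s.t_mem _ hy)
  · exact h2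

include hd in
theorem pair_ofModel {X : ∀ g, BTangentG E H g} (hp : p.2.proj ∈ s.V) {q : lieAlg E H × ℝ}
    (hq : X (s.ofModel p).proj = s.frame _ q) : BCotangent.pair X (s.ofModel p) =
      p.1 q.1 + q.2 * p.2.cov (s.chart.frame p.2.proj ()) := by
  obtain ⟨h1, h2⟩ := ofModel_spec hd hp
  rw [BCotangent.pair, hq, frame_apply (ofModel_proj_mem hp), map_add, h1, map_smul, h2, smul_eq_mul]

omit [FiniteDimensional ℝ E] in
theorem smoothAt_comp_c {k : G → ℝ} {y : CosetSpace H} (hy : y ∈ s.V)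
    (hk : (SmoothStr.ofManifold E G).SmoothAt k (s.c (s.t y))) :
    (cosetStr E H).SmoothAt (fun y => k (s.c (s.t y))) y := by
  have h1 : ∀ᶠ r in 𝓝 (s.t y), ContDiffAt ℝ ∞ (fun r => k (s.c r)) r := by
    filter_upwards [(s.smooth_c _ (s.t_mem y hy)).continuousAt.eventually hk,
      s.isOpen_J.mem_nhds (s.t_mem y hy)] with r h1 h2
    exact (h1.comp r (s.smooth_c r h2)).contDiffAt
  refine SmoothStr.comp_local (ι := Unit) (F := fun z => k (s.c (z ()))) (g := fun _ => s.t) ?_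
    fun _ => smoothAt_t hy
  have h2 : Tendsto (fun z : Unit → ℝ => z ()) (𝓝 fun _ => s.t y) (𝓝 (s.t y)) :=
    (continuous_apply ()).tendsto _
  filter_upwards [h2.eventually h1] with z hz
  exact ContDiffAt.comp (g := fun r => k (s.c r)) (f := fun z : Unit → ℝ => z ()) z hz
    (contDiff_apply ℝ ℝ ()).contDiffAt

omit [FiniteDimensional ℝ E] [LieGroup 𝓘(ℝ, E) ∞ G] in
theorem smoothAt_model_base {k : CosetSpace H → ℝ} (hk : (cosetStr E H).SmoothAt k p.2.proj) :
    (modelStr E H).SmoothAt (fun q => k q.2.proj) p :=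
  SmoothStr.smoothAt_snd (f := k ∘ BCotangent.proj) (smoothAt_comp_proj hk)

include hd in
-- The coefficients of `X` in the invariant frame are smooth on `G`; along the curve `c` they become
-- smooth functions on the base. The pairing is the combination of the linear coordinates of the
-- model with these coefficients.
theorem smoothAt_pair_ofModel {X : ∀ g, BTangentG E H g} (hp : p.2.proj ∈ s.V)
    (hX : IsSmoothFieldAt X (s.ofModel p).proj) :
    (modelStr E H).SmoothAt (fun q => BCotangent.pair X (s.ofModel q)) p := by
  set β := Module.finBasis ℝ (lieAlg E H)
  have h0 : ∀ z : G, ∃ q : lieAlg E H × ℝ, z ∈ s.dom → X z = s.frame z q := fun z => by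
    by_cases hz : z ∈ s.dom
    · obtain ⟨q, hq⟩ := (bijective_frame hd hz).2 (X z)
      exact ⟨q, fun _ => hq.symm⟩
    · exact ⟨0, fun h => (hz h).elim⟩
  choose q hq using h0
  have hg := ofModel_proj_mem hp
  obtain ⟨h1, h2⟩ := smoothAt_frame_symm hd hg hX (q := q) (by
    filter_upwards [isOpen_dom.mem_nhds hg] with z hz using hq z hz)
  have h3 : (modelStr E H).SmoothAt (fun p => (∑ j, β.repr (q (s.c (s.t p.2.proj))).1 j *
      s.modelChart.x (.inl j) p) + (q (s.c (s.t p.2.proj))).2 * s.modelChart.x (.inr (.inr ())) p) p := by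
    refine (SmoothStr.SmoothAt.sum fun j _ => ?_).add ?_
    · exact (smoothAt_model_base (k := fun y => β.repr (q (s.c (s.t y))).1 j)
        (smoothAt_comp_c hp (h1 j))).mul (s.modelChart.smoothAt_x (mem_modelChart_source.2 hp) _)
    · exact (smoothAt_model_base (k := fun y => (q (s.c (s.t y))).2)
        (smoothAt_comp_c hp h2)).mul (s.modelChart.smoothAt_x (mem_modelChart_source.2 hp) _)
  refine SmoothStr.congr _ h3 ?_
  filter_upwards [s.modelChart.e.open_source.mem_nhds (mem_modelChart_source.2 hp)] with p' hp'
  have hp'' := mem_modelChart_source.1 hp'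
  rw [pair_ofModel hd hp'' (hq _ (ofModel_proj_mem hp''))]
  change _ = p'.1 (q (s.c (s.t p'.2.proj))).1 + (q (s.c (s.t p'.2.proj))).2 * _
  congr 1
  conv_rhs => rw [← β.sum_repr (q (s.c (s.t p'.2.proj))).1, map_sum]
  exact Finset.sum_congr rfl fun j _ => (map_smul p'.1 _ _).symm

include hd in
theorem smoothAt_x_ofModel (hp : p.2.proj ∈ s.V)
    {b : BChart (SmoothStr.ofManifold E G) (H : Set G) (Fin (Module.finrank ℝ E))}
    (hb : (s.ofModel p).proj ∈ b.e.source) (i) :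
    (modelStr E H).SmoothAt (b.cotangent.x i ∘ s.ofModel) p := by
  rcases i with i | i
  · exact smoothAt_model_base (k := fun y => b.x i (s.c (s.t y)))
      (smoothAt_comp_c hp (b.smoothAt_x hb i))
  · exact smoothAt_pair_ofModel hd hp (BChart.isSmoothFieldAt_frame hb i)

include hd in
theorem continuousAt_ofModel (hp : p.2.proj ∈ s.V) : ContinuousAt s.ofModel p := by
  obtain ⟨b, hb, -, -⟩ := exists_bChart (ofModel_proj_mem hp)
  refine b.cotangent.toChart.continuousAt_of_x ?_ fun i =>
    SmoothStr.continuousAt _ (smoothAt_x_ofModel hd hp hb i)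
  have h1 : ContinuousAt (fun p : StrongDual ℝ (lieAlg E H) × BCotangentCoset E H =>
      s.c (s.t p.2.proj)) p := by
    have h2 : ContinuousAt s.t p.2.proj := SmoothStr.continuousAt _ (smoothAt_t hp)
    have h3 : ContinuousAt (fun p : StrongDual ℝ (lieAlg E H) × BCotangentCoset E H => p.2.proj) p :=
      (BCotangent.continuous_proj.comp continuous_snd).continuousAt
    exact ContinuousAt.comp (g := s.c) (s.smooth_c _ (s.t_mem _ hp)).continuousAt
      (ContinuousAt.comp (g := s.t) h2 h3)
  exact h1.eventually (b.e.open_source.mem_nhds hb)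

include hd in
theorem smoothAt_comp_ofModel (hp : p.2.proj ∈ s.V) {f : BCotangentG E H → ℝ}
    (hf : (BCotangent.str (SmoothStr.ofManifold E G) (H : Set G)).SmoothAt f (s.ofModel p)) :
    (modelStr E H).SmoothAt (f ∘ s.ofModel) p := by
  obtain ⟨b, hb, -, -⟩ := exists_bChart (ofModel_proj_mem hp)
  exact b.cotangent.toChart.smoothAt_comp (φ := s.ofModel) hb (continuousAt_ofModel hd hp)
    (smoothAt_x_ofModel hd hp hb) hf

end

end Slice

end Lie

/-! ### The reduced space as a manifold -/

section Lie

variable {E : Type*} [NormedAddCommGroup E] [NormedSpace ℝ E] [FiniteDimensional ℝ E]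
  {G : Type*} [TopologicalSpace G] [ChartedSpace E G] [Group G] [LieGroup 𝓘(ℝ, E) ∞ G]
  {H : Subgroup G}

omit [FiniteDimensional ℝ E] [LieGroup 𝓘(ℝ, E) ∞ G] in
theorem smoothAt_comp_toReduced {F : Reduced E H → ℝ} {α : BCotangentG E H}
    (hF : (reducedStr E H).SmoothAt F (toReduced E H α)) :
    (BCotangent.str (SmoothStr.ofManifold E G) (H : Set G)).SmoothAt (F ∘ toReduced E H) α := by
  obtain ⟨U, hU, h⟩ := hF
  exact h α (mem_of_mem_nhds hU)

omit [FiniteDimensional ℝ E] [LieGroup 𝓘(ℝ, E) ∞ G] in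
theorem continuous_reducedProj : Continuous (reducedProj E H) :=
  continuous_quot_lift _ (continuous_toCoset.comp BCotangent.continuous_proj)

namespace Slice

variable {s : Slice E H} {α β : BCotangentG E H}

theorem toModel_eq_iff (hα : α.proj ∈ s.dom) (hβ : β.proj ∈ s.dom) :
    s.toModel α = s.toModel β ↔ ∀ i, s.u i α = s.u i β := by
  simp only [← x_toModel hα, ← x_toModel hβ]
  constructor
  · intro h i
    rw [h]
  · intro h
    exact s.modelChart.e.injOn (toModel_mem hα) (toModel_mem hβ) (funext h)

/-- The fields `A X` and `B` and the function `τ` are invariant under left translation by `H`, so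
the model coordinates are constant on orbits. -/
theorem toModel_of_rel (hα : α.proj ∈ s.dom) (h : cotangentLiftRel E H α β) :
    s.toModel α = s.toModel β := by
  obtain ⟨x, hx, b, rfl, hb⟩ := h
  rw [toModel_eq_iff hα ((mul_left_mem hx).2 hα)]
  rintro (j | (_ | _))
  · change α.cov (s.A _ _) = b (s.A _ _)
    rw [← leftMap_A hx hα, hb]
  · exact (τ_mul_left hx).symm
  · change α.cov (s.B _) = b (s.B _)
    rw [← leftMap_B hx hα, hb]

/-- Equal base coordinates put the two base points in one coset, and the translation relating them
matches the covectors because these agree on an invariant frame. Hence the fibres of `toModel` are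
single orbits. -/
theorem toReduced_eq (hd : Module.finrank ℝ (lieAlg E H) + 1 = Module.finrank ℝ E)
    (hα : α.proj ∈ s.dom) (hβ : β.proj ∈ s.dom) (h : s.toModel α = s.toModel β) :
    toReduced E H α = toReduced E H β := by
  obtain ⟨g, a⟩ := α
  obtain ⟨g', b⟩ := β
  have h1 : toCoset H g = toCoset H g' := congrArg (fun p => p.2.proj) h
  obtain ⟨x, hx, rfl⟩ : ∃ x ∈ H, g' = x * g := ⟨_, toCoset_eq_iff.1 h1, by simp⟩
  have hg : g ∈ s.dom := hα
  refine Quot.sound ⟨x, hx, b, rfl, fun v => ?_⟩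
  have h2 : b ∘ₗ leftMap E H x g = a := by
    refine dual_ext hd hg (fun X => ?_) ?_
    · rw [LinearMap.comp_apply, leftMap_A hx hg, ← Aₗ_apply hg, ← Aₗ_apply hβ]
      exact (DFunLike.congr_fun (congrArg Prod.fst h) X).symm
    · rw [LinearMap.comp_apply, leftMap_B hx hg]
      exact ((toModel_eq_iff hα hβ).1 h (.inr (.inr ()))).symm
  exact DFunLike.congr_fun h2 v

open Classical in
variable (s) in
/-- The map of the reduced space to the model. -/
def reducedToModel : Reduced E H → StrongDual ℝ (lieAlg E H) × BCotangentCoset E H :=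
  -- The value off the domain of the slice is arbitrary; it only has to be constant on orbits.
  Quot.lift (fun α => if α.proj ∈ s.dom then s.toModel α else (0, ⟨toCoset H 1, 0⟩)) (by
    intro α β h
    have h1 : β.proj ∈ s.dom ↔ α.proj ∈ s.dom := by
      obtain ⟨x, hx, b, rfl, -⟩ := h
      exact mul_left_mem hx
    by_cases hα : α.proj ∈ s.dom
    · rw [if_pos hα, if_pos (h1.2 hα), toModel_of_rel hα h]
    · rw [if_neg hα, if_neg (mt h1.1 hα)])

theorem reducedToModel_toReduced (hα : α.proj ∈ s.dom) :
    s.reducedToModel (toReduced E H α) = s.toModel α := if_pos hα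

variable (hd : Module.finrank ℝ (lieAlg E H) + 1 = Module.finrank ℝ E)

variable (s) in
/-- The local trivialization of the reduced space. -/
def trivialization :
    OpenPartialHomeomorph (Reduced E H) (StrongDual ℝ (lieAlg E H) × BCotangentCoset E H) where
  toFun := s.reducedToModel
  invFun p := toReduced E H (s.ofModel p)
  source := reducedProj E H ⁻¹' s.V
  target := {p | p.2.proj ∈ s.V}
  map_source' := by
    rintro ⟨α⟩ (hα : α.proj ∈ s.dom)
    change (s.reducedToModel (toReduced E H α)).2.proj ∈ s.V
    rw [reducedToModel_toReduced hα]
    exact hα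
  map_target' p hp := ofModel_proj_mem hp
  left_inv' := by
    rintro ⟨α⟩ (hα : α.proj ∈ s.dom)
    change toReduced E H (s.ofModel (s.reducedToModel (toReduced E H α))) = toReduced E H α
    rw [reducedToModel_toReduced hα]
    have h1 : (s.toModel α).2.proj ∈ s.V := hα
    exact toReduced_eq hd (ofModel_proj_mem h1) hα (toModel_ofModel hd h1)
  right_inv' p hp := by
    rw [reducedToModel_toReduced (ofModel_proj_mem hp), toModel_ofModel hd hp]
  open_source := s.isOpen_V.preimage continuous_reducedProj
  open_target := s.isOpen_V.preimage (BCotangent.continuous_proj.comp continuous_snd)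
  continuousOn_toFun := by
    rw [(isQuotientMap_quot_mk (r := cotangentLiftRel E H)).continuousOn_isOpen_iff
      (s.isOpen_V.preimage continuous_reducedProj)]
    intro α (hα : α.proj ∈ s.dom)
    refine ((continuousAt_toModel hα).congr ?_).continuousWithinAt
    filter_upwards [eventually_mem_dom hα] with β hβ
    exact (reducedToModel_toReduced hβ).symm
  continuousOn_invFun p hp :=
    (continuous_quot_mk.continuousAt.comp (continuousAt_ofModel hd hp)).continuousWithinAt

theorem trivialization_toReduced (hα : α.proj ∈ s.dom) :
    s.trivialization hd (toReduced E H α) = s.toModel α := reducedToModel_toReduced hα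

theorem comp_trivialization_eventuallyEq (hα : α.proj ∈ s.dom) {W : Type*}
    (f : StrongDual ℝ (lieAlg E H) × BCotangentCoset E H → W) :
    (f ∘ s.trivialization hd) ∘ toReduced E H =ᶠ[𝓝 α] f ∘ s.toModel := by
  filter_upwards [eventually_mem_dom hα] with β hβ
  exact congrArg f (trivialization_toReduced hd hβ)

/-- Smooth functions of the model pull back along the smooth map `toModel`; conversely a function on
the quotient is recovered from its lift by restricting to the smooth section `ofModel`. -/
theorem smoothAt_trivialization_iff {y : Reduced E H} (hy : reducedProj E H y ∈ s.V)
    (f : StrongDual ℝ (lieAlg E H) × BCotangentCoset E H → ℝ) :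
    (modelStr E H).SmoothAt f (s.trivialization hd y) ↔
      (reducedStr E H).SmoothAt (f ∘ s.trivialization hd) y := by
  have hy' : y ∈ (s.trivialization hd).source := hy
  constructor
  · intro h
    refine ⟨reducedProj E H ⁻¹' s.V ∩ s.trivialization hd ⁻¹' {p | (modelStr E H).SmoothAt f p},
      inter_mem ((s.trivialization hd).open_source.mem_nhds hy')
      ((s.trivialization hd).continuousAt hy' (SmoothStr.eventually _ h)), ?_⟩
    intro α hα
    have hα1 : α.proj ∈ s.dom := hα.1
    have hα2 : (modelStr E H).SmoothAt f (s.trivialization hd (toReduced E H α)) := hα.2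
    rw [trivialization_toReduced hd hα1] at hα2
    exact SmoothStr.congr _ (smoothAt_comp_toModel hα1 hα2)
      (comp_trivialization_eventuallyEq hd hα1 f).symm
  · intro h
    set p := s.trivialization hd y with hp
    have hps : p.2.proj ∈ s.V := (s.trivialization hd).map_source hy'
    have h1 : toReduced E H (s.ofModel p) = y := (s.trivialization hd).left_inv hy'
    rw [← h1] at h
    refine SmoothStr.congr _ (smoothAt_comp_ofModel hd hps (smoothAt_comp_toReduced h)) ?_
    filter_upwards [(s.trivialization hd).open_target.mem_nhds
      (show p ∈ (s.trivialization hd).target from hps)] with p' hp'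
    exact congrArg f ((s.trivialization hd).right_inv hp')

theorem smoothAt_comp_trivialization_symm {y : Reduced E H} (hy : reducedProj E H y ∈ s.V)
    {F : Reduced E H → ℝ} :
    (reducedStr E H).SmoothAt F y ↔
      (modelStr E H).SmoothAt (F ∘ (s.trivialization hd).symm) (s.trivialization hd y) := by
  have hy' : y ∈ (s.trivialization hd).source := hy
  have h1 : F =ᶠ[𝓝 y] (F ∘ (s.trivialization hd).symm) ∘ s.trivialization hd := by
    filter_upwards [(s.trivialization hd).open_source.mem_nhds hy'] with z hz
    exact congrArg F ((s.trivialization hd).left_inv hz).symm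
  rw [smoothAt_trivialization_iff hd hy]
  exact ⟨fun h => SmoothStr.congr _ h h1, fun h => SmoothStr.congr _ h h1.symm⟩

variable (s) in
/-- The chart of the reduced space given by a local trivialization. -/
def reducedChart :
    Chart (reducedStr E H) (Fin (Module.finrank ℝ (lieAlg E H)) ⊕ (Unit ⊕ Unit)) where
  e := (s.trivialization hd).trans s.modelChart.e
  smooth_iff y hy F := by
    rw [OpenPartialHomeomorph.trans_source] at hy
    rw [smoothAt_comp_trivialization_symm hd hy.1, s.modelChart.smooth_iff _ hy.2]
    rfl

theorem mem_reducedChart_source {y : Reduced E H} :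
    y ∈ (s.reducedChart hd).e.source ↔ reducedProj E H y ∈ s.V := by
  rw [show (s.reducedChart hd).e = (s.trivialization hd).trans s.modelChart.e from rfl,
    OpenPartialHomeomorph.trans_source]
  exact ⟨fun h => h.1, fun h => ⟨h, mem_modelChart_source.2 ((s.trivialization hd).map_source h)⟩⟩

end Slice

/-- The reduced space is a manifold. -/
theorem isManifold_reducedStr (hH : IsBLieGroup E H) :
    (reducedStr E H).IsManifold (Module.finrank ℝ E + 1) := by
  have hd := hH.finrank_lieAlg
  have : IsTopologicalGroup G := topologicalGroup_of_lieGroup 𝓘(ℝ, E) ∞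
  have : T2Space (CosetSpace H) := t2Space_cosetSpace hH.isClosed
  have : T2Space (Reduced E H) := by
    refine ⟨fun y z hyz => ?_⟩
    -- Points over different cosets are separated in the Hausdorff base; points over one coset lie
    -- in a common chart.
    by_cases h : reducedProj E H y = reducedProj E H z
    · obtain ⟨s, hs⟩ := exists_slice hH (reducedProj E H y)
      have hy : y ∈ (s.reducedChart hd).e.source := (Slice.mem_reducedChart_source hd).2 hs
      have hz : z ∈ (s.reducedChart hd).e.source := (Slice.mem_reducedChart_source hd).2 (h ▸ hs)
      obtain ⟨U, V, hU, hV, hyU, hzV, hUV⟩ := t2_separation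
        ((s.reducedChart hd).e.injOn.ne hy hz hyz)
      refine ⟨_, _, (s.reducedChart hd).e.isOpen_inter_preimage hU,
        (s.reducedChart hd).e.isOpen_inter_preimage hV, ⟨hy, hyU⟩, ⟨hz, hzV⟩, ?_⟩
      exact (hUV.preimage _).mono inter_subset_right inter_subset_right
    · obtain ⟨U, V, hU, hV, hyU, hzV, hUV⟩ := t2_separation h
      exact ⟨_, _, hU.preimage continuous_reducedProj, hV.preimage continuous_reducedProj, hyU, hzV,
        hUV.preimage _⟩
  refine SmoothStr.isManifold_of_chart
    (ι := Fin (Module.finrank ℝ (lieAlg E H)) ⊕ (Unit ⊕ Unit)) (fun y => ?_) ?_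
  · obtain ⟨s, hs⟩ := exists_slice hH (reducedProj E H y)
    exact ⟨s.reducedChart hd, (Slice.mem_reducedChart_source hd).2 hs⟩
  -- Codimension one of `𝔥` gives `dim 𝔥 + 2 = dim G + 1`.
  · simp only [Fintype.card_sum, Fintype.card_fin, Fintype.card_unit]
    omega

/-- The coset space is a one-dimensional `b`-manifold. -/
theorem isManifold_cosetStr (hH : IsBLieGroup E H) : (cosetStr E H).IsManifold 1 := by
  have : IsTopologicalGroup G := topologicalGroup_of_lieGroup 𝓘(ℝ, E) ∞
  have : T2Space (CosetSpace H) := t2Space_cosetSpace hH.isClosed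
  refine SmoothStr.isManifold_of_chart (ι := Unit) (fun y => ?_) (by simp)
  obtain ⟨s, hs⟩ := exists_slice hH y
  exact ⟨s.chart.toChart, hs⟩

theorem exists_bChart_coset (hH : IsBLieGroup E H) (y : CosetSpace H) :
    ∃ c : BChart (cosetStr E H) (critPt H) Unit, y ∈ c.e.source := by
  obtain ⟨s, hs⟩ := exists_slice hH y
  exact ⟨s.chart, hs⟩

theorem exists_bChart_group (hH : IsBLieGroup E H) (g : G) :
    ∃ c : BChart (SmoothStr.ofManifold E G) (H : Set G) (Fin (Module.finrank ℝ E)),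
      g ∈ c.e.source := by
  obtain ⟨s, hs⟩ := exists_slice hH (toCoset H g)
  obtain ⟨b, hb, -⟩ := Slice.exists_bChart (s := s) hs
  exact ⟨b, hb⟩

end Lie

/-! ### Partial derivatives on a product of coordinate spaces -/

section SumElim

variable {ι κ : Type} [Fintype ι] [Fintype κ] [DecidableEq ι] [DecidableEq κ]

theorem fderiv_sumElim {W : Type*} [NormedAddCommGroup W] [NormedSpace ℝ W] {F : (ι ⊕ κ → ℝ) → ℝ}
    (L : W →L[ℝ] (ι → ℝ)) (b : κ → ℝ) {w : W} (hF : DifferentiableAt ℝ F (Sum.elim (L w) b)) (v : W) :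
    fderiv ℝ (fun w => F (Sum.elim (L w) b)) w v = ∑ i, L v i * pd F (Sum.elim (L w) b) (.inl i) := by
  let j : W →L[ℝ] (ι ⊕ κ → ℝ) :=
    ContinuousLinearMap.pi (Sum.elim (fun i => (ContinuousLinearMap.proj i).comp L) fun _ => 0)
  have h1 : HasFDerivAt (fun w => (Sum.elim (L w) b : ι ⊕ κ → ℝ)) j w := by
    rw [hasFDerivAt_pi']
    rintro (i | i)
    · exact ((ContinuousLinearMap.proj i).comp L).hasFDerivAt
    · exact hasFDerivAt_const _ _
  have h2 := (hF.hasFDerivAt.comp w h1).fderiv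
  rw [show (fun w => F (Sum.elim (L w) b)) = F ∘ fun w => (Sum.elim (L w) b : ι ⊕ κ → ℝ) from rfl, h2]
  change fderiv ℝ F (Sum.elim (L w) b) (j v) = _
  rw [fderiv_eq_sum_pd, Fintype.sum_sum_type]
  have h4 : ∀ i, j v (.inr i) = 0 := fun i => rfl
  have h5 : ∀ i, j v (.inl i) = L v i := fun i => rfl
  simp only [h4, h5, zero_mul, Finset.sum_const_zero, add_zero]

theorem pd_sumElim {F : (ι ⊕ κ → ℝ) → ℝ} {a : ι → ℝ} {z : κ → ℝ} (hF : DifferentiableAt ℝ F (Sum.elim a z)) (i : κ) :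
    pd (fun z => F (Sum.elim a z)) z i = pd F (Sum.elim a z) (.inr i) := by
  let j : (κ → ℝ) →L[ℝ] (ι ⊕ κ → ℝ) :=
    ContinuousLinearMap.pi (Sum.elim (fun _ => 0) fun i => ContinuousLinearMap.proj i)
  have h1 : HasFDerivAt (fun z : κ → ℝ => (Sum.elim a z : ι ⊕ κ → ℝ)) j z := by
    rw [hasFDerivAt_pi']
    rintro (i | i)
    · exact hasFDerivAt_const _ _
    · exact (ContinuousLinearMap.proj (R := ℝ) (φ := fun _ : κ => ℝ) i).hasFDerivAt
  have h2 := (hF.hasFDerivAt.comp z h1).fderiv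
  rw [pd, pd, show (fun z => F (Sum.elim a z)) = F ∘ fun z => (Sum.elim a z : ι ⊕ κ → ℝ) from rfl, h2]
  change fderiv ℝ F (Sum.elim a z) (j (Pi.single i 1)) = _
  congr 1
  funext k
  rcases k with k | k
  · change (0 : ℝ) = (Pi.single (.inr i) 1 : ι ⊕ κ → ℝ) (.inl k)
    simp
  · change (Pi.single i 1 : κ → ℝ) k = (Pi.single (.inr i) 1 : ι ⊕ κ → ℝ) (.inr k)
    simp only [Pi.single_apply, Sum.inr.injEq]

/-- The differential of a function of the coordinates on a dual space. -/
theorem evalEquiv_symm_fderiv {W : Type*} [NormedAddCommGroup W] [NormedSpace ℝ W]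
    [FiniteDimensional ℝ W] {F : (ι ⊕ κ → ℝ) → ℝ} (L : StrongDual ℝ W →L[ℝ] (ι → ℝ)) (e : ι → W)
    (hL : ∀ μ i, L μ i = μ (e i)) (b : κ → ℝ) {μ : StrongDual ℝ W}
    (hF : DifferentiableAt ℝ F (Sum.elim (L μ) b)) :
    (Module.evalEquiv ℝ W).symm ((fderiv ℝ (fun μ => F (Sum.elim (L μ) b)) μ).toLinearMap ∘ₗ
      LinearMap.toContinuousLinearMap.toLinearMap) =
        ∑ i, pd F (Sum.elim (L μ) b) (.inl i) • e i := by
  rw [LinearEquiv.symm_apply_eq]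
  refine LinearMap.ext fun ν => ?_
  rw [Module.evalEquiv_apply, map_sum, LinearMap.sum_apply]
  refine (fderiv_sumElim L b hF (LinearMap.toContinuousLinearMap ν)).trans
    (Finset.sum_congr rfl fun i _ => ?_)
  rw [map_smul, LinearMap.smul_apply, smul_eq_mul, mul_comm, hL, LinearMap.coe_toContinuousLinearMap',
    Module.Dual.eval_apply]

end SumElim

/-! ### Brackets of the coordinates upstairs and in the model -/

section Lie

variable {E : Type*} [NormedAddCommGroup E] [NormedSpace ℝ E] [FiniteDimensional ℝ E]
  {G : Type*} [TopologicalSpace G] [ChartedSpace E G] [Group G] [LieGroup 𝓘(ℝ, E) ∞ G]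
  {H : Subgroup G}

variable (H) in
/-- The Lie bracket of the Lie algebra of `H`, as a bilinear map. -/
def lieₗ : lieAlg E H →ₗ[ℝ] lieAlg E H →ₗ[ℝ] lieAlg E H :=
  haveI : LieGroup 𝓘(ℝ, E) (minSmoothness ℝ 3) G :=
    LieGroup.of_le (n := ∞) (by simp; exact WithTop.coe_le_coe.2 le_top)
  LinearMap.mk₂ ℝ (fun X Y => ⟨lieBracketOne E G X Y, lie_mem H X.2 Y.2⟩)
    (fun X Y Z => Subtype.ext (add_lie (L := GroupLieAlgebra 𝓘(ℝ, E) G)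
      (M := GroupLieAlgebra 𝓘(ℝ, E) G) (X : E) (Y : E) (Z : E)))
    (fun a X Y => Subtype.ext (smul_lie (L := GroupLieAlgebra 𝓘(ℝ, E) G)
      (M := GroupLieAlgebra 𝓘(ℝ, E) G) a (X : E) (Y : E)))
    (fun X Y Z => Subtype.ext (lie_add (L := GroupLieAlgebra 𝓘(ℝ, E) G)
      (M := GroupLieAlgebra 𝓘(ℝ, E) G) (X : E) (Y : E) (Z : E)))
    (fun a X Y => Subtype.ext (lie_smul (L := GroupLieAlgebra 𝓘(ℝ, E) G)
      (M := GroupLieAlgebra 𝓘(ℝ, E) G) a (X : E) (Y : E)))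

theorem lieMinus_eq (f k : StrongDual ℝ (lieAlg E H) → ℝ) (μ : StrongDual ℝ (lieAlg E H)) :
    lieMinus f k μ = -μ (lieₗ H (dualGradient f μ) (dualGradient k μ)) := rfl

namespace Slice

variable (s : Slice E H)

/-- The brackets of the coordinates of the model. -/
def struct (p : StrongDual ℝ (lieAlg E H) × BCotangentCoset E H) :
    Fin (Module.finrank ℝ (lieAlg E H)) ⊕ (Unit ⊕ Unit) →
      Fin (Module.finrank ℝ (lieAlg E H)) ⊕ (Unit ⊕ Unit) → ℝ
  | .inl i, .inl j => -p.1 (lieₗ H (Module.finBasis ℝ _ i) (Module.finBasis ℝ _ j))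
  | .inr (.inl _), .inr (.inr _) => s.t p.2.proj
  | .inr (.inr _), .inr (.inl _) => -s.t p.2.proj
  | _, _ => 0

variable {s} {α : BCotangentG E H}

omit [FiniteDimensional ℝ E] [LieGroup 𝓘(ℝ, E) ∞ G] in
/-- Fields with constant logarithmic derivative of the defining function: the bracket in
coordinates. -/
theorem coord_bracket {g : G} {b : BChart (SmoothStr.ofManifold E G) (H : Set G)
    (Fin (Module.finrank ℝ E))} (hb : g ∈ b.e.source) (hb0 : ∀ y ∈ b.e.source, b.x0 y = s.τ y)
    {X Y : ∀ g, BTangentG E H g} {l m : ℝ} (hX : ∀ᶠ z in 𝓝 g, bLogDeriv (X z) s.τ = l)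
    (hY : ∀ᶠ z in 𝓝 g, bLogDeriv (Y z) s.τ = m) {v : BTangentG E H g} (hv : bLogDeriv v s.τ = 0)
    (h : ∀ k, (SmoothStr.ofManifold E G).SmoothAt k g →
      bDeriv v k = bDeriv (X g) (fun z => bDeriv (Y z) k) - bDeriv (Y g) (fun z => bDeriv (X z) k))
    (j) : b.coord g v j =
      bDeriv (X g) (fun z => b.coord z (Y z) j) - bDeriv (Y g) (fun z => b.coord z (X z) j) := by
  -- The logarithmic coordinates of both fields are constant near `g`, so their derivatives vanish;
  -- the other coordinates are derivatives of ordinary functions.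
  by_cases hj : j = b.i0
  · have h1 : ∀ y ∈ b.e.source, b.x0 =ᶠ[𝓝 y] s.τ := fun y hy => by
      filter_upwards [b.e.open_source.mem_nhds hy] with z hz using hb0 z hz
    have h2 : ∀ {Y : ∀ g, BTangentG E H g} {m : ℝ}, (∀ᶠ z in 𝓝 g, bLogDeriv (Y z) s.τ = m) →
        (fun z => b.coord z (Y z) j) =ᶠ[𝓝 g] fun _ => m := by
      intro Y m hY
      filter_upwards [hY, b.e.open_source.mem_nhds hb] with z hz hzb
      rw [hj, BChart.coord_i0, bLogDeriv_congr _ (h1 z hzb), hz]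
    rw [bDeriv_congr _ (h2 hX), bDeriv_congr _ (h2 hY), bDeriv_const, bDeriv_const, hj,
      BChart.coord_i0, bLogDeriv_congr _ (h1 g hb), hv, sub_zero]
  · simp only [BChart.coord_ne _ hj]
    exact h _ (b.smoothAt_x hb j)

/-- Brackets of linear functions are minus those of the fields, and `[A X, A Y] = A [X, Y]`, `[A X,
B] = 0`, `A X τ = 0`, `B τ = τ`. The values depend on `α` only through its image in the model. -/
theorem poisson_u_u
    (hσ : IsNondegenerate (canonicalForm (SmoothStr.ofManifold E G) (H : Set G)))
    (hα : α.proj ∈ s.dom) (i j : Fin (Module.finrank ℝ (lieAlg E H)) ⊕ (Unit ⊕ Unit)) :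
    poisson (canonicalForm (SmoothStr.ofManifold E G) (H : Set G)) (s.u i) (s.u j) α =
      s.struct (s.toModel α) i j := by
  obtain ⟨b, hb, -, hb0⟩ := exists_bChart hα
  have hA : ∀ X : lieAlg E H, ∀ᶠ z in 𝓝 α.proj, bLogDeriv (s.A X z) s.τ = 0 := fun X => by
    filter_upwards [isOpen_dom.mem_nhds hα] with z hz using bLogDeriv_A X hz
  have hB : ∀ᶠ z in 𝓝 α.proj, bLogDeriv (s.B z) s.τ = 1 := by
    filter_upwards [isOpen_dom.mem_nhds hα] with z hz using bLogDeriv_B hz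
  have hAB : ∀ X : lieAlg E H, poisson (canonicalForm (SmoothStr.ofManifold E G) (H : Set G))
      (BCotangent.pair (s.A X)) (BCotangent.pair s.B) α = 0 := fun X => by
    rw [BChart.poisson_pair_pair hσ hb (isSmoothFieldAt_A X hα) (isSmoothFieldAt_B hα)
      (b := 0) (coord_bracket hb hb0 (hA X) hB (bLogDeriv_vec_zero _) fun k hk => by
        rw [bDeriv_vec_zero, bDeriv_A_B_comm X hα hk, sub_self]), map_zero, neg_zero]
  have hAτ : ∀ X : lieAlg E H, poisson (canonicalForm (SmoothStr.ofManifold E G) (H : Set G))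
      (BCotangent.pair (s.A X)) (s.τ ∘ BCotangent.proj) α = 0 := fun X => by
    rw [BChart.poisson_pair_comp_proj hσ hb (isSmoothFieldAt_A X hα) (smoothAt_τ hα),
      bDeriv_A_τ X hα, neg_zero]
  have hBτ : poisson (canonicalForm (SmoothStr.ofManifold E G) (H : Set G))
      (BCotangent.pair s.B) (s.τ ∘ BCotangent.proj) α = -s.τ α.proj := by
    rw [BChart.poisson_pair_comp_proj hσ hb (isSmoothFieldAt_B hα) (smoothAt_τ hα), bDeriv_B_τ hα]
  have hself : ∀ F, poisson (canonicalForm (SmoothStr.ofManifold E G) (H : Set G)) F F α = 0 :=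
    fun F => by have := hσ.poisson_skew F F α; linarith
  rcases i with i | (i | i) <;> rcases j with j | (j | j)
  · change poisson _ (BCotangent.pair (s.A _)) (BCotangent.pair (s.A _)) α = -(α.cov (s.Aₗ _ _))
    rw [Aₗ_apply hα]
    refine BChart.poisson_pair_pair hσ hb (isSmoothFieldAt_A _ hα) (isSmoothFieldAt_A _ hα)
      (coord_bracket hb hb0 (hA _) (hA _) (bLogDeriv_A _ hα) fun k hk => ?_)
    exact bDeriv_A_lie _ _ _ rfl hα hk
  · exact hAτ _
  · exact hAB _
  · exact (hσ.poisson_skew _ _ α).trans ((congrArg Neg.neg (hAτ _)).trans neg_zero)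
  · exact hself _
  · exact (hσ.poisson_skew _ _ α).trans ((congrArg Neg.neg hBτ).trans (neg_neg _))
  · exact (hσ.poisson_skew _ _ α).trans ((congrArg Neg.neg (hAB _)).trans neg_zero)
  · exact hBτ
  · exact hself _

/-- The canonical bracket of functions which factor through the model. -/
theorem canonicalBracket_comp_toModel
    (hσ : IsNondegenerate (canonicalForm (SmoothStr.ofManifold E G) (H : Set G)))
    (hα : α.proj ∈ s.dom) {f k : StrongDual ℝ (lieAlg E H) × BCotangentCoset E H → ℝ}
    (hf : (modelStr E H).SmoothAt f (s.toModel α)) (hk : (modelStr E H).SmoothAt k (s.toModel α)) :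
    canonicalBracket E H (f ∘ s.toModel) (k ∘ s.toModel) α = ∑ i, ∑ j,
      s.modelChart.d i f (s.toModel α) * s.modelChart.d j k (s.toModel α) *
        s.struct (s.toModel α) i j := by
  have hx : (fun i => s.u i α) = s.modelChart.e (s.toModel α) :=
    funext fun i => (x_toModel hα i).symm
  have h1 : ∀ f : StrongDual ℝ (lieAlg E H) × BCotangentCoset E H → ℝ,
      f ∘ s.toModel =ᶠ[𝓝 α] fun β => (f ∘ s.modelChart.e.symm) fun i => s.u i β := fun f => by
    filter_upwards [(continuousAt_toModel hα).eventually
      (s.modelChart.exists_eq_comp (toModel_mem hα) f), eventually_mem_dom hα] with β h1 h2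
    rw [Function.comp_apply, h1]
    congr 1
    exact funext fun i => x_toModel h2 i
  rw [canonicalBracket, hσ.poisson_congr (h1 f) (h1 k), hσ.poisson_comp
    (by rw [hx]; exact (s.modelChart.smooth_iff _ (toModel_mem hα) f).1 hf)
    (by rw [hx]; exact (s.modelChart.smooth_iff _ (toModel_mem hα) k).1 hk) (smoothAt_u hα)]
  simp only [poisson_u_u hσ hα, hx]
  rfl

section

variable {p : StrongDual ℝ (lieAlg E H) × BCotangentCoset E H}

theorem dualGradient_eq (hp : p.2.proj ∈ s.V)
    {f : StrongDual ℝ (lieAlg E H) × BCotangentCoset E H → ℝ} (hf : (modelStr E H).SmoothAt f p) :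
    dualGradient (fun μ => f (μ, p.2)) p.1 =
      ∑ i, s.modelChart.d (.inl i) f p • Module.finBasis ℝ (lieAlg E H) i := by
  have hp' := mem_modelChart_source.2 hp
  have hx : ∀ μ, s.modelChart.e (μ, p.2) =
      Sum.elim (dualCoord E H μ) (fun i => s.chart.cotangent.x i p.2) := by
    intro μ
    funext i
    rcases i with i | i <;> rfl
  have h3 : (fun μ => f (μ, p.2)) = fun μ => (f ∘ s.modelChart.e.symm)
      (Sum.elim (dualCoord E H μ) (fun i => s.chart.cotangent.x i p.2)) := by
    funext μ
    rw [← hx]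
    have h4 : (μ, p.2) ∈ s.modelChart.e.source := mem_modelChart_source.2 hp
    exact congrArg f (s.modelChart.e.left_inv h4).symm
  have h1 : DifferentiableAt ℝ (f ∘ s.modelChart.e.symm)
      (Sum.elim (dualCoord E H p.1) (fun i => s.chart.cotangent.x i p.2)) := by
    rw [← hx]
    exact Chart.differentiableAt hp' hf
  have h4 : ∀ i, s.modelChart.d (.inl i) f p = pd (f ∘ s.modelChart.e.symm)
      (Sum.elim (dualCoord E H p.1) (fun i => s.chart.cotangent.x i p.2)) (.inl i) := fun i => by
    rw [← hx]
    rfl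
  have h5 := evalEquiv_symm_fderiv (dualCoord E H).toContinuousLinearMap
    (Module.finBasis ℝ (lieAlg E H)) (fun μ i => dualCoord_apply _ μ i) _ h1
  rw [dualGradient, h3]
  simp only [h4]
  exact h5

theorem lieMinus_eq_sum (hp : p.2.proj ∈ s.V)
    {f k : StrongDual ℝ (lieAlg E H) × BCotangentCoset E H → ℝ} (hf : (modelStr E H).SmoothAt f p)
    (hk : (modelStr E H).SmoothAt k p) :
    lieMinus (fun μ => f (μ, p.2)) (fun μ => k (μ, p.2)) p.1 = ∑ i, ∑ j,
      s.modelChart.d (.inl i) f p * s.modelChart.d (.inl j) k p * s.struct p (.inl i) (.inl j) := by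
  rw [lieMinus_eq, dualGradient_eq hp hf, dualGradient_eq hp hk]
  simp only [map_sum, map_smul, LinearMap.sum_apply, LinearMap.smul_apply, smul_eq_mul, struct,
    ← Finset.sum_neg_distrib, Finset.mul_sum]
  rw [Finset.sum_comm]
  exact Finset.sum_congr rfl fun i _ => Finset.sum_congr rfl fun j _ => by ring

/-- The fibre coordinate of `ᵇT*(G/H)` is the pairing with `t ∂_t`, so its bracket with `t` is `-t`.
-/
theorem poisson_coset_x (hσ : IsNondegenerate (canonicalForm (cosetStr E H) (critPt H)))
    (hp : p.2.proj ∈ s.V) (i j : Unit ⊕ Unit) :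
    poisson (canonicalForm (cosetStr E H) (critPt H)) (s.chart.cotangent.x i)
      (s.chart.cotangent.x j) p.2 = s.struct p (.inr i) (.inr j) := by
  have hself : ∀ F, poisson (canonicalForm (cosetStr E H) (critPt H)) F F p.2 = 0 :=
    fun F => by have := hσ.poisson_skew F F p.2; linarith
  have h1 : poisson (canonicalForm (cosetStr E H) (critPt H)) (s.chart.cotangent.x (.inr ()))
      (s.chart.cotangent.x (.inl ())) p.2 = -s.t p.2.proj := by
    rw [BChart.cotangent_x_inl, BChart.cotangent_x_inr, BChart.poisson_pair_comp_proj hσ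
      (c := s.chart) hp (BChart.isSmoothFieldAt_frame hp ()) (s.chart.smoothAt_x hp ()),
      BChart.bDeriv_x hp, BChart.coord_frame hp]
    simp [BChart.wt]
    rfl
  rcases i with (i | i) <;> rcases j with (j | j)
  · exact hself _
  · exact (hσ.poisson_skew _ _ _).trans ((congrArg Neg.neg h1).trans (neg_neg _))
  · exact h1
  · exact hself _

/-- The model bracket is block diagonal, with the Lie–Poisson block linear in `μ` and the canonical
block `±t`. These are the structure functions found upstairs in `poisson_u_u`, so the chain rule
gives the same formula on both sides. -/
theorem modelBracket_eq_sum (hσ : IsNondegenerate (canonicalForm (cosetStr E H) (critPt H)))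
    (hp : p.2.proj ∈ s.V) {f k : StrongDual ℝ (lieAlg E H) × BCotangentCoset E H → ℝ}
    (hf : (modelStr E H).SmoothAt f p) (hk : (modelStr E H).SmoothAt k p) :
    modelBracket E H f k p = ∑ i, ∑ j,
      s.modelChart.d i f p * s.modelChart.d j k p * s.struct p i j := by
  have hp' := mem_modelChart_source.2 hp
  have hx : s.modelChart.e p =
      Sum.elim (dualCoord E H p.1) (fun i => s.chart.cotangent.x i p.2) := by
    funext i
    rcases i with i | i <;> rfl
  have h1 : ∀ f : StrongDual ℝ (lieAlg E H) × BCotangentCoset E H → ℝ,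
      (fun b => f (p.1, b)) =ᶠ[𝓝 p.2] fun b => (fun z => (f ∘ s.modelChart.e.symm)
        (Sum.elim (dualCoord E H p.1) z)) fun i => s.chart.cotangent.x i b := fun f => by
    filter_upwards [(s.isOpen_V.preimage BCotangent.continuous_proj).mem_nhds hp] with b hb
    have h2 : s.modelChart.e (p.1, b) =
        Sum.elim (dualCoord E H p.1) (fun i => s.chart.cotangent.x i b) := by
      funext i
      rcases i with i | i <;> rfl
    have h3 : (p.1, b) ∈ s.modelChart.e.source := mem_modelChart_source.2 hb
    simp only [Function.comp_apply, ← h2, s.modelChart.e.left_inv h3]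
  have hcont : Tendsto (fun z : Unit ⊕ Unit → ℝ =>
      (Sum.elim (dualCoord E H p.1) z : Fin (Module.finrank ℝ (lieAlg E H)) ⊕ (Unit ⊕ Unit) → ℝ))
      (𝓝 fun i => s.chart.cotangent.x i p.2) (𝓝 (s.modelChart.e p)) := by
    rw [hx]
    refine Continuous.tendsto (continuous_pi fun i => ?_) _
    rcases i with i | i
    · exact continuous_const
    · exact continuous_apply i
  have h2 : ∀ {f : StrongDual ℝ (lieAlg E H) × BCotangentCoset E H → ℝ},
      (modelStr E H).SmoothAt f p → ∀ᶠ z in 𝓝 fun i => s.chart.cotangent.x i p.2,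
        ContDiffAt ℝ ∞ (fun z => (f ∘ s.modelChart.e.symm) (Sum.elim (dualCoord E H p.1) z)) z := by
    intro f hf
    filter_upwards [hcont.eventually ((s.modelChart.smooth_iff p hp' f).1 hf)] with z hz
    refine ContDiffAt.comp (g := f ∘ s.modelChart.e.symm) z hz (ContDiff.contDiffAt
      (contDiff_pi.2 fun i => ?_))
    rcases i with i | i
    · exact contDiff_const
    · exact contDiff_apply ℝ ℝ i
  have h3 : ∀ {f : StrongDual ℝ (lieAlg E H) × BCotangentCoset E H → ℝ},
      (modelStr E H).SmoothAt f p → ∀ i,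
        pd (fun z => (f ∘ s.modelChart.e.symm) (Sum.elim (dualCoord E H p.1) z))
          (fun i => s.chart.cotangent.x i p.2) i = s.modelChart.d (.inr i) f p := by
    intro f hf i
    rw [pd_sumElim (by rw [← hx]; exact Chart.differentiableAt hp' hf), ← hx]
    rfl
  have h4 : ∀ i j, s.struct p (.inl i) (.inr j) = 0 := fun i j => rfl
  have h5 : ∀ i j, s.struct p (.inr i) (.inl j) = 0 := by
    rintro (i | i) j <;> rfl
  rw [modelBracket, lieMinus_eq_sum hp hf hk, hσ.poisson_congr (h1 f) (h1 k),
    hσ.poisson_comp (h2 hf) (h2 hk) fun i => s.chart.cotangent.smoothAt_x hp i]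
  simp only [h3 hf, h3 hk, poisson_coset_x hσ hp]
  simp only [Fintype.sum_sum_type (α₁ := Fin (Module.finrank ℝ (lieAlg E H))), h4, h5, mul_zero,
    Finset.sum_const_zero, add_zero, zero_add]

end

end Slice

end Lie

/-! ### The reduced Poisson structure -/

section Lie

variable {E : Type*} [NormedAddCommGroup E] [NormedSpace ℝ E] [FiniteDimensional ℝ E]
  {G : Type*} [TopologicalSpace G] [ChartedSpace E G] [Group G] [LieGroup 𝓘(ℝ, E) ∞ G]
  {H : Subgroup G}

namespace Slice

variable {s : Slice E H} {α β : BCotangentG E H}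
  (hd : Module.finrank ℝ (lieAlg E H) + 1 = Module.finrank ℝ E)

theorem comp_toReduced_eventuallyEq (hα : α.proj ∈ s.dom) (F : Reduced E H → ℝ) :
    F ∘ toReduced E H =ᶠ[𝓝 α] (F ∘ (s.trivialization hd).symm) ∘ s.toModel := by
  filter_upwards [eventually_mem_dom hα] with β hβ
  have h1 : toReduced E H β ∈ (s.trivialization hd).source := hβ
  have h2 := (s.trivialization hd).left_inv h1
  rw [trivialization_toReduced hd hβ] at h2
  exact congrArg F h2.symm

theorem canonicalBracket_comp_toReduced
    (hσ : IsNondegenerate (canonicalForm (SmoothStr.ofManifold E G) (H : Set G)))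
    (hσ' : IsNondegenerate (canonicalForm (cosetStr E H) (critPt H))) (hα : α.proj ∈ s.dom)
    {F K : Reduced E H → ℝ} (hF : (reducedStr E H).SmoothAt F (toReduced E H α))
    (hK : (reducedStr E H).SmoothAt K (toReduced E H α)) :
    canonicalBracket E H (F ∘ toReduced E H) (K ∘ toReduced E H) α =
      modelBracket E H (F ∘ (s.trivialization hd).symm) (K ∘ (s.trivialization hd).symm)
        (s.toModel α) := by
  have hF' := (smoothAt_comp_trivialization_symm hd (s := s) (y := toReduced E H α) hα).1 hF
  have hK' := (smoothAt_comp_trivialization_symm hd (s := s) (y := toReduced E H α) hα).1 hK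
  rw [trivialization_toReduced hd hα] at hF' hK'
  have h1 : (s.toModel α).2.proj ∈ s.V := hα
  rw [modelBracket_eq_sum hσ' h1 hF' hK', ← canonicalBracket_comp_toModel hσ hα hF' hK']
  exact hσ.poisson_congr (comp_toReduced_eventuallyEq hd hα F) (comp_toReduced_eventuallyEq hd hα K)

end Slice

/-- The canonical bracket descends to the reduced space. -/
theorem canonicalBracket_eq_reducedBracket (hH : IsBLieGroup E H)
    (hσ : IsNondegenerate (canonicalForm (SmoothStr.ofManifold E G) (H : Set G)))
    (hσ' : IsNondegenerate (canonicalForm (cosetStr E H) (critPt H))) {α : BCotangentG E H}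
    {F K : Reduced E H → ℝ} (hF : (reducedStr E H).SmoothAt F (toReduced E H α))
    (hK : (reducedStr E H).SmoothAt K (toReduced E H α)) :
    canonicalBracket E H (F ∘ toReduced E H) (K ∘ toReduced E H) α =
      reducedBracket E H F K (toReduced E H α) := by
  have hd := hH.finrank_lieAlg
  obtain ⟨s, hs⟩ := exists_slice hH (toCoset H α.proj)
  have hα : α.proj ∈ s.dom := hs
  have h0 : toReduced E H (Quot.out (toReduced E H α)) = toReduced E H α := Quot.out_eq _
  have hβ : (Quot.out (toReduced E H α)).proj ∈ s.dom := by
    have h1 : reducedProj E H (toReduced E H (Quot.out (toReduced E H α))) ∈ s.V := by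
      rw [h0]
      exact hs
    exact h1
  -- At both representatives the canonical bracket is the model bracket at the image of the common
  -- class.
  rw [reducedBracket, Slice.canonicalBracket_comp_toReduced hd hσ hσ' hα hF hK,
    Slice.canonicalBracket_comp_toReduced hd hσ hσ' hβ (by rwa [h0]) (by rwa [h0]),
    ← Slice.trivialization_toReduced hd hα, ← Slice.trivialization_toReduced hd hβ, h0]

/-- The canonical bracket of functions pulled back from the model and the model bracket are given by
the same sum over coordinates. -/
theorem isPoissonTrivialOver_slice (s : Slice E H) (hH : IsBLieGroup E H)
    (hσ : IsNondegenerate (canonicalForm (SmoothStr.ofManifold E G) (H : Set G)))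
    (hσ' : IsNondegenerate (canonicalForm (cosetStr E H) (critPt H))) :
    IsPoissonTrivialOver E H s.V := by
  have hd := hH.finrank_lieAlg
  refine ⟨s.trivialization hd, rfl, rfl, ?_, fun y hy f => Slice.smoothAt_trivialization_iff hd hy f,
    ?_⟩
  · rintro ⟨α⟩ (hα : α.proj ∈ s.dom)
    exact congrArg (fun p => p.2.proj) (Slice.trivialization_toReduced hd hα)
  · rintro ⟨α⟩ (hα : α.proj ∈ s.dom) f k hf hk
    have hf' := (Slice.smoothAt_trivialization_iff hd (s := s) (y := toReduced E H α) hα f).1 hf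
    have hk' := (Slice.smoothAt_trivialization_iff hd (s := s) (y := toReduced E H α) hα k).1 hk
    change reducedBracket E H _ _ (toReduced E H α) =
      modelBracket E H f k (s.trivialization hd (toReduced E H α))
    change (modelStr E H).SmoothAt f (s.trivialization hd (toReduced E H α)) at hf
    change (modelStr E H).SmoothAt k (s.trivialization hd (toReduced E H α)) at hk
    rw [Slice.trivialization_toReduced hd hα] at hf hk ⊢
    have h1 : (s.toModel α).2.proj ∈ s.V := hα
    rw [← canonicalBracket_eq_reducedBracket hH hσ hσ' hf' hk',
      Slice.modelBracket_eq_sum hσ' h1 hf hk, ← Slice.canonicalBracket_comp_toModel hσ hα hf hk]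
    exact hσ.poisson_congr (Slice.comp_trivialization_eventuallyEq hd hα f)
      (Slice.comp_trivialization_eventuallyEq hd hα k)

/-- Each identity is checked at a representative in `ᵇT*G`, where the bracket is a derivation in its
first argument and satisfies the Jacobi identity. -/
theorem isPoissonBracket_reducedBracket (hH : IsBLieGroup E H)
    (hσ : IsNondegenerate (canonicalForm (SmoothStr.ofManifold E G) (H : Set G)))
    (hσ' : IsNondegenerate (canonicalForm (cosetStr E H) (critPt H))) :
    IsPoissonBracket (reducedStr E H) (reducedBracket E H) := by
  -- The equality is needed on a neighbourhood, as it is inserted into another bracket.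
  have hbr : ∀ {F K : Reduced E H → ℝ} {α : BCotangentG E H},
      (reducedStr E H).SmoothAt F (toReduced E H α) →
      (reducedStr E H).SmoothAt K (toReduced E H α) →
      reducedBracket E H F K ∘ toReduced E H =ᶠ[𝓝 α]
        canonicalBracket E H (F ∘ toReduced E H) (K ∘ toReduced E H) := by
    intro F K α hF hK
    have hc : ContinuousAt (toReduced E H) α := continuous_quot_mk.continuousAt
    filter_upwards [hc.eventually (SmoothStr.eventually _ hF),
      hc.eventually (SmoothStr.eventually _ hK)] with β h1 h2
    exact (canonicalBracket_eq_reducedBracket hH hσ hσ' h1 h2).symm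
  have hsm : ∀ {F K : Reduced E H → ℝ} {y : Reduced E H}, (reducedStr E H).SmoothAt F y →
      (reducedStr E H).SmoothAt K y → (reducedStr E H).SmoothAt (reducedBracket E H F K) y := by
    intro F K y hF hK
    refine ⟨_, inter_mem (SmoothStr.eventually _ hF) (SmoothStr.eventually _ hK), ?_⟩
    rintro α ⟨h1, h2⟩
    obtain ⟨c, hc⟩ := exists_bChart_group hH α.proj
    exact SmoothStr.congr _ (BChart.smoothAt_poisson hσ hc (smoothAt_comp_toReduced h1)
      (smoothAt_comp_toReduced h2)) (hbr h1 h2).symm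
  refine ⟨hsm, ?_, ?_, ?_, ?_, ?_⟩
  · intro F K y _ _
    exact hσ.poisson_skew _ _ _
  all_goals
    intro F K
  · rintro L ⟨α⟩ hF hK hL
    change (reducedStr E H).SmoothAt F (toReduced E H α) at hF
    change (reducedStr E H).SmoothAt K (toReduced E H α) at hK
    change (reducedStr E H).SmoothAt L (toReduced E H α) at hL
    change reducedBracket E H (F + K) L (toReduced E H α) =
      reducedBracket E H F L (toReduced E H α) + reducedBracket E H K L (toReduced E H α)
    obtain ⟨w, hw⟩ := hσ.exists_hamiltonian (L ∘ toReduced E H) α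
    rw [← canonicalBracket_eq_reducedBracket hH hσ hσ' (F := F + K) (hF.add hK) hL,
      ← canonicalBracket_eq_reducedBracket hH hσ hσ' hF hL,
      ← canonicalBracket_eq_reducedBracket hH hσ hσ' hK hL]
    exact (hσ.poisson_eq_bDeriv _ hw).trans ((bDeriv_add w (smoothAt_comp_toReduced hF)
      (smoothAt_comp_toReduced hK)).trans (congrArg₂ _ (hσ.poisson_eq_bDeriv _ hw).symm
        (hσ.poisson_eq_bDeriv _ hw).symm))
  · rintro ⟨α⟩ r hF hK
    change (reducedStr E H).SmoothAt F (toReduced E H α) at hF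
    change (reducedStr E H).SmoothAt K (toReduced E H α) at hK
    change reducedBracket E H (r • F) K (toReduced E H α) =
      r * reducedBracket E H F K (toReduced E H α)
    obtain ⟨w, hw⟩ := hσ.exists_hamiltonian (K ∘ toReduced E H) α
    rw [← canonicalBracket_eq_reducedBracket hH hσ hσ' (F := r • F) (hF.const_mul r) hK,
      ← canonicalBracket_eq_reducedBracket hH hσ hσ' hF hK]
    exact (hσ.poisson_eq_bDeriv _ hw).trans ((bDeriv_const_mul w r (smoothAt_comp_toReduced hF)).trans
      (congrArg _ (hσ.poisson_eq_bDeriv _ hw).symm))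
  · rintro L ⟨α⟩ hF hK hL
    change (reducedStr E H).SmoothAt F (toReduced E H α) at hF
    change (reducedStr E H).SmoothAt K (toReduced E H α) at hK
    change (reducedStr E H).SmoothAt L (toReduced E H α) at hL
    change reducedBracket E H (F * K) L (toReduced E H α) =
      F (toReduced E H α) * reducedBracket E H K L (toReduced E H α) +
        K (toReduced E H α) * reducedBracket E H F L (toReduced E H α)
    obtain ⟨w, hw⟩ := hσ.exists_hamiltonian (L ∘ toReduced E H) α
    rw [← canonicalBracket_eq_reducedBracket hH hσ hσ' (F := F * K) (hF.mul hK) hL,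
      ← canonicalBracket_eq_reducedBracket hH hσ hσ' hF hL,
      ← canonicalBracket_eq_reducedBracket hH hσ hσ' hK hL]
    rw [canonicalBracket, canonicalBracket, canonicalBracket, hσ.poisson_eq_bDeriv _ hw,
      hσ.poisson_eq_bDeriv _ hw, hσ.poisson_eq_bDeriv _ hw]
    exact bDeriv_mul w (smoothAt_comp_toReduced hF) (smoothAt_comp_toReduced hK)
  · rintro L ⟨α⟩ hF hK hL
    change (reducedStr E H).SmoothAt F (toReduced E H α) at hF
    change (reducedStr E H).SmoothAt K (toReduced E H α) at hK
    change (reducedStr E H).SmoothAt L (toReduced E H α) at hL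
    have h1 : ∀ {F K L : Reduced E H → ℝ}, (reducedStr E H).SmoothAt F (toReduced E H α) →
        (reducedStr E H).SmoothAt K (toReduced E H α) →
        (reducedStr E H).SmoothAt L (toReduced E H α) →
        reducedBracket E H F (reducedBracket E H K L) (toReduced E H α) =
          canonicalBracket E H (F ∘ toReduced E H)
            (canonicalBracket E H (K ∘ toReduced E H) (L ∘ toReduced E H)) α := by
      intro F K L hF hK hL
      rw [← canonicalBracket_eq_reducedBracket hH hσ hσ' hF (hsm hK hL)]
      exact hσ.poisson_congr EventuallyEq.rfl (hbr hK hL)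
    obtain ⟨c, hc⟩ := exists_bChart_group hH α.proj
    change reducedBracket E H F (reducedBracket E H K L) (toReduced E H α) +
      reducedBracket E H K (reducedBracket E H L F) (toReduced E H α) +
      reducedBracket E H L (reducedBracket E H F K) (toReduced E H α) = 0
    rw [h1 hF hK hL, h1 hK hL hF, h1 hL hF hK]
    exact BChart.jacobi_canonicalForm hσ hc (smoothAt_comp_toReduced hF) (smoothAt_comp_toReduced hK)
      (smoothAt_comp_toReduced hL)

end Lie

/-! ### Fundamental fields and the annihilator -/

section Lie

variable {E : Type*} [NormedAddCommGroup E] [NormedSpace ℝ E] [FiniteDimensional ℝ E]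
  {G : Type*} [TopologicalSpace G] [ChartedSpace E G] [Group G] [LieGroup 𝓘(ℝ, E) ∞ G]
  {H : Subgroup G}

namespace Slice

variable {s : Slice E H} {g : G}

/-- The fundamental vectors are tangent to the level sets of `τ`. -/
theorem isFundamentalAt_spec {X : lieAlg E H} (hg : g ∈ s.dom) {v : BTangentG E H g}
    (h : IsFundamentalAt E H (X : E) g v) : bLogDeriv v s.τ = 0 ∧
      ∀ k, (SmoothStr.ofManifold E G).SmoothAt k g →
        bDeriv v k = diffOne E (fun x => k (x * g)) X := by
  obtain ⟨Y, hY, rfl, hYd⟩ := h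
  refine ⟨?_, fun k hk => hYd.self_of_nhds k hk⟩
  obtain ⟨b, hb, -, hb0⟩ := exists_bChart hg
  -- The derivative of `τ` along the field is `τ` times the logarithmic derivative and vanishes,
  -- since left translation by `H` preserves `τ`. Off `H` one divides by `τ`; density of the
  -- complement gives the value on `H`.
  have h1 : ∀ᶠ z in 𝓝 g, b.x b.i0 z ≠ 0 → bLogDeriv (Y z) s.τ = 0 := by
    filter_upwards [hYd, isOpen_dom.mem_nhds hg, b.e.open_source.mem_nhds hb] with z h2 hz hzb h3
    have h4 := h2 s.τ (smoothAt_τ hz)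
    rw [bDeriv_defining _ (isDefiningAt_τ hz), diffOne_eq_of_eqOn X.2 (F := fun x => s.τ (x * z))
      (K := fun _ => s.τ z)
      (smoothAt_comp_of_contMDiff (f := s.τ) (m := fun x => x * z) (by rw [one_mul]; exact smoothAt_τ hz)
        contMDiff_mul_right) (SmoothStr.smoothAt_const _)
      (Eventually.of_forall fun x hx => τ_mul_left hx), diffOne_const] at h4
    refine (mul_eq_zero.1 h4).resolve_left ?_
    rw [← hb0 z hzb]
    exact h3
  exact (Chart.eventuallyEq_of_mul_x hb b.i0 (hY.self_of_nhds.2 _ (isDefiningAt_τ hg))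
    (SmoothStr.smoothAt_const 0) h1).self_of_nhds

/-- The fields are the velocities of `x ↦ x z`, which maps `H` into a level set of `τ`; vanishing
logarithmic derivative of `τ` makes them linear in `X` and smooth. -/
theorem exists_fundamental (hg : g ∈ s.dom) :
    ∃ ζ : lieAlg E H →ₗ[ℝ] BTangentG E H g, ∀ X : lieAlg E H, IsFundamentalAt E H (X : E) g (ζ X) := by
  have h0 : ∀ (X : lieAlg E H) (z : G), ∃ v : BTangentG E H z, z ∈ s.dom → bLogDeriv v s.τ = 0 ∧
      ∀ k, (SmoothStr.ofManifold E G).SmoothAt k z →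
        bDeriv v k = diffOne E (fun x => k (x * z)) X := by
    intro X z
    by_cases hz : z ∈ s.dom
    · obtain ⟨v, h1, h2⟩ := exists_vertical hz (m := fun x => x * z) contMDiff_mul_right
        (one_mul z) (fun x hx => τ_mul_left hx) X
      exact ⟨v, fun _ => ⟨h1, h2⟩⟩
    · exact ⟨0, fun h => (hz h).elim⟩
  choose Y hY using h0
  refine ⟨{ toFun := fun X => Y X g, map_add' := fun X X' => ?_, map_smul' := fun a X => ?_ }, ?_⟩
  · refine bTangent_ext hg ?_ fun k hk => ?_
    · rw [bLogDeriv_vec_add, (hY _ _ hg).1, (hY _ _ hg).1, (hY _ _ hg).1, add_zero]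
    · rw [bDeriv_vec_add, (hY _ _ hg).2 k hk, (hY _ _ hg).2 k hk, (hY _ _ hg).2 k hk]
      exact map_add _ _ _
  · refine bTangent_ext hg ?_ fun k hk => ?_
    · rw [bLogDeriv_vec_smul, (hY _ _ hg).1, (hY _ _ hg).1, mul_zero]
    · rw [bDeriv_vec_smul, (hY _ _ hg).2 k hk, (hY _ _ hg).2 k hk]
      exact map_smul _ _ _
  · intro X
    refine ⟨Y X, ?_, rfl, ?_⟩
    · exact isSmoothFieldAt_of_diffOne (m := fun z x => x * z)
        (fun _ _ => contMDiffAt_snd.mul contMDiffAt_fst) one_mul hg X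
        fun z hz => hY X z hz
    · filter_upwards [isOpen_dom.mem_nhds hg] with z hz f hf
      exact (hY X z hz).2 f hf

/-- By `isFundamentalAt_spec` any admissible choice in the definition has these derivatives, so the
choice does not matter. -/
theorem fundamental_spec (hg : g ∈ s.dom) (X : lieAlg E H) :
    bLogDeriv (fundamental E H g X) s.τ = 0 ∧ ∀ k, (SmoothStr.ofManifold E G).SmoothAt k g →
      bDeriv (fundamental E H g X) k = diffOne E (fun x => k (x * g)) X := by
  have h := exists_fundamental hg
  rw [fundamental, dif_pos h]
  exact isFundamentalAt_spec hg (h.choose_spec X)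

theorem isSmoothFieldAt_fundamental (hg : g ∈ s.dom) (X : lieAlg E H) :
    IsSmoothFieldAt (fun z => fundamental E H z X) g :=
  isSmoothFieldAt_of_diffOne (m := fun z x => x * z)
    (fun _ _ => contMDiffAt_snd.mul contMDiffAt_fst) one_mul hg X
    fun _ hz => fundamental_spec hz X

variable (θ : BConnection E H)

include θ

/-- The splitting of a `b`-tangent vector given by a connection. -/
theorem eq_fundamental_add (hd : Module.finrank ℝ (lieAlg E H) + 1 = Module.finrank ℝ E)
    (hg : g ∈ s.dom) (v : BTangentG E H g) :
    ∃ X, v = fundamental E H g X + bLogDeriv v s.τ • s.B g := by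
  obtain ⟨h2, h3⟩ := finrank_bTangent hg
  have h0 : ∀ q : lieAlg E H × ℝ,
      bLogDeriv (fundamental E H g q.1 + q.2 • s.B g) s.τ = q.2 := fun q => by
    rw [bLogDeriv_vec_add, (fundamental_spec hg _).1, bLogDeriv_vec_smul, bLogDeriv_B hg, mul_one,
      zero_add]
  let L : lieAlg E H × ℝ →ₗ[ℝ] BTangentG E H g :=
    (fundamental E H g).coprod (LinearMap.toSpanSingleton ℝ _ (s.B g))
  have hL : ∀ q, L q = fundamental E H g q.1 + q.2 • s.B g := fun q => rfl
  -- The form `d log |τ|` detects the coefficient of `B`, and `θ`, a left inverse of the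
  -- infinitesimal action, detects the vertical part.
  have hi : Function.Injective L := by
    rw [← LinearMap.ker_eq_bot, LinearMap.ker_eq_bot']
    rintro ⟨X, a⟩ h
    rw [hL] at h
    have ha := h0 (X, a)
    rw [h, bLogDeriv_vec_zero] at ha
    subst ha
    have h1 := congrArg (θ.form g) h
    rw [zero_smul, add_zero, map_zero, θ.vertical] at h1
    exact Prod.ext h1 rfl
  have hs : Function.Surjective L := by
    refine (LinearMap.injective_iff_surjective_of_finrank_eq_finrank ?_).1 hi
    rw [h3, Module.finrank_prod, Module.finrank_self, hd]
  obtain ⟨q, hq⟩ := hs v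
  refine ⟨q.1, ?_⟩
  rw [← hq, hL, h0]

/-- The annihilator is spanned by `d log |τ|`. -/
theorem annihilator_apply (hd : Module.finrank ℝ (lieAlg E H) + 1 = Module.finrank ℝ E)
    (α : annihilator E H) (hα : α.1.proj ∈ s.dom) (v : BTangentG E H α.1.proj) :
    α.1.cov v = bLogDeriv v s.τ * α.1.cov (s.B α.1.proj) := by
  obtain ⟨X, hX⟩ := eq_fundamental_add θ hd hα v
  conv_lhs => rw [hX]
  rw [map_add, α.2 X, zero_add, map_smul, smul_eq_mul]

omit θ in
theorem isBMapAt_toCoset (hg : g ∈ s.dom) :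
    IsBMapAt (SmoothStr.ofManifold E G) (H : Set G) (cosetStr E H) (critPt H) (toCoset H) g :=
  s.chart.isBMapAt hg continuous_toCoset.continuousAt (fun _ => smoothAt_τ hg) (isDefiningAt_τ hg)

omit θ in
theorem coord_bMap_toCoset (hg : g ∈ s.dom) (v : BTangentG E H g) (i : Unit) :
    s.chart.coord _ (bMap (SmoothStr.ofManifold E G) (H : Set G) (cosetStr E H) (critPt H)
      (toCoset H) g v) i = bLogDeriv v s.τ :=
  (BChart.coord_i0 (c := s.chart) _).trans
    (bLogDeriv_bMap (isBMapAt_toCoset hg) v (BChart.isDefiningAt_x0 (c := s.chart) hg))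

/-- An element of the annihilator is `α(B) d log |τ|`, the pullback of `α(B) d log |t|`. So the
covector required in `annihilatorProj` exists, and since `π_* B` is the frame vector `t ∂_t`, its
value there is `α(B)`. -/
theorem annihilatorProj_frame (hd : Module.finrank ℝ (lieAlg E H) + 1 = Module.finrank ℝ E)
    (α : annihilator E H) (hα : α.1.proj ∈ s.dom) :
    (annihilatorProj E H α).cov (s.chart.frame _ ()) = α.1.cov (s.B α.1.proj) := by
  have h : ∃ b : Module.Dual ℝ (bTangent (cosetStr E H) (critPt H) (toCoset H α.1.proj)),
      ∀ v, b (bMap (SmoothStr.ofManifold E G) H (cosetStr E H) (critPt H) (toCoset H) α.1.proj v) =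
        α.1.cov v := by
    refine ⟨s.chart.covec _ fun _ => α.1.cov (s.B α.1.proj), fun v => ?_⟩
    rw [BChart.covec_apply, annihilator_apply θ hd α hα v]
    simp [coord_bMap_toCoset hα, mul_comm]
  have h1 : annihilatorProj E H α = ⟨toCoset H α.1.proj, h.choose⟩ := congrArg (BCotangent.mk _) (dif_pos h)
  rw [h1]
  change h.choose _ = _
  rw [← h.choose_spec]
  congr 1
  refine BChart.coord_injective (c := s.chart) hα (funext fun i => ?_)
  rw [coord_bMap_toCoset hα, bLogDeriv_B hα, BChart.coord_frame hα]
  simp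

end Slice

end Lie

/-! ### Transport of charts, forms and brackets -/

section Transport

variable {M N : Type*} [TopologicalSpace M] [TopologicalSpace N] {S : SmoothStr M} {Z : Set M}
  {T : SmoothStr N} {ZN : Set N} {ι : Type} [Fintype ι]

/-- Transport of an adapted chart along an isomorphism. -/
def BChart.comap (c : BChart T ZN ι) (φ : M ≃ₜ N)
    (hφ : ∀ p f, T.SmoothAt f (φ p) ↔ S.SmoothAt (f ∘ φ) p) : BChart S (φ ⁻¹' ZN) ι where
  e := φ.transOpenPartialHomeomorph c.e
  smooth_iff y hy f := by
    have h1 : f = (f ∘ φ.symm) ∘ φ := by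
      funext x
      simp
    have hy' : φ y ∈ c.e.source := hy
    rw [h1, ← hφ, c.smooth_iff _ hy', ← h1]
    rfl
  i0 := c.i0
  crit y hy := c.crit _ hy

variable [DecidableEq ι]

theorem BChart.isBMapAt_comap (c : BChart T ZN ι) (φ : M ≃ₜ N)
    (hφ : ∀ p f, T.SmoothAt f (φ p) ↔ S.SmoothAt (f ∘ φ) p) {p : M} (hp : φ p ∈ c.e.source) :
    IsBMapAt S (φ ⁻¹' ZN) T ZN φ p :=
  c.isBMapAt hp φ.continuous.continuousAt (fun i => (hφ p _).1 (c.smoothAt_x hp i))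
    (BChart.isDefiningAt_x0 (c := c.comap φ hφ) hp)

theorem BChart.coord_bMap_comap (c : BChart T ZN ι) (φ : M ≃ₜ N)
    (hφ : ∀ p f, T.SmoothAt f (φ p) ↔ S.SmoothAt (f ∘ φ) p) {p : M} (hp : φ p ∈ c.e.source)
    (v : bTangent S (φ ⁻¹' ZN) p) (i : ι) :
    c.coord _ (bMap S (φ ⁻¹' ZN) T ZN φ p v) i = (c.comap φ hφ).coord p v i := by
  by_cases hi : i = c.i0
  · subst hi
    rw [BChart.coord_i0, bLogDeriv_bMap (c.isBMapAt_comap φ hφ hp) v (BChart.isDefiningAt_x0 hp)]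
    exact (BChart.coord_i0 (c := c.comap φ hφ) v).symm
  · rw [BChart.coord_ne _ hi, bDeriv_bMap (c.isBMapAt_comap φ hφ hp) v (c.smoothAt_x hp i),
      BChart.coord_ne (c := c.comap φ hφ) v hi]
    rfl

theorem BChart.bijective_bMap_comap (c : BChart T ZN ι) (φ : M ≃ₜ N)
    (hφ : ∀ p f, T.SmoothAt f (φ p) ↔ S.SmoothAt (f ∘ φ) p) {p : M} (hp : φ p ∈ c.e.source) :
    Function.Bijective (bMap S (φ ⁻¹' ZN) T ZN φ p) := by
  have h1 : c.coord (φ p) ∘ bMap S (φ ⁻¹' ZN) T ZN φ p = (c.comap φ hφ).coord p :=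
    funext fun v => funext fun i => c.coord_bMap_comap φ hφ hp v i
  have h2 : Function.Bijective (c.coord (φ p)) := (c.coordEquiv hp).bijective
  have h3 : Function.Bijective ((c.comap φ hφ).coord p) :=
    ((c.comap φ hφ).coordEquiv (p := p) hp).bijective
  rw [← h1] at h3
  exact (Function.Bijective.of_comp_iff' h2 _).1 h3

variable {σ : ∀ p, bTangent S Z p → bTangent S Z p → ℝ}
  {ρ : ∀ p, bTangent T ZN p → bTangent T ZN p → ℝ} {φ : M → N}

theorem IsNondegenerate.of_pullback (hρ : IsNondegenerate ρ)
    (hb : ∀ p, Function.Bijective (bMap S Z T ZN φ p))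
    (hσ : ∀ p v w, σ p v w = ρ (φ p) (bMap S Z T ZN φ p v) (bMap S Z T ZN φ p w)) :
    IsNondegenerate σ := by
  intro p
  obtain ⟨B, hB, h0, hB1⟩ := hρ (φ p)
  let e := LinearEquiv.ofBijective (bMap S Z T ZN φ p) (hb p)
  refine ⟨(e.dualMap.toLinearMap ∘ₗ B) ∘ₗ e.toLinearMap, fun v w => ?_, fun v => ?_, ?_⟩
  · rw [hσ, ← hB]
    rfl
  · rw [hσ, h0]
  · exact (e.dualMap.bijective.comp hB1).comp e.bijective

/-- Under the bijective `b`-differential the Hamiltonian vector of `K` corresponds to that of `K ∘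
φ`. -/
theorem IsNondegenerate.poisson_pullback (hρ : IsNondegenerate ρ)
    (hb : ∀ p, Function.Bijective (bMap S Z T ZN φ p))
    (hσ : ∀ p v w, σ p v w = ρ (φ p) (bMap S Z T ZN φ p v) (bMap S Z T ZN φ p w)) {p : M}
    (hφ : IsBMapAt S Z T ZN φ p) {F K : N → ℝ} (hF : T.SmoothAt F (φ p))
    (hK : T.SmoothAt K (φ p)) : poisson σ (F ∘ φ) (K ∘ φ) p = poisson ρ F K (φ p) := by
  obtain ⟨w, hw⟩ := hρ.exists_hamiltonian K (φ p)
  obtain ⟨w', rfl⟩ := (hb p).2 w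
  have hw' : IsHamiltonianAt σ (K ∘ φ) p w' := fun u => by
    rw [hσ, hw, bDeriv_bMap hφ u hK]
  rw [hρ.poisson_eq_bDeriv F hw, (hρ.of_pullback hb hσ).poisson_eq_bDeriv _ hw',
    bDeriv_bMap hφ w' hF]

end Transport

/-! ### Smooth maps into subspaces and products -/

section Sub

variable {X Y : Type*} [TopologicalSpace X] [TopologicalSpace Y] {S : SmoothStr X}

theorem SmoothStr.smoothAt_sub {A : Set X} {f : X → ℝ} {a : A} (hf : S.SmoothAt f a) :
    (S.sub A).SmoothAt (fun b => f b) a :=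
  ⟨Unit, inferInstance, fun z => z (), fun _ b => f b, contDiff_apply ℝ ℝ (),
    fun _ => ⟨f, hf, rfl⟩, EventuallyEq.rfl⟩

/-- A map to a subspace is smooth when its composition with the inclusion is. -/
theorem SmoothStr.smoothAt_comp_sub {T : SmoothStr Y} {A : Set X} {φ : Y → A} {p : Y}
    (hφ : ContinuousAt φ p) (h : ∀ f : X → ℝ, S.SmoothAt f (φ p) → T.SmoothAt (fun y => f (φ y)) p)
    {f : A → ℝ} (hf : (S.sub A).SmoothAt f (φ p)) : T.SmoothAt (f ∘ φ) p := by
  obtain ⟨ι, _, F, g, hF, hg, hfg⟩ := hf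
  refine T.congr (T.comp (g := fun i => g i ∘ φ) hF fun i => ?_)
    (EventuallyEq.symm (hφ.eventually hfg))
  obtain ⟨k, hk, hki⟩ := hg i
  rw [hki]
  exact h k hk

/-- A map to a product is smooth when its components are. -/
theorem SmoothStr.smoothAt_comp_prod {W : Type*} [TopologicalSpace W] {T : SmoothStr Y}
    {R : SmoothStr W} {φ : W → X × Y} {p : W} (hφ : ContinuousAt φ p)
    (h1 : ∀ f : X → ℝ, S.SmoothAt f (φ p).1 → R.SmoothAt (fun y => f (φ y).1) p)
    (h2 : ∀ f : Y → ℝ, T.SmoothAt f (φ p).2 → R.SmoothAt (fun y => f (φ y).2) p)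
    {f : X × Y → ℝ} (hf : (S.prod T).SmoothAt f (φ p)) : R.SmoothAt (f ∘ φ) p := by
  obtain ⟨ι, _, F, g, hF, hg, hfg⟩ := hf
  refine R.congr (R.comp (g := fun i => g i ∘ φ) hF fun i => ?_)
    (EventuallyEq.symm (hφ.eventually hfg))
  obtain ⟨k, hk, hki⟩ | ⟨k, hk, hki⟩ := hg i
  · rw [hki]
    exact h1 k hk
  · rw [hki]
    exact h2 k hk

end Sub

section

variable {W : Type*} [NormedAddCommGroup W] [NormedSpace ℝ W]

theorem SmoothStr.smoothAt_dual_apply (x : W) (μ : StrongDual ℝ W) :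
    (SmoothStr.std (StrongDual ℝ W)).SmoothAt (fun μ => μ x) μ :=
  Eventually.of_forall fun _ => (ContinuousLinearMap.apply ℝ ℝ x).contDiff.contDiffAt

theorem Chart.mem_ofEquiv_source {ι : Type} [Fintype ι] (L : W ≃L[ℝ] (ι → ℝ)) (w : W) :
    w ∈ (Chart.ofEquiv L).e.source := mem_univ w

end

/-! ### Minimal coupling as a diffeomorphism -/

section Lie

variable {E : Type*} [NormedAddCommGroup E] [NormedSpace ℝ E] [FiniteDimensional ℝ E]
  {G : Type*} [TopologicalSpace G] [ChartedSpace E G] [Group G] [LieGroup 𝓘(ℝ, E) ∞ G]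
  {H : Subgroup G}

variable (E H) in
/-- The coordinate functions of the Lie algebra. -/
def lieCoord (i : Fin (Module.finrank ℝ (lieAlg E H))) : StrongDual ℝ (lieAlg E H) :=
  LinearMap.toContinuousLinearMap ((Module.finBasis ℝ (lieAlg E H)).coord i)

omit [LieGroup 𝓘(ℝ, E) ∞ G] in
theorem sum_lieCoord (X : lieAlg E H) :
    ∑ i, lieCoord E H i X • Module.finBasis ℝ (lieAlg E H) i = X :=
  (Module.finBasis ℝ (lieAlg E H)).sum_repr X

omit [LieGroup 𝓘(ℝ, E) ∞ G] in
theorem map_eq_sum_lieCoord {W : Type*} [AddCommGroup W] [Module ℝ W] (L : lieAlg E H →ₗ[ℝ] W)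
    (X : lieAlg E H) : L X = ∑ i, lieCoord E H i X • L (Module.finBasis ℝ (lieAlg E H) i) := by
  conv_lhs => rw [← sum_lieCoord X, map_sum]
  exact Finset.sum_congr rfl fun i _ => map_smul _ _ _

variable (θ : BConnection E H) {g : G} {b : BChart (SmoothStr.ofManifold E G) (H : Set G)
    (Fin (Module.finrank ℝ E))}

omit [LieGroup 𝓘(ℝ, E) ∞ G] in
theorem smoothAt_form_frame (hb : g ∈ b.e.source) (j) (i) :
    (SmoothStr.ofManifold E G).SmoothAt (fun z => lieCoord E H i (θ.form z (b.frame z j))) g :=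
  θ.smooth _ g (BChart.isSmoothFieldAt_frame hb j) _

section Coupling

variable {p : annihilator E H × StrongDual ℝ (lieAlg E H)}

omit [FiniteDimensional ℝ E] [LieGroup 𝓘(ℝ, E) ∞ G] in
theorem smoothAt_coupling_fst {f : BCotangentG E H → ℝ}
    (hf : (BCotangent.str (SmoothStr.ofManifold E G) (H : Set G)).SmoothAt f p.1.1) :
    (couplingStr E H).SmoothAt (fun q => f q.1.1) p :=
  SmoothStr.smoothAt_fst (f := fun a : annihilator E H => f a) (SmoothStr.smoothAt_sub hf)

omit [FiniteDimensional ℝ E] [LieGroup 𝓘(ℝ, E) ∞ G] in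
theorem smoothAt_coupling_base {f : G → ℝ}
    (hf : (SmoothStr.ofManifold E G).SmoothAt f (couplingBase E H p)) :
    (couplingStr E H).SmoothAt (f ∘ couplingBase E H) p :=
  smoothAt_coupling_fst (f := f ∘ BCotangent.proj) (smoothAt_comp_proj hf)

omit [FiniteDimensional ℝ E] [LieGroup 𝓘(ℝ, E) ∞ G] in
theorem smoothAt_coupling_snd (X : lieAlg E H) :
    (couplingStr E H).SmoothAt (fun q => q.2 X) p :=
  SmoothStr.smoothAt_snd (f := fun μ : StrongDual ℝ (lieAlg E H) => μ X)
    (SmoothStr.smoothAt_dual_apply X p.2)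

omit [LieGroup 𝓘(ℝ, E) ∞ G] in
-- Smoothness of `θ` is formulated for fixed functionals on `𝔥`. Expanding in a basis of `𝔥`
-- separates the varying `μ` from the smooth components of `θ`.
theorem smoothAt_coupling_form (hb : couplingBase E H p ∈ b.e.source) (j) :
    (couplingStr E H).SmoothAt
      (fun q => q.2 (θ.form (couplingBase E H q) (b.frame (couplingBase E H q) j))) p := by
  refine SmoothStr.congr _ (SmoothStr.SmoothAt.sum (s := Finset.univ) fun i _ =>
    (smoothAt_coupling_base (smoothAt_form_frame θ hb j i)).mul
      (smoothAt_coupling_snd (p := p) (Module.finBasis ℝ (lieAlg E H) i)))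
      (Eventually.of_forall fun q => ?_)
  exact (map_eq_sum_lieCoord q.2.toLinearMap _).symm

omit [LieGroup 𝓘(ℝ, E) ∞ G] in
theorem smoothAt_x_minimalCoupling_symm (hb : couplingBase E H p ∈ b.e.source) (i) :
    (couplingStr E H).SmoothAt (b.cotangent.x i ∘ (minimalCoupling θ).symm) p := by
  rcases i with i | i
  · exact smoothAt_coupling_base (b.smoothAt_x hb i)
  · exact (smoothAt_coupling_fst (BChart.smoothAt_pair_frame (c := b) hb i)).add
      (smoothAt_coupling_form θ hb i)

omit [FiniteDimensional ℝ E] [LieGroup 𝓘(ℝ, E) ∞ G] in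
theorem continuous_couplingBase : Continuous (couplingBase E H) :=
  BCotangent.continuous_proj.comp (continuous_subtype_val.comp continuous_fst)

omit [LieGroup 𝓘(ℝ, E) ∞ G] in
theorem continuousAt_minimalCoupling_symm (hb : couplingBase E H p ∈ b.e.source) :
    ContinuousAt (minimalCoupling θ).symm p :=
  b.cotangent.toChart.continuousAt_of_x
    (continuous_couplingBase.continuousAt.eventually (b.e.open_source.mem_nhds hb))
    fun i => SmoothStr.continuousAt _ (smoothAt_x_minimalCoupling_symm θ hb i)

omit [LieGroup 𝓘(ℝ, E) ∞ G] in
theorem smoothAt_comp_minimalCoupling_symm (hb : couplingBase E H p ∈ b.e.source)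
    {f : BCotangentG E H → ℝ} (hf : (BCotangent.str (SmoothStr.ofManifold E G) (H : Set G)).SmoothAt f
      ((minimalCoupling θ).symm p)) :
    (couplingStr E H).SmoothAt (f ∘ (minimalCoupling θ).symm) p :=
  b.cotangent.toChart.smoothAt_comp (φ := (minimalCoupling θ).symm) hb
    (continuousAt_minimalCoupling_symm θ hb) (smoothAt_x_minimalCoupling_symm θ hb) hf

end Coupling

variable {α : BCotangentG E H} {s : Slice E H}

variable (E H) in
/-- The linear chart of the dual of the Lie algebra. -/
def dualChart : Chart (SmoothStr.std (StrongDual ℝ (lieAlg E H)))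
    (Fin (Module.finrank ℝ (lieAlg E H))) := Chart.ofEquiv (dualCoord E H)

omit [LieGroup 𝓘(ℝ, E) ∞ G] in
theorem mem_dualChart_source (μ : StrongDual ℝ (lieAlg E H)) : μ ∈ (dualChart E H).e.source :=
  Chart.mem_ofEquiv_source _ μ

omit [LieGroup 𝓘(ℝ, E) ∞ G] in
theorem dualChart_x (i) (μ : StrongDual ℝ (lieAlg E H)) :
    (dualChart E H).x i μ = μ (Module.finBasis ℝ (lieAlg E H) i) := rfl

theorem smoothAt_pair_fundamental (hα : α.proj ∈ s.dom) (X : lieAlg E H) :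
    (BCotangent.str (SmoothStr.ofManifold E G) (H : Set G)).SmoothAt
      (BCotangent.pair fun z => fundamental E H z X) α :=
  smoothAt_pair (Slice.isSmoothFieldAt_fundamental hα X)

/-- The fibre coordinates of `α - α ∘ ζ ∘ θ` are those of `α` minus the sum over `j` of the `j`-th
component of `θ(eᵢ)` times the pairing with the `j`-th fundamental field, all of which are smooth.
-/
theorem smoothAt_x_horizontal (hα : α.proj ∈ s.dom) (hb : α.proj ∈ b.e.source) (i) :
    (BCotangent.str (SmoothStr.ofManifold E G) (H : Set G)).SmoothAt
      (b.cotangent.x i ∘ fun α => (minimalCoupling θ α).1.1) α := by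
  rcases i with i | i
  · exact smoothAt_comp_proj (b.smoothAt_x hb i)
  · refine SmoothStr.congr _ ((BChart.smoothAt_pair_frame (c := b) hb i).sub
      (SmoothStr.SmoothAt.sum (s := Finset.univ) fun j _ =>
        (smoothAt_comp_proj (smoothAt_form_frame θ hb i j)).mul
          (smoothAt_pair_fundamental hα (Module.finBasis ℝ (lieAlg E H) j))))
        (Eventually.of_forall fun β => ?_)
    exact congrArg (fun r => β.cov (b.frame β.proj i) - r) (map_eq_sum_lieCoord
      (β.cov ∘ₗ fundamental E H β.proj) (θ.form β.proj (b.frame β.proj i))).symm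

theorem smoothAt_x_vertical (hα : α.proj ∈ s.dom) (i) :
    (BCotangent.str (SmoothStr.ofManifold E G) (H : Set G)).SmoothAt
      ((dualChart E H).x i ∘ fun α => (minimalCoupling θ α).2) α := by
  refine SmoothStr.congr _ (smoothAt_pair_fundamental hα (Module.finBasis ℝ (lieAlg E H) i))
    (Eventually.of_forall fun β => ?_)
  rw [Function.comp_apply, dualChart_x]
  rfl

theorem continuousAt_minimalCoupling (hα : α.proj ∈ s.dom) :
    ContinuousAt (minimalCoupling θ) α := by
  obtain ⟨b, hb, -, -⟩ := Slice.exists_bChart hα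
  have h1 : ContinuousAt (fun α => (minimalCoupling θ α).1.1) α :=
    b.cotangent.toChart.continuousAt_of_x
      (BCotangent.continuous_proj.continuousAt.eventually (b.e.open_source.mem_nhds hb))
      fun i => SmoothStr.continuousAt _ (smoothAt_x_horizontal θ hα hb i)
  have h2 : ContinuousAt (fun α => (minimalCoupling θ α).2) α :=
    (dualChart E H).continuousAt_of_x
      (Eventually.of_forall fun _ => mem_dualChart_source _)
      fun i => SmoothStr.continuousAt _ (smoothAt_x_vertical θ hα i)
  exact ContinuousAt.prodMk (IsInducing.subtypeVal.continuousAt_iff.2 h1) h2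

theorem smoothAt_comp_minimalCoupling (hα : α.proj ∈ s.dom)
    {f : annihilator E H × StrongDual ℝ (lieAlg E H) → ℝ}
    (hf : (couplingStr E H).SmoothAt f (minimalCoupling θ α)) :
    (BCotangent.str (SmoothStr.ofManifold E G) (H : Set G)).SmoothAt (f ∘ minimalCoupling θ) α := by
  obtain ⟨b, hb, -, -⟩ := Slice.exists_bChart hα
  have hc := continuousAt_minimalCoupling θ hα
  have hc1 : ContinuousAt (fun α => (minimalCoupling θ α).1) α := continuousAt_fst.comp hc
  have hc2 : ContinuousAt (fun α => (minimalCoupling θ α).2) α := continuousAt_snd.comp hc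
  refine SmoothStr.smoothAt_comp_prod hc (fun k hk => ?_) (fun k hk => ?_) hf
  · refine SmoothStr.smoothAt_comp_sub hc1 (fun l hl => ?_) hk
    exact b.cotangent.toChart.smoothAt_comp (φ := fun α => (minimalCoupling θ α).1.1) hb
      (continuousAt_subtype_val.comp hc1) (smoothAt_x_horizontal θ hα hb) hl
  · exact (dualChart E H).smoothAt_comp (mem_dualChart_source _) hc2
      (smoothAt_x_vertical θ hα) hk

/-- The inverse of the minimal coupling map, as a homeomorphism. -/
def couplingHomeo (hH : IsBLieGroup E H) :
    annihilator E H × StrongDual ℝ (lieAlg E H) ≃ₜ BCotangentG E H where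
  toEquiv := (minimalCoupling θ).symm
  continuous_toFun := continuous_iff_continuousAt.2 fun p => by
    obtain ⟨b, hb⟩ := exists_bChart_group hH (couplingBase E H p)
    exact continuousAt_minimalCoupling_symm θ hb
  continuous_invFun := continuous_iff_continuousAt.2 fun α => by
    obtain ⟨s, hs⟩ := exists_slice hH (toCoset H α.proj)
    exact continuousAt_minimalCoupling θ (s := s) hs

theorem smoothAt_couplingHomeo (hH : IsBLieGroup E H)
    (p : annihilator E H × StrongDual ℝ (lieAlg E H)) (f : BCotangentG E H → ℝ) :
    (BCotangent.str (SmoothStr.ofManifold E G) (H : Set G)).SmoothAt f (couplingHomeo θ hH p) ↔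
      (couplingStr E H).SmoothAt (f ∘ couplingHomeo θ hH) p := by
  constructor
  · intro h
    obtain ⟨b, hb⟩ := exists_bChart_group hH (couplingBase E H p)
    exact smoothAt_comp_minimalCoupling_symm θ hb h
  · intro h
    obtain ⟨s, hs⟩ := exists_slice hH (toCoset H (couplingBase E H p))
    have h1 := smoothAt_comp_minimalCoupling θ (s := s) (α := (minimalCoupling θ).symm p) hs
      (f := f ∘ (minimalCoupling θ).symm) (by rw [Equiv.apply_symm_apply]; exact h)
    rwa [Function.comp_assoc, Equiv.symm_comp_self, Function.comp_id] at h1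

end Lie

/-! ### The coupling form and its bracket -/

section Lie

variable {E : Type*} [NormedAddCommGroup E] [NormedSpace ℝ E] [FiniteDimensional ℝ E]
  {G : Type*} [TopologicalSpace G] [ChartedSpace E G] [Group G] [LieGroup 𝓘(ℝ, E) ∞ G]
  {H : Subgroup G} (θ : BConnection E H) (hH : IsBLieGroup E H)
  {p : annihilator E H × StrongDual ℝ (lieAlg E H)} {s : Slice E H}
  {b : BChart (SmoothStr.ofManifold E G) (H : Set G) (Fin (Module.finrank ℝ E))}

variable (b) in
/-- The chart of `ℋ° × 𝔥*` induced by a chart of the group. -/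
def couplingChart : BChart (couplingStr E H) (couplingCrit E H)
    (Fin (Module.finrank ℝ E) ⊕ Fin (Module.finrank ℝ E)) :=
  -- Minimal coupling does not move base points, so the critical set of `ℋ° × 𝔥*` is by definition
  -- the preimage of that of `ᵇT*G`.
  b.cotangent.comap (couplingHomeo θ hH) (smoothAt_couplingHomeo θ hH)

omit [FiniteDimensional ℝ E] [LieGroup 𝓘(ℝ, E) ∞ G] in
/-- The coefficients of `λ^θ`. -/
theorem couplingOneForm_apply (hb : couplingBase E H p ∈ b.e.source)
    (v : bTangent (couplingStr E H) (couplingCrit E H) p) :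
    couplingOneForm θ p v = ∑ i, p.2 (θ.form _ (b.frame (couplingBase E H p) i)) *
      (b.coform i _ ∘ₗ bMap (couplingStr E H) (couplingCrit E H) (SmoothStr.ofManifold E G)
        (H : Set G) (couplingBase E H) p) v :=
  BChart.apply_eq_sum hb (p.2.toLinearMap ∘ₗ θ.form (couplingBase E H p)) _

include θ hH

theorem isBMapAt_couplingBase (hb : couplingBase E H p ∈ b.e.source) :
    IsBMapAt (couplingStr E H) (couplingCrit E H) (SmoothStr.ofManifold E G) (H : Set G)
      (couplingBase E H) p :=
  b.isBMapAt hb continuous_couplingBase.continuousAt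
    (fun i => smoothAt_coupling_base (b.smoothAt_x hb i))
    (BChart.isDefiningAt_x0 (c := couplingChart θ hH b) hb)

theorem coord_bMap_couplingBase (hb : couplingBase E H p ∈ b.e.source)
    (v : bTangent (couplingStr E H) (couplingCrit E H) p) (i) :
    b.coord _ (bMap (couplingStr E H) (couplingCrit E H) (SmoothStr.ofManifold E G) (H : Set G)
      (couplingBase E H) p v) i = (couplingChart θ hH b).coord p v (.inl i) := by
  by_cases hi : i = b.i0
  · subst hi
    rw [BChart.coord_i0, bLogDeriv_bMap (isBMapAt_couplingBase θ hH hb) v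
      (BChart.isDefiningAt_x0 hb)]
    exact (BChart.coord_i0 (c := couplingChart θ hH b) v).symm
  · rw [BChart.coord_ne _ hi, bDeriv_bMap (isBMapAt_couplingBase θ hH hb) v (b.smoothAt_x hb i),
      BChart.coord_ne (c := couplingChart θ hH b) v (i := .inl i) (fun h => hi (Sum.inl.inj h))]
    rfl

/-- The form `λ^θ` is `∑ μ(θ(eᵢ)) κᵢ` with `κᵢ` pulled back from the exact coframe of the group, so
only the coefficients are differentiated. -/
theorem bExtDeriv_couplingOneForm (hb : couplingBase E H p ∈ b.e.source)
    (v w : bTangent (couplingStr E H) (couplingCrit E H) p) :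
    bExtDeriv (couplingOneForm θ) p v w = ∑ i,
      (bDeriv v (fun q => q.2 (θ.form (couplingBase E H q) (b.frame (couplingBase E H q) i))) *
          (couplingChart θ hH b).coord p w (.inl i) -
        bDeriv w (fun q => q.2 (θ.form (couplingBase E H q) (b.frame (couplingBase E H q) i))) *
          (couplingChart θ hH b).coord p v (.inl i)) := by
  have hev : ∀ᶠ q in 𝓝 p, couplingBase E H q ∈ b.e.source :=
    continuous_couplingBase.continuousAt.eventually (b.e.open_source.mem_nhds hb)
  rw [bExtDeriv_eq_sum (couplingChart θ hH b) hb (fun i => smoothAt_coupling_form θ hb i)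
    (κ := fun i q => b.coform i _ ∘ₗ bMap (couplingStr E H) (couplingCrit E H)
      (SmoothStr.ofManifold E G) (H : Set G) (couplingBase E H) q)
    (fun i => (BChart.isExactAt_coform (c := b) hb i).comp
      (hev.mono fun q hq => isBMapAt_couplingBase θ hH hq)
      fun f hf => hf.eventually b hb)
    (hev.mono fun q hq v => couplingOneForm_apply θ hq v)]
  refine Finset.sum_congr rfl fun i _ => ?_
  have h1 : ∀ v, (b.coform i (couplingBase E H p) ∘ₗ bMap (couplingStr E H) (couplingCrit E H)
      (SmoothStr.ofManifold E G) (H : Set G) (couplingBase E H) p) v =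
        (couplingChart θ hH b).coord p v (.inl i) := fun v => coord_bMap_couplingBase θ hH hb v i
  rw [h1, h1]

omit θ hH in
/-- The fibre coordinate of `π̄`. -/
theorem smoothAt_annihilatorProj_fibre (hp : couplingBase E H p ∈ s.dom) :
    (couplingStr E H).SmoothAt (BCotangent.pair s.B ∘ fun q => q.1.1) p :=
  smoothAt_coupling_fst (smoothAt_pair (Slice.isSmoothFieldAt_B hp))

theorem x_annihilatorProj (hp : couplingBase E H p ∈ s.dom) (i : Unit) :
    s.chart.cotangent.x (.inr i) ∘ (fun q => annihilatorProj E H q.1) =ᶠ[𝓝 p]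
      BCotangent.pair s.B ∘ fun q => q.1.1 := by
  filter_upwards [continuous_couplingBase.continuousAt.eventually (Slice.isOpen_dom.mem_nhds hp)]
    with q hq
  exact Slice.annihilatorProj_frame θ hH.finrank_lieAlg q.1 hq

theorem isDefiningAt_τ_couplingBase (hp : couplingBase E H p ∈ s.dom) :
    IsDefiningAt (couplingStr E H) (couplingCrit E H) (s.τ ∘ couplingBase E H) p := by
  obtain ⟨b, hb, -, -⟩ := Slice.exists_bChart hp
  exact (isBMapAt_couplingBase θ hH hb).2.1 _ (Slice.isDefiningAt_τ hp)

theorem isBMapAt_annihilatorProj (hp : couplingBase E H p ∈ s.dom) :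
    IsBMapAt (couplingStr E H) (couplingCrit E H) (BCotangent.str (cosetStr E H) (critPt H))
      (BCotangent.crit (cosetStr E H) (critPt H)) (fun q => annihilatorProj E H q.1) p := by
  have hx : ∀ i, (couplingStr E H).SmoothAt
      (s.chart.cotangent.x i ∘ fun q => annihilatorProj E H q.1) p := by
    rintro (i | i)
    · exact smoothAt_coupling_base (Slice.smoothAt_τ hp)
    · exact SmoothStr.congr _ (smoothAt_annihilatorProj_fibre hp) (x_annihilatorProj θ hH hp i).symm
  exact s.chart.cotangent.isBMapAt hp
    (s.chart.cotangent.toChart.continuousAt_of_x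
      (continuous_couplingBase.continuousAt.eventually (Slice.isOpen_dom.mem_nhds hp))
      fun i => SmoothStr.continuousAt _ (hx i)) hx (isDefiningAt_τ_couplingBase θ hH hp)

/-- The base `G/H` is one-dimensional, so its canonical form is `d log |t| ∧ dξ`. Under `π̄` the
coordinate `t` pulls back to `τ` and `ξ` to the pairing with `B`. -/
theorem canonicalForm_annihilatorProj (hp : couplingBase E H p ∈ s.dom)
    (v w : bTangent (couplingStr E H) (couplingCrit E H) p) :
    canonicalForm (cosetStr E H) (critPt H) (annihilatorProj E H p.1)
      (bMap (couplingStr E H) (couplingCrit E H) (BCotangent.str (cosetStr E H) (critPt H))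
        (BCotangent.crit (cosetStr E H) (critPt H)) (fun p => annihilatorProj E H p.1) p v)
      (bMap (couplingStr E H) (couplingCrit E H) (BCotangent.str (cosetStr E H) (critPt H))
        (BCotangent.crit (cosetStr E H) (critPt H)) (fun p => annihilatorProj E H p.1) p w) =
    bLogDeriv v (s.τ ∘ couplingBase E H) * bDeriv w (BCotangent.pair s.B ∘ fun q => q.1.1) -
      bDeriv v (BCotangent.pair s.B ∘ fun q => q.1.1) * bLogDeriv w (s.τ ∘ couplingBase E H) := by
  have hm := isBMapAt_annihilatorProj θ hH hp
  have h1 : ∀ v, s.chart.cotangent.coord _ (bMap (couplingStr E H) (couplingCrit E H)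
      (BCotangent.str (cosetStr E H) (critPt H)) (BCotangent.crit (cosetStr E H) (critPt H))
      (fun p => annihilatorProj E H p.1) p v) (.inl ()) =
        bLogDeriv v (s.τ ∘ couplingBase E H) := fun v =>
    (BChart.coord_i0 (c := s.chart.cotangent) _).trans
      (bLogDeriv_bMap hm v (BChart.isDefiningAt_x0 (c := s.chart.cotangent) hp))
  have h2 : ∀ v, s.chart.cotangent.coord _ (bMap (couplingStr E H) (couplingCrit E H)
      (BCotangent.str (cosetStr E H) (critPt H)) (BCotangent.crit (cosetStr E H) (critPt H))
      (fun p => annihilatorProj E H p.1) p v) (.inr ()) =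
        bDeriv v (BCotangent.pair s.B ∘ fun q => q.1.1) := fun v => by
    rw [BChart.coord_ne (c := s.chart.cotangent) _ (i := .inr ()) (fun h => Sum.inr_ne_inl h),
      bDeriv_bMap hm v (s.chart.cotangent.smoothAt_x hp (.inr ())),
      bDeriv_congr v (x_annihilatorProj θ hH hp ())]
  rw [BChart.canonicalForm_eq_sum (c := s.chart) (α := annihilatorProj E H p.1) hp, Fintype.sum_unique]
  exact congrArg₂ _ (congrArg₂ _ (h1 v) (h2 w)) (congrArg₂ _ (h2 v) (h1 w))

/-- The fibre coordinate of `β + μ ∘ θ` is `β(eᵢ) + μ(θ(eᵢ))`. As `β = β(B) d log |τ|` and the chart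
has `τ` as defining coordinate, `β(eᵢ)` is `β(B)` for `i = i0` and `0` otherwise. -/
theorem coord_couplingChart_inr (hb : couplingBase E H p ∈ b.e.source)
    (hb0 : ∀ y ∈ b.e.source, b.x0 y = s.τ y) (hs : b.e.source ⊆ s.dom)
    (v : bTangent (couplingStr E H) (couplingCrit E H) p) (i) :
    (couplingChart θ hH b).coord p v (.inr i) =
      (if i = b.i0 then bDeriv v (BCotangent.pair s.B ∘ fun q => q.1.1) else 0) +
        bDeriv v (fun q => q.2 (θ.form (couplingBase E H q) (b.frame (couplingBase E H q) i))) := by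
  have h1 : (couplingChart θ hH b).x (.inr i) =ᶠ[𝓝 p] fun q =>
      (if i = b.i0 then 1 else 0) * (BCotangent.pair s.B ∘ fun q => q.1.1) q +
        q.2 (θ.form (couplingBase E H q) (b.frame (couplingBase E H q) i)) := by
    filter_upwards [continuous_couplingBase.continuousAt.eventually (b.e.open_source.mem_nhds hb)]
      with q hq
    refine congrArg (· + q.2 (θ.form (couplingBase E H q) (b.frame (couplingBase E H q) i)))
      ((Slice.annihilator_apply θ hH.finrank_lieAlg q.1 (hs hq) _).trans
        (congrArg (· * q.1.1.cov (s.B q.1.1.proj)) ?_))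
    have h2 : b.x0 =ᶠ[𝓝 q.1.1.proj] s.τ := by
      filter_upwards [b.e.open_source.mem_nhds hq] with z hz using hb0 z hz
    change bLogDeriv (b.frame q.1.1.proj i) s.τ = _
    rw [← bLogDeriv_congr _ h2, ← BChart.coord_i0, BChart.coord_frame (p := q.1.1.proj) hq]
    simp only [eq_comm]
  have h3 := smoothAt_annihilatorProj_fibre (hs hb)
  rw [BChart.coord_ne (c := couplingChart θ hH b) v (i := .inr i) (fun h => Sum.inr_ne_inl h),
    bDeriv_congr v h1, bDeriv_add v (h3.const_mul _) (smoothAt_coupling_form θ hb i),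
    bDeriv_const_mul v _ h3]
  simp only [ite_mul, one_mul, zero_mul]

/-- Under minimal coupling, the canonical form corresponds to `π̄^* ω - dλ^θ`. -/
theorem couplingForm_eq (v w : bTangent (couplingStr E H) (couplingCrit E H) p) :
    couplingForm θ p v w = canonicalForm (SmoothStr.ofManifold E G) (H : Set G)
      (couplingHomeo θ hH p)
      (bMap (couplingStr E H) (couplingCrit E H) (BCotangent.str _ _) (BCotangent.crit _ _)
        (couplingHomeo θ hH) p v)
      (bMap (couplingStr E H) (couplingCrit E H) (BCotangent.str _ _) (BCotangent.crit _ _)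
        (couplingHomeo θ hH) p w) := by
  obtain ⟨s, hs⟩ := exists_slice hH (toCoset H (couplingBase E H p))
  have hp : couplingBase E H p ∈ s.dom := hs
  obtain ⟨b, hb, hbs, hb0⟩ := Slice.exists_bChart hp
  have h1 : ∀ v i, b.cotangent.coord _ (bMap (couplingStr E H) (couplingCrit E H)
      (BCotangent.str _ _) (BCotangent.crit _ _) (couplingHomeo θ hH) p v) i =
        (couplingChart θ hH b).coord p v i := fun v i =>
    b.cotangent.coord_bMap_comap (couplingHomeo θ hH) (smoothAt_couplingHomeo θ hH) hb v i
  have h2 : ∀ v : bTangent (couplingStr E H) (couplingCrit E H) p,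
      bLogDeriv v (s.τ ∘ couplingBase E H) = (couplingChart θ hH b).coord p v (.inl b.i0) := fun v => by
    have h3 : b.x0 ∘ couplingBase E H =ᶠ[𝓝 p] s.τ ∘ couplingBase E H := by
      filter_upwards [continuous_couplingBase.continuousAt.eventually
        (b.e.open_source.mem_nhds hb)] with q hq using hb0 _ hq
    rw [← bLogDeriv_congr v h3]
    exact (BChart.coord_i0 (c := couplingChart θ hH b) v).symm
  rw [couplingForm, canonicalForm_annihilatorProj θ hH hp, bExtDeriv_couplingOneForm θ hH hb,
    BChart.canonicalForm_eq_sum (c := b) (α := couplingHomeo θ hH p) hb]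
  simp only [h1, h2, coord_couplingChart_inr θ hH hb hb0 hbs]
  -- Each summand of `∑ κᵢ ∧ dξᵢ` splits into the part of `β(B)`, present for `i = i0` only and
  -- equal to `π̄^* ω_{G/H}`, and the part of `μ(θ(eᵢ))`, which belongs to `-dλ^θ`.
  have h3 : ∀ i, (couplingChart θ hH b).coord p v (.inl i) *
      ((if i = b.i0 then bDeriv w (BCotangent.pair s.B ∘ fun q => q.1.1) else 0) +
        bDeriv w fun q => q.2 (θ.form (couplingBase E H q) (b.frame (couplingBase E H q) i))) -
      ((if i = b.i0 then bDeriv v (BCotangent.pair s.B ∘ fun q => q.1.1) else 0) +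
        bDeriv v fun q => q.2 (θ.form (couplingBase E H q) (b.frame (couplingBase E H q) i))) *
        (couplingChart θ hH b).coord p w (.inl i) =
      (if i = b.i0 then (couplingChart θ hH b).coord p v (.inl i) *
          bDeriv w (BCotangent.pair s.B ∘ fun q => q.1.1) -
        bDeriv v (BCotangent.pair s.B ∘ fun q => q.1.1) *
          (couplingChart θ hH b).coord p w (.inl i) else 0) -
      ((bDeriv v fun q => q.2 (θ.form (couplingBase E H q) (b.frame (couplingBase E H q) i))) *
          (couplingChart θ hH b).coord p w (.inl i) -
        (bDeriv w fun q => q.2 (θ.form (couplingBase E H q) (b.frame (couplingBase E H q) i))) *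
          (couplingChart θ hH b).coord p v (.inl i)) := fun i => by
    split_ifs <;> ring
  rw [Finset.sum_congr rfl fun i _ => h3 i, eq_comm, Finset.sum_sub_distrib, Finset.sum_ite_eq',
    if_pos (Finset.mem_univ _)]

theorem bijective_bMap_couplingHomeo :
    Function.Bijective (bMap (couplingStr E H) (couplingCrit E H)
      (BCotangent.str (SmoothStr.ofManifold E G) (H : Set G)) (BCotangent.crit _ _)
      (couplingHomeo θ hH) p) := by
  obtain ⟨b, hb⟩ := exists_bChart_group hH (couplingBase E H p)
  exact b.cotangent.bijective_bMap_comap (couplingHomeo θ hH) (smoothAt_couplingHomeo θ hH) hb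

theorem isNondegenerate_couplingForm
    (hσ : IsNondegenerate (canonicalForm (SmoothStr.ofManifold E G) (H : Set G))) :
    IsNondegenerate (couplingForm θ) :=
  hσ.of_pullback (fun _ => bijective_bMap_couplingHomeo θ hH) fun _ => couplingForm_eq θ hH

/-- By `couplingForm_eq` the inverse of `ψ_θ` pulls the canonical form back to the coupling form, so
the coupling bracket is the canonical bracket of the lifted functions. -/
theorem couplingBracket_eq_reducedBracket
    (hσ : IsNondegenerate (canonicalForm (SmoothStr.ofManifold E G) (H : Set G)))
    (hσ' : IsNondegenerate (canonicalForm (cosetStr E H) (critPt H))) {α : BCotangentG E H}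
    {F K : Reduced E H → ℝ} (hF : (reducedStr E H).SmoothAt F (toReduced E H α))
    (hK : (reducedStr E H).SmoothAt K (toReduced E H α)) :
    couplingBracket θ F K α = reducedBracket E H F K (toReduced E H α) := by
  obtain ⟨b, hb⟩ := exists_bChart_group hH α.proj
  have h0 : couplingHomeo θ hH (minimalCoupling θ α) = α := (minimalCoupling θ).symm_apply_apply α
  have h1 := hσ.poisson_pullback (fun _ => bijective_bMap_couplingHomeo θ hH)
    (fun _ => couplingForm_eq θ hH) (p := minimalCoupling θ α)
    (b.cotangent.isBMapAt_comap (couplingHomeo θ hH) (smoothAt_couplingHomeo θ hH) hb)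
    (F := F ∘ toReduced E H) (K := K ∘ toReduced E H)
    (by rw [h0]; exact smoothAt_comp_toReduced hF) (by rw [h0]; exact smoothAt_comp_toReduced hK)
  rw [← canonicalBracket_eq_reducedBracket hH hσ hσ' hF hK, canonicalBracket]
  rw [h0] at h1
  exact h1

end Lie

end BLie

end

/-! ### The main theorem -/

theorem mainTheorem1 {E : Type*} [NormedAddCommGroup E] [NormedSpace ℝ E] [FiniteDimensional ℝ E]
    {G : Type*} [TopologicalSpace G] [T2Space G] [ChartedSpace E G] [Group G]
    [LieGroup 𝓘(ℝ, E) ∞ G] (H : Subgroup G) (hH : IsBLieGroup E H) :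
    -- `G/H` is a one-dimensional `b`-manifold with critical hypersurface `{[e]}`
    ((cosetStr E H).IsManifold 1 ∧ IsHypersurface (cosetStr E H) (critPt H)) ∧
    -- the canonical forms of `ᵇT*G` and `ᵇT*(G/H)` are nondegenerate
    (IsNondegenerate (canonicalForm (SmoothStr.ofManifold E G) (H : Set G)) ∧
      IsNondegenerate (canonicalForm (cosetStr E H) (critPt H))) ∧
    -- `(ᵇT*G)/H` is a manifold to which the canonical Poisson structure of `ᵇT*G` descends
    ((reducedStr E H).IsManifold (Module.finrank ℝ E + 1) ∧
      IsPoissonBracket (reducedStr E H) (reducedBracket E H) ∧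
      ∀ (F K : Reduced E H → ℝ) (α : BCotangentG E H),
        (reducedStr E H).SmoothAt F (toReduced E H α) →
        (reducedStr E H).SmoothAt K (toReduced E H α) →
        canonicalBracket E H (F ∘ toReduced E H) (K ∘ toReduced E H) α =
          reducedBracket E H F K (toReduced E H α)) ∧
    -- this is the Poisson structure induced by minimal coupling, for every connection
    (∀ θ : BConnection E H, IsNondegenerate (couplingForm θ) ∧
      ∀ (F K : Reduced E H → ℝ) (α : BCotangentG E H),
        (reducedStr E H).SmoothAt F (toReduced E H α) →
        (reducedStr E H).SmoothAt K (toReduced E H α) →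
        couplingBracket θ F K α = reducedBracket E H F K (toReduced E H α)) ∧
    -- it is locally equivalent to `𝔥* × ᵇT*(G/H)`
    ∀ x : CosetSpace H, ∃ V : Set (CosetSpace H), IsOpen V ∧ x ∈ V ∧
      IsPoissonTrivialOver E H V := by
  have hσ := isNondegenerate_canonicalForm (exists_bChart_group hH)
  have hσ' := isNondegenerate_canonicalForm (exists_bChart_coset hH)
  refine ⟨⟨isManifold_cosetStr hH, Chart.isHypersurface (exists_bChart_coset hH)⟩, ⟨hσ, hσ'⟩,
    ⟨isManifold_reducedStr hH, isPoissonBracket_reducedBracket hH hσ hσ',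
      fun F K α hF hK => canonicalBracket_eq_reducedBracket hH hσ hσ' hF hK⟩,
    fun θ => ⟨isNondegenerate_couplingForm θ hH hσ,
      fun F K α hF hK => couplingBracket_eq_reducedBracket θ hH hσ hσ' hF hK⟩, fun x => ?_⟩
  obtain ⟨s, hs⟩ := exists_slice hH x
  exact ⟨s.V, s.isOpen_V, hs, isPoissonTrivialOver_slice s hH hσ hσ'⟩
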